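/- **Conventions.** Let $f\colon X\to S$ be a morphism of schemes with $X$ connected. Valuations on fields are non-archimedean, of arbitrary rank, the trivial one included; $\mathcal O_v$ denotes the valuation ring. If $L/K$ is a finite separable field extension, $w$ a valuation on $L$ and $v=w|_K$, then $w/v$ is called *tamely ramified* if the degree $[L_w^{sh}:K_v^{sh}]$ of the fraction fields of the strict henselizations of $\mathcal O_w$ and $\mathcal O_v$ is prime to the residue characteristic of $v$ (no condition if this characteristic is $0$; unramified extensions are included). For an $S$-scheme $Y$, $\mathrm{Val}_S(Y)$ is the set of pairs $(y,w)$ with $y\in Y$ and $w$ a valuation on the residue field $k(y)$ such that $\operatorname{Spec}k(y)\to S$ extends to a morphism $\operatorname{Spec}\mathcal O_w\to S$. The *tame site* $(X/S)_t$ is the category of étale $X$-schemes, in which a family $(U_i\to U)_i$ is a covering if it is jointly surjective and every $(u,v)\in\mathrm{Val}_S(U)$ is the image of some $(u_i,v_i)\in\mathrm{Val}_S(U_i)$, for some $i$, with $v_i/v$ tamely ramified. A *tame point* $(\bar x,\bar v)$ of $X/S$ consists of a morphism $\bar x\colon\operatorname{Spec}k(\bar x)\to X$ from the spectrum of a field and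 an $S$-valuation $\bar v$ on $k(\bar x)$ such that $k(\bar x)$ has no nontrivial finite separable extension to which $\bar v$ has a tamely ramified extension. The *stalk* of a sheaf $\mathcal F$ on $(X/S)_t$ at it is $\mathcal F_{\bar x}=\operatorname{colim}\mathcal F(U)$, over étale $U\to X$ with a lift $\operatorname{Spec}k(\bar x)\to U$ of $\bar x$. A sheaf $\mathcal F$ of abelian groups on $(X/S)_t$ is *locally constant* if there is a tame covering $(U_i\to X)_i$ such that each $\mathcal F|_{U_i}$ is isomorphic to a constant sheaf $\underline{A_i}$, where $\underline{A}(V)$ is the group of locally constant functions $V\to A$. A *finite tame cover* of $X$ is a finite étale morphism $g\colon Y\to X$ such that for every $(y,w)\in\mathrm{Val}_S(Y)$ the extension $k(y)/k(g(y))$ is tamely ramified at $w$. Let $\mathrm{FT}_{X/S}$ be the category of finite tame covers of $X$ and $X$-morphisms. For a tame point $(\bar x,\bar v)$ let $\hat\pi_1^t(X/S,(\bar x,\bar v))$ be the profinite group of automorphisms of the functor $F_{(\bar x,\bar v)}\colon\mathrm{FT}_{X/S}\to\mathrm{Sets}$, $Y\mapsto\pi_0(Y\times_X\bar x)$. **Proposition.**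 Let $X$ be a connected $S$-scheme and let $(\bar x,\bar v)$ be a tame point of $X/S$. Then there is a natural equivalence between the category of finite discrete $\hat\pi_1^t(X/S,(\bar x,\bar v))$-modules and the category of sheaves of abelian groups on $(X/S)_t$ which are locally constant and have finite stalks (at all tame points). Explicitly, the equivalence sends a sheaf $\mathcal F$ to a module whose underlying abelian group is identified with $\mathcal F_{\bar x}$, naturally in $\mathcal F$, and whose action is determined by the following property: if $Y$ is a finite tame cover of $X$, $s\in\mathcal F(Y)$, if $y,y'\colon\operatorname{Spec}k(\bar x)\to Y$ are lifts of $\bar x$ and if $\gamma\in\hat\pi_1^t(X/S,(\bar x,\bar v))$ maps the component of $Y\times_X\bar x$ given by $y$ to the one given by $y'$, then $\gamma\cdot s_y=s_{y'}$ for the germs $s_y,s_{y'}\in\mathcal F_{\bar x}$ of $s$ at $y$ and $y'$. -/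

import Mathlib

universe u

open CategoryTheory CategoryTheory.Limits AlgebraicGeometry Opposite

namespace TameSite

/-! ### Tamely ramified extensions of valuations

A (non-archimedean) valuation on a field, up to equivalence, is given by its valuation ring. -/

/-- Let `Ω` be a separable closure of `K` and `V` a valuation ring of `Ω`. This is the fraction
field of the strict henselization of the valuation ring `V ∩ K` of `K`, realised inside `Ω` as
the fixed field of the inertia group of `V` in the absolute Galois group of `K`. -/
noncomputable def strictHenselization (K : Type*) {Ω : Type*} [Field K] [Field Ω] [Algebra K Ω]
    (V : ValuationSubring Ω) : IntermediateField K Ω :=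
  IntermediateField.fixedField
    ((V.inertiaSubgroup K).map (V.decompositionSubgroup K).subtype)

/-- Let `L / K` be a finite separable extension and `W` a valuation ring of `L`, with
restriction `V = W ∩ K`. The extension `W / V` is (at most) tamely ramified if the degree of
`L^sh / K^sh` is prime to the residue characteristic of `V` (no condition if the latter is `0`).
The strict henselizations are formed inside a separable closure of `L`, which is also one
of `K`, with respect to a common valuation extending `W`. -/
def IsTamelyRamified (K : Type*) {L : Type*} [Field K] [Field L] [Algebra K L]
    (W : ValuationSubring L) : Prop :=
  ∃ V' : ValuationSubring (SeparableClosure L),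
    V'.comap (algebraMap L (SeparableClosure L)) = W ∧
    Nat.Coprime
      ((strictHenselization K V').relfinrank
        ((strictHenselization L V').restrictScalars K))
      (ringExpChar (IsLocalRing.ResidueField (W.comap (algebraMap K L))))

/-! ### `S`-valuations -/

/-- A valuation ring `V` of a field `K` is an `S`-valuation with respect to a morphism
`t : Spec K ⟶ S` if `t` extends to a morphism `Spec V ⟶ S`. -/
def IsSValuation {S : Scheme.{u}} {K : Type u} [Field K] (t : Spec (.of K) ⟶ S)
    (V : ValuationSubring K) : Prop :=
  ∃ φ : Spec (.of V) ⟶ S, Spec.map (CommRingCat.ofHom V.subtype) ≫ φ = t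

/-- A pair `(x, v)` of a point `x` of a scheme and a valuation `v` on its residue field. -/
structure ValuedPoint (X : Scheme.{u}) where
  /-- the point -/
  pt : X
  /-- the valuation ring in the residue field -/
  val : ValuationSubring (X.residueField pt)

namespace ValuedPoint

/-- The pair `(x, v)` belongs to `Val_S X`, where `X` is an `S`-scheme via `f`. -/
def IsOver {X S : Scheme.{u}} (f : X ⟶ S) (ξ : ValuedPoint X) : Prop :=
  IsSValuation (K := X.residueField ξ.pt) (X.fromSpecResidueField ξ.pt ≫ f) ξ.val

/-- The image of a pair `(y, w)` under a morphism `g : Y ⟶ X`: the point `g y` with the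
restriction of `w` to its residue field. -/
noncomputable def map {Y X : Scheme.{u}} (g : Y ⟶ X) (η : ValuedPoint Y) : ValuedPoint X where
  pt := g η.pt
  val := η.val.comap (g.residueFieldMap η.pt).hom

/-- For a pair `(y, w)` on `Y`, the extension `k(y) / k(g y)` is (at most) tamely ramified
at `w`. -/
def IsTame {Y X : Scheme.{u}} (g : Y ⟶ X) (η : ValuedPoint Y) : Prop :=
  letI := (g.residueFieldMap η.pt).hom.toAlgebra
  IsTamelyRamified (X.residueField (g η.pt)) η.val

end ValuedPoint

variable {X S : Scheme.{u}} (f : X ⟶ S)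

/-! ### The tame site -/

/-- The tame coverings in the category of étale `X`-schemes: the jointly surjective families
`(Uᵢ ⟶ U)` such that every point of `Val_S U` is the image of a point of some `Val_S Uᵢ`
which is tamely ramified over it. -/
def tamePrecoverage : Precoverage X.Etale where
  coverings U := { R |
    (∀ x : U.left, ∃ (V : X.Etale) (g : V ⟶ U), R g ∧ ∃ y : V.left, g.left y = x) ∧
    ∀ ξ : ValuedPoint U.left, ξ.IsOver (U.hom ≫ f) →
      ∃ (V : X.Etale) (g : V ⟶ U), R g ∧
        ∃ η : ValuedPoint V.left, η.IsOver (V.hom ≫ f) ∧ η.map g.left = ξ ∧ η.IsTame g.left }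

/-- The Grothendieck topology of the tame site `(X/S)_t`, generated by the tame coverings. -/
def tameTopology : GrothendieckTopology X.Etale :=
  (tamePrecoverage f).toGrothendieck

/-- A tame point `(x̄, v̄)` of `X/S`. -/
structure TamePoint where
  /-- the field `k(x̄)` -/
  field : Type u
  [isField : Field field]
  /-- the morphism `x̄ : Spec k(x̄) ⟶ X` -/
  pt : Spec (.of field) ⟶ X
  /-- the valuation ring of `v̄` -/
  val : ValuationSubring field
  isSValuation : IsSValuation (pt ≫ f) val
  /-- `k(x̄)` has no nontrivial finite separable extension to which `v̄` has a tamely ramified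
  extension -/
  bijective_of_isTamelyRamified (L : Type u) [Field L] [Algebra field L]
    [FiniteDimensional field L] [Algebra.IsSeparable field L] (W : ValuationSubring L) :
    W.comap (algebraMap field L) = val → IsTamelyRamified field W →
      Function.Bijective (algebraMap field L)

attribute [instance] TamePoint.isField

/-! ### Stalks -/

section Stalk

variable {K : Type u} [Field K] (x : Spec (.of K) ⟶ X)

/-- The functor sending an étale `X`-scheme `U` to the set of `X`-morphisms `Spec K ⟶ U`. Its
category of elements is the category of étale neighbourhoods of `x`. -/
noncomputable def lifts : X.Etale ⥤ Type u :=
  Scheme.Etale.forget X ⋙ coyoneda.obj (op (Over.mk x))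

instance : IsCofiltered (lifts x).Elements := by
  unfold lifts
  exact Functor.isCofiltered_elements _

instance : InitiallySmall.{u} (lifts x).Elements :=
  initiallySmall_of_essentiallySmall_weakly_initial_objectProperty
    (Functor.Elements.precomp (Scheme.AffineEtale.Spec X) (lifts x)).essImage (by
    rintro ⟨U, t⟩
    cases U with | _ Y g
    obtain ⟨y, hy, rfl⟩ := Over.homMk_surjective t
    dsimp at y hy
    obtain ⟨R, j, _, y', rfl⟩ : ∃ (R : CommRingCat) (j : Spec (.of R) ⟶ Y)
        (_ : IsOpenImmersion j) (y' : _ ⟶ _), y' ≫ j = y := by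
      obtain ⟨R, j, _, hj, _⟩ := Scheme.exists_affine_mem_range_and_range_subset
        (x := y.base default) (U := ⊤) (by simp)
      refine ⟨R, j, inferInstance, _, IsOpenImmersion.lift_fac j y ?_⟩
      rintro _ ⟨a, rfl⟩
      rwa [Subsingleton.elim a default]
    exact ⟨_,
      ⟨Functor.elementsMk _ (Scheme.AffineEtale.mk (j ≫ g)) (Over.homMk y'), ⟨Iso.refl _⟩⟩,
      ⟨⟨MorphismProperty.Over.homMk j rfl trivial, by cat_disch⟩⟩⟩)

instance : HasColimitsOfShape (lifts x).Elementsᵒᵖ Ab.{u} :=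
  hasColimitsOfShape_of_finallySmall _ _

/-- The stalk functor `F ↦ F_x̄ = colim F(U)`, the filtered colimit over the étale neighbourhoods
`(U, Spec K ⟶ U)` of `x̄`. For a tame point this is `Γ(Spec k(x̄), x̄^* F)`: every tame covering
of `Spec k(x̄)` splits, so that sheafification does not change the sections over `Spec k(x̄)` of
the presheaf inverse image. -/
noncomputable def stalk : (X.Etaleᵒᵖ ⥤ Ab.{u}) ⥤ Ab.{u} :=
  (Functor.whiskeringLeft _ _ _).obj (CategoryOfElements.π (lifts x)).op ⋙ colim

/-- The germ at `y : Spec K ⟶ U` of a section over `U`. -/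
noncomputable def germ (F : X.Etaleᵒᵖ ⥤ Ab.{u}) (U : X.Etale) (y : (lifts x).obj U) :
    F.obj (op U) ⟶ (stalk x).obj F :=
  colimit.ι ((CategoryOfElements.π (lifts x)).op ⋙ F) (op ⟨U, y⟩)

end Stalk

/-! ### Locally constant sheaves -/

/-- The constant sheaf on the category of étale `U`-schemes associated with an abelian group `A`,
that is the Zariski sheafification of the constant presheaf: it sends `V` to the group of locally
constant functions `V → A`. -/
def constantEtaleSheaf (U : Scheme.{u}) (A : Type u) [AddCommGroup A] : U.Etaleᵒᵖ ⥤ Ab.{u} :=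
  letI : TopologicalSpace A := ⊥
  haveI : DiscreteTopology A := ⟨rfl⟩
  (Scheme.Etale.forget U ⋙ Over.forget U).op ⋙ continuousMapPresheafAb A

/-- An étale scheme over `U`, regarded as an étale `X`-scheme, for `U` étale over `X`. -/
def composeToBase (U : X.Etale) : U.left.Etale ⥤ X.Etale where
  obj V := MorphismProperty.Over.mk ⊤ (V.hom ≫ U.hom) (by
    have h₁ : Etale V.hom := V.prop
    have h₂ : Etale U.hom := U.prop
    exact Etale.etale_comp V.hom U.hom)
  map {V W} g := MorphismProperty.Over.homMk g.left (by
    have h : g.left ≫ W.hom = V.hom := MorphismProperty.Over.w g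
    exact (Category.assoc _ _ _).symm.trans (congrArg (· ≫ U.hom) h)) trivial

/-- The restriction of a presheaf on the étale `X`-schemes to the étale `U`-schemes, for `U`
étale over `X`. -/
def restrict (U : X.Etale) (F : X.Etaleᵒᵖ ⥤ Ab.{u}) : U.left.Etaleᵒᵖ ⥤ Ab.{u} :=
  (composeToBase U).op ⋙ F

/-- A sheaf on `(X/S)_t` is locally constant if there is a tame covering `(Uᵢ ⟶ X)` such that
the restriction of the sheaf to each `Uᵢ` is isomorphic to a constant sheaf. -/
def IsLocallyConstant (F : Sheaf (tameTopology f) Ab.{u}) : Prop :=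
  ∃ R ∈ tamePrecoverage f (MorphismProperty.Over.mk ⊤ (𝟙 X) inferInstance),
    ∀ ⦃U : X.Etale⦄ (g : U ⟶ _), R g →
      ∃ A : Ab.{u}, Nonempty (restrict U F.obj ≅ constantEtaleSheaf U.left A)

/-- The stalks of the sheaf at all tame points are finite. -/
def HasFiniteStalks (F : Sheaf (tameTopology f) Ab.{u}) : Prop :=
  ∀ x : TamePoint f, Finite ((stalk x.pt).obj F.obj)

/-- The category of locally constant sheaves of abelian groups with finite stalks on
`(X/S)_t`, a full subcategory of the category of sheaves. -/
abbrev LocConstFin : Type _ :=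
  ObjectProperty.FullSubcategory
    (fun F : Sheaf (tameTopology f) Ab.{u} ↦ IsLocallyConstant f F ∧ HasFiniteStalks f F)

/-! ### The profinite tame fundamental group -/

/-- A finite étale morphism `Y ⟶ X` is a finite tame cover if for every `y ∈ Y` and every
`w ∈ Val_S k(y)` the residue field extension at `y` is (at most) tamely ramified at `w`. -/
def IsFiniteTameCover (Y : X.Etale) : Prop :=
  IsFinite Y.hom ∧ ∀ η : ValuedPoint Y.left, η.IsOver (Y.hom ≫ f) → η.IsTame Y.hom

/-- The category `FT_{X/S}` of finite tame covers of `X` and `X`-morphisms. -/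
abbrev FT : Type _ := ObjectProperty.FullSubcategory (IsFiniteTameCover f)

variable {f}

/-- The fibre `Y ×_X x̄` of a finite tame cover. -/
noncomputable abbrev fibreScheme {K : Type u} [Field K] (x : Spec (.of K) ⟶ X) (Y : FT f) :
    Scheme.{u} :=
  pullback Y.obj.hom x

instance {K : Type u} [Field K] (x : Spec (.of K) ⟶ X) (Y : FT f) :
    Finite (fibreScheme x Y) := by
  have := Y.property.1
  have hf : IsFinite (pullback.snd Y.obj.hom x) := inferInstance
  have h := (pullback.snd Y.obj.hom x).finite_preimage (s := Set.univ) Set.finite_univ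
  exact Set.finite_univ_iff.mp (by simpa using h)

/-- The morphism between fibres induced by a morphism of finite tame covers. -/
noncomputable def fibreMap {K : Type u} [Field K] (x : Spec (.of K) ⟶ X) {Y Z : FT f}
    (g : Y ⟶ Z) : fibreScheme x Y ⟶ fibreScheme x Z :=
  pullback.lift (pullback.fst _ _ ≫ g.hom.left) (pullback.snd _ _) (by
    have h : g.hom.left ≫ Z.obj.hom = Y.obj.hom := MorphismProperty.Over.w g.hom
    exact (Category.assoc _ _ _).trans ((congrArg _ h).trans pullback.condition))

lemma fibreMap_fst {K : Type u} [Field K] (x : Spec (.of K) ⟶ X) {Y Z : FT f} (g : Y ⟶ Z) :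
    fibreMap x g ≫ pullback.fst Z.obj.hom x = pullback.fst Y.obj.hom x ≫ g.hom.left :=
  pullback.lift_fst _ _ _

lemma fibreMap_snd {K : Type u} [Field K] (x : Spec (.of K) ⟶ X) {Y Z : FT f} (g : Y ⟶ Z) :
    fibreMap x g ≫ pullback.snd Z.obj.hom x = pullback.snd Y.obj.hom x :=
  pullback.lift_snd _ _ _

lemma fibreMap_id {K : Type u} [Field K] (x : Spec (.of K) ⟶ X) (Y : FT f) :
    fibreMap x (𝟙 Y) = 𝟙 (fibreScheme x Y) := by
  apply pullback.hom_ext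
  · exact (fibreMap_fst x (𝟙 Y)).trans
      ((Category.comp_id _).trans (Category.id_comp _).symm)
  · exact (fibreMap_snd x (𝟙 Y)).trans (Category.id_comp _).symm

lemma fibreMap_comp {K : Type u} [Field K] (x : Spec (.of K) ⟶ X) {Y Z W : FT f}
    (g : Y ⟶ Z) (h : Z ⟶ W) : fibreMap x (g ≫ h) = fibreMap x g ≫ fibreMap x h := by
  apply pullback.hom_ext
  · refine (fibreMap_fst x (g ≫ h)).trans ?_
    rw [Category.assoc, fibreMap_fst x h, ← Category.assoc, fibreMap_fst x g, Category.assoc]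
    rfl
  · rw [Category.assoc, fibreMap_snd, fibreMap_snd, fibreMap_snd]

/-- The fibre functor `F_(x̄, v̄) : Y ↦ π₀(Y ×_X x̄)` on `FT_{X/S}`. -/
noncomputable def fibreFunctor (p : TamePoint f) : FT f ⥤ FintypeCat.{u} where
  obj Y := FintypeCat.of (_root_.ConnectedComponents (fibreScheme p.pt Y))
  map g := FintypeCat.homMk (fibreMap p.pt g).continuous.connectedComponentsMap
  map_id Y := by
    rw [FintypeCat.homMk_eq_id_iff]
    funext c
    obtain ⟨z, rfl⟩ := ConnectedComponents.surjective_coe c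
    change ConnectedComponents.mk ((fibreMap p.pt (𝟙 Y)) z) = _
    rw [fibreMap_id]; rfl
  map_comp {Y Z W} g h := by
    rw [FintypeCat.homMk_eq_comp_iff]
    funext c
    obtain ⟨z, rfl⟩ := ConnectedComponents.surjective_coe c
    change ConnectedComponents.mk ((fibreMap p.pt (g ≫ h)) z) = _
    rw [fibreMap_comp]; rfl

/-- The profinite tame fundamental group `π̂₁ᵗ(X/S, (x̄, v̄))`: the automorphism group of the
fibre functor. It carries the topology induced from the product of the discrete groups
`Aut (F Y)`. -/
abbrev tamePi1 (p : TamePoint f) : Type (u + 1) := Aut (fibreFunctor p)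

/-- The connected component of the fibre `Y ×_X x̄` determined by a lift `x̄ ⟶ Y` of `x̄`. -/
noncomputable def componentOfLift (p : TamePoint f) (Y : FT f) (y : (lifts p.pt).obj Y.obj) :
    (fibreFunctor p).obj Y :=
  let z : Spec (.of p.field) ⟶ fibreScheme p.pt Y :=
    pullback.lift y.left (𝟙 _) ((Over.w y).trans (Category.id_comp _).symm)
  (z default : _root_.ConnectedComponents (fibreScheme p.pt Y))

/-- The category of finite discrete `G`-modules, for a topological group `G`: finite abelian
groups with an additive action of `G` such that the stabilizer of every element is open. -/
abbrev FinDiscMod (G : Type*) [Group G] [TopologicalSpace G] : Type _ :=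
  ObjectProperty.FullSubcategory
    (fun M : Action Ab.{u} G ↦ Finite M.V ∧ ∀ m : M.V, IsOpen {γ : G | (M.ρ γ).hom m = m})

/-- The functor sending a finite discrete module to its underlying abelian group. -/
noncomputable def FinDiscMod.toAb (G : Type*) [Group G] [TopologicalSpace G] :
    FinDiscMod.{u} G ⥤ Ab.{u} :=
  ObjectProperty.ι _ ⋙ Action.forget _ _

/-- The stalk at a point `x̄` as a functor on locally constant sheaves with finite stalks. -/
noncomputable def LocConstFin.stalk {K : Type u} [Field K] (x : Spec (.of K) ⟶ X) :
    LocConstFin f ⥤ Ab.{u} :=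
  ObjectProperty.ι _ ⋙ sheafToPresheaf _ _ ⋙ TameSite.stalk x

end TameSite

open TameSite

/-! The statement is the dictionary between local systems and representations. Two facts make it
available here: finite tame covers of `X` form a Galois category with fibre functor `fibreFunctor
p`, and the locally constant sheaves with finite stalks are exactly the sheaves of abelian groups
represented by finite tame covers.

Tameness enters through one criterion, `isFiniteTameCover_iff`: a finite étale `Y` over `X` is tame
iff, over every tame point, each point of `Y` with values in an extension field is already rational
over the field of the tame point. It rests on ramification theory in arbitrary rank. By
`isTamelyRamified_comap_iff`, a finite separable extension is tame at a valuation iff it is fixed by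
the wild automorphisms, those changing every nonzero element by a principal unit. By
`IsTameClosed.mem_range`, a tamely closed field absorbs tame extensions of its subfields. The
criterion passes easily to fibre products, clopen pieces and finite colimits.

Representing schemes are built by descent. Let `F` be a presheaf that is étale locally constant with
a finite value set, up to Zariski sheafification. Its ring of natural functions over `W` consists of
the natural maps from `F` over `W` to the functions. On affines these rings commute with étale base
change (`isPushout_natRing`), so their spectra glue to a finite étale `X`-scheme `espace F`, and
étale locally sections of `F` and morphisms to `espace F` are the same. For a sheaf trivialised by a
tame covering this yields a representing tame cover (`exists_isUniversal`). For the presheaf colimit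
of a finite diagram of covers it yields colimits in `FT f` that the fibre functor preserves, which
is the hard part of the Galois axioms.

If `Y` represents `F`, the lifts of the tame point to `Y` are at once the fibre of `Y` and the stalk
of `F`; the fundamental group acts on them, additively because the action is natural in the cover.
Morphisms of covers are equivariant maps of fibres, which gives full faithfulness. Conversely, a
finite discrete module is the fibre of some cover, its operations are equivariant and lift to a
`GroupLaw`, and the represented sheaf is locally constant because a Galois cover splits it
(`IsUniversal.exists_isConstOver`). -/

namespace TameSite

/-! ### Ramification groups for valuations of arbitrary rank -/

section Wild

open Pointwise

variable {K Ω : Type*} [Field K] [Field Ω] [Algebra K Ω]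

theorem valuation_lt_one_iff_inv_notMem (V : ValuationSubring Ω) (x : Ω) :
    V.valuation x < 1 ↔ x = 0 ∨ x⁻¹ ∉ V := by
  rcases eq_or_ne x 0 with rfl | hx
  · simp
  · rw [← not_le, ← V.valuation_le_one_iff, map_inv₀,
      inv_le_one₀ (by simpa [zero_lt_iff] using hx)]
    simp [hx]

theorem valuation_comap_lt_one_iff {L : Type*} [Field L] (i : L →+* Ω)
    (V : ValuationSubring Ω) (x : L) :
    (V.comap i).valuation x < 1 ↔ V.valuation (i x) < 1 := by
  simp [valuation_lt_one_iff_inv_notMem, ValuationSubring.mem_comap]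

theorem valuation_mul_sub_one_lt (V : ValuationSubring Ω) {x y : Ω}
    (hx : V.valuation (x - 1) < 1) (hy : V.valuation (y - 1) < 1) :
    V.valuation (x * y - 1) < 1 := by
  have h1 : V.valuation y ≤ 1 := by
    have : y = (y - 1) + 1 := by ring
    rw [this]
    exact (Valuation.map_add _ _ _).trans (max_le hy.le (by simp))
  have : x * y - 1 = (x - 1) * y + (y - 1) := by ring
  rw [this]
  refine Valuation.map_add_lt _ ?_ hy
  rw [map_mul]
  exact mul_lt_one_of_lt_of_le hx h1

theorem valuation_eq_one_of_sub_one_lt (V : ValuationSubring Ω) {x : Ω}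
    (hx : V.valuation (x - 1) < 1) : V.valuation x = 1 := by
  have := Valuation.map_add_eq_of_lt_right V.valuation (x := x - 1) (y := 1) (by simpa using hx)
  simpa using this

/-- An automorphism `σ` is wild with respect to the valuation ring `V` if `σ a / a` is a principal
unit for all nonzero `a`, that is if it lies in the ramification group of `V`. -/
def IsWild (V : ValuationSubring Ω) (σ : Ω ≃ₐ[K] Ω) : Prop :=
  ∀ a : Ω, a ≠ 0 → V.valuation (σ a / a - 1) < 1

/-- `V` is stable under `σ` and `σ` acts trivially on the residue field. -/
def IsInert (V : ValuationSubring Ω) (σ : Ω ≃ₐ[K] Ω) : Prop :=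
  ∀ a ∈ V, V.valuation (σ a - a) < 1

theorem IsInert.mem {V : ValuationSubring Ω} {σ : Ω ≃ₐ[K] Ω} (h : IsInert V σ) {a : Ω}
    (ha : a ∈ V) : σ a ∈ V := by
  have : σ a = (σ a - a) + a := by ring
  rw [this]
  exact add_mem ((V.valuation_le_one_iff _).1 (h a ha).le) ha

theorem IsWild.valuation_apply {V : ValuationSubring Ω} {σ : Ω ≃ₐ[K] Ω} (h : IsWild V σ) (a : Ω) :
    V.valuation (σ a) = V.valuation a := by
  rcases eq_or_ne a 0 with rfl | ha
  · simp
  have := valuation_eq_one_of_sub_one_lt V (h a ha)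
  rw [map_div₀] at this
  rwa [div_eq_one_iff_eq (by simpa using ha)] at this

theorem IsWild.isInert {V : ValuationSubring Ω} {σ : Ω ≃ₐ[K] Ω} (h : IsWild V σ) :
    IsInert V σ := by
  intro a ha
  rcases eq_or_ne a 0 with rfl | h0
  · simp
  have : σ a - a = (σ a / a - 1) * a := by field_simp
  rw [this, map_mul]
  exact mul_lt_one_of_lt_of_le (h a h0) ((V.valuation_le_one_iff _).2 ha)

theorem IsWild.restrict {K' Ω' : Type*} [Field K'] [Field Ω'] [Algebra K' Ω']
    {V : ValuationSubring Ω} {σ : Ω ≃ₐ[K] Ω} (h : IsWild V σ) (i : Ω' →+* Ω)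
    (τ : Ω' ≃ₐ[K'] Ω') (hτ : ∀ a, i (τ a) = σ (i a)) : IsWild (V.comap i) τ := by
  intro a ha
  rw [valuation_comap_lt_one_iff]
  simpa [hτ] using h (i a) (by simpa using ha)

theorem IsInert.restrict {K' Ω' : Type*} [Field K'] [Field Ω'] [Algebra K' Ω']
    {V : ValuationSubring Ω} {σ : Ω ≃ₐ[K] Ω} (h : IsInert V σ) (i : Ω' →+* Ω)
    (τ : Ω' ≃ₐ[K'] Ω') (hτ : ∀ a, i (τ a) = σ (i a)) : IsInert (V.comap i) τ := by
  intro a ha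
  rw [valuation_comap_lt_one_iff]
  simpa [hτ] using h (i a) ha

section Finite

variable {V : ValuationSubring Ω} [FiniteDimensional K Ω]
  (hV : ∀ σ : Ω ≃ₐ[K] Ω, IsInert V σ)

include hV in
theorem one_lt_valuation_apply (σ : Ω ≃ₐ[K] Ω) {u : Ω} (hu : 1 < V.valuation u) :
    1 < V.valuation (σ u) := by
  rw [← not_le, V.valuation_le_one_iff] at hu ⊢
  intro h
  have := (hV σ⁻¹).mem h
  rw [← AlgEquiv.mul_apply, inv_mul_cancel] at this
  exact hu this

-- Automorphisms preserve the elements of valuation greater than `1`. If `σ a / a` were such an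
-- element, applying the powers of `σ` would make the valuations of `σ ^ k a` strictly increasing in
-- `k`, although `σ` has finite order.
include hV in
theorem valuation_apply_le (σ : Ω ≃ₐ[K] Ω) (a : Ω) : V.valuation (σ a) ≤ V.valuation a := by
  by_contra! hlt
  have ha : a ≠ 0 := by rintro rfl; simp at hlt
  have hu : 1 < V.valuation (σ a / a) := by
    rw [map_div₀]
    rwa [one_lt_div₀ (by simpa [zero_lt_iff] using ha)]
  have hstep (k : ℕ) : V.valuation ((σ ^ k) a) < V.valuation ((σ ^ (k + 1)) a) := by
    have h1 := one_lt_valuation_apply hV (σ ^ k) hu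
    have h0 : (σ ^ k) a ≠ 0 := (map_ne_zero _).2 ha
    rw [map_div₀, map_div₀, one_lt_div₀ (by rw [zero_lt_iff]; exact (map_ne_zero _).2 h0)] at h1
    rwa [pow_succ, AlgEquiv.mul_apply]
  have hmono := strictMono_nat_of_lt_succ hstep
  have h2 := hmono (orderOf_pos σ)
  simp [pow_orderOf_eq_one] at h2

include hV in
theorem valuation_apply_eq (σ : Ω ≃ₐ[K] Ω) (a : Ω) : V.valuation (σ a) = V.valuation a := by
  refine (valuation_apply_le hV σ a).antisymm ?_
  have := valuation_apply_le hV σ⁻¹ (σ a)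
  rwa [← AlgEquiv.mul_apply, inv_mul_cancel] at this

/-- The ramification group of a totally inert finite extension. -/
def wildSubgroup : Subgroup (Ω ≃ₐ[K] Ω) where
  carrier := {σ | IsWild V σ}
  one_mem' := fun a ha ↦ by simp [ha]
  mul_mem' := by
    intro σ τ hσ hτ a ha
    have hb : τ a ≠ 0 := by simpa using ha
    have : (σ * τ) a / a = (σ (τ a) / τ a) * (τ a / a) := by
      rw [AlgEquiv.mul_apply]; field_simp
    rw [this]
    exact valuation_mul_sub_one_lt V (hσ _ hb) (hτ a ha)
  inv_mem' := by
    intro σ hσ a ha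
    have hb : σ⁻¹ a ≠ 0 := by simpa using ha
    have h1 := hσ _ hb
    have h2 : σ (σ⁻¹ a) = a := by rw [← AlgEquiv.mul_apply, mul_inv_cancel, AlgEquiv.one_apply]
    rw [h2] at h1
    have h3 : σ⁻¹ a / a - 1 = -((a / σ⁻¹ a - 1) * (a / σ⁻¹ a)⁻¹) := by field_simp; ring
    rw [h3, Valuation.map_neg, map_mul, map_inv₀, valuation_eq_one_of_sub_one_lt V h1]
    simpa using h1

include hV in
theorem wildSubgroup_normal : (wildSubgroup (K := K) (V := V)).Normal := by
  refine ⟨fun σ hσ τ a ha ↦ ?_⟩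
  have hb : τ⁻¹ a ≠ 0 := by simpa using ha
  have h2 : τ (τ⁻¹ a) = a := by rw [← AlgEquiv.mul_apply, mul_inv_cancel, AlgEquiv.one_apply]
  have : (τ * σ * τ⁻¹) a / a - 1 = τ (σ (τ⁻¹ a) / τ⁻¹ a - 1) := by
    simp [AlgEquiv.mul_apply]
  rw [this, valuation_apply_eq hV]
  exact hσ _ hb

/-- Let `σ` be wild of prime order `l` and let `T` be the trace over its powers. For nonzero `b`
with `T b = 0`, the `l` elements `σ ^ i b / b - 1` lie in the maximal ideal and have sum `-l`. -/
theorem valuation_prime_lt_of_dvd_card_wild {l : ℕ} (hl : l.Prime)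
    (h : l ∣ Nat.card (wildSubgroup (K := K) (V := V))) : V.valuation (l : Ω) < 1 := by
  have := Fact.mk hl
  obtain ⟨⟨σ, hσ⟩, ho⟩ := exists_prime_orderOf_dvd_card' l h
  rw [Subgroup.orderOf_mk] at ho
  by_contra hlt
  have hl0 : (l : Ω) ≠ 0 := by rintro h0; simp [h0] at hlt
  obtain ⟨a, ha⟩ : ∃ a, σ a ≠ a := by
    by_contra! hfix
    have : σ = 1 := AlgEquiv.ext hfix
    rw [this, orderOf_one] at ho
    exact hl.one_lt.ne ho
  let T : Ω → Ω := fun x ↦ ∑ i ∈ Finset.range l, (σ ^ i) x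
  have hσT (x : Ω) : σ (T x) = T x := by
    have h1 : σ (T x) = ∑ i ∈ Finset.range l, (σ ^ (i + 1)) x := by
      simp [T, map_sum, pow_succ']
    have h2 := Finset.sum_range_succ (fun i ↦ (σ ^ i) x) l
    rw [Finset.sum_range_succ'] at h2
    have h3 : (σ ^ l) x = x := by rw [← ho, pow_orderOf_eq_one]; rfl
    simp only [h3, pow_zero, AlgEquiv.one_apply] at h2
    rw [h1]; exact add_right_cancel h2
  have hσT' (i : ℕ) (x : Ω) : (σ ^ i) (T x) = T x := by
    induction i with
    | zero => simp
    | succ n ih => rw [pow_succ, AlgEquiv.mul_apply, hσT, ih]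
  -- `T b = 0` because `T (T a) = l * T a`. And `b ≠ 0`, since otherwise `l * a` would be fixed by
  -- `σ`, hence `a` too.
  set b := l * a - T a with hb
  have hb0 : b ≠ 0 := by
    intro h0
    have h1 : (l : Ω) * a = T a := by linear_combination h0
    have h2 := hσT a
    rw [← h1] at h2
    simp only [map_mul, map_natCast] at h2
    exact ha (mul_left_cancel₀ hl0 h2)
  have hTb : T b = 0 := by
    have : T b = l * T a - ∑ i ∈ Finset.range l, (σ ^ i) (T a) := by
      simp only [T, hb, map_sub, map_mul, map_natCast, Finset.sum_sub_distrib, Finset.mul_sum]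
    rw [this, Finset.sum_congr rfl (fun i _ ↦ hσT' i a)]
    simp
  have hsum : ∑ i ∈ Finset.range l, ((σ ^ i) b / b - 1) = -l := by
    rw [Finset.sum_sub_distrib, ← Finset.sum_div]
    change T b / b - _ = _
    simp [hTb]
  apply hlt
  rw [← Valuation.map_neg, ← hsum]
  exact Valuation.map_sum_lt _ one_ne_zero fun i _ ↦ (pow_mem hσ i : σ ^ i ∈ wildSubgroup) b hb0

-- Inertia acts trivially on the residue field, so modulo the maximal ideal `σ ^ i a / a` is the
-- `i`-th power of `u = σ a / a`. If `σ ^ l` is wild then `u ^ l` reduces to `1`, and in residue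
-- characteristic `l` this forces `u` to reduce to `1`. Hence the quotient by the ramification group
-- has no element of order `l`.
include hV in
theorem not_valuation_prime_lt_of_dvd_index_wild {l : ℕ} (hl : l.Prime)
    (h : l ∣ (wildSubgroup (K := K) (V := V)).index) : ¬ V.valuation (l : Ω) < 1 := by
  intro hlt
  have := Fact.mk hl
  have := wildSubgroup_normal hV
  rw [Subgroup.index] at h
  obtain ⟨q, ho⟩ := exists_prime_orderOf_dvd_card' l h
  obtain ⟨σ, rfl⟩ := QuotientGroup.mk_surjective q
  have h1 : σ ∉ wildSubgroup (V := V) := by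
    intro h1
    rw [(QuotientGroup.eq_one_iff σ).2 h1, orderOf_one] at ho
    exact hl.one_lt.ne ho
  have h2 : σ ^ l ∈ wildSubgroup (V := V) := by
    rw [← QuotientGroup.eq_one_iff, QuotientGroup.mk_pow, ← ho, pow_orderOf_eq_one]
  apply h1
  intro a ha
  set u := σ a / a with hu
  have hu1 : V.valuation u = 1 := by
    rw [hu, map_div₀, valuation_apply_eq hV, div_self (by simpa using ha)]
  have huV : u ∈ V := (V.valuation_le_one_iff _).1 hu1.le
  -- modulo the maximal ideal, `σ ^ i a / a` is `u ^ i`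
  have hpow (i : ℕ) : V.valuation ((σ ^ i) a / a - u ^ i) < 1 := by
    induction i with
    | zero => simp [ha]
    | succ n ih =>
      have hs : (σ ^ (n + 1)) a / a - u ^ (n + 1) =
          ((σ ^ n) u - u) * ((σ ^ n) a / a) + u * ((σ ^ n) a / a - u ^ n) := by
        have : (σ ^ n) a ≠ 0 := (map_ne_zero _).2 ha
        have e : (σ ^ n) u = (σ ^ (n + 1)) a / (σ ^ n) a := by
          rw [hu, map_div₀, pow_succ, AlgEquiv.mul_apply]
        rw [e, pow_succ u]
        field_simp
        ring
      rw [hs]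
      refine Valuation.map_add_lt _ ?_ ?_
      · rw [map_mul, map_div₀ V.valuation ((σ ^ n) a), valuation_apply_eq hV,
          div_self (by simpa using ha), mul_one]
        exact hV _ _ huV
      · rwa [map_mul, hu1, one_mul]
  have h3 : V.valuation (u ^ l - 1) < 1 := by
    have : u ^ l - 1 = ((σ ^ l) a / a - 1) - ((σ ^ l) a / a - u ^ l) := by ring
    rw [this]
    exact Valuation.map_sub_lt _ (h2 a ha) (hpow l)
  let r := IsLocalRing.residue V
  have hr (x : V) : r x = 0 ↔ V.valuation (x : Ω) < 1 := by
    rw [IsLocalRing.residue_eq_zero_iff, ← V.valuation_lt_one_iff]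
  have hchar : (l : IsLocalRing.ResidueField V) = 0 := by
    have := (hr (l : V)).2 (by simpa using hlt)
    simpa using this
  have : CharP (IsLocalRing.ResidueField V) l :=
    (CharP.charP_iff_prime_eq_zero hl).2 hchar
  have h4 : r (⟨u, huV⟩ ^ l - 1) = 0 := (hr _).2 (by simpa using h3)
  rw [map_sub, map_pow, map_one, ← one_pow (M := IsLocalRing.ResidueField V) l,
    ← sub_pow_char] at h4
  have h5 := pow_eq_zero_iff (hl.ne_zero) |>.1 h4
  rw [← map_one r, ← map_sub] at h5
  simpa using (hr _).1 h5

/-- Every element of the ramification group of a subextension comes from an element of the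
ramification group. -/
theorem exists_isWild_restrictNormalHom_eq (hV : ∀ σ : Ω ≃ₐ[K] Ω, IsInert V σ)
    (N : Type*) [Field N] [Algebra K N] [Algebra N Ω] [IsScalarTower K N Ω] [Normal K N]
    [Normal K Ω] (τ : N ≃ₐ[K] N) (hτ : IsWild (V.comap (algebraMap N Ω)) τ) :
    ∃ σ : Ω ≃ₐ[K] Ω, IsWild V σ ∧ AlgEquiv.restrictNormalHom N σ = τ := by
  have := FiniteDimensional.left K N Ω
  have hn := wildSubgroup_normal hV
  obtain ⟨σ, rfl⟩ := AlgEquiv.restrictNormalHom_surjective (F := K) (K₁ := N) Ω τ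
  set m := (wildSubgroup (K := K) (V := V)).index with hm
  let τ' : wildSubgroup (K := K) (V := V.comap (algebraMap N Ω)) :=
    ⟨AlgEquiv.restrictNormalHom N σ, hτ⟩
  have hco : Nat.Coprime m (orderOf τ') := by
    refine Nat.Coprime.coprime_dvd_right (orderOf_dvd_natCard τ') ?_
    refine Nat.coprime_of_dvd fun l hl h1 h2 ↦ ?_
    refine not_valuation_prime_lt_of_dvd_index_wild hV hl h1 ?_
    have := valuation_prime_lt_of_dvd_card_wild hl h2
    rw [valuation_comap_lt_one_iff] at this
    simpa using this
  -- Any lift `σ` becomes wild when raised to the index `m`. As `m` is prime to the order of the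
  -- wild `τ`, a further power `j` turns `τ ^ m` back into `τ`.
  obtain ⟨j, hj⟩ := exists_pow_eq_self_of_coprime hco
  refine ⟨(σ ^ m) ^ j, (pow_mem (Subgroup.pow_index_mem _ σ) j : (σ ^ m) ^ j ∈ wildSubgroup), ?_⟩
  have := congrArg Subtype.val hj
  simpa [τ'] using this

end Finite

end Wild

end TameSite

namespace TameSite

/-! ### Extensions of valuations and transitivity of the Galois action -/

section Extension

variable {K Ω : Type*} [Field K] [Field Ω]

/-- A valuation extends along any extension of fields. -/
theorem exists_valuationSubring_comap_eq (i : K →+* Ω) (V : ValuationSubring K) :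
    ∃ W : ValuationSubring Ω, W.comap i = V := by
  obtain ⟨W, h, hW⟩ := IsLocalRing.exists_factor_valuationRing (i.comp V.subtype)
  refine ⟨W, ?_⟩
  ext x
  rw [ValuationSubring.mem_comap]
  refine ⟨fun hx ↦ ?_, fun hx ↦ h ⟨x, hx⟩⟩
  -- The map from `V` to `W` is local: `x⁻¹` becomes a unit in `W`, so it is already a unit in `V`.
  by_contra hxV
  have hx' := (V.mem_or_inv_mem x).resolve_left hxV
  have hu : IsUnit (((i.comp V.subtype).codRestrict W.toSubring h) ⟨x⁻¹, hx'⟩) := by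
    refine IsUnit.of_mul_eq_one ⟨i x, hx⟩ (Subtype.ext ?_)
    have h0 : x ≠ 0 := by rintro rfl; exact hxV V.zero_mem
    change i x⁻¹ * i x = 1
    rw [← map_mul, inv_mul_cancel₀ h0, map_one]
  have hu' := hW.map_nonunit _ hu
  obtain ⟨⟨y, hy⟩, hy'⟩ := hu'.exists_right_inv
  have : x⁻¹ * y = 1 := congrArg Subtype.val hy'
  apply hxV
  rwa [← inv_inv x, inv_eq_of_mul_eq_one_right this]

variable [Algebra K Ω]

theorem mem_of_isIntegral_valuationSubring {V : ValuationSubring K} {W : ValuationSubring Ω}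
    (h : V ≤ W.comap (algebraMap K Ω)) {b : Ω}
    (hb : ((algebraMap K Ω).comp V.subtype).IsIntegralElem b) : b ∈ W := by
  obtain ⟨p, hp, hpb⟩ := hb
  have : IsIntegral W b := by
    let j : V →+* W := ((algebraMap K Ω).comp V.subtype).codRestrict W.toSubring (fun x ↦ h x.2)
    refine ⟨p.map j, hp.map _, ?_⟩
    rw [Polynomial.eval₂_map]
    exact hpb
  obtain ⟨y, rfl⟩ := IsIntegrallyClosed.isIntegral_iff.1 this
  exact y.2

/-- The integral closure of a subring of a field is the intersection of the valuation rings
containing it. The rest of the proof moves the monic equation from the image of `V` back to `V`. -/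
theorem isIntegralElem_of_forall_mem {V : ValuationSubring K} {b : Ω}
    (hb : ∀ W : ValuationSubring Ω, V ≤ W.comap (algebraMap K Ω) → b ∈ W) :
    ((algebraMap K Ω).comp V.subtype).IsIntegralElem b := by
  have h := iInf_valuationSubring_superset
    (s := (((algebraMap K Ω).comp V.subtype).range : Set Ω))
  have hmem : b ∈ (integralClosure (Subring.closure
      (((algebraMap K Ω).comp V.subtype).range : Set Ω)) Ω).toSubring := by
    rw [← h]
    simp only [Subring.mem_iInf]
    rintro ⟨W, hW⟩
    exact hb W fun x hx ↦ hW ⟨⟨x, hx⟩, rfl⟩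
  have hint : IsIntegral (Subring.closure
      (((algebraMap K Ω).comp V.subtype).range : Set Ω)) b := hmem
  obtain ⟨p, hp, hpb⟩ := hint
  have hcl : Subring.closure (((algebraMap K Ω).comp V.subtype).range : Set Ω) =
      ((algebraMap K Ω).comp V.subtype).range := Subring.closure_eq _
  have : ((algebraMap K Ω).comp V.subtype).range.subtype.IsIntegralElem b := by
    rw [← hcl]; exact ⟨p, hp, hpb⟩
  obtain ⟨p, hp, hpb⟩ := this
  obtain ⟨q, hq, -, hqm⟩ := Polynomial.lifts_and_natDegree_eq_and_monic
    (f := ((algebraMap K Ω).comp V.subtype).rangeRestrict)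
    ((Polynomial.mem_lifts _).2 (Polynomial.map_surjective _
      (RingHom.rangeRestrict_surjective _) p)) hp
  refine ⟨q, hqm, ?_⟩
  rw [← hq, Polynomial.eval₂_map] at hpb
  exact hpb

/-- Two extensions of a valuation to an algebraic extension coincide if they have the same center
on the integral closure. -/
theorem valuationSubring_le_of_center [Algebra.IsAlgebraic K Ω] {V : ValuationSubring K}
    {V₁ V₂ : ValuationSubring Ω} (h₁ : V₁.comap (algebraMap K Ω) = V)
    (h₂ : V₂.comap (algebraMap K Ω) = V)
    (h : ∀ b, ((algebraMap K Ω).comp V.subtype).IsIntegralElem b →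
      V₂.valuation b < 1 → V₁.valuation b < 1) : V₁ ≤ V₂ := by
  intro x hx
  obtain ⟨p, hp0, hpx⟩ := Algebra.IsAlgebraic.isAlgebraic (R := K) x
  -- The last index at which a coefficient has maximal valuation. Dividing by that coefficient puts
  -- all coefficients in `V`, and the later ones in its maximal ideal.
  obtain ⟨j, hj⟩ : ∃ j, p.coeff j ≠ 0 ∧ (∀ i, V.valuation (p.coeff i) ≤ V.valuation (p.coeff j)) ∧
      ∀ i, j < i → V.valuation (p.coeff i) < V.valuation (p.coeff j) := by
    have hne : (Finset.range (p.natDegree + 1)).Nonempty := by simp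
    obtain ⟨m, hm, hmax⟩ := Finset.exists_max_image (Finset.range (p.natDegree + 1))
      (fun i ↦ V.valuation (p.coeff i)) hne
    have hmax' (i : ℕ) : V.valuation (p.coeff i) ≤ V.valuation (p.coeff m) := by
      by_cases hi : i ≤ p.natDegree
      · exact hmax i (by simp; omega)
      · rw [Polynomial.coeff_eq_zero_of_natDegree_lt (by omega)]; simp
    have hm0 : V.valuation (p.coeff m) ≠ 0 := by
      intro h0
      have := hmax' p.natDegree
      rw [h0, le_zero_iff, map_eq_zero] at this
      exact hp0 (Polynomial.leadingCoeff_eq_zero.1 this)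
    let S := (Finset.range (p.natDegree + 1)).filter
      (fun i ↦ V.valuation (p.coeff i) = V.valuation (p.coeff m))
    have hS : S.Nonempty := ⟨m, by simp [S] at hm ⊢; exact hm⟩
    refine ⟨S.max' hS, ?_⟩
    have hmem := Finset.mem_filter.1 (S.max'_mem hS)
    refine ⟨fun h0 ↦ hm0 (by rw [← hmem.2, h0, map_zero]), fun i ↦ by rw [hmem.2]; exact hmax' i,
      fun i hi ↦ ?_⟩
    rw [hmem.2]
    refine lt_of_le_of_ne (hmax' i) fun he ↦ ?_
    have : i ∈ S := by
      refine Finset.mem_filter.2 ⟨?_, he⟩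
      by_contra hir
      rw [Polynomial.coeff_eq_zero_of_natDegree_lt (by simpa using hir)] at he
      exact hm0 (by rw [← he, map_zero])
    exact absurd (S.le_max' i this) (by omega)
  obtain ⟨hj0, hjle, hjlt⟩ := hj
  set n := max (p.natDegree + 1) (j + 1) with hn
  let d (i : ℕ) : Ω := algebraMap K Ω (p.coeff i / p.coeff j)
  have hdV (i : ℕ) : p.coeff i / p.coeff j ∈ V := by
    rw [← V.valuation_le_one_iff, map_div₀]
    exact div_le_one_of_le₀ (hjle i) zero_le
  have hsum : ∑ i ∈ Finset.range n, d i * x ^ i = 0 := by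
    have h1 : (Polynomial.aeval x) p =
        ∑ i ∈ Finset.range n, algebraMap K Ω (p.coeff i) * x ^ i := by
      rw [Polynomial.aeval_eq_sum_range' (n := n) (by omega)]
      simp [Algebra.smul_def]
    have h2 : ∑ i ∈ Finset.range n, d i * x ^ i =
        (algebraMap K Ω (p.coeff j))⁻¹ * (Polynomial.aeval x) p := by
      rw [h1, Finset.mul_sum]
      refine Finset.sum_congr rfl fun i _ ↦ ?_
      simp only [d, map_div₀]; ring
    rw [h2, hpx, mul_zero]
  -- The equation of `x` expresses `b * x ^ j` through lower powers of `x`. In a valuation ring over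
  -- `V` containing `x`, both `b` and `b * x` lie; if it contains `x⁻¹` instead, division by `x ^ (j
  -- - 1)` gives the same. So `b` is integral over `V`. It reduces to `1` in `V₁`, which contains
  -- `x`. By the hypothesis on centers it is then a unit of `V₂`, and `x = (b * x) / b` lies in
  -- `V₂`.
  set b := ∑ i ∈ Finset.range (n - j), d (j + i) * x ^ i with hb
  have hsplit : b * x ^ j = - ∑ i ∈ Finset.range j, d i * x ^ i := by
    have hnj : n = j + (n - j) := by omega
    rw [hnj, Finset.sum_range_add] at hsum
    rw [eq_neg_iff_add_eq_zero, add_comm, ← hsum, hb, Finset.sum_mul]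
    congr 1
    exact Finset.sum_congr rfl fun i _ ↦ by ring
  have key (A : ValuationSubring Ω) (hA : V ≤ A.comap (algebraMap K Ω)) : b ∈ A ∧ b * x ∈ A := by
    have hdA (i : ℕ) : d i ∈ A := hA (hdV i)
    have hpos : x ∈ A → b ∈ A := fun hxA ↦
      sum_mem fun i _ ↦ mul_mem (hdA _) (pow_mem hxA _)
    rcases eq_or_ne x 0 with hx0 | hx0
    · have hxA : x ∈ A := by rw [hx0]; exact A.zero_mem
      exact ⟨hpos hxA, mul_mem (hpos hxA) hxA⟩
    rcases A.mem_or_inv_mem x with hxA | hxA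
    · exact ⟨hpos hxA, mul_mem (hpos hxA) hxA⟩
    · have hxj : x ^ j ≠ 0 := pow_ne_zero _ hx0
      have e1 : b * x = - ∑ i ∈ Finset.range j, d i * x⁻¹ ^ (j - 1 - i) := by
        apply mul_right_cancel₀ hxj
        rw [mul_right_comm, hsplit, neg_mul, neg_mul, Finset.sum_mul, Finset.sum_mul]
        congr 1
        refine Finset.sum_congr rfl fun i hi ↦ ?_
        have hi' : i < j := Finset.mem_range.1 hi
        obtain ⟨k, rfl⟩ : ∃ k, j = i + 1 + k := ⟨j - (i + 1), by omega⟩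
        have : i + 1 + k - 1 - i = k := by omega
        rw [this, mul_assoc, mul_assoc]
        congr 1
        rw [inv_pow, pow_add, pow_succ]
        field_simp
      have e2 : b * x ∈ A := by
        rw [e1]
        exact neg_mem (sum_mem fun i _ ↦ mul_mem (hdA _) (pow_mem hxA _))
      refine ⟨?_, e2⟩
      have : b = (b * x) * x⁻¹ := by field_simp
      rw [this]; exact mul_mem e2 hxA
  have hbint := isIntegralElem_of_forall_mem (b := b) (V := V) fun W hW ↦ (key W hW).1
  have hvb : V₁.valuation b = 1 := by
    have hd1 : d j = 1 := by simp [d, hj0]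
    have hnj : n - j = (n - j - 1) + 1 := by omega
    have : b - 1 = ∑ i ∈ Finset.range (n - j - 1), d (j + (i + 1)) * x ^ (i + 1) := by
      rw [hb, hnj, Finset.sum_range_succ']
      simp [hd1]
    apply valuation_eq_one_of_sub_one_lt
    rw [this]
    refine Valuation.map_sum_lt _ one_ne_zero fun i _ ↦ ?_
    rw [map_mul]
    refine mul_lt_one_of_lt_of_le ?_ ((V₁.valuation_le_one_iff _).2 (pow_mem hx _))
    have := valuation_comap_lt_one_iff (algebraMap K Ω) V₁ (p.coeff (j + (i + 1)) / p.coeff j)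
    rw [h₁] at this
    rw [← this, map_div₀]
    exact (div_lt_one₀ (by rw [zero_lt_iff]; simpa using hj0)).2 (hjlt _ (by omega))
  have h2b : ¬ V₂.valuation b < 1 := fun hlt ↦ (h b hbint hlt).ne hvb
  have k2 := key V₂ h₂.ge
  have hb2 : V₂.valuation b = 1 :=
    le_antisymm ((V₂.valuation_le_one_iff _).2 k2.1) (not_lt.1 h2b)
  have := (V₂.valuation_le_one_iff _).2 k2.2
  rw [map_mul, hb2, one_mul] at this
  exact (V₂.valuation_le_one_iff _).1 this

/-- This makes every set of automorphisms cut out by conditions on the values at individual elements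
closed in the Krull topology. -/
theorem isLocallyConstant_galois_apply [Algebra.IsAlgebraic K Ω] (a : Ω) :
    _root_.IsLocallyConstant fun σ : Ω ≃ₐ[K] Ω ↦ σ a := by
  rw [_root_.IsLocallyConstant.iff_exists_open]
  intro σ
  have : FiniteDimensional K (IntermediateField.adjoin K {a}) :=
    IntermediateField.adjoin.finiteDimensional (Algebra.IsAlgebraic.isAlgebraic a).isIntegral
  refine ⟨(fun τ ↦ σ⁻¹ * τ) ⁻¹'
      ((IntermediateField.adjoin K {a}).fixingSubgroup : Set (Ω ≃ₐ[K] Ω)),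
    (IntermediateField.fixingSubgroup_isOpen _).preimage (continuous_mul_left _), ?_, ?_⟩
  · simp [one_mem]
  · intro τ hτ
    have h1 := (mem_fixingSubgroup_iff (Ω ≃ₐ[K] Ω)).1 hτ a
      (IntermediateField.mem_adjoin_simple_self K a)
    rw [AlgEquiv.smul_def, AlgEquiv.mul_apply] at h1
    have h2 := congrArg σ h1
    rwa [← AlgEquiv.mul_apply, mul_inv_cancel, AlgEquiv.one_apply] at h2

/-- The Galois group acts transitively on the extensions of a valuation. -/
theorem exists_comap_galois_eq [IsGalois K Ω] {V₁ V₂ : ValuationSubring Ω}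
    (h : V₁.comap (algebraMap K Ω) = V₂.comap (algebraMap K Ω)) :
    ∃ σ : Ω ≃ₐ[K] Ω, V₁.comap (σ : Ω →+* Ω) = V₂ := by
  set V := V₁.comap (algebraMap K Ω) with hV
  let := ((algebraMap K Ω).comp V.subtype).toAlgebra
  have : IsScalarTower V K Ω := .of_algebraMap_eq' rfl
  let B := integralClosure V Ω
  have hcomm : SMulCommClass (Ω ≃ₐ[K] Ω) V Ω := ⟨fun σ r x ↦ by
    rw [← algebraMap_smul K r, ← algebraMap_smul K r, smul_comm]⟩
  let : TopologicalSpace B := ⊥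
  have : DiscreteTopology B := ⟨rfl⟩
  have : ContinuousSMul (Ω ≃ₐ[K] Ω) B := by
    rw [continuousSMul_iff_stabilizer_isOpen]
    intro b
    convert (isLocallyConstant_galois_apply (K := K) (b : Ω)).isOpen_fiber (b : Ω)
    ext σ
    rw [SetLike.mem_coe, MulAction.mem_stabilizer_iff, Subtype.ext_iff]
    rfl
  have hinv : Algebra.IsInvariant V B (Ω ≃ₐ[K] Ω) := by
    refine ⟨fun b hb ↦ ?_⟩
    obtain ⟨x, hx⟩ := (InfiniteGalois.mem_range_algebraMap_iff_fixed (k := K) (b : Ω)).2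
      fun σ ↦ congrArg Subtype.val (hb σ)
    have hxV : x ∈ V := by
      rw [hV, ValuationSubring.mem_comap, hx]
      exact mem_of_isIntegral_valuationSubring (V := V) le_rfl b.2
    exact ⟨⟨x, hxV⟩, Subtype.ext hx⟩
  let j (W : ValuationSubring Ω) (hW : V ≤ W.comap (algebraMap K Ω)) : B →+* W :=
    (B.val : B →+* Ω).codRestrict W.toSubring fun b ↦ mem_of_isIntegral_valuationSubring hW b.2
  let P (W : ValuationSubring Ω) (hW : V ≤ W.comap (algebraMap K Ω)) : Ideal B :=
    (IsLocalRing.maximalIdeal W).comap (j W hW)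
  have hP (W hW) (b : B) : b ∈ P W hW ↔ W.valuation (b : Ω) < 1 := by
    exact W.valuation_lt_one_iff (j W hW b)
  have hu (W hW) (hWV : W.comap (algebraMap K Ω) = V) (x : V) :
      x ∈ (P W hW).under V ↔ V.valuation (x : K) < 1 := by
    have h1 := valuation_comap_lt_one_iff (algebraMap K Ω) W (x : K)
    rw [hWV] at h1
    exact (hP W hW (algebraMap V B x)).trans h1.symm
  have : (P V₁ le_rfl).IsPrime := Ideal.comap_isPrime _ _
  have : (P V₂ h.le).IsPrime := Ideal.comap_isPrime _ _
  -- A profinite group acts transitively on the primes of the integral closure over a given prime of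
  -- the ring of invariants. The centers of `V₁` and `V₂` are two such primes, and a center
  -- determines its valuation ring.
  obtain ⟨g, hg⟩ := Algebra.IsInvariant.exists_smul_of_under_eq_of_profinite (A := V)
    (G := Ω ≃ₐ[K] Ω) (P V₁ le_rfl) (P V₂ h.le) (by
      ext x; rw [hu V₁ le_rfl rfl, hu V₂ h.le h.symm])
  have hcom : (V₁.comap ((g⁻¹ : Ω ≃ₐ[K] Ω) : Ω →+* Ω)).comap (algebraMap K Ω) = V := by
    rw [hV, ValuationSubring.comap_comap]
    congr 1
    ext x
    simp
  have hcen (b : Ω) (hb : IsIntegral V b) : V₂.valuation b < 1 ↔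
      (V₁.comap ((g⁻¹ : Ω ≃ₐ[K] Ω) : Ω →+* Ω)).valuation b < 1 := by
    rw [← hP V₂ h.le ⟨b, hb⟩, hg, Ideal.mem_pointwise_smul_iff_inv_smul_mem, hP V₁ le_rfl,
      valuation_comap_lt_one_iff]
    rfl
  refine ⟨g⁻¹, le_antisymm ?_ ?_⟩
  · exact valuationSubring_le_of_center hcom h.symm fun b hb ↦ (hcen b hb).1
  · exact valuationSubring_le_of_center h.symm hcom fun b hb ↦ (hcen b hb).2

end Extension

end TameSite

/-! ### Tame ramification in terms of wild automorphisms -/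

namespace TameSite

/-- Normality of `P` gives `[P : P ∩ H] = [HP : H]`. This number divides both the order of `P` and
the index of `H`. -/
theorem subgroup_le_of_coprime_card_index {G : Type*} [Group G] [Finite G] (P H : Subgroup G)
    [P.Normal] (h : Nat.Coprime (Nat.card P) H.index) : P ≤ H := by
  have e2 := Subgroup.relIndex_mul_relIndex ⊥ (P ⊓ H) P bot_le inf_le_left
  have e3 := Subgroup.relIndex_mul_relIndex ⊥ (P ⊓ H) H bot_le inf_le_right
  have e4 := Subgroup.relIndex_mul_relIndex ⊥ P (H ⊔ P) bot_le le_sup_right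
  have e5 := Subgroup.relIndex_mul_relIndex ⊥ H (H ⊔ P) bot_le le_sup_left
  rw [Subgroup.relIndex_sup_right] at e4
  rw [Subgroup.inf_relIndex_right] at e3
  rw [Subgroup.inf_relIndex_left] at e2
  have h0 : 0 < (⊥ : Subgroup G).relIndex (P ⊓ H) := by
    rw [Subgroup.relIndex_bot_left]; exact Nat.card_pos
  have h1 : 0 < (⊥ : Subgroup G).relIndex H := by
    rw [Subgroup.relIndex_bot_left]; exact Nat.card_pos
  have key : H.relIndex P = H.relIndex (H ⊔ P) := by
    apply Nat.eq_of_mul_eq_mul_left h1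
    rw [e5, ← e4, ← e3, ← e2]
    ring
  rw [← Subgroup.relIndex_eq_one]
  refine Nat.eq_one_of_dvd_coprimes h (Subgroup.relIndex_dvd_card H P) ?_
  rw [key]
  exact Subgroup.relIndex_dvd_index_of_le le_sup_left

theorem _root_.IsLocallyConstant.isClosed_fiber' {X α β : Type*} [TopologicalSpace X]
    {g : X → α} (h : _root_.IsLocallyConstant g) (p : β → α → Prop) (b : β) :
    IsClosed {x | p b (g x)} :=
  ⟨h {a | ¬ p b a}⟩

/-- In characteristic zero the exponential characteristic is `1`, and both sides hold for every `n`;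
this is the convention that tameness is then no condition. -/
theorem coprime_ringExpChar_iff {k : Type*} [Field k] {n : ℕ} :
    Nat.Coprime n (ringExpChar k) ↔ ∀ l : ℕ, l.Prime → l ∣ n → (l : k) ≠ 0 := by
  obtain ⟨q, hq⟩ := ExpChar.exists k
  have hq' := ringExpChar.eq k q
  rw [hq']
  cases hq with
  | zero =>
    simp only [Nat.coprime_one_right_eq_true, true_iff]
    intro l hl _
    exact_mod_cast hl.ne_zero
  | prime hp =>
    rw [Nat.coprime_comm, hp.coprime_iff_not_dvd]
    constructor
    · intro h l hl hln h0
      have := (CharP.cast_eq_zero_iff k q l).1 h0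
      rw [(Nat.prime_dvd_prime_iff_eq hp hl).1 this] at h
      exact h hln
    · intro h hqn
      exact h q hp hqn (CharP.cast_eq_zero k q)

theorem natCast_residueField_eq_zero_iff {k : Type*} [Field k] (V : ValuationSubring k) (l : ℕ) :
    (l : IsLocalRing.ResidueField V) = 0 ↔ V.valuation (l : k) < 1 := by
  have : (l : IsLocalRing.ResidueField V) = IsLocalRing.residue V (l : V) := by simp
  rw [this, IsLocalRing.residue_eq_zero_iff]
  exact V.valuation_lt_one_iff _

section

variable {K Ω : Type*} [Field K] [Field Ω] [Algebra K Ω]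

open scoped Pointwise in
theorem mem_map_inertiaSubgroup {V : ValuationSubring Ω} {σ : Ω ≃ₐ[K] Ω} :
    σ ∈ (V.inertiaSubgroup K).map (V.decompositionSubgroup K).subtype ↔
      (∀ a, σ a ∈ V ↔ a ∈ V) ∧ IsInert V σ := by
  have hs : σ • V = V ↔ ∀ a, σ a ∈ V ↔ a ∈ V := by
    constructor
    · intro h a
      conv_lhs => rw [← h]
      exact ValuationSubring.smul_mem_pointwise_smul_iff
    · intro h
      ext a
      rw [ValuationSubring.mem_pointwise_smul_iff_inv_smul_mem, ← h]
      change σ (σ⁻¹ a) ∈ V ↔ _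
      rw [← AlgEquiv.mul_apply, mul_inv_cancel, AlgEquiv.one_apply]
  have key (g : V.decompositionSubgroup K) : g ∈ V.inertiaSubgroup K ↔ IsInert V g.1 := by
    rw [ValuationSubring.inertiaSubgroup, MonoidHom.mem_ker, RingEquiv.ext_iff]
    constructor
    · intro h a ha
      have h1 := h (IsLocalRing.residue V ⟨a, ha⟩)
      have h2 : IsLocalRing.residue V (g • ⟨a, ha⟩) = IsLocalRing.residue V ⟨a, ha⟩ := h1
      rw [← sub_eq_zero, ← map_sub, IsLocalRing.residue_eq_zero_iff] at h2
      exact (V.valuation_lt_one_iff _).1 h2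
    · intro h x
      obtain ⟨⟨a, ha⟩, rfl⟩ := IsLocalRing.residue_surjective x
      change IsLocalRing.residue V (g • ⟨a, ha⟩) = IsLocalRing.residue V ⟨a, ha⟩
      rw [← sub_eq_zero, ← map_sub, IsLocalRing.residue_eq_zero_iff]
      exact (V.valuation_lt_one_iff _).2 (h a ha)
  rw [← hs, Subgroup.mem_map]
  constructor
  · rintro ⟨g, hg, rfl⟩
    exact ⟨g.2, (key g).1 hg⟩
  · rintro ⟨h1, h2⟩
    exact ⟨⟨σ, h1⟩, (key ⟨σ, h1⟩).2 h2, rfl⟩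

theorem isClosed_setOf_forall_galois [Algebra.IsAlgebraic K Ω] (p : Ω → Ω → Prop) :
    IsClosed {σ : Ω ≃ₐ[K] Ω | ∀ a, p a (σ a)} := by
  rw [Set.ofPred_forall]
  exact isClosed_iInter fun a ↦ ((isLocallyConstant_galois_apply a).isClosed_fiber' p a)

/-- Closedness lets the Galois correspondence recover the inertia group from its fixed field, the
strict henselization. -/
theorem isClosed_inertia [Algebra.IsAlgebraic K Ω] (V : ValuationSubring Ω) :
    IsClosed (((V.inertiaSubgroup K).map (V.decompositionSubgroup K).subtype :
      Subgroup (Ω ≃ₐ[K] Ω)) : Set (Ω ≃ₐ[K] Ω)) := by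
  convert isClosed_setOf_forall_galois (K := K) (Ω := Ω)
    (fun a b ↦ (b ∈ V ↔ a ∈ V) ∧ (a ∈ V → V.valuation (b - a) < 1)) using 1
  ext σ
  rw [SetLike.mem_coe, mem_map_inertiaSubgroup, Set.mem_ofPred_eq, forall_and]
  rfl

theorem mem_fixingSubgroup_strictHenselization [IsGalois K Ω] (V : ValuationSubring Ω)
    {σ : Ω ≃ₐ[K] Ω} : σ ∈ (strictHenselization K V).fixingSubgroup ↔
      (∀ a, σ a ∈ V ↔ a ∈ V) ∧ IsInert V σ := by
  rw [← mem_map_inertiaSubgroup]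
  have := InfiniteGalois.fixingSubgroup_fixedField
    ⟨(V.inertiaSubgroup K).map (V.decompositionSubgroup K).subtype, isClosed_inertia V⟩
  exact iff_of_eq (congrArg (σ ∈ ·) this)

theorem IsWild.mem_iff {V : ValuationSubring Ω} {σ : Ω ≃ₐ[K] Ω} (h : IsWild V σ) (a : Ω) :
    σ a ∈ V ↔ a ∈ V := by
  rw [← V.valuation_le_one_iff, h.valuation_apply, V.valuation_le_one_iff]

theorem exists_restrictNormalHom_eq [IsGalois K Ω] (N : IntermediateField K Ω) [Normal K N]
    (τ : N ≃ₐ[K] N) : ∃ σ : Ω ≃ₐ[K] Ω, (∀ a : N, σ a = τ a) ∧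
      AlgEquiv.restrictNormalHom N σ = τ := by
  obtain ⟨σ, rfl⟩ := AlgEquiv.restrictNormalHom_surjective (F := K) (K₁ := N) Ω τ
  exact ⟨σ, fun a ↦ (AlgEquiv.restrictNormal_commutes σ N a).symm, rfl⟩

/-- Wild automorphisms of a finite subextension lift, if all automorphisms are inert. -/
theorem exists_isWild_forall_eq [IsGalois K Ω] {V : ValuationSubring Ω}
    (hV : ∀ σ : Ω ≃ₐ[K] Ω, IsInert V σ) (N : IntermediateField K Ω) [Normal K N]
    [FiniteDimensional K N] (τ : N ≃ₐ[K] N) (hτ : IsWild (V.comap (algebraMap N Ω)) τ) :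
    ∃ σ : Ω ≃ₐ[K] Ω, IsWild V σ ∧ ∀ a : N, σ a = τ a := by
  let t (a : Ω) : Set (Ω ≃ₐ[K] Ω) := {σ | a ≠ 0 → V.valuation (σ a / a - 1) < 1}
  have ht (a : Ω) : IsClosed (t a) :=
    (isLocallyConstant_galois_apply a).isClosed_fiber'
      (fun a b ↦ a ≠ 0 → V.valuation (b / a - 1) < 1) a
  have hs : IsClosed {σ : Ω ≃ₐ[K] Ω | ∀ a : N, σ a = τ a} := by
    convert isClosed_setOf_forall_galois (K := K) (Ω := Ω)
      (fun a b ↦ ∀ h : a ∈ N, b = τ ⟨a, h⟩) using 1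
    ext σ
    exact ⟨fun h a ha ↦ h ⟨a, ha⟩, fun h a ↦ h a a.2⟩
  -- Compactness of the Galois group: the lifts of `τ` form a closed set and wildness is one closed
  -- condition for each element. Finitely many of these conditions only concern a finite normal
  -- subextension, where the finite case supplies a lift.
  obtain ⟨σ, h1, h2⟩ := hs.isCompact.inter_iInter_nonempty t ht (by
    intro u
    let M : IntermediateField K Ω := N ⊔ IntermediateField.adjoin K (u : Set Ω)
    have : FiniteDimensional K (IntermediateField.adjoin K (u : Set Ω)) :=
      IntermediateField.finiteDimensional_adjoin fun x _ ↦
        (Algebra.IsAlgebraic.isAlgebraic x).isIntegral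
    have : FiniteDimensional K M := IntermediateField.finiteDimensional_sup _ _
    let N' := IntermediateField.normalClosure K M Ω
    have hMN : M ≤ N' := IntermediateField.le_normalClosure M
    have hN : N ≤ N' := le_sup_left.trans hMN
    let := (IntermediateField.inclusion hN).toRingHom.toAlgebra
    have : IsScalarTower K N N' := .of_algebraMap_eq fun x ↦ rfl
    have hV' (σ : N' ≃ₐ[K] N') : IsInert (V.comap (algebraMap N' Ω)) σ := by
      obtain ⟨σ', h, -⟩ := exists_restrictNormalHom_eq N' σ
      exact (hV σ').restrict _ _ fun a ↦ (h a).symm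
    obtain ⟨σ, h1, h2⟩ := exists_isWild_restrictNormalHom_eq hV' N τ hτ
    obtain ⟨σ', h, -⟩ := exists_restrictNormalHom_eq N' σ
    refine ⟨σ', fun a ↦ ?_, ?_⟩
    · rw [← h2]
      have e1 := AlgEquiv.restrictNormal_commutes σ N a
      have e2 := h (IntermediateField.inclusion hN a)
      exact e2.trans (congrArg Subtype.val e1.symm)
    · simp only [Set.mem_iInter]
      intro a ha h0
      have haN : a ∈ N' := hMN (le_sup_right (a := N)
        (IntermediateField.subset_adjoin K (u : Set Ω) ha))
      have := h1 ⟨a, haN⟩ (fun h ↦ h0 (congrArg Subtype.val h))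
      rw [valuation_comap_lt_one_iff] at this
      rw [h ⟨a, haN⟩]
      exact this)
  exact ⟨σ, fun a ha ↦ Set.mem_iInter.1 h2 a ha, h1⟩

/-- Let `G` be the Galois group of the normal closure of `M`, with ramification group `P`, and let
`H` be the subgroup fixing `M`. A prime dividing the order of `P` is zero in the residue field, one
dividing the index of `P` is not. So if `[G : H]` avoids the residue characteristic, then `P ≤ H`;
conversely `P ≤ H` makes `[G : H]` divide `[G : P]`. Restricting and lifting wild automorphisms
links `G` to the automorphisms of `Ω`. -/
theorem coprime_finrank_iff [IsGalois K Ω] {V : ValuationSubring Ω}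
    (hV : ∀ σ : Ω ≃ₐ[K] Ω, IsInert V σ) (M : IntermediateField K Ω) [FiniteDimensional K M] :
    (∀ l : ℕ, l.Prime → l ∣ Module.finrank K M → ¬ V.valuation (l : Ω) < 1) ↔
      ∀ σ : Ω ≃ₐ[K] Ω, IsWild V σ → σ ∈ M.fixingSubgroup := by
  let N := IntermediateField.normalClosure K M Ω
  have hMN : M ≤ N := IntermediateField.le_normalClosure M
  let M' : IntermediateField K N := IntermediateField.restrict hMN
  have hM' : Module.finrank K M = M'.fixingSubgroup.index := by
    have : IsGalois K N := IsGalois.mk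
    rw [← IntermediateField.finrank_eq_fixingSubgroup_index]
    exact (IntermediateField.restrictAlgEquiv hMN).toLinearEquiv.finrank_eq
  have hV' (σ : N ≃ₐ[K] N) : IsInert (V.comap (algebraMap N Ω)) σ := by
    obtain ⟨σ', h, -⟩ := exists_restrictNormalHom_eq N σ
    exact (hV σ').restrict _ _ fun a ↦ (h a).symm
  have hl (l : ℕ) : (V.comap (algebraMap N Ω)).valuation (l : N) < 1 ↔ V.valuation (l : Ω) < 1 := by
    rw [valuation_comap_lt_one_iff, map_natCast]
  have hmem (τ : N ≃ₐ[K] N) : τ ∈ M'.fixingSubgroup ↔ ∀ a ∈ M, ∀ h : a ∈ N, (τ ⟨a, h⟩ : Ω) = a := by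
    rw [IntermediateField.mem_fixingSubgroup_iff]
    constructor
    · intro h a ha haN
      exact congrArg Subtype.val (h ⟨a, haN⟩ ((IntermediateField.mem_restrict hMN _).2 ha))
    · intro h a ha
      exact Subtype.ext (h a ((IntermediateField.mem_restrict hMN _).1 ha) a.2)
  constructor
  · intro h σ hσ
    let τ := AlgEquiv.restrictNormalHom N σ
    have hτ (a : N) : (τ a : Ω) = σ a := AlgEquiv.restrictNormal_commutes σ N a
    have hτw : τ ∈ wildSubgroup (K := K) (V := V.comap (algebraMap N Ω)) := hσ.restrict _ _ hτ
    have := wildSubgroup_normal hV'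
    have hle := subgroup_le_of_coprime_card_index
      (wildSubgroup (K := K) (V := V.comap (algebraMap N Ω))) M'.fixingSubgroup
      (Nat.coprime_of_dvd fun l hlp h1 h2 ↦ by
        have h3 := valuation_prime_lt_of_dvd_card_wild hlp h1
        rw [hl] at h3
        rw [← hM'] at h2
        exact h l hlp h2 h3)
    rw [IntermediateField.mem_fixingSubgroup_iff]
    intro a ha
    have := (hmem τ).1 (hle hτw) a ha (hMN ha)
    rwa [hτ] at this
  · intro h l hlp hdvd hlt
    refine not_valuation_prime_lt_of_dvd_index_wild hV' hlp ?_ ((hl l).2 hlt)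
    rw [hM'] at hdvd
    refine hdvd.trans (Subgroup.index_dvd_of_le fun τ hτ ↦ ?_)
    obtain ⟨σ, h1, h2⟩ := exists_isWild_forall_eq hV N τ hτ
    rw [hmem]
    intro a ha haN
    rw [← h2 ⟨a, haN⟩]
    exact (IntermediateField.mem_fixingSubgroup_iff _ _).1 (h σ h1) a ha

end

section

variable {K L Ω : Type*} [Field K] [Field L] [Field Ω] [Algebra K L] [Algebra L Ω] [Algebra K Ω]
  [IsScalarTower K L Ω] [FiniteDimensional K L] [IsGalois K Ω]

/-- Both sides are fixed fields: the inertia group over `L` is the part of the inertia group over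
`K` that fixes `L`. -/
theorem strictHenselization_restrictScalars_eq_sup (V : ValuationSubring Ω) :
    (strictHenselization L V).restrictScalars K =
      strictHenselization K V ⊔ (IsScalarTower.toAlgHom K L Ω).fieldRange := by
  rw [← InfiniteGalois.fixedField_fixingSubgroup
    (strictHenselization K V ⊔ (IsScalarTower.toAlgHom K L Ω).fieldRange)]
  ext x
  rw [IntermediateField.mem_restrictScalars, strictHenselization,
    IntermediateField.mem_fixedField_iff, IntermediateField.mem_fixedField_iff,
    IntermediateField.fixingSubgroup_sup]
  constructor
  · rintro h σ ⟨h1, h2⟩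
    have h1' := (mem_fixingSubgroup_strictHenselization V).1 h1
    have h2' := (IntermediateField.mem_fixingSubgroup_iff _ _).1 h2
    exact h (AlgEquiv.ofRingEquiv (f := σ.toRingEquiv) fun a ↦ h2' _ ⟨a, rfl⟩)
      (mem_map_inertiaSubgroup.2 h1')
  · intro h τ hτ
    have h1 := mem_map_inertiaSubgroup.1 hτ
    refine h (τ.restrictScalars K)
      ⟨(mem_fixingSubgroup_strictHenselization V).2 ⟨h1.1, h1.2⟩,
        (IntermediateField.mem_fixingSubgroup_iff _ _).2 ?_⟩
    rintro _ ⟨a, rfl⟩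
    exact τ.commutes a

/-- Over the strict henselization `E` of `K` every automorphism is inert, so `coprime_finrank_iff`
applies to the compositum of `E` and `L`. Wild automorphisms over `K` are inert, hence fix `E`
anyway, and it only matters whether they fix `L`. -/
theorem coprime_relfinrank_iff (V : ValuationSubring Ω) :
    Nat.Coprime
      ((strictHenselization K V).relfinrank ((strictHenselization L V).restrictScalars K))
      (ringExpChar (IsLocalRing.ResidueField
        ((V.comap (algebraMap L Ω)).comap (algebraMap K L)))) ↔
    ∀ σ : Ω ≃ₐ[K] Ω, IsWild V σ → ∀ a : L, σ (algebraMap L Ω a) = algebraMap L Ω a := by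
  set E := strictHenselization K V with hE
  let M := (IsScalarTower.toAlgHom K L Ω).fieldRange
  have : FiniteDimensional K M :=
    (IsScalarTower.toAlgHom K L Ω).toLinearMap.finiteDimensional_range
  obtain ⟨s, hs⟩ := M.fg_of_fg_toSubalgebra
    (Subalgebra.fg_of_fg_toSubmodule (Module.Finite.iff_fg.1 this))
  let M' : IntermediateField E Ω := IntermediateField.adjoin E (s : Set Ω)
  have hM' : (strictHenselization L V).restrictScalars K = M'.restrictScalars K := by
    rw [strictHenselization_restrictScalars_eq_sup,
      IntermediateField.restrictScalars_adjoin_eq_sup, hs]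
  have hfin : FiniteDimensional E M' :=
    IntermediateField.finiteDimensional_adjoin fun x _ ↦
      (Algebra.IsAlgebraic.isAlgebraic x).isIntegral
  have hle : E ≤ M'.restrictScalars K := by
    rw [← hM', strictHenselization_restrictScalars_eq_sup]; exact le_sup_left
  have hrel : E.relfinrank ((strictHenselization L V).restrictScalars K) =
      Module.finrank E M' := by
    rw [hM', IntermediateField.relfinrank_eq_finrank_of_le hle]
    rfl
  have hV (σ : Ω ≃ₐ[E] Ω) : IsInert V σ := by
    refine ((mem_fixingSubgroup_strictHenselization (K := K) (σ := σ.restrictScalars K) V).1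
      ((IntermediateField.mem_fixingSubgroup_iff _ _).2 fun x hx ↦ σ.commutes ⟨x, hx⟩)).2
  rw [hrel, coprime_ringExpChar_iff]
  have hl (l : ℕ) : (l : IsLocalRing.ResidueField
        ((V.comap (algebraMap L Ω)).comap (algebraMap K L))) = 0 ↔ V.valuation (l : Ω) < 1 := by
    rw [natCast_residueField_eq_zero_iff, valuation_comap_lt_one_iff, valuation_comap_lt_one_iff,
      map_natCast, map_natCast]
  simp only [ne_eq, hl]
  rw [coprime_finrank_iff hV]
  have hMM' : ∀ a : L, algebraMap L Ω a ∈ M' := fun a ↦ by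
    have : algebraMap L Ω a ∈ (strictHenselization L V).restrictScalars K := by
      rw [strictHenselization_restrictScalars_eq_sup]
      exact le_sup_right (a := strictHenselization K V) ⟨a, rfl⟩
    rw [hM'] at this
    exact this
  constructor
  · intro h σ hσ a
    have hσE : ∀ x ∈ E, σ x = x := (IntermediateField.mem_fixingSubgroup_iff _ _).1
      ((mem_fixingSubgroup_strictHenselization V).2 ⟨hσ.mem_iff, hσ.isInert⟩)
    let τ : Ω ≃ₐ[E] Ω := AlgEquiv.ofRingEquiv (f := σ.toRingEquiv) fun a ↦ hσE _ a.2
    exact (IntermediateField.mem_fixingSubgroup_iff _ _).1 (h τ hσ) _ (hMM' a)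
  · intro h σ hσ
    have h1 : σ.restrictScalars K ∈ (E ⊔ M).fixingSubgroup := by
      rw [IntermediateField.fixingSubgroup_sup]
      refine ⟨(IntermediateField.mem_fixingSubgroup_iff _ _).2 fun x hx ↦ σ.commutes ⟨x, hx⟩,
        (IntermediateField.mem_fixingSubgroup_iff _ _).2 ?_⟩
      rintro _ ⟨a, rfl⟩
      exact h (σ.restrictScalars K) hσ a
    rw [IntermediateField.mem_fixingSubgroup_iff] at h1 ⊢
    intro x hx
    refine h1 x ?_
    rw [← strictHenselization_restrictScalars_eq_sup, hM']
    exact hx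

end

end TameSite

/-! ### Tamely closed valued fields -/

namespace TameSite

section

variable {K L Ω : Type*} [Field K] [Field L] [Field Ω] [Algebra K L] [Algebra L Ω] [Algebra K Ω]
  [IsScalarTower K L Ω]

theorem isWild_conj_iff {Ω' : Type*} [Field Ω'] [Algebra K Ω'] (e : Ω' ≃ₐ[K] Ω)
    (V : ValuationSubring Ω) (σ : Ω ≃ₐ[K] Ω) :
    IsWild (V.comap (e : Ω' →+* Ω)) ((e.trans σ).trans e.symm) ↔ IsWild V σ := by
  constructor
  · intro h
    have := h.restrict (e.symm : Ω →+* Ω') σ (fun a ↦ by simp)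
    rw [ValuationSubring.comap_comap] at this
    convert this
    ext x
    simp
  · intro h
    exact h.restrict _ _ fun a ↦ by simp

theorem forall_isWild_of_algEquiv {Ω' : Type*} [Field Ω'] [Algebra K Ω'] [Algebra L Ω']
    [IsScalarTower K L Ω'] (e : Ω' ≃ₐ[L] Ω) {V : ValuationSubring Ω}
    (h : ∀ σ : Ω' ≃ₐ[K] Ω', IsWild (V.comap (e : Ω' →+* Ω)) σ →
      ∀ a : L, σ (algebraMap L Ω' a) = algebraMap L Ω' a)
    (σ : Ω ≃ₐ[K] Ω) (hσ : IsWild V σ) (a : L) : σ (algebraMap L Ω a) = algebraMap L Ω a := by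
  have := h _ ((isWild_conj_iff (e.restrictScalars K) V σ).2 hσ) a
  simpa [AlgEquiv.symm_apply_eq] using this

instance isGalois_separableClosure [FiniteDimensional K L] [Algebra.IsSeparable K L] :
    IsGalois K (SeparableClosure L) := by
  have : Algebra.IsSeparable K (SeparableClosure L) := .trans K L _
  have : IsSepClosure K (SeparableClosure L) := ⟨inferInstance, inferInstance⟩
  infer_instance

variable [FiniteDimensional K L] [IsGalois K Ω]

/-- Tame ramification, in terms of the ramification group of any extension of the valuation. -/
theorem isTamelyRamified_comap_iff [IsSepClosed Ω] (V : ValuationSubring Ω) :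
    IsTamelyRamified K (V.comap (algebraMap L Ω)) ↔
      ∀ σ : Ω ≃ₐ[K] Ω, IsWild V σ → ∀ a : L, σ (algebraMap L Ω a) = algebraMap L Ω a := by
  have : Algebra.IsSeparable K L := Algebra.isSeparable_tower_bot_of_isSeparable K L Ω
  have : Algebra.IsSeparable L Ω := Algebra.isSeparable_tower_top_of_isSeparable K L Ω
  have : IsSepClosure L Ω := ⟨inferInstance, inferInstance⟩
  have : IsSepClosure L (SeparableClosure L) := ⟨inferInstance, inferInstance⟩
  let e : SeparableClosure L ≃ₐ[L] Ω := IsSepClosure.equiv L _ _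
  have he : (V.comap (e : SeparableClosure L →+* Ω)).comap (algebraMap L (SeparableClosure L)) =
      V.comap (algebraMap L Ω) := by
    rw [ValuationSubring.comap_comap]
    congr 1
    ext x
    simp
  constructor
  · rintro ⟨V', hV', hco⟩
    rw [← hV', coprime_relfinrank_iff] at hco
    -- The valuation ring `V'` from the definition of tameness and the transport of `V` along `e`
    -- both extend the same ring of `L`, but may differ; an automorphism over `L` moves one to the
    -- other.
    obtain ⟨g, hg⟩ := exists_comap_galois_eq (K := L) (hV'.trans he.symm)
    have h1 := forall_isWild_of_algEquiv (K := K) (L := L) g.symm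
      (V := V.comap (e : SeparableClosure L →+* Ω)) (by
        rw [← hg, ValuationSubring.comap_comap]
        have : (g : SeparableClosure L →+* SeparableClosure L).comp
          (g.symm : SeparableClosure L →+* SeparableClosure L) = RingHom.id _ := by ext; simp
        rw [this]
        exact hco)
    exact forall_isWild_of_algEquiv e h1
  · intro h
    refine ⟨V.comap (e : SeparableClosure L →+* Ω), he, ?_⟩
    rw [← he, coprime_relfinrank_iff]
    have h1 := forall_isWild_of_algEquiv (K := K) (L := L) e.symm
      (V := V.comap (e : SeparableClosure L →+* Ω)) (by
        rw [ValuationSubring.comap_comap]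
        have : (e : SeparableClosure L →+* Ω).comp
          (e.symm : Ω →+* SeparableClosure L) = RingHom.id _ := by ext; simp
        rw [this]
        exact h)
    exact h1

end

/-- A valued field without nontrivial finite separable tamely ramified extensions. -/
def IsTameClosed {k : Type u} [Field k] (v : ValuationSubring k) : Prop :=
  ∀ (L : Type u) [Field L] [Algebra k L] [FiniteDimensional k L] [Algebra.IsSeparable k L]
    (W : ValuationSubring L), W.comap (algebraMap k L) = v → IsTamelyRamified k W →
      Function.Bijective (algebraMap k L)

section

variable {K L k Ω : Type u} [Field K] [Field L] [Field k] [Field Ω] [Algebra K L] [Algebra K k]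
  [Algebra K Ω] [Algebra k Ω] [IsScalarTower K k Ω] [FiniteDimensional K L]
  [Algebra.IsSeparable K L]

omit [Algebra.IsSeparable K L] in
theorem finiteDimensional_adjoin_range (j : L →ₐ[K] Ω) :
    FiniteDimensional k (IntermediateField.adjoin k (Set.range j)) := by
  classical
  obtain ⟨s, hs⟩ := Module.Finite.fg_top (R := K) (M := L)
  have : IntermediateField.adjoin k (Set.range j) =
      IntermediateField.adjoin k ((s.image j : Finset Ω) : Set Ω) := by
    refine le_antisymm ?_ (IntermediateField.adjoin.mono _ _ _ (by
      rw [Finset.coe_image]; exact Set.image_subset_range _ _))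
    rw [IntermediateField.adjoin_le_iff]
    rintro _ ⟨x, rfl⟩
    have hx : x ∈ Submodule.span K (s : Set L) := hs ▸ trivial
    induction hx using Submodule.span_induction with
    | mem x h => exact IntermediateField.subset_adjoin _ _ (by simpa using ⟨x, h, rfl⟩)
    | zero => simp
    | add x y _ _ h1 h2 => rw [map_add]; exact add_mem h1 h2
    | smul c x _ h =>
      rw [map_smul, ← algebraMap_smul k c]
      exact (IntermediateField.adjoin k _).smul_mem h
  rw [this]
  exact IntermediateField.finiteDimensional_adjoin fun x hx ↦ by
    obtain ⟨y, -, rfl⟩ := Finset.mem_image.1 hx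
    have h1 : IsIntegral K (j y) := (Algebra.IsIntegral.isIntegral (R := K) y).map j
    exact h1.tower_top

omit [Algebra.IsSeparable K L] [FiniteDimensional K L] in
theorem forall_adjoin_range_apply_eq {Ω' : Type u} [Field Ω'] [Algebra k Ω'] (j : L →ₐ[K] Ω)
    (ι : IntermediateField.adjoin k (Set.range j) →ₐ[k] Ω') (σ : Ω' ≃ₐ[k] Ω')
    (h : ∀ x, σ (ι ⟨j x, IntermediateField.subset_adjoin _ _ ⟨x, rfl⟩⟩) =
      ι ⟨j x, IntermediateField.subset_adjoin _ _ ⟨x, rfl⟩⟩)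
    (z : IntermediateField.adjoin k (Set.range j)) : σ (ι z) = ι z := by
  obtain ⟨z, hz⟩ := z
  induction hz using IntermediateField.adjoin_induction with
  | mem x hx => obtain ⟨y, rfl⟩ := hx; exact h y
  | algebraMap x =>
    have e : ι ⟨algebraMap k Ω x, IntermediateField.algebraMap_mem _ x⟩ = algebraMap k Ω' x :=
      ι.commutes x
    rw [e, σ.commutes]
  | add x y hx hy h1 h2 => rw [← AddMemClass.mk_add_mk _ x y hx hy, map_add, map_add, h1, h2]
  | inv x hx h1 =>
    have e : (⟨x⁻¹, inv_mem hx⟩ : IntermediateField.adjoin k (Set.range j)) = ⟨x, hx⟩⁻¹ := rfl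
    rw [e, map_inv₀, map_inv₀, h1]
  | mul x y hx hy h1 h2 => rw [← MulMemClass.mk_mul_mk _ x y hx hy, map_mul, map_mul, h1, h2]

/-- The image of `j` lies in the separable closure of `K` in `Ω`. The restriction of `σ` to that
closure is again wild, and tameness over `K` can be tested there. -/
theorem apply_eq_of_isTamelyRamified_comap [IsSepClosed Ω] (V : ValuationSubring Ω)
    (j : L →ₐ[K] Ω) (hj : IsTamelyRamified K (V.comap (j : L →+* Ω)))
    (σ : Ω ≃ₐ[k] Ω) (hσ : IsWild V σ) (x : L) : σ (j x) = j x := by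
  let N := separableClosure K Ω
  let jN : L →ₐ[K] N := j.codRestrict N.toSubalgebra fun x ↦
    (isSeparable_map_iff j j.injective).2 (Algebra.IsSeparable.isSeparable K x)
  let := (jN : L →+* N).toAlgebra
  have : IsScalarTower K L N := .of_algebraMap_eq fun x ↦ (jN.commutes x).symm
  have : IsSepClosure K N := inferInstance
  have : IsSepClosed N := IsSepClosure.sep_closed K
  have hVN : (V.comap (algebraMap N Ω)).comap (algebraMap L N) = V.comap (j : L →+* Ω) := by
    rw [ValuationSubring.comap_comap]; rfl
  rw [← hVN, isTamelyRamified_comap_iff] at hj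
  let τ := AlgEquiv.restrictNormalHom N (σ.restrictScalars K)
  have hτ (a : N) : (τ a : Ω) = σ a :=
    AlgEquiv.restrictNormal_commutes (σ.restrictScalars K) N a
  have := congrArg Subtype.val (hj τ (hσ.restrict _ _ hτ) x)
  rw [hτ] at this
  exact this

/-- A tamely ramified extension of a subfield of a tamely closed field, inside a valued extension,
is contained in the tamely closed field. -/
theorem IsTameClosed.mem_range {v : ValuationSubring k} (hv : IsTameClosed v)
    (V : ValuationSubring Ω) (hV : V.comap (algebraMap k Ω) = v) (j : L →ₐ[K] Ω)
    (hj : IsTamelyRamified K (V.comap (j : L →+* Ω))) (a : L) :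
    j a ∈ (algebraMap k Ω).range := by
  let L' : IntermediateField k Ω := IntermediateField.adjoin k (Set.range j)
  have hjint (x : L) : IsSeparable k (j x) :=
    ((isSeparable_map_iff j j.injective).2 (Algebra.IsSeparable.isSeparable K x)).tower_top k
  have : Algebra.IsSeparable k L' := by
    rw [IntermediateField.isSeparable_adjoin_iff_isSeparable]
    rintro _ ⟨x, rfl⟩
    exact hjint x
  have : FiniteDimensional k L' := finiteDimensional_adjoin_range j
  let j' : L →ₐ[K] L' :=
    { (j : L →+* Ω).codRestrict L' fun x ↦ IntermediateField.subset_adjoin _ _ ⟨x, rfl⟩ with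
      commutes' := fun r ↦ Subtype.ext (by
        rw [IsScalarTower.algebraMap_apply K k L']
        exact (j.commutes r).trans (IsScalarTower.algebraMap_apply K k Ω r)) }
  let W' := V.comap (algebraMap L' Ω)
  have hW' : W'.comap (algebraMap k L') = v := by
    rw [← hV, ValuationSubring.comap_comap]; rfl
  -- The compositum `L' = k(j L)` is tame over `k`: a wild automorphism over `k` is also one over
  -- `K`, so it fixes the image of `L`. As `k` is tamely closed, `L' = k`.
  suffices IsTamelyRamified k W' by
    obtain ⟨b, hb⟩ := (hv L' W' hW' this).2 (j' a)
    exact ⟨b, congrArg Subtype.val hb⟩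
  obtain ⟨V', hV'⟩ := exists_valuationSubring_comap_eq (algebraMap L' (SeparableClosure L')) W'
  rw [← hV', isTamelyRamified_comap_iff]
  intro σ hσ
  let := ((algebraMap k (SeparableClosure L')).comp (algebraMap K k)).toAlgebra
  have : IsScalarTower K k (SeparableClosure L') := .of_algebraMap_eq' rfl
  let jj : L →ₐ[K] SeparableClosure L' :=
    ((IsScalarTower.toAlgHom k L' (SeparableClosure L')).restrictScalars K).comp j'
  have hjj : V'.comap (jj : L →+* SeparableClosure L') = V.comap (j : L →+* Ω) := by
    have e1 : V.comap (j : L →+* Ω) = W'.comap (j' : L →+* L') :=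
      (ValuationSubring.comap_comap V (algebraMap L' Ω) (j' : L →+* L')).symm
    rw [e1, ← hV', ValuationSubring.comap_comap]
    rfl
  rw [← hjj] at hj
  exact forall_adjoin_range_apply_eq j (IsScalarTower.toAlgHom k L' (SeparableClosure L')) σ
    (apply_eq_of_isTamelyRamified_comap V' jj hj σ hσ)

-- Take any embedding of `L` into the separable closure of `K`. The Galois group permutes
-- transitively the extensions of the valuation of `K`, so an automorphism corrects the induced
-- valuation.
omit [FiniteDimensional K L] in
theorem exists_algHom_comap_eq [IsSepClosed Ω] (V : ValuationSubring Ω) (W : ValuationSubring L)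
    (h : W.comap (algebraMap K L) = V.comap (algebraMap K Ω)) :
    ∃ j : L →ₐ[K] Ω, V.comap (j : L →+* Ω) = W := by
  let N := separableClosure K Ω
  have : IsSepClosure K N := inferInstance
  have : IsSepClosed N := IsSepClosure.sep_closed K
  let j₀ : L →ₐ[K] N := IsSepClosed.lift
  let := (j₀ : L →+* N).toAlgebra
  have : IsScalarTower K L N := .of_algebraMap_eq fun x ↦ (j₀.commutes x).symm
  obtain ⟨W', hW'⟩ := exists_valuationSubring_comap_eq (algebraMap L N) W
  obtain ⟨g, hg⟩ := exists_comap_galois_eq (K := K) (V₁ := V.comap (algebraMap N Ω)) (V₂ := W') (by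
    have e1 : W'.comap (algebraMap K N) = W.comap (algebraMap K L) := by
      rw [← hW', ValuationSubring.comap_comap, ← IsScalarTower.algebraMap_eq]
    rw [e1, h, ValuationSubring.comap_comap, ← IsScalarTower.algebraMap_eq])
  refine ⟨((IsScalarTower.toAlgHom K N Ω).comp (g : N →ₐ[K] N)).comp j₀, ?_⟩
  rw [← hW', ← hg]
  simp only [ValuationSubring.comap_comap]
  rfl

/-- Tamely ramified extensions of valued fields split over tamely closed fields. -/
theorem IsTameClosed.exists_algHom {v : ValuationSubring k} (hv : IsTameClosed v)
    (W : ValuationSubring L) (hW : IsTamelyRamified K W)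
    (h : W.comap (algebraMap K L) = v.comap (algebraMap K k)) :
    ∃ j : L →ₐ[K] k, v.comap (j : L →+* k) = W := by
  let Ω' := SeparableClosure k
  let := ((algebraMap k Ω').comp (algebraMap K k)).toAlgebra
  have : IsScalarTower K k Ω' := .of_algebraMap_eq' rfl
  obtain ⟨V, hV⟩ := exists_valuationSubring_comap_eq (algebraMap k Ω') v
  obtain ⟨j, hj⟩ := exists_algHom_comap_eq V W (by
    rw [h, ← hV, ValuationSubring.comap_comap, ← IsScalarTower.algebraMap_eq])
  have hr := hv.mem_range V hV j (by rw [hj]; exact hW)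
  let ι : k →ₐ[K] Ω' := IsScalarTower.toAlgHom K k Ω'
  let e : k ≃ₐ[K] ι.range := AlgEquiv.ofInjective ι ι.injective
  let j' : L →ₐ[K] ι.range := j.codRestrict ι.range hr
  have hcomp (x : L) : algebraMap k Ω' (e.symm (j' x)) = j x :=
    congrArg Subtype.val (e.apply_symm_apply (j' x))
  refine ⟨(e.symm : ι.range →ₐ[K] k).comp j', ?_⟩
  rw [← hV, ← hj, ValuationSubring.comap_comap]
  exact congrArg V.comap (RingHom.ext hcomp)

end

section

variable {K Ω : Type u} [Field K] [Field Ω] [Algebra K Ω] [IsGalois K Ω] [IsSepClosed Ω]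

/-- The fixed field of the ramification group is tamely closed. -/
theorem exists_isTameClosed (V : ValuationSubring Ω) :
    ∃ k : IntermediateField K Ω, IsTameClosed (V.comap (algebraMap k Ω)) ∧
      ∀ σ : Ω ≃ₐ[K] Ω, IsWild V σ → ∀ a ∈ k, σ a = a := by
  let k : IntermediateField K Ω :=
    IntermediateField.fixedField (Subgroup.closure {σ : Ω ≃ₐ[K] Ω | IsWild V σ})
  have hk (σ : Ω ≃ₐ[K] Ω) (hσ : IsWild V σ) (a) (ha : a ∈ k) : σ a = a :=
    (IntermediateField.mem_fixedField_iff _ _).1 ha σ (Subgroup.subset_closure hσ)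
  refine ⟨k, fun L _ _ _ _ W hW ht ↦ ⟨(algebraMap k L).injective, fun x ↦ ?_⟩, hk⟩
  obtain ⟨j, hj⟩ := exists_algHom_comap_eq (K := k) V W hW
  let := (j : L →+* Ω).toAlgebra
  have : IsScalarTower k L Ω := .of_algebraMap_eq fun x ↦ (j.commutes x).symm
  have hj' : V.comap (algebraMap L Ω) = W := hj
  rw [← hj', isTamelyRamified_comap_iff] at ht
  -- All wild automorphisms over `K` fix `k`, so they are wild over `k` as well and fix every tame
  -- extension of `k` inside `Ω`.
  have hx : j x ∈ k := by
    refine (IntermediateField.mem_fixedField_iff _ _).2 fun σ hσ ↦ ?_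
    induction hσ using Subgroup.closure_induction with
    | mem σ hσ =>
      let σ' : Ω ≃ₐ[k] Ω := AlgEquiv.ofRingEquiv (f := σ.toRingEquiv) fun a ↦ hk σ hσ a a.2
      exact ht σ' hσ x
    | one => rfl
    | mul a b _ _ h1 h2 => rw [AlgEquiv.mul_apply, h2, h1]
    | inv a _ h => 
      nth_rewrite 1 [← h]
      rw [← AlgEquiv.mul_apply, inv_mul_cancel, AlgEquiv.one_apply]
  exact ⟨⟨j x, hx⟩, j.injective (by simp [IntermediateField.algebraMap_apply])⟩

end

end TameSite

namespace TameSite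

/-! ### Valued points of schemes and the splitting criterion for tame covers -/

section FieldPoints

variable {S : Scheme.{u}} {K L : Type u} [Field K] [Field L]

theorem exists_eq_SpecMap_fromSpecResidueField (x : Spec (.of K) ⟶ S) :
    ∃ (s : S) (a : S.residueField s ⟶ .of K), x = Spec.map a ≫ S.fromSpecResidueField s := by
  obtain ⟨⟨s, a⟩, rfl⟩ := (Scheme.SpecToEquivOfField K S).symm.surjective x
  exact ⟨s, a, rfl⟩

theorem SpecMap_fromSpecResidueField_apply {s : S} (a : S.residueField s ⟶ .of K)
    (z : Spec (.of K)) : (Spec.map a ≫ S.fromSpecResidueField s) z = s := by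
  simp

theorem eq_of_SpecMap_fromSpecResidueField_eq {s s' : S} {a : S.residueField s ⟶ .of K}
    {b : S.residueField s' ⟶ .of K}
    (h : Spec.map a ≫ S.fromSpecResidueField s = Spec.map b ≫ S.fromSpecResidueField s') :
    s = s' :=
  congrArg Sigma.fst
    ((Scheme.SpecToEquivOfField K S).symm.injective (a₁ := ⟨s, a⟩) (a₂ := ⟨s', b⟩) h)

theorem SpecMap_fromSpecResidueField_eq_iff {s : S} {a b : S.residueField s ⟶ .of K} :
    Spec.map a ≫ S.fromSpecResidueField s = Spec.map b ≫ S.fromSpecResidueField s ↔ a = b := by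
  rw [cancel_mono, Spec.map_inj]

/-- `S`-valuations and restriction to subfields. -/
theorem isSValuation_comp_iff (t : Spec (.of K) ⟶ S) (i : K →+* L) (W : ValuationSubring L) :
    IsSValuation (Spec.map (CommRingCat.ofHom i) ≫ t) W ↔ IsSValuation t (W.comap i) := by
  constructor
  · rintro ⟨φ, hφ⟩
    let s₀ : S := φ (IsLocalRing.closedPoint W)
    let b : S.presheaf.stalk s₀ ⟶ .of W := Scheme.stalkClosedPointTo φ
    have hb : Spec.map b ≫ S.fromSpecStalk s₀ = φ := Scheme.Spec_stalkClosedPointTo_fromSpecStalk φ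
    let s : S := t (IsLocalRing.closedPoint K)
    let c : S.presheaf.stalk s ⟶ .of K := Scheme.stalkClosedPointTo t
    have hc : Spec.map c ≫ S.fromSpecStalk s = t := Scheme.Spec_stalkClosedPointTo_fromSpecStalk t
    have hs : s ⤳ s₀ := by
      have : s ∈ Set.range (S.fromSpecStalk s₀) := by
        have e : (Spec.map (CommRingCat.ofHom W.subtype) ≫ Spec.map b) ≫ S.fromSpecStalk s₀ =
            Spec.map (CommRingCat.ofHom i) ≫ t := by rw [Category.assoc, hb, hφ]
        have e' := congrArg (fun g : Spec (.of L) ⟶ S ↦ g default) e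
        refine ⟨(Spec.map (CommRingCat.ofHom W.subtype) ≫ Spec.map b) default, e'.trans ?_⟩
        exact congrArg t (Subsingleton.elim (Spec.map (CommRingCat.ofHom i) default) _)
      rwa [Scheme.range_fromSpecStalk] at this
    -- The image of `t` specialises to the image `s₀` of the closed point, so `t` factors through
    -- the local ring at `s₀`. The images of this local ring in `K` land in `W` inside `L`, hence in
    -- the restriction of `W`.
    obtain ⟨a, ha⟩ : ∃ a : S.presheaf.stalk s₀ ⟶ .of K, Spec.map a ≫ S.fromSpecStalk s₀ = t :=
      ⟨S.presheaf.stalkSpecializes hs ≫ c, by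
        rw [Spec.map_comp, Category.assoc, Scheme.SpecMap_stalkSpecializes_fromSpecStalk, hc]⟩
    have key : a ≫ CommRingCat.ofHom i = b ≫ CommRingCat.ofHom W.subtype := by
      apply Spec.map_injective
      rw [← cancel_mono (S.fromSpecStalk s₀), Spec.map_comp, Spec.map_comp, Category.assoc, ha,
        Category.assoc, hb, hφ]
    have hmem (x : S.presheaf.stalk s₀) : a.hom x ∈ W.comap i := by
      rw [ValuationSubring.mem_comap]
      have : i (a.hom x) = (b.hom x : L) := congrArg (fun g ↦ g.hom x) key
      rw [this]
      exact (b.hom x).2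
    let a' : S.presheaf.stalk s₀ ⟶ .of (W.comap i) :=
      CommRingCat.ofHom (a.hom.codRestrict (W.comap i).toSubring hmem)
    refine ⟨Spec.map a' ≫ S.fromSpecStalk s₀, ?_⟩
    rw [← Category.assoc, ← Spec.map_comp]
    exact ha
  · rintro ⟨φ, hφ⟩
    let j : W.comap i →+* W := (i.comp (W.comap i).subtype).codRestrict W.toSubring fun x ↦ x.2
    refine ⟨Spec.map (CommRingCat.ofHom j) ≫ φ, ?_⟩
    rw [← hφ, ← Category.assoc, ← Category.assoc, ← Spec.map_comp, ← Spec.map_comp]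
    rfl

theorem isSValuation_fromSpecResidueField_iff {X : Scheme.{u}} (f : X ⟶ S) {x : X}
    (a : X.residueField x ⟶ .of K) (v : ValuationSubring K) :
    IsSValuation ((Spec.map a ≫ X.fromSpecResidueField x) ≫ f) v ↔
      ValuedPoint.IsOver f ⟨x, v.comap a.hom⟩ := by
  rw [Category.assoc]
  exact isSValuation_comp_iff (K := X.residueField x) (X.fromSpecResidueField x ≫ f) a.hom v

theorem ValuedPoint.isOver_map_iff {X Y : Scheme.{u}} (f : X ⟶ S) (g : Y ⟶ X)
    (η : ValuedPoint Y) : (η.map g).IsOver f ↔ η.IsOver (g ≫ f) := by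
  have := isSValuation_comp_iff (K := X.residueField (g η.pt)) (L := Y.residueField η.pt)
    (X.fromSpecResidueField (g η.pt) ≫ f) (g.residueFieldMap η.pt).hom η.val
  refine this.symm.trans (iff_of_eq ?_)
  have e : Spec.map (g.residueFieldMap η.pt) ≫ X.fromSpecResidueField (g η.pt) ≫ f =
      Y.fromSpecResidueField η.pt ≫ g ≫ f := by
    rw [Scheme.Hom.SpecMap_residueFieldMap_fromSpecResidueField_assoc]
  exact congrArg (fun t ↦ IsSValuation (K := Y.residueField η.pt) t η.val) e

/-- The residue field extensions of an étale morphism are finite separable. -/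
theorem finite_residueFieldMap {X Y : Scheme.{u}} (f : X ⟶ Y) [Etale f] (x : X) :
    (f.residueFieldMap x).hom.Finite := by
  algebraize [(f.stalkMap x).hom]
  have : IsLocalHom (algebraMap (Y.presheaf.stalk (f x)) (X.presheaf.stalk x)) :=
    inferInstanceAs <| IsLocalHom (f.stalkMap x).hom
  suffices h : Module.Finite
      (IsLocalRing.ResidueField <| Y.presheaf.stalk (f x))
      (IsLocalRing.ResidueField <| X.presheaf.stalk x) by
    have e : (f.residueFieldMap x).hom = algebraMap
        (IsLocalRing.ResidueField <| Y.presheaf.stalk (f x))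
        (IsLocalRing.ResidueField <| X.presheaf.stalk x) := by
      refine RingHom.ext fun z ↦ ?_
      obtain ⟨z, rfl⟩ := IsLocalRing.residue_surjective z
      rfl
    have h' : (algebraMap (IsLocalRing.ResidueField <| Y.presheaf.stalk (f x))
        (IsLocalRing.ResidueField <| X.presheaf.stalk x)).Finite := RingHom.finite_algebraMap.2 h
    rw [e]
    exact h'
  have : Algebra.EssFiniteType (Y.presheaf.stalk (f x)) (X.presheaf.stalk x) := by
    rw [← RingHom.essFiniteType_algebraMap, RingHom.algebraMap_toAlgebra]
    exact LocallyOfFiniteType.stalkMap f x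
  have : Algebra.FormallyUnramified (Y.presheaf.stalk (f x)) (X.presheaf.stalk x) := by
    rw [← RingHom.formallyUnramified_algebraMap, RingHom.algebraMap_toAlgebra]
    exact FormallyUnramified.stalkMap f x
  infer_instance

theorem isSeparable_residueFieldMap {X Y : Scheme.{u}} (f : X ⟶ Y) [Etale f] (x : X) :
    letI := (f.residueFieldMap x).hom.toAlgebra
    Algebra.IsSeparable (Y.residueField (f x)) (X.residueField x) :=
  inferInstance

end FieldPoints

variable {X S : Scheme.{u}} {f : X ⟶ S}

theorem TamePoint.isTameClosed (p : TamePoint f) : IsTameClosed p.val :=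
  p.bijective_of_isTamelyRamified

/-! ### Étale schemes and their points -/

/-- The structure morphism of an étale `X`-scheme. -/
def str (U : X.Etale) : U.left ⟶ X := U.hom

/-- The morphism of schemes underlying a morphism of étale `X`-schemes. -/
def homLeft {U V : X.Etale} (g : V ⟶ U) : V.left ⟶ U.left := g.left

instance (U : X.Etale) : Etale (str U) := U.prop

@[simp]
theorem homLeft_str {U V : X.Etale} (g : V ⟶ U) : homLeft g ≫ str U = str V :=
  MorphismProperty.Over.w g

@[simp]
theorem homLeft_str_assoc {U V : X.Etale} (g : V ⟶ U) {Z : Scheme.{u}} (h : X ⟶ Z) :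
    homLeft g ≫ str U ≫ h = str V ≫ h := by
  rw [← Category.assoc, homLeft_str]

@[simp]
theorem homLeft_id (U : X.Etale) : homLeft (𝟙 U) = 𝟙 U.left := rfl

@[simp]
theorem homLeft_comp {U V W : X.Etale} (g : U ⟶ V) (h : V ⟶ W) :
    homLeft (g ≫ h) = homLeft g ≫ homLeft h := rfl

theorem homLeft_injective {U V : X.Etale} {g h : V ⟶ U} (e : homLeft g = homLeft h) : g = h :=
  MorphismProperty.Over.Hom.ext e

instance {U V : X.Etale} (g : V ⟶ U) : Etale (homLeft g) := by
  have : Etale (homLeft g ≫ str U) := by rw [homLeft_str]; infer_instance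
  exact Etale.of_comp (homLeft g) (str U)

/-- An étale morphism, as an étale `X`-scheme. -/
def mkEtale {U : Scheme.{u}} (g : U ⟶ X) [h : Etale g] : X.Etale :=
  MorphismProperty.Over.mk ⊤ g h

/-- A morphism of étale `X`-schemes. -/
def mkHom {U V : X.Etale} (g : V.left ⟶ U.left) (h : g ≫ str U = str V) : V ⟶ U :=
  MorphismProperty.Over.homMk g h trivial

@[simp]
theorem homLeft_mkHom {U V : X.Etale} (g : V.left ⟶ U.left) (h : g ≫ str U = str V) :
    homLeft (mkHom g h) = g := rfl

@[simp]
theorem str_mkEtale {U : Scheme.{u}} (g : U ⟶ X) [h : Etale g] : str (mkEtale g) = g := rfl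

section Lifts

variable {K : Type u} [Field K] {x : Spec (.of K) ⟶ X} {U V : X.Etale}

/-- The morphism underlying a lift of a point. -/
noncomputable def liftHom (y : (lifts x).obj U) : Spec (.of K) ⟶ U.left := Over.Hom.left y

@[simp]
theorem liftHom_str (y : (lifts x).obj U) : liftHom y ≫ str U = x := Over.w y

@[simp]
theorem liftHom_str_assoc (y : (lifts x).obj U) {Z : Scheme.{u}} (h : X ⟶ Z) :
    liftHom y ≫ str U ≫ h = x ≫ h := by
  rw [← Category.assoc, liftHom_str]

/-- The lift of a point given by a morphism. -/
noncomputable def mkLift (y : Spec (.of K) ⟶ U.left) (h : y ≫ str U = x) : (lifts x).obj U :=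
  Over.homMk y h

@[simp]
theorem liftHom_mkLift (y : Spec (.of K) ⟶ U.left) (h : y ≫ str U = x) :
    liftHom (mkLift y h) = y := rfl

theorem liftHom_injective {y z : (lifts x).obj U} (h : liftHom y = liftHom z) : y = z :=
  Over.OverMorphism.ext h

@[simp]
theorem liftHom_map (g : V ⟶ U) (y : (lifts x).obj V) :
    liftHom ((lifts x).map g y) = liftHom y ≫ homLeft g := rfl

end Lifts

section

variable {Y : Scheme.{u}} (g : Y ⟶ X) [Etale g]

theorem exists_lift_of_isTame {k : Type u} [Field k] {v : ValuationSubring k}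
    (hv : IsTameClosed v) {η : ValuedPoint Y} {a : X.residueField (g η.pt) ⟶ .of k}
    (h : η.IsTame g) (hη : η.val.comap (g.residueFieldMap η.pt).hom = v.comap a.hom) :
    ∃ y : Spec (.of k) ⟶ Y, y ≫ g = Spec.map a ≫ X.fromSpecResidueField _ := by
  let := (g.residueFieldMap η.pt).hom.toAlgebra
  let := a.hom.toAlgebra
  have : Module.Finite (X.residueField (g η.pt)) (Y.residueField η.pt) :=
    finite_residueFieldMap g η.pt
  have := isSeparable_residueFieldMap g η.pt
  obtain ⟨j, -⟩ := hv.exists_algHom (K := X.residueField (g η.pt))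
    (L := Y.residueField η.pt) η.val h hη
  refine ⟨Spec.map (CommRingCat.ofHom (j : Y.residueField η.pt →+* k)) ≫
    Y.fromSpecResidueField η.pt, ?_⟩
  rw [Category.assoc, ← Scheme.Hom.SpecMap_residueFieldMap_fromSpecResidueField,
    ← Category.assoc, ← Spec.map_comp]
  congr 2
  ext z
  exact j.commutes z

/-- Extend the valuation of `p` to `Ω` and restrict it to the residue field at the image of `y`.
This is an `S`-valuation, so the residue field extension is tame there, and `IsTameClosed.mem_range`
places the residue field inside the field of `p`. -/
theorem exists_factor_of_isTame (p : TamePoint f)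
    (h : ∀ η : ValuedPoint Y, η.IsOver (g ≫ f) → η.IsTame g)
    {Ω : Type u} [Field Ω] (i : p.field →+* Ω) (y : Spec (.of Ω) ⟶ Y)
    (hy : y ≫ g = Spec.map (CommRingCat.ofHom i) ≫ p.pt) :
    ∃ z : Spec (.of p.field) ⟶ Y, z ≫ g = p.pt ∧ Spec.map (CommRingCat.ofHom i) ≫ z = y := by
  obtain ⟨x, a, rfl⟩ := exists_eq_SpecMap_fromSpecResidueField y
  obtain ⟨x₀, b, hb⟩ := exists_eq_SpecMap_fromSpecResidueField p.pt
  rw [hb, Category.assoc, ← Scheme.Hom.SpecMap_residueFieldMap_fromSpecResidueField,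
    ← Category.assoc, ← Spec.map_comp, ← Category.assoc, ← Spec.map_comp] at hy
  obtain rfl : g x = x₀ := eq_of_SpecMap_fromSpecResidueField_eq hy
  rw [SpecMap_fromSpecResidueField_eq_iff] at hy
  obtain ⟨V, hV⟩ := exists_valuationSubring_comap_eq i p.val
  have hover : ValuedPoint.IsOver (g ≫ f) ⟨x, V.comap a.hom⟩ := by
    rw [← isSValuation_fromSpecResidueField_iff]
    have : (Spec.map a ≫ Y.fromSpecResidueField x) ≫ g ≫ f =
        Spec.map (CommRingCat.ofHom i) ≫ p.pt ≫ f := by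
      rw [hb, Category.assoc, ← Scheme.Hom.SpecMap_residueFieldMap_fromSpecResidueField_assoc,
        ← Spec.map_comp_assoc, hy, Spec.map_comp_assoc, Category.assoc]
    rw [this, isSValuation_comp_iff, hV]
    exact p.isSValuation
  have ht := h _ hover
  let := (g.residueFieldMap x).hom.toAlgebra
  let := b.hom.toAlgebra
  let := i.toAlgebra
  let := (i.comp b.hom).toAlgebra
  have : IsScalarTower (X.residueField (g x)) p.field Ω := .of_algebraMap_eq' rfl
  have : Module.Finite (X.residueField (g x)) (Y.residueField x) :=
    finite_residueFieldMap g x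
  have := isSeparable_residueFieldMap g x
  let j : Y.residueField x →ₐ[X.residueField (g x)] Ω :=
    { a.hom with commutes' := fun r ↦ congrArg (fun g ↦ g.hom r) hy }
  have hr := p.isTameClosed.mem_range V hV j ht
  let e : p.field ≃+* i.range := RingEquiv.ofBijective i.rangeRestrict
      ⟨fun x y hxy ↦ i.injective (congrArg Subtype.val hxy), i.rangeRestrict_surjective⟩
  let c : Y.residueField x →+* p.field := e.symm.toRingHom.comp (a.hom.codRestrict i.range hr)
  have hc (z) : i (c z) = a.hom z :=
    congrArg Subtype.val (e.apply_symm_apply (a.hom.codRestrict i.range hr z))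
  refine ⟨Spec.map (CommRingCat.ofHom c) ≫ Y.fromSpecResidueField x, ?_, ?_⟩
  · rw [hb, Category.assoc, ← Scheme.Hom.SpecMap_residueFieldMap_fromSpecResidueField,
      ← Category.assoc, ← Spec.map_comp]
    congr 2
    ext z
    apply i.injective
    exact (hc _).trans (congrArg (fun g ↦ g.hom z) hy)
  · rw [← Category.assoc, ← Spec.map_comp]
    congr 2
    ext z
    exact hc z

/-- For a given valued point, the field `k` of `exists_isTameClosed` is used as a test tame point;
it is fixed by the wild automorphisms. The geometric point of `Y` with values in the separable
closure factors through `k`, so the residue field of `Y` lies in `k` and is fixed too. -/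
theorem isTame_of_exists_factor
    (h : ∀ (p : TamePoint f) (Ω : Type u) [Field Ω] (i : p.field →+* Ω) (y : Spec (.of Ω) ⟶ Y),
      y ≫ g = Spec.map (CommRingCat.ofHom i) ≫ p.pt →
        ∃ z : Spec (.of p.field) ⟶ Y, Spec.map (CommRingCat.ofHom i) ≫ z = y)
    (η : ValuedPoint Y) (hη : η.IsOver (g ≫ f)) : η.IsTame g := by
  obtain ⟨x, w⟩ := η
  let := (g.residueFieldMap x).hom.toAlgebra
  have : Module.Finite (X.residueField (g x)) (Y.residueField x) := finite_residueFieldMap g x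
  have : Algebra.IsSeparable (X.residueField (g x)) (Y.residueField x) :=
    isSeparable_residueFieldMap g x
  change IsTamelyRamified (X.residueField (g x)) w
  obtain ⟨V, rfl⟩ := exists_valuationSubring_comap_eq
    (algebraMap (Y.residueField x) (SeparableClosure (Y.residueField x))) w
  rw [isTamelyRamified_comap_iff]
  intro σ hσ a
  obtain ⟨k, hk, hkσ⟩ := exists_isTameClosed (K := X.residueField (g x)) V
  let pt : Spec (.of k) ⟶ X :=
    Spec.map (CommRingCat.ofHom (algebraMap (X.residueField (g x)) k)) ≫
      X.fromSpecResidueField (g x)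
  have hval : (V.comap (algebraMap k (SeparableClosure (Y.residueField x)))).comap
      (algebraMap (X.residueField (g x)) k) =
      (V.comap (algebraMap (Y.residueField x) _)).comap
        (algebraMap (X.residueField (g x)) (Y.residueField x)) := by
    rw [ValuationSubring.comap_comap, ValuationSubring.comap_comap,
      ← IsScalarTower.algebraMap_eq, ← IsScalarTower.algebraMap_eq]
  have hS : IsSValuation (pt ≫ f) (V.comap (algebraMap k _)) := by
    rw [isSValuation_fromSpecResidueField_iff]
    have := (ValuedPoint.isOver_map_iff f g _).2 hη
    rw [CommRingCat.hom_ofHom, hval]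
    exact this
  let p : TamePoint f :=
    { field := k
      pt := pt
      val := V.comap (algebraMap k _)
      isSValuation := hS
      bijective_of_isTamelyRamified := hk }
  obtain ⟨z, hz'⟩ := h p (SeparableClosure (Y.residueField x)) (algebraMap k _)
    (Spec.map (CommRingCat.ofHom (algebraMap (Y.residueField x) _)) ≫
      Y.fromSpecResidueField x) (by
    rw [Category.assoc, ← Scheme.Hom.SpecMap_residueFieldMap_fromSpecResidueField,
      ← Spec.map_comp_assoc]
    change _ = Spec.map _ ≫ Spec.map _ ≫ _
    rw [← Spec.map_comp_assoc]
    rfl)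
  obtain ⟨x', c, rfl⟩ := exists_eq_SpecMap_fromSpecResidueField z
  rw [← Spec.map_comp_assoc] at hz'
  obtain rfl : x' = x := eq_of_SpecMap_fromSpecResidueField_eq hz'
  rw [SpecMap_fromSpecResidueField_eq_iff] at hz'
  have ha : algebraMap (Y.residueField x') (SeparableClosure (Y.residueField x')) a =
      algebraMap k _ (c.hom a) :=
    congrArg (fun g ↦ g.hom a) hz'.symm
  rw [ha]
  exact hkσ σ hσ _ (c.hom a).2

end

/-- Tame coverings lift tame points. -/
theorem exists_map_lifts_eq {U : X.Etale} {R : Presieve U} (hR : R ∈ tamePrecoverage f U)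
    (p : TamePoint f) (y : (lifts p.pt).obj U) :
    ∃ (V : X.Etale) (g : V ⟶ U), R g ∧ ∃ y' : (lifts p.pt).obj V, (lifts p.pt).map g y' = y := by
  have hy := liftHom_str y
  obtain ⟨x, a, hxa⟩ := exists_eq_SpecMap_fromSpecResidueField (liftHom y)
  have hover : ValuedPoint.IsOver (str U ≫ f) ⟨x, p.val.comap a.hom⟩ := by
    rw [← isSValuation_fromSpecResidueField_iff, ← hxa, liftHom_str_assoc]
    exact p.isSValuation
  obtain ⟨V, g, hg, η, -, hη, ht⟩ := hR.2 _ hover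
  change η.map (homLeft g) = _ at hη
  obtain rfl : homLeft g η.pt = x := congrArg ValuedPoint.pt hη
  have hval : η.val.comap ((homLeft g).residueFieldMap η.pt).hom = p.val.comap a.hom := by
    simpa [ValuedPoint.map] using hη
  obtain ⟨y', h⟩ := exists_lift_of_isTame (homLeft g) p.isTameClosed ht hval
  rw [← hxa] at h
  refine ⟨V, g, hg, mkLift y' ?_, liftHom_injective h⟩
  rw [← homLeft_str g, ← Category.assoc, h, liftHom_str]

/-- Every geometric point of the étale `X`-scheme `Y` over the tame point `p` is rational
over the field of `p`. -/
def SplitAt (p : TamePoint f) (Y : X.Etale) : Prop :=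
  ∀ (Ω : Type u) [Field Ω] (i : p.field →+* Ω) (y : Spec (.of Ω) ⟶ Y.left),
    y ≫ str Y = Spec.map (CommRingCat.ofHom i) ≫ p.pt →
      ∃ z : (lifts p.pt).obj Y, Spec.map (CommRingCat.ofHom i) ≫ liftHom z = y

/-- Finite tame covers are the finite étale covers split by all tame points. -/
theorem isFiniteTameCover_iff {Y : X.Etale} :
    IsFiniteTameCover f Y ↔ IsFinite (str Y) ∧ ∀ p : TamePoint f, SplitAt p Y := by
  refine and_congr_right fun _ ↦ ⟨fun h p Ω _ i y hy ↦ ?_, fun h ↦ ?_⟩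
  · obtain ⟨z, h1, h2⟩ := exists_factor_of_isTame (str Y) p h i y hy
    exact ⟨mkLift z h1, h2⟩
  · refine isTame_of_exists_factor (str Y) fun p Ω _ i y hy ↦ ?_
    obtain ⟨z, hz⟩ := h p Ω i y hy
    exact ⟨liftHom z, hz⟩

end TameSite

/-! ### Étale descent for morphisms and functions -/

namespace TameSite

variable {X : Scheme.{u}}

section Fib

variable {U V W Z : X.Etale}

/-- The fibre product of étale `X`-schemes. -/
noncomputable def fib (g : V ⟶ U) (h : W ⟶ U) : X.Etale :=
  mkEtale (pullback.fst (homLeft g) (homLeft h) ≫ str V)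

/-- The first projection. -/
noncomputable def fibFst (g : V ⟶ U) (h : W ⟶ U) : fib g h ⟶ V :=
  mkHom (pullback.fst (homLeft g) (homLeft h)) rfl

/-- The second projection. -/
noncomputable def fibSnd (g : V ⟶ U) (h : W ⟶ U) : fib g h ⟶ W :=
  mkHom (pullback.snd (homLeft g) (homLeft h)) (by
    change _ = pullback.fst (homLeft g) (homLeft h) ≫ str V
    rw [← homLeft_str g, pullback.condition_assoc, homLeft_str]; rfl)

theorem isPullback_fib (g : V ⟶ U) (h : W ⟶ U) :
    IsPullback (homLeft (fibFst g h)) (homLeft (fibSnd g h)) (homLeft g) (homLeft h) :=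
  IsPullback.of_hasPullback (homLeft g) (homLeft h)

theorem fib_condition (g : V ⟶ U) (h : W ⟶ U) : fibFst g h ≫ g = fibSnd g h ≫ h :=
  homLeft_injective (isPullback_fib g h).w

/-- The morphism to a fibre product. -/
noncomputable def fibLift (g : V ⟶ U) (h : W ⟶ U) (a : Z ⟶ V) (b : Z ⟶ W)
    (w : a ≫ g = b ≫ h) : Z ⟶ fib g h :=
  mkHom ((isPullback_fib g h).lift (homLeft a) (homLeft b) (by
    rw [← homLeft_comp, w, homLeft_comp])) (by
    rw [← homLeft_str (fibFst g h), ← Category.assoc, IsPullback.lift_fst, homLeft_str])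

@[simp]
theorem fibLift_fst (g : V ⟶ U) (h : W ⟶ U) (a : Z ⟶ V) (b : Z ⟶ W) (w : a ≫ g = b ≫ h) :
    fibLift g h a b w ≫ fibFst g h = a :=
  homLeft_injective ((isPullback_fib g h).lift_fst ..)

@[simp]
theorem fibLift_snd (g : V ⟶ U) (h : W ⟶ U) (a : Z ⟶ V) (b : Z ⟶ W) (w : a ≫ g = b ≫ h) :
    fibLift g h a b w ≫ fibSnd g h = b :=
  homLeft_injective ((isPullback_fib g h).lift_snd ..)

theorem fib_hom_ext {g : V ⟶ U} {h : W ⟶ U} {a b : Z ⟶ fib g h}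
    (h₁ : a ≫ fibFst g h = b ≫ fibFst g h) (h₂ : a ≫ fibSnd g h = b ≫ fibSnd g h) : a = b :=
  homLeft_injective ((isPullback_fib g h).hom_ext (congrArg homLeft h₁) (congrArg homLeft h₂))

theorem exists_fib_apply_eq (g : V ⟶ U) (h : W ⟶ U) (v : V.left) (w : W.left)
    (e : homLeft g v = homLeft h w) :
    ∃ z, homLeft (fibFst g h) z = v ∧ homLeft (fibSnd g h) z = w :=
  Scheme.Pullback.exists_preimage_pullback v w e

end Fib

/-- Jointly surjective étale families are fppf coverings, and the fppf topology is subcanonical. -/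
theorem isSheafFor_ofArrows_homLeft {U : X.Etale} (Y : Scheme.{u}) {ι : Type u} {Z : ι → X.Etale}
    (h : ∀ i, Z i ⟶ U) (hh : ∀ x : U.left, ∃ i z, homLeft (h i) z = x) :
    Presieve.IsSheafFor (yoneda.obj Y)
      (Presieve.ofArrows (fun i ↦ (Z i).left) (fun i ↦ homLeft (h i))) := by
  have hmem : Presieve.ofArrows (fun i ↦ (Z i).left) (fun i ↦ homLeft (h i)) ∈
      Scheme.fppfPrecoverage U.left :=
    (Scheme.ofArrows_mem_precoverage_iff _).2 ⟨hh, fun i ↦ ⟨inferInstance, inferInstance⟩⟩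
  exact (GrothendieckTopology.Subcanonical.isSheaf_of_isRepresentable
    (J := Scheme.fppfTopology) (yoneda.obj Y)).isSheafFor _
      (Precoverage.generate_mem_toGrothendieck hmem)

/-- Equality of morphisms is étale local. -/
theorem hom_ext_of_locally {U : X.Etale} {Y : Scheme.{u}} {φ ψ : U.left ⟶ Y}
    (H : ∀ x : U.left, ∃ (Z : X.Etale) (h : Z ⟶ U) (z : Z.left),
      homLeft h z = x ∧ homLeft h ≫ φ = homLeft h ≫ ψ) : φ = ψ := by
  choose Z h z hz hc using H
  refine (isSheafFor_ofArrows_homLeft Y h fun x ↦ ⟨x, z x, hz x⟩).isSeparatedFor.ext ?_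
  rintro _ _ ⟨x⟩
  exact hc x

/-- Morphisms glue along jointly surjective families of étale morphisms. -/
theorem exists_hom_of_locally {U : X.Etale} {Y : Scheme.{u}}
    (P : ∀ ⦃Z : X.Etale⦄, (Z ⟶ U) → (Z.left ⟶ Y) → Prop)
    (hres : ∀ ⦃Z Z' : X.Etale⦄ (h : Z ⟶ U) (c : Z.left ⟶ Y) (k : Z' ⟶ Z), P h c →
      P (k ≫ h) (homLeft k ≫ c))
    (huniq : ∀ ⦃Z : X.Etale⦄ (h : Z ⟶ U) (c c' : Z.left ⟶ Y), P h c → P h c' → c = c')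
    (hex : ∀ x : U.left, ∃ (Z : X.Etale) (h : Z ⟶ U) (z : Z.left) (c : Z.left ⟶ Y),
      homLeft h z = x ∧ P h c) :
    ∃ φ : U.left ⟶ Y, ∀ ⦃Z : X.Etale⦄ (h : Z ⟶ U) (c : Z.left ⟶ Y), P h c →
      homLeft h ≫ φ = c := by
  choose Z h z c hz hc using hex
  have hsh := isSheafFor_ofArrows_homLeft Y h fun x ↦ ⟨x, z x, hz x⟩
  rw [Presieve.isSheafFor_arrows_iff_pullbacks] at hsh
  -- Compatibility on overlaps is automatic: both restrictions satisfy `P` on the fibre product,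
  -- where `huniq` applies.
  obtain ⟨φ, hφ, -⟩ := hsh c (by
    intro i j
    exact huniq (fibFst (h i) (h j) ≫ h i) _ _ (hres _ _ _ (hc i)) (by
      rw [fib_condition]; exact hres _ _ (fibSnd (h i) (h j)) (hc j)))
  refine ⟨φ, fun Z' h' c' hc' ↦ hom_ext_of_locally fun y ↦ ?_⟩
  obtain ⟨w, hw, -⟩ := exists_fib_apply_eq h' (h (homLeft h' y)) y (z _) (hz _).symm
  refine ⟨_, fibFst h' (h (homLeft h' y)), w, hw, ?_⟩
  have e : homLeft (fibFst h' (h (homLeft h' y))) ≫ homLeft h' ≫ φ =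
      homLeft (fibSnd h' (h (homLeft h' y))) ≫ c _ := by
    rw [← Category.assoc, ← homLeft_comp, fib_condition, homLeft_comp, Category.assoc]
    exact congrArg _ (hφ _)
  rw [e]
  refine huniq (fibFst h' (h (homLeft h' y)) ≫ h') _ _ ?_ (hres _ _ _ hc')
  rw [fib_condition]
  exact hres _ _ _ (hc _)

section Functions

/-- The ring of functions on an étale `X`-scheme. -/
abbrev fn (U : X.Etale) : Type u := Γ(U.left, ⊤)

/-- The restriction of functions. -/
def fnMap {U V : X.Etale} (g : V ⟶ U) : fn U →+* fn V := (homLeft g).appTop.hom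

@[simp]
theorem fnMap_id_apply {U : X.Etale} (a : fn U) : fnMap (𝟙 U) a = a := by
  simp [fnMap]

theorem fnMap_comp_apply {U V W : X.Etale} (h : W ⟶ V) (g : V ⟶ U) (a : fn U) :
    fnMap (h ≫ g) a = fnMap h (fnMap g a) := rfl

theorem fnMap_comp {U V W : X.Etale} (h : W ⟶ V) (g : V ⟶ U) :
    fnMap (h ≫ g) = (fnMap h).comp (fnMap g) :=
  RingHom.ext (fnMap_comp_apply h g)

/-- Functions, as morphisms to the affine line. -/
noncomputable def fnEquiv (U : X.Etale) :
    (U.left ⟶ Spec (.of (MvPolynomial PUnit.{u + 1} (ULift.{u} ℤ)))) ≃ fn U :=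
  (AffineSpace.toSpecMvPolyIntEquiv PUnit).trans (Equiv.funUnique PUnit _)

theorem fnEquiv_comp {U V : X.Etale} (g : V ⟶ U)
    (φ : U.left ⟶ Spec (.of (MvPolynomial PUnit.{u + 1} (ULift.{u} ℤ)))) :
    fnEquiv V (homLeft g ≫ φ) = fnMap g (fnEquiv U φ) := rfl

theorem fnEquiv_symm_fnMap {U V : X.Etale} (g : V ⟶ U) (a : fn U) :
    (fnEquiv V).symm (fnMap g a) = homLeft g ≫ (fnEquiv U).symm a := by
  rw [Equiv.symm_apply_eq, fnEquiv_comp, Equiv.apply_symm_apply]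

/-- Equality of functions is étale local. -/
theorem fn_ext_of_locally {U : X.Etale} {a b : fn U}
    (H : ∀ x : U.left, ∃ (Z : X.Etale) (h : Z ⟶ U) (z : Z.left),
      homLeft h z = x ∧ fnMap h a = fnMap h b) : a = b := by
  apply (fnEquiv U).symm.injective
  refine hom_ext_of_locally fun x ↦ ?_
  obtain ⟨Z, h, z, hz, e⟩ := H x
  exact ⟨Z, h, z, hz, by rw [← fnEquiv_symm_fnMap, e, fnEquiv_symm_fnMap]⟩

/-- Functions glue along jointly surjective families of étale morphisms. -/
theorem exists_fn_of_locally {U : X.Etale} (P : ∀ ⦃Z : X.Etale⦄, (Z ⟶ U) → fn Z → Prop)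
    (hres : ∀ ⦃Z Z' : X.Etale⦄ (h : Z ⟶ U) (c : fn Z) (k : Z' ⟶ Z), P h c →
      P (k ≫ h) (fnMap k c))
    (huniq : ∀ ⦃Z : X.Etale⦄ (h : Z ⟶ U) (c c' : fn Z), P h c → P h c' → c = c')
    (hex : ∀ x : U.left, ∃ (Z : X.Etale) (h : Z ⟶ U) (z : Z.left) (c : fn Z),
      homLeft h z = x ∧ P h c) :
    ∃ a : fn U, ∀ ⦃Z : X.Etale⦄ (h : Z ⟶ U) (c : fn Z), P h c → fnMap h a = c := by
  obtain ⟨φ, hφ⟩ := exists_hom_of_locally (U := U)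
    (Y := Spec (.of (MvPolynomial PUnit.{u + 1} (ULift.{u} ℤ)))) (fun Z h c ↦ P h (fnEquiv Z c))
    (fun Z Z' h c k H ↦ hres h _ k H)
    (fun Z h c c' H H' ↦ (fnEquiv Z).injective (huniq h _ _ H H'))
    (fun x ↦ by
      obtain ⟨Z, h, z, c, hz, hc⟩ := hex x
      exact ⟨Z, h, z, (fnEquiv Z).symm c, hz, by rwa [Equiv.apply_symm_apply]⟩)
  refine ⟨fnEquiv U φ, fun Z h c hc ↦ ?_⟩
  rw [← fnEquiv_comp, hφ h ((fnEquiv Z).symm c) (by rwa [Equiv.apply_symm_apply]),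
    Equiv.apply_symm_apply]

end Functions

end TameSite

/-! ### Natural functions on a presheaf -/

namespace TameSite

variable {X : Scheme.{u}} (F : X.Etaleᵒᵖ ⥤ Type u)

/-- The restriction of sections of a presheaf. -/
def secMap {U V : X.Etale} (g : V ⟶ U) (t : F.obj (op U)) : F.obj (op V) := F.map g.op t

@[simp]
theorem secMap_id {U : X.Etale} (t : F.obj (op U)) : secMap F (𝟙 U) t = t := by
  simp [secMap]

theorem secMap_comp {U V W : X.Etale} (h : W ⟶ V) (g : V ⟶ U) (t : F.obj (op U)) :
    secMap F (h ≫ g) t = secMap F h (secMap F g t) := by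
  simp [secMap]

/-- The ring of natural functions on (the sections of) the restriction of `F` to `W`. -/
def natFun (W : X.Etale) : Subring (∀ (U : X.Etale) (_ : U ⟶ W) (_ : F.obj (op U)), fn U) where
  -- For the presheaf represented by an étale `X`-scheme `Y`, the Yoneda lemma makes these the
  -- functions on the product of `Y` and `W`. In general they are the candidate for the coordinate
  -- ring of the scheme to be constructed.
  carrier := { b | ∀ ⦃U U' : X.Etale⦄ (k : U' ⟶ U) (g : U ⟶ W) (t : F.obj (op U)),
    b U' (k ≫ g) (secMap F k t) = fnMap k (b U g t) }
  mul_mem' ha hb U U' k g t := by simp [ha k g t, hb k g t]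
  one_mem' U U' k g t := by simp
  add_mem' ha hb U U' k g t := by simp [ha k g t, hb k g t]
  zero_mem' U U' k g t := by simp
  neg_mem' ha U U' k g t := by simp [ha k g t]

variable {F}

namespace natFun

variable {W W' U U' : X.Etale}

/-- The value of a natural function at a section. -/
def eval (g : U ⟶ W) (t : F.obj (op U)) : natFun F W →+* fn U where
  toFun b := b.1 U g t
  map_zero' := rfl
  map_one' := rfl
  map_add' _ _ := rfl
  map_mul' _ _ := rfl

theorem ext {b c : natFun F W} (h : ∀ (U : X.Etale) (g : U ⟶ W) (t : F.obj (op U)),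
    eval g t b = eval g t c) : b = c :=
  Subtype.ext (funext fun U ↦ funext fun g ↦ funext fun t ↦ h U g t)

theorem eval_comp (k : U' ⟶ U) (g : U ⟶ W) (t : F.obj (op U)) (b : natFun F W) :
    eval (k ≫ g) (secMap F k t) b = fnMap k (eval g t b) := b.2 k g t

/-- The restriction of natural functions. -/
def res (h : W' ⟶ W) : natFun F W →+* natFun F W' where
  toFun b := ⟨fun _ g t ↦ eval (g ≫ h) t b, fun U U' k g t ↦
    (congrArg (fun g ↦ eval g (secMap F k t) b) (Category.assoc k g h)).trans
      (eval_comp k (g ≫ h) t b)⟩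
  map_zero' := rfl
  map_one' := rfl
  map_add' _ _ := rfl
  map_mul' _ _ := rfl

@[simp]
theorem eval_res (h : W' ⟶ W) (g : U ⟶ W') (t : F.obj (op U)) (b : natFun F W) :
    eval g t (res h b) = eval (g ≫ h) t b := rfl

theorem res_comp_apply {W'' : X.Etale} (k : W'' ⟶ W') (h : W' ⟶ W) (b : natFun F W) :
    res (k ≫ h) b = res k (res h b) :=
  ext fun U g t ↦ by simp

theorem res_res_eq {V V' Z : X.Etale} {p : V ⟶ W} {p' : V' ⟶ W} {k : Z ⟶ V} {k' : Z ⟶ V'}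
    (b : natFun F W) (e : k ≫ p = k' ≫ p') : res k (res p b) = res k' (res p' b) := by
  rw [← res_comp_apply, ← res_comp_apply, e]

theorem res_eq_of_res_eq {V V' Z : X.Etale} {a : Z ⟶ U} {p : U ⟶ V} {p' : U ⟶ V'} {k : Z ⟶ V}
    {k' : Z ⟶ V'} {b : natFun F V} {c : natFun F V'} (h : res p b = res p' c) (e : a ≫ p = k)
    (e' : a ≫ p' = k') : res k b = res k' c := by
  subst e e'
  rw [res_comp_apply, h, res_comp_apply]

@[simp]
theorem res_id_apply (b : natFun F W) : res (𝟙 W) b = b := ext fun U g t ↦ by simp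

theorem fnMap_eval (k : U' ⟶ U) (t : F.obj (op U)) (b : natFun F U) :
    fnMap k (eval (𝟙 U) t b) = eval (𝟙 U') (secMap F k t) (res k b) := by
  rw [eval_res, Category.id_comp, ← eval_comp, Category.comp_id]

variable (F) in
/-- The functions on `W`, as natural functions. -/
def const (W : X.Etale) : fn W →+* natFun F W where
  toFun a := ⟨fun _ g _ ↦ fnMap g a, fun U U' k g t ↦ fnMap_comp_apply k g a⟩
  map_zero' := Subtype.ext (by funext; simp)
  map_one' := Subtype.ext (by funext; simp)
  map_add' _ _ := Subtype.ext (by funext; simp)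
  map_mul' _ _ := Subtype.ext (by funext; simp)

@[simp]
theorem eval_const (g : U ⟶ W) (t : F.obj (op U)) (a : fn W) : eval g t (const F W a) = fnMap g a :=
  rfl

theorem res_const (h : W' ⟶ W) (a : fn W) : res h (const F W a) = const F W' (fnMap h a) :=
  ext fun U g t ↦ by simp [fnMap_comp_apply]

/-- Natural functions are determined étale locally. -/
theorem ext_of_locally {b c : natFun F W}
    (H : ∀ x : W.left, ∃ (Z : X.Etale) (h : Z ⟶ W) (z : Z.left),
      homLeft h z = x ∧ res h b = res h c) : b = c := by
  refine ext fun U g t ↦ fn_ext_of_locally fun x ↦ ?_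
  obtain ⟨Z, h, z, hz, e⟩ := H (homLeft g x)
  obtain ⟨w, hw, -⟩ := exists_fib_apply_eq g h x z hz.symm
  refine ⟨_, fibFst g h, w, hw, ?_⟩
  rw [← eval_comp, ← eval_comp, fib_condition, ← eval_res, ← eval_res, e]

/-- Natural functions glue along jointly surjective families of étale morphisms. -/
theorem exists_of_compatible {J : Type*} {T : J → X.Etale} (p : ∀ j, T j ⟶ W)
    (hp : ∀ x : W.left, ∃ j z, homLeft (p j) z = x) (b : ∀ j, natFun F (T j))
    (hb : ∀ (i j : J) (Z : X.Etale) (k : Z ⟶ T i) (l : Z ⟶ T j), k ≫ p i = l ≫ p j →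
      res k (b i) = res l (b j)) :
    ∃ c : natFun F W, ∀ j, res (p j) c = b j := by
  have hb' {Z : X.Etale} {i j : J} (k : Z ⟶ T i) (l : Z ⟶ T j) (e : k ≫ p i = l ≫ p j)
      (t : F.obj (op Z)) : eval k t (b i) = eval l t (b j) := by
    have := congrArg (eval (𝟙 Z) t) (hb i j Z k l e)
    rwa [eval_res, eval_res, Category.id_comp, Category.id_comp] at this
  let P (U : X.Etale) (g : U ⟶ W) (t : F.obj (op U)) ⦃Z : X.Etale⦄ (h : Z ⟶ U) (c : fn Z) : Prop :=
    ∃ j, ∃ k : Z ⟶ T j, k ≫ p j = h ≫ g ∧ c = eval k (secMap F h t) (b j)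
  have key (U : X.Etale) (g : U ⟶ W) (t : F.obj (op U)) : ∃ a : fn U,
      ∀ ⦃Z : X.Etale⦄ (h : Z ⟶ U) (c : fn Z), P U g t h c → fnMap h a = c := by
    refine exists_fn_of_locally (P U g t) ?_ ?_ ?_
    · rintro Z Z' h c k ⟨j, l, e, rfl⟩
      refine ⟨j, k ≫ l, by simp [e], ?_⟩
      rw [secMap_comp, eval_comp]
    · rintro Z h c c' ⟨j, l, e, rfl⟩ ⟨j', l', e', rfl⟩
      exact hb' _ _ (e.trans e'.symm) _
    · intro x
      obtain ⟨j, z, hz⟩ := hp (homLeft g x)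
      obtain ⟨w, hw, -⟩ := exists_fib_apply_eq g (p j) x z hz.symm
      exact ⟨_, fibFst g (p j), w, _, hw, j, fibSnd g (p j), (fib_condition _ _).symm, rfl⟩
  choose c hc using key
  refine ⟨⟨c, fun U U' k g t ↦ ?_⟩, fun j ↦ ?_⟩
  · refine fn_ext_of_locally fun x ↦ ?_
    obtain ⟨j, z, hz⟩ := hp (homLeft (k ≫ g) x)
    obtain ⟨w, hw, -⟩ := exists_fib_apply_eq (k ≫ g) (p j) x z hz.symm
    refine ⟨_, fibFst (k ≫ g) (p j), w, hw, ?_⟩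
    rw [hc _ _ _ (fibFst (k ≫ g) (p j)) _ ⟨j, fibSnd _ _, (fib_condition _ _).symm, rfl⟩,
      ← fnMap_comp_apply,
      hc _ _ _ (fibFst (k ≫ g) (p j) ≫ k) _ ⟨j, fibSnd _ _, by
        rw [← fib_condition, Category.assoc], rfl⟩]
    rw [secMap_comp]
  · refine ext fun U g t ↦ ?_
    have := hc U (g ≫ p j) t (𝟙 U) _ ⟨j, g, by simp, rfl⟩
    rw [fnMap_id_apply, secMap_id] at this
    exact this

end natFun

/-! ### Locally constant presheaves -/

variable (F) in
/-- The sections `s a` over `T` identify the restriction of `F` to `T`, up to sheafification for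
the Zariski topology, with the constant presheaf. -/
structure IsTriv {T : X.Etale} {A : Type u} (s : A → F.obj (op T)) : Prop where
  exists_map_eq (U : X.Etale) (g : U ⟶ T) (t : F.obj (op U)) (x : U.left) :
    ∃ (Z : X.Etale) (h : Z ⟶ U) (z : Z.left) (a : A), IsOpenImmersion (homLeft h) ∧
      homLeft h z = x ∧ secMap F h t = secMap F (h ≫ g) (s a)
  eq_of_map_eq (U : X.Etale) (g : U ⟶ T) [Nonempty U.left] (a a' : A) :
    secMap F g (s a) = secMap F g (s a') → a = a'

namespace IsTriv

variable {T T' : X.Etale} {A : Type u} {s : A → F.obj (op T)}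

theorem pullback (hs : IsTriv F s) (q : T' ⟶ T) : IsTriv F fun a ↦ secMap F q (s a) where
  exists_map_eq U g t x := by
    obtain ⟨Z, h, z, a, ho, hz, e⟩ := hs.exists_map_eq U (g ≫ q) t x
    exact ⟨Z, h, z, a, ho, hz, by rw [e, ← Category.assoc, secMap_comp]⟩
  eq_of_map_eq U g _ a a' e := by
    rw [← secMap_comp, ← secMap_comp] at e
    exact hs.eq_of_map_eq U (g ≫ q) a a' e

/-- The natural functions on a locally constant presheaf that is trivialised by sections. -/
theorem bijective_eval (hs : IsTriv F s) :
    Function.Bijective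
      (RingHom.pi fun a ↦ natFun.eval (𝟙 T) (s a) : natFun F T →+* (A → fn T)) := by
  constructor
  · intro b c hbc
    refine natFun.ext fun U g t ↦ fn_ext_of_locally fun x ↦ ?_
    obtain ⟨Z, h, z, a, -, hz, e⟩ := hs.exists_map_eq U g t x
    have hbca := congrFun hbc a
    refine ⟨Z, h, z, hz, ?_⟩
    rw [← natFun.eval_comp, ← natFun.eval_comp, e]
    have := congrArg (fnMap (h ≫ g)) hbca
    simp only [RingHom.pi_apply] at this
    rw [← natFun.eval_comp, ← natFun.eval_comp, Category.comp_id] at this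
    exact this
  · intro c
    -- The value at a section `t` is prescribed wherever `t` agrees with some `s a`. Such places
    -- cover, and `a` is unique over a nonempty scheme; over the empty scheme all functions agree.
    let P (U : X.Etale) (g : U ⟶ T) (t : F.obj (op U)) ⦃Z : X.Etale⦄ (h : Z ⟶ U)
        (d : fn Z) : Prop :=
      ∃ a, secMap F h t = secMap F (h ≫ g) (s a) ∧ d = fnMap (h ≫ g) (c a)
    have key (U : X.Etale) (g : U ⟶ T) (t : F.obj (op U)) : ∃ a : fn U,
        ∀ ⦃Z : X.Etale⦄ (h : Z ⟶ U) (c : fn Z), P U g t h c → fnMap h a = c := by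
      refine exists_fn_of_locally (P U g t) ?_ ?_ ?_
      · rintro Z Z' h d k ⟨a, e, rfl⟩
        refine ⟨a, ?_, ?_⟩
        · rw [secMap_comp, e, ← secMap_comp, Category.assoc]
        · rw [Category.assoc, fnMap_comp_apply k]
      · rintro Z h d d' ⟨a, e, rfl⟩ ⟨a', e', rfl⟩
        by_cases hZ : Nonempty Z.left
        · rw [hs.eq_of_map_eq Z (h ≫ g) a a' (e.symm.trans e')]
        · have : IsEmpty Z.left := not_nonempty_iff.1 hZ
          exact Subsingleton.elim _ _
      · intro x
        obtain ⟨Z, h, z, a, -, hz, e⟩ := hs.exists_map_eq U g t x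
        exact ⟨Z, h, z, _, hz, a, e, rfl⟩
    choose b hb using key
    refine ⟨⟨b, fun U U' k g t ↦ ?_⟩, funext fun a ↦ ?_⟩
    · refine fn_ext_of_locally fun x ↦ ?_
      obtain ⟨Z, h, z, a, -, hz, e⟩ := hs.exists_map_eq U' (k ≫ g) (secMap F k t) x
      refine ⟨Z, h, z, hz, ?_⟩
      rw [hb _ _ _ h _ ⟨a, e, rfl⟩, ← fnMap_comp_apply, hb _ _ _ (h ≫ k) _ ⟨a, by
        rw [secMap_comp, e, Category.assoc], rfl⟩, Category.assoc]
    · have := hb T (𝟙 T) (s a) (𝟙 T) _ ⟨a, by simp, rfl⟩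
      rw [fnMap_id_apply, Category.comp_id, fnMap_id_apply] at this
      exact this

end IsTriv

end TameSite

/-! ### Étale base change for natural functions -/

namespace TameSite

open TensorProduct in
/-- Kernels are compatible with flat base change. -/
theorem isBaseChange_of_exact {R R' : Type*} [CommRing R] [CommRing R'] [Algebra R R']
    [Module.Flat R R'] {M₀ M₁ M₂ N₀ N₁ N₂ : Type*} [AddCommGroup M₀] [AddCommGroup M₁]
    [AddCommGroup M₂] [AddCommGroup N₀] [AddCommGroup N₁] [AddCommGroup N₂]
    [Module R M₀] [Module R M₁] [Module R M₂] [Module R' N₀] [Module R' N₁] [Module R' N₂]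
    [Module R N₀] [Module R N₁] [Module R N₂] [IsScalarTower R R' N₀] [IsScalarTower R R' N₁]
    [IsScalarTower R R' N₂] {i : M₀ →ₗ[R] M₁} {d : M₁ →ₗ[R] M₂} {i' : N₀ →ₗ[R'] N₁}
    {d' : N₁ →ₗ[R'] N₂} {f₀ : M₀ →ₗ[R] N₀} {f₁ : M₁ →ₗ[R] N₁} {f₂ : M₂ →ₗ[R] N₂}
    (hi : Function.Injective i) (hd : Function.Exact i d) (hi' : Function.Injective i')
    (hd' : Function.Exact i' d') (h₁ : ∀ x, f₁ (i x) = i' (f₀ x))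
    (h₂ : ∀ x, f₂ (d x) = d' (f₁ x)) (hf₁ : IsBaseChange R' f₁) (hf₂ : IsBaseChange R' f₂) :
    IsBaseChange R' f₀ := by
  let l₀ : R' ⊗[R] M₀ →ₗ[R'] N₀ := LinearMap.liftBaseChange R' f₀
  have sq₁ (z : R' ⊗[R] M₀) : hf₁.equiv (i.baseChange R' z) = i' (l₀ z) := by
    induction z with
    | zero => simp
    | add x y hx hy => simp only [map_add, hx, hy]
    | tmul r m => simp [l₀, IsBaseChange.equiv_tmul, h₁]
  have sq₂ (z : R' ⊗[R] M₁) : hf₂.equiv (d.baseChange R' z) = d' (hf₁.equiv z) := by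
    induction z with
    | zero => simp
    | add x y hx hy => simp only [map_add, hx, hy]
    | tmul r m => simp [IsBaseChange.equiv_tmul, h₂]
  have hinj : Function.Injective (i.baseChange R') :=
    Module.Flat.lTensor_preserves_injective_linearMap (M := R') i hi
  have hex : Function.Exact (i.baseChange R') (d.baseChange R') := Module.Flat.lTensor_exact R' hd
  refine IsBaseChange.of_equiv (LinearEquiv.ofBijective l₀ ⟨fun x y hxy ↦ ?_, fun n ↦ ?_⟩)
    fun x ↦ (LinearMap.liftBaseChange_tmul ..).trans (one_smul R' _)
  · apply hinj
    apply hf₁.equiv.injective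
    rw [sq₁, sq₁, hxy]
  · obtain ⟨z, hz⟩ := hf₁.equiv.surjective (i' n)
    have : d.baseChange R' z = 0 := by
      apply hf₂.equiv.injective
      rw [sq₂, hz, map_zero]
      exact (hd' _).2 ⟨n, rfl⟩
    obtain ⟨w, rfl⟩ := (hex _).1 this
    exact ⟨w, hi' (by rw [← sq₁, hz])⟩

variable {X : Scheme.{u}} (F : X.Etaleᵒᵖ ⥤ Type u)

section Affine

instance {U V W : X.Etale} (g : V ⟶ U) (h : W ⟶ U) [IsAffine U.left] [IsAffine V.left]
    [IsAffine W.left] : IsAffine (fib g h).left :=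
  inferInstanceAs (IsAffine (Limits.pullback (homLeft g) (homLeft h)))

theorem flat_fnMap {U V : X.Etale} (g : V ⟶ U) [IsAffine U.left] [IsAffine V.left] :
    (fnMap g).Flat :=
  (homLeft g).flat_appTop

theorem isPullback_fib_appTop {U V W : X.Etale} (g : V ⟶ U) (h : W ⟶ U) [IsAffine U.left]
    [IsAffine V.left] [IsAffine W.left] :
    IsPushout (CommRingCat.ofHom (fnMap g)) (CommRingCat.ofHom (fnMap h))
      (CommRingCat.ofHom (fnMap (fibFst g h))) (CommRingCat.ofHom (fnMap (fibSnd g h))) :=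
  isPushout_appTop_of_isPullback (isPullback_fib g h)

end Affine

section Modules

variable {U W W' : X.Etale}

/-- The functions on `U`, as an algebra over the functions on `W`. -/
def FnOver (_ : U ⟶ W) : Type u := fn U

/-- The natural functions on `U`, as an algebra over the functions on `W`. -/
def NatOver (_ : U ⟶ W) : Type (u + 1) := natFun F U

/-- The functions on `U`, as an algebra over the functions on `W'` and on `W`. -/
def FnOver₂ (_ : W' ⟶ W) (_ : U ⟶ W') : Type u := fn U

/-- The natural functions on `U`, as an algebra over the functions on `W'` and on `W`. -/
def NatOver₂ (_ : W' ⟶ W) (_ : U ⟶ W') : Type (u + 1) := natFun F U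

variable (g : U ⟶ W) (q : W' ⟶ W) (h : U ⟶ W')

/-- The synonyms separate the many algebra structures on one ring: a fibre product acts as an
algebra through either projection, so the structure has to be read off from the morphism. The second
family has `FnOver q` as its intermediate ring of scalars, which produces the scalar towers over `fn
W`. -/
instance : CommRing (FnOver g) := inferInstanceAs (CommRing (fn U))
instance : CommRing (NatOver F g) := inferInstanceAs (CommRing (natFun F U))
instance : CommRing (FnOver₂ q h) := inferInstanceAs (CommRing (fn U))
instance : CommRing (NatOver₂ F q h) := inferInstanceAs (CommRing (natFun F U))
instance : Algebra (fn W) (FnOver g) := (fnMap g).toAlgebra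
instance : Algebra (fn W) (NatOver F g) := ((natFun.const F U).comp (fnMap g)).toAlgebra
instance : Algebra (FnOver q) (FnOver₂ q h) := (fnMap h).toAlgebra
instance : Algebra (FnOver q) (NatOver₂ F q h) := ((natFun.const F U).comp (fnMap h)).toAlgebra
instance : Algebra (fn W) (FnOver₂ q h) := ((fnMap h).comp (fnMap q)).toAlgebra
instance : Algebra (fn W) (NatOver₂ F q h) :=
  ((natFun.const F U).comp ((fnMap h).comp (fnMap q))).toAlgebra
instance : IsScalarTower (fn W) (FnOver q) (FnOver₂ q h) := .of_algebraMap_eq' rfl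
instance : IsScalarTower (fn W) (FnOver q) (NatOver₂ F q h) := .of_algebraMap_eq' rfl

variable {F g q h} {U' : X.Etale} {g' : U' ⟶ W} {h' : U' ⟶ W'}

/-- The restriction of functions, as an algebra homomorphism. -/
def fnOverMap (k : U' ⟶ U) (e : k ≫ g = h' ≫ q) : FnOver g →ₐ[fn W] FnOver₂ q h' :=
  { fnMap k with
    commutes' := fun a ↦ by
      change fnMap k (fnMap g a) = fnMap h' (fnMap q a)
      rw [← fnMap_comp_apply, ← fnMap_comp_apply, e] }

/-- The restriction of natural functions, as an algebra homomorphism. -/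
def natOverMap (k : U' ⟶ U) (e : k ≫ g = h' ≫ q) : NatOver F g →ₐ[fn W] NatOver₂ F q h' :=
  { natFun.res k with
    commutes' := fun a ↦ by
      change natFun.res k (natFun.const F U (fnMap g a)) =
        natFun.const F U' (fnMap h' (fnMap q a))
      rw [natFun.res_const, ← fnMap_comp_apply, ← fnMap_comp_apply, e] }

/-- The restriction of natural functions, as an algebra homomorphism. -/
def natOverRes (k : U' ⟶ U) (e : k ≫ g = g') : NatOver F g →ₐ[fn W] NatOver F g' :=
  { natFun.res k with
    commutes' := fun a ↦ by
      change natFun.res k (natFun.const F U (fnMap g a)) = natFun.const F U' (fnMap g' a)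
      rw [natFun.res_const, ← fnMap_comp_apply, e] }

/-- The restriction of natural functions, as an algebra homomorphism. -/
def natOverRes₂ (k : U' ⟶ U) (e : k ≫ h = h') : NatOver₂ F q h →ₐ[FnOver q] NatOver₂ F q h' :=
  { natFun.res k with
    commutes' := fun a ↦ by
      change natFun.res k (natFun.const F U (fnMap h a)) = natFun.const F U' (fnMap h' a)
      rw [natFun.res_const]
      exact congrArg (natFun.const F U') ((fnMap_comp_apply k h (a : fn W')).symm.trans
        (congrArg (fun m ↦ fnMap m (a : fn W')) e)) }

/-- Natural functions on a presheaf trivialised by sections. -/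
noncomputable def natOverEquiv {A : Type u} {s : A → F.obj (op U)} (hs : IsTriv F s) (g : U ⟶ W) :
    NatOver F g ≃ₗ[fn W] (A → FnOver g) :=
  { RingEquiv.ofBijective _ hs.bijective_eval with
    map_smul' := fun a b ↦ funext fun x ↦ by
      rw [Algebra.smul_def]
      refine (map_mul (natFun.eval (𝟙 U) (s x)) _ _).trans ?_
      change fnMap (𝟙 U) (fnMap g a) * _ = fnMap g a * _
      rw [fnMap_id_apply]
      rfl }

/-- Natural functions on a presheaf trivialised by sections. -/
noncomputable def natOverEquiv₂ {A : Type u} {s : A → F.obj (op U)} (hs : IsTriv F s) (q : W' ⟶ W)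
    (h : U ⟶ W') : NatOver₂ F q h ≃ₗ[FnOver q] (A → FnOver₂ q h) :=
  { RingEquiv.ofBijective _ hs.bijective_eval with
    map_smul' := fun a b ↦ funext fun x ↦ by
      rw [Algebra.smul_def]
      refine (map_mul (natFun.eval (𝟙 U) (s x)) _ _).trans ?_
      change fnMap (𝟙 U) (fnMap h a) * _ = fnMap h a * _
      rw [fnMap_id_apply]
      rfl }

theorem isBaseChange_fnOverMap (p : U ⟶ W) (q : W' ⟶ W) [IsAffine U.left] [IsAffine W.left]
    [IsAffine W'.left] :
    IsBaseChange (FnOver q)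
      (fnOverMap (g := p) (h' := fibSnd p q) (fibFst p q) (fib_condition p q)).toLinearMap := by
  let : Algebra (FnOver p) (FnOver₂ q (fibSnd p q)) :=
    (fnOverMap (g := p) (h' := fibSnd p q) (fibFst p q) (fib_condition p q)).toAlgebra
  have : IsScalarTower (fn W) (FnOver p) (FnOver₂ q (fibSnd p q)) :=
    .of_algebraMap_eq' (AlgHom.comp_algebraMap _).symm
  have h := (isPullback_fib_appTop p q).flip
  exact ((CommRingCat.isPushout_iff_isPushout (R := fn W) (R' := FnOver q) (S := FnOver p)
    (S' := FnOver₂ q (fibSnd p q))).1 h).1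

theorem isBaseChange_natOverMap_of_isTriv (p : U ⟶ W) (q : W' ⟶ W) [IsAffine U.left]
    [IsAffine W.left] [IsAffine W'.left] {A : Type u} [Finite A] {s : A → F.obj (op U)}
    (hs : IsTriv F s) :
    IsBaseChange (FnOver q) (natOverMap (F := F) (g := p) (h' := fibSnd p q) (fibFst p q)
      (fib_condition p q)).toLinearMap := by
  refine (IsBaseChange.iff_of_equiv_comm (f' := (fnOverMap (g := p) (h' := fibSnd p q) (fibFst p q)
      (fib_condition p q)).toLinearMap.compLeft A) (natOverEquiv hs p)
    (natOverEquiv₂ (hs.pullback (fibFst p q)) q (fibSnd p q)) ?_).2 ?_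
  rotate_left
  · exact (isBaseChange_fnOverMap p q).finitePow A
  · exact LinearMap.ext fun b ↦ funext fun a ↦ natFun.fnMap_eval (fibFst p q) (s a) b

/-- Natural functions on a locally constant presheaf are compatible with étale base change. -/
theorem isBaseChange_natOverMap (q : W' ⟶ W) [IsAffine W.left] [IsAffine W'.left]
    {J : Type u} [Finite J] {T : J → X.Etale} [∀ j, IsAffine (T j).left] (p : ∀ j, T j ⟶ W)
    (hp : ∀ x : W.left, ∃ j z, homLeft (p j) z = x) {A : J → Type u} [∀ j, Finite (A j)]
    {s : ∀ j, A j → F.obj (op (T j))} (hs : ∀ j, IsTriv F (s j)) :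
    IsBaseChange (FnOver q) (natOverMap (F := F) (g := 𝟙 W) (q := q) (h' := 𝟙 W') q
      (by simp)).toLinearMap := by
  have : Module.Flat (fn W) (FnOver q) := flat_fnMap q
  let T₂ (jl : J × J) : X.Etale := fib (p jl.1) (p jl.2)
  let p₂ (jl : J × J) : T₂ jl ⟶ W := fibFst (p jl.1) (p jl.2) ≫ p jl.1
  have hs₂ (jl : J × J) := (hs jl.1).pullback (fibFst (p jl.1) (p jl.2))
  -- By gluing, the natural functions on `W` are the kernel of the difference map `d` from the
  -- members of the covering to their double overlaps, and likewise over `W'`. On members and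
  -- overlaps `F` is trivial, where base change for functions, taken to a finite power, suffices.
  -- Flatness of `q` carries this over to the kernels.
  let i : NatOver F (𝟙 W) →ₗ[fn W] (∀ j, NatOver F (p j)) :=
    LinearMap.pi fun j ↦ (natOverRes (p j) (by simp)).toLinearMap
  let i' : NatOver₂ F q (𝟙 W') →ₗ[FnOver q] (∀ j, NatOver₂ F q (fibSnd (p j) q)) :=
    LinearMap.pi fun j ↦ (natOverRes₂ (fibSnd (p j) q) (by simp)).toLinearMap
  let d : (∀ j, NatOver F (p j)) →ₗ[fn W] (∀ jl, NatOver F (p₂ jl)) :=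
    LinearMap.pi fun jl ↦
      (natOverRes (fibFst (p jl.1) (p jl.2)) rfl).toLinearMap ∘ₗ LinearMap.proj jl.1 -
      (natOverRes (fibSnd (p jl.1) (p jl.2)) (fib_condition _ _).symm).toLinearMap ∘ₗ
        LinearMap.proj jl.2
  let a₁ (jl : J × J) : fib (p₂ jl) q ⟶ fib (p jl.1) q :=
    fibLift _ _ (fibFst (p₂ jl) q ≫ fibFst _ _) (fibSnd (p₂ jl) q) (by
      rw [← fib_condition, Category.assoc])
  let a₂ (jl : J × J) : fib (p₂ jl) q ⟶ fib (p jl.2) q :=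
    fibLift _ _ (fibFst (p₂ jl) q ≫ fibSnd _ _) (fibSnd (p₂ jl) q) (by
      rw [← fib_condition, Category.assoc, ← fib_condition])
  let d' : (∀ j, NatOver₂ F q (fibSnd (p j) q)) →ₗ[FnOver q]
      (∀ jl, NatOver₂ F q (fibSnd (p₂ jl) q)) :=
    LinearMap.pi fun jl ↦
      (natOverRes₂ (a₁ jl) (fibLift_snd ..)).toLinearMap ∘ₗ LinearMap.proj jl.1 -
      (natOverRes₂ (a₂ jl) (fibLift_snd ..)).toLinearMap ∘ₗ LinearMap.proj jl.2
  refine isBaseChange_of_exact (i := i) (i' := i') (d := d) (d' := d')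
    (f₁ := .pi fun j ↦ (natOverMap (fibFst (p j) q) (fib_condition _ _)).toLinearMap ∘ₗ .proj j)
    (f₂ := .pi fun jl ↦
      (natOverMap (fibFst (p₂ jl) q) (fib_condition _ _)).toLinearMap ∘ₗ .proj jl)
    ?_ ?_ ?_ ?_ ?_ ?_ ?_ ?_
  · intro b c hbc
    refine natFun.ext_of_locally fun x ↦ ?_
    obtain ⟨j, z, hz⟩ := hp x
    exact ⟨T j, p j, z, hz, congrFun hbc j⟩
  · intro b
    constructor
    · intro hb
      refine (natFun.exists_of_compatible p hp b fun j l Z k k' e ↦ ?_).imp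
        fun c hc ↦ funext hc
      exact natFun.res_eq_of_res_eq (sub_eq_zero.1 (congrFun hb (j, l))) (fibLift_fst _ _ k k' e)
        (fibLift_snd _ _ k k' e)
    · rintro ⟨c, rfl⟩
      exact funext fun jl ↦ sub_eq_zero.2 (natFun.res_res_eq c (fib_condition _ _))
  · intro b c hbc
    refine natFun.ext_of_locally fun x ↦ ?_
    obtain ⟨j, z, hz⟩ := hp (homLeft q x)
    obtain ⟨w, -, hw⟩ := exists_fib_apply_eq (p j) q z x hz
    exact ⟨_, fibSnd (p j) q, w, hw, congrFun hbc j⟩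
  · intro b
    constructor
    · intro hb
      refine (natFun.exists_of_compatible (fun j ↦ fibSnd (p j) q) (fun x ↦ ?_) b
        fun j l Z k k' e ↦ ?_).imp fun c hc ↦ funext hc
      · obtain ⟨j, z, hz⟩ := hp (homLeft q x)
        obtain ⟨w, -, hw⟩ := exists_fib_apply_eq (p j) q z x hz
        exact ⟨j, w, hw⟩
      · let m : Z ⟶ fib (p j) (p l) := fibLift _ _ (k ≫ fibFst _ _) (k' ≫ fibFst _ _) (by
          rw [Category.assoc, Category.assoc, fib_condition, fib_condition, ← Category.assoc, e,
            Category.assoc])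
        let n : Z ⟶ fib (p₂ (j, l)) q := fibLift _ _ m (k ≫ fibSnd _ _) (by
          change m ≫ fibFst _ _ ≫ _ = _
          rw [← Category.assoc, fibLift_fst, Category.assoc, fib_condition, Category.assoc])
        have e₁ : n ≫ a₁ (j, l) = k := by
          apply fib_hom_ext
          · rw [Category.assoc, fibLift_fst, ← Category.assoc, fibLift_fst, fibLift_fst]
          · rw [Category.assoc, fibLift_snd, fibLift_snd]
        have e₂ : n ≫ a₂ (j, l) = k' := by
          apply fib_hom_ext
          · rw [Category.assoc, fibLift_fst, ← Category.assoc, fibLift_fst, fibLift_snd]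
          · rw [Category.assoc, fibLift_snd, fibLift_snd, e]
        exact natFun.res_eq_of_res_eq (sub_eq_zero.1 (congrFun hb (j, l))) e₁ e₂
    · rintro ⟨c, rfl⟩
      exact funext fun jl ↦ sub_eq_zero.2 (natFun.res_res_eq c (by rw [fibLift_snd, fibLift_snd]))
  · intro b
    exact funext fun j ↦ natFun.res_res_eq b (fib_condition _ _)
  · intro b
    refine funext fun jl ↦ (map_sub (natOverMap (q := q) (fibFst (p₂ jl) q)
      (fib_condition (p₂ jl) q)) _ _).trans ?_
    exact congrArg₂ (fun x y : NatOver₂ F q (fibSnd (p₂ jl) q) ↦ x - y)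
      (natFun.res_res_eq (b jl.1) (by rw [fibLift_fst]))
      (natFun.res_res_eq (b jl.2) (by rw [fibLift_fst]))
  · exact IsBaseChange.pi (fun j ↦ (natOverMap (g := p j) (fibFst (p j) q)
      (fib_condition _ _)).toLinearMap) fun j ↦ isBaseChange_natOverMap_of_isTriv (p j) q (hs j)
  · exact IsBaseChange.pi (fun jl ↦ (natOverMap (g := p₂ jl) (fibFst (p₂ jl) q)
      (fib_condition _ _)).toLinearMap) fun jl ↦
        isBaseChange_natOverMap_of_isTriv (p₂ jl) q (hs₂ jl)

end Modules

end TameSite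

/-! ### Locally trivial presheaves and their rings of natural functions -/

namespace TameSite

variable {X : Scheme.{u}}

section Opens

/-- The scheme `X` as an étale `X`-scheme. -/
noncomputable def topEtale (X : Scheme.{u}) : X.Etale := mkEtale (𝟙 X)

/-- The structure morphism as a morphism of étale `X`-schemes. -/
noncomputable def toTop (U : X.Etale) : U ⟶ topEtale X := mkHom (str U) (Category.comp_id _)

theorem toTop_unique {U : X.Etale} (g h : U ⟶ topEtale X) : g = h :=
  homLeft_injective (by
    rw [← Category.comp_id (homLeft g), ← Category.comp_id (homLeft h)]
    exact (homLeft_str g).trans (homLeft_str h).symm)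

/-- An open subscheme of an étale `X`-scheme. -/
noncomputable def openEtale {U : X.Etale} (O : U.left.Opens) : X.Etale := mkEtale (O.ι ≫ str U)

/-- The inclusion of an open subscheme. -/
noncomputable def openIncl {U : X.Etale} (O : U.left.Opens) : openEtale O ⟶ U := mkHom O.ι rfl

instance {U : X.Etale} (O : U.left.Opens) : IsOpenImmersion (homLeft (openIncl O)) :=
  inferInstanceAs (IsOpenImmersion O.ι)

theorem exists_openIncl_eq {U : X.Etale} {O : U.left.Opens} {x : U.left} (hx : x ∈ O) :
    ∃ z, homLeft (openIncl O) z = x := ⟨⟨x, hx⟩, rfl⟩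

theorem exists_isAffine_openEtale {U : X.Etale} {O : U.left.Opens} {x : U.left} (hx : x ∈ O) :
    ∃ (V : X.Etale) (g : V ⟶ U) (v : V.left), IsAffine V.left ∧ IsOpenImmersion (homLeft g) ∧
      homLeft g v = x ∧ Set.range (homLeft g) ⊆ O := by
  obtain ⟨_, ⟨W, hW, rfl⟩, hxW, hWO⟩ :=
    (U.left.isBasis_affineOpens).exists_subset_of_mem_open hx O.isOpen
  refine ⟨openEtale W, openIncl W, ⟨x, hxW⟩, hW, inferInstance, rfl, ?_⟩
  rintro _ ⟨z, rfl⟩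
  exact hWO z.2

end Opens

/-- A presheaf of sets that is étale locally isomorphic, up to Zariski sheafification, to the
constant presheaf of a finite set. -/
class IsLocallyTrivial (F : X.Etaleᵒᵖ ⥤ Type u) : Prop where
  exists_isTriv (x : X) : ∃ (T : X.Etale) (z : T.left), str T z = x ∧
    ∃ (A : Type u) (_ : Finite A) (s : A → F.obj (op T)), IsTriv F s

variable (F : X.Etaleᵒᵖ ⥤ Type u) [IsLocallyTrivial F]

theorem exists_isTriv_affine (W : X.Etale) (w : W.left) :
    ∃ (T : X.Etale) (p : T ⟶ W) (z : T.left), IsAffine T.left ∧ homLeft p z = w ∧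
      ∃ (A : Type u) (_ : Finite A) (s : A → F.obj (op T)), IsTriv F s := by
  obtain ⟨T, z, hz, A, hA, s, hs⟩ := IsLocallyTrivial.exists_isTriv (F := F) (str W w)
  obtain ⟨v, hv, -⟩ := exists_fib_apply_eq (toTop W) (toTop T) w z hz.symm
  obtain ⟨V, g, v', hV, -, rfl, -⟩ := exists_isAffine_openEtale (O := ⊤) (x := v) trivial
  exact ⟨V, g ≫ fibFst _ _, v', hV, hv, A, hA, _, hs.pullback (g ≫ fibSnd _ _)⟩

/-- Étale morphisms are open and affine schemes are quasi-compact. A finite index set is what makes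
the products in the descent argument commute with base change. -/
theorem exists_finite_isTriv (W : X.Etale) [IsAffine W.left] :
    ∃ (J : Type u) (_ : Finite J) (T : J → X.Etale) (_ : ∀ j, IsAffine (T j).left)
      (p : ∀ j, T j ⟶ W) (_ : ∀ x : W.left, ∃ j z, homLeft (p j) z = x) (A : J → Type u)
      (_ : ∀ j, Finite (A j)) (s : ∀ j, A j → F.obj (op (T j))), ∀ j, IsTriv F (s j) := by
  choose T p z hT hz A hA s hs using exists_isTriv_affine F W
  obtain ⟨t, -, ht⟩ := isCompact_univ.elim_nhds_subcover (X := W.left)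
    (fun w ↦ Set.range (homLeft (p w))) fun w _ ↦
      (homLeft (p w)).isOpenMap.isOpen_range.mem_nhds ⟨_, hz w⟩
  refine ⟨t, inferInstance, fun j ↦ T j, fun j ↦ hT j, fun j ↦ p j, fun x ↦ ?_, fun j ↦ A j,
    fun j ↦ hA j, fun j ↦ s j, fun j ↦ hs j⟩
  obtain ⟨j, hj, y, hy⟩ := Set.mem_iUnion₂.1 (ht (Set.mem_univ x))
  exact ⟨⟨j, hj⟩, y, hy⟩

/-- Natural functions are families over all test schemes and so live in a larger universe.
Evaluation on one trivialising covering embeds them in a small product, so that their spectrum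
exists in the universe of `X`. -/
instance (W : X.Etale) : Small.{u} (natFun F W) := by
  choose T p z _ hz A hA s hs using exists_isTriv_affine F W
  refine small_of_injective (β := ∀ w, A w → fn (T w))
    (f := fun b w a ↦ natFun.eval (𝟙 _) (s w a) (natFun.res (p w) b)) fun b c hbc ↦ ?_
  exact natFun.ext_of_locally fun w ↦ ⟨T w, p w, z w, hz w,
    (hs w).bijective_eval.injective (congrFun hbc w)⟩

section Rings

variable {W W' U U' : X.Etale}

/-- The ring of natural functions. -/
noncomputable def natRing (W : X.Etale) : CommRingCat.{u} := .of (Shrink.{u} (natFun F W))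

/-- The ring of natural functions in the large universe. -/
noncomputable def natRingEquiv (W : X.Etale) : natRing F W ≃+* natFun F W := Shrink.ringEquiv _

/-- The inclusion of the functions in the natural functions. -/
noncomputable def natConst (W : X.Etale) : CommRingCat.of (fn W) ⟶ natRing F W :=
  CommRingCat.ofHom ((natRingEquiv F W).symm.toRingHom.comp (natFun.const F W))

/-- The restriction of natural functions. -/
noncomputable def natRes (q : W' ⟶ W) : natRing F W ⟶ natRing F W' :=
  CommRingCat.ofHom ((natRingEquiv F W').symm.toRingHom.comp
    ((natFun.res q).comp (natRingEquiv F W).toRingHom))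

variable {F}

/-- The evaluation of natural functions at a section. -/
noncomputable def natEval (g : U ⟶ W) (t : F.obj (op U)) : natRing F W ⟶ CommRingCat.of (fn U) :=
  CommRingCat.ofHom ((natFun.eval g t).comp (natRingEquiv F W).toRingHom)

variable (F)

theorem natConst_natRes (q : W' ⟶ W) :
    natConst F W ≫ natRes F q = CommRingCat.ofHom (fnMap q) ≫ natConst F W' := by
  ext a
  exact congrArg (natRingEquiv F W').symm ((congrArg (natFun.res q)
    ((natRingEquiv F W).apply_symm_apply (natFun.const F W a))).trans (natFun.res_const q a))

theorem natRes_comp {W'' : X.Etale} (k : W'' ⟶ W') (q : W' ⟶ W) :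
    natRes F (k ≫ q) = natRes F q ≫ natRes F k := by
  ext b
  exact congrArg (natRingEquiv F W'').symm ((natFun.res_comp_apply k q _).trans
    (congrArg (natFun.res k) ((natRingEquiv F W').apply_symm_apply _).symm))

theorem natRes_id (W : X.Etale) : natRes F (𝟙 W) = 𝟙 _ := by
  ext b
  exact (congrArg (natRingEquiv F W).symm (natFun.res_id_apply _)).trans
    ((natRingEquiv F W).symm_apply_apply b)

variable {F}

theorem natConst_natEval (g : U ⟶ W) (t : F.obj (op U)) :
    natConst F W ≫ natEval g t = CommRingCat.ofHom (fnMap g) := by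
  ext a
  exact congrArg (natFun.eval g t) ((natRingEquiv F W).apply_symm_apply (natFun.const F W a))

theorem natRes_natEval (q : W' ⟶ W) (g : U ⟶ W') (t : F.obj (op U)) :
    natRes F q ≫ natEval g t = natEval (g ≫ q) t := by
  ext b
  exact congrArg (natFun.eval g t) ((natRingEquiv F W').apply_symm_apply _)

theorem natEval_fnMap (k : U' ⟶ U) (g : U ⟶ W) (t : F.obj (op U)) :
    natEval g t ≫ CommRingCat.ofHom (fnMap k) = natEval (k ≫ g) (secMap F k t) := by
  ext b
  exact (natFun.eval_comp k g t _).symm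

variable (F)

/-- On spectra this says that restriction to a smaller affine is a base change, which is the
condition for gluing them over `X`. -/
theorem isPushout_natRing (q : W' ⟶ W) [IsAffine W.left] [IsAffine W'.left] :
    IsPushout (CommRingCat.ofHom (fnMap q)) (natConst F W) (natConst F W') (natRes F q) := by
  obtain ⟨J, _, T, _, p, hp, A, _, s, hs⟩ := exists_finite_isTriv F W
  have h := isBaseChange_natOverMap q p hp hs
  let : Algebra (fn W) (natRing F W) := (natConst F W).hom.toAlgebra
  let : Algebra (FnOver q) (natRing F W') := (natConst F W').hom.toAlgebra
  let : Algebra (natRing F W) (natRing F W') := (natRes F q).hom.toAlgebra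
  let : Algebra (fn W) (natRing F W') := ((natConst F W').hom.comp (fnMap q)).toAlgebra
  have : IsScalarTower (fn W) (natRing F W) (natRing F W') :=
    .of_algebraMap_eq' (congrArg CommRingCat.Hom.hom (natConst_natRes F q)).symm
  have : IsScalarTower (fn W) (FnOver q) (natRing F W') := .of_algebraMap_eq' rfl
  refine (CommRingCat.isPushout_iff_isPushout (R := fn W) (R' := FnOver q) (S := natRing F W)
    (S' := natRing F W')).2 ⟨?_⟩
  let e : natRing F W ≃ₗ[fn W] NatOver F (𝟙 W) :=
    { natRingEquiv F W with
      map_smul' := fun a b ↦ by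
        refine (map_mul (natRingEquiv F W) ((natConst F W).hom a) b).trans
          (congrArg (· * natRingEquiv F W b) ?_)
        exact ((natRingEquiv F W).apply_symm_apply (natFun.const F W a)).trans
          (congrArg (natFun.const F W) (fnMap_id_apply a).symm) }
  let e' : natRing F W' ≃ₗ[FnOver q] NatOver₂ F q (𝟙 W') :=
    { natRingEquiv F W' with
      map_smul' := fun a b ↦ by
        refine (map_mul (natRingEquiv F W') ((natConst F W').hom a) b).trans
          (congrArg (· * natRingEquiv F W' b) ?_)
        exact ((natRingEquiv F W').apply_symm_apply (natFun.const F W' a)).trans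
          (congrArg (natFun.const F W') (fnMap_id_apply (U := W') a).symm) }
  refine (IsBaseChange.iff_of_equiv_comm e e' (LinearMap.ext fun b ↦ ?_)).2 h
  exact ((natRingEquiv F W').apply_symm_apply (natFun.res q (natRingEquiv F W b))).symm

end Rings

end TameSite

/-! ### The scheme of sections -/

namespace TameSite

variable {X : Scheme.{u}} (F : X.Etaleᵒᵖ ⥤ Type u) [IsLocallyTrivial F]

section

variable {W W' U U' : X.Etale}

/-- The spectrum of the ring of natural functions. -/
noncomputable def specStr (W : X.Etale) [IsAffine W.left] : Spec (natRing F W) ⟶ W.left :=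
  Spec.map (natConst F W) ≫ W.left.isoSpec.inv

theorem isPullback_specStr (q : W' ⟶ W) [IsAffine W.left] [IsAffine W'.left] :
    IsPullback (specStr F W') (Spec.map (natRes F q)) (homLeft q) (specStr F W) := by
  have h := isPullback_SpecMap_of_isPushout _ _ _ _ (isPushout_natRing F q)
  refine h.of_iso (Iso.refl _) W'.left.isoSpec.symm (Iso.refl _) W.left.isoSpec.symm ?_ ?_ ?_ ?_
  · simp [specStr]
  · simp
  · exact Scheme.isoSpec_inv_naturality (homLeft q)
  · simp [specStr]

end

/-- An open subscheme of `X` as an étale `X`-scheme. -/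
noncomputable def etOpen (U : X.Opens) : X.Etale := mkEtale U.ι

/-- The inclusion of open subschemes of `X`. -/
noncomputable def etOpenMap {U V : X.Opens} (h : U ≤ V) : etOpen U ⟶ etOpen V :=
  mkHom (X.homOfLE h) (X.homOfLE_ι h)

instance (U : X.AffineZariskiSite) : IsAffine (etOpen U.1).left := U.2

/-- The spectra of the rings of natural functions, as data for gluing. -/
noncomputable def natGluing :
    (Scheme.AffineZariskiSite.directedCover X).RelativeGluingData where
  functor :=
    { obj U := Spec (natRing F (etOpen U.1))
      map h := Spec.map (natRes F (etOpenMap (Scheme.AffineZariskiSite.toOpens_mono h.le)))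
      map_id U := by
        have : etOpenMap (le_refl U.1) = 𝟙 _ := homLeft_injective (X.homOfLE_rfl U.1)
        rw [← Spec.map_id, ← natRes_id]
        congr 2
      map_comp {U V W} g h := by
        rw [← Spec.map_comp, ← natRes_comp]
        congr 2
        exact homLeft_injective (X.homOfLE_homOfLE (Scheme.AffineZariskiSite.toOpens_mono g.le)
          (Scheme.AffineZariskiSite.toOpens_mono h.le)).symm }
  natTrans :=
    { app U := specStr F (etOpen U.1)
      naturality U V h := (isPullback_specStr F (etOpenMap _)).w.symm }
  equifibered U V h := (isPullback_specStr F (etOpenMap _)).flip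

instance : ((natGluing F).functor ⋙ Scheme.forget).IsLocallyDirected :=
  Scheme.Cover.RelativeGluingData.instIsLocallyDirectedI₀CompFunctorForgetOfIsThin ..

/-- The scheme of sections of a locally trivial presheaf. -/
noncomputable def espace : Scheme.{u} := (natGluing F).glued

/-- The structure morphism of the scheme of sections. -/
noncomputable def espaceStr : espace F ⟶ X := (natGluing F).toBase

/-- The charts of the scheme of sections. -/
noncomputable def espaceChart (U : X.AffineZariskiSite) :
    Spec (natRing F (etOpen U.1)) ⟶ espace F :=
  colimit.ι (natGluing F).functor U

theorem isPullback_espaceChart (U : X.AffineZariskiSite) :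
    IsPullback (specStr F (etOpen U.1)) (espaceChart F U) U.1.ι (espaceStr F) :=
  (natGluing F).isPullback_natTrans_ι_toBase U

theorem natRes_espaceChart {U V : X.AffineZariskiSite} (h : U ≤ V) :
    Spec.map (natRes F (etOpenMap (Scheme.AffineZariskiSite.toOpens_mono h))) ≫ espaceChart F V =
      espaceChart F U :=
  colimit.w (natGluing F).functor (homOfLE h)

end TameSite

/-! ### Finiteness and étaleness of the scheme of sections -/

namespace TameSite

variable {X : Scheme.{u}}

instance isZariskiLocalAtTarget_etale : IsZariskiLocalAtTarget.{u} @Etale :=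
  HasRingHomProperty.instIsZariskiLocalAtTarget (P := @Etale) (Q := RingHom.Etale)

instance isZariskiLocalAtSource_etale : IsZariskiLocalAtSource.{u} @Etale :=
  HasRingHomProperty.instIsZariskiLocalAtSource (Q := RingHom.Etale)

instance isZariskiLocalAtTarget_isAffineHom : IsZariskiLocalAtTarget.{u} @IsAffineHom :=
  @HasAffineProperty.instIsZariskiLocalAtTarget @IsAffineHom (fun X _ _ _ ↦ IsAffine X)
    instHasAffinePropertyIsAffineHomIsAffine

/-- fpqc descent implies fppf descent, for properties that are local on the target. -/
theorem descendsAlong_fppf (P : MorphismProperty Scheme.{u})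
    [P.DescendsAlong (@Surjective ⊓ @Flat ⊓ @QuasiCompact)] [IsZariskiLocalAtTarget P] :
    P.DescendsAlong (@Surjective ⊓ @Flat ⊓ @LocallyOfFinitePresentation) :=
  inferInstance

/-- Descent along jointly surjective families of étale morphisms. -/
theorem of_forall_isPullback (P : MorphismProperty Scheme.{u}) [P.IsStableUnderBaseChange]
    [P.DescendsAlong (@Surjective ⊓ @Flat ⊓ @QuasiCompact)]
    [IsZariskiLocalAtTarget P] {Y : Scheme.{u}} (π : Y ⟶ X)
    (H : ∀ x : X, ∃ (T : X.Etale) (z : T.left) (E : Scheme.{u}) (a : E ⟶ T.left) (b : E ⟶ Y),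
      str T z = x ∧ IsPullback a b (str T) π ∧ P a) : P π := by
  choose T z E a b hz hab ha using H
  -- The neighbourhoods are assembled into one surjective étale morphism. It need not be
  -- quasi-compact, so descent is used in its fppf form.
  let d : (∐ fun x ↦ (T x).left) ⟶ X := Sigma.desc fun x ↦ str (T x)
  have h₁ : Surjective d := ⟨fun x ↦ ⟨Sigma.ι (fun x ↦ (T x).left) x (z x), by
    rw [← Scheme.Hom.comp_apply, Sigma.ι_desc, hz]⟩⟩
  have : Etale d := IsZariskiLocalAtSource.sigmaDesc (P := @Etale) fun x ↦
    (inferInstance : Etale (str (T x)))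
  have := descendsAlong_fppf P
  have h₂ : Flat d := inferInstance
  have h₃ : LocallyOfFinitePresentation d := inferInstance
  refine MorphismProperty.of_pullback_fst_of_descendsAlong (P := P)
    (Q := @Surjective ⊓ @Flat ⊓ @LocallyOfFinitePresentation) (f := d) (g := π) ⟨⟨h₁, h₂⟩, h₃⟩ ?_
  rw [IsZariskiLocalAtTarget.iff_of_openCover (P := P) (sigmaOpenCover fun x ↦ (T x).left)]
  intro x
  have h := (IsPullback.of_hasPullback (pullback.fst d π)
    ((sigmaOpenCover fun x ↦ (T x).left).f x)).flip.paste_vert (IsPullback.of_hasPullback d π)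
  have e : (sigmaOpenCover fun x ↦ (T x).left).f x ≫ d = str (T x) := Sigma.ι_desc _ _
  rw [e] at h
  change P (pullback.snd (pullback.fst d π) ((sigmaOpenCover fun x ↦ (T x).left).f x))
  rw [← h.isoIsPullback_hom_fst _ _ (hab x)]
  exact (P.cancel_left_of_respectsIso _ _).2 (ha x)

variable (F : X.Etaleᵒᵖ ⥤ Type u) [IsLocallyTrivial F]

theorem isPullback_espaceStr {T : X.Etale} [IsAffine T.left] {U : X.AffineZariskiSite}
    (q : T ⟶ etOpen U.1) : IsPullback (specStr F T)
      (Spec.map (natRes F q) ≫ espaceChart F U) (str T) (espaceStr F) := by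
  have h := (isPullback_specStr F q).flip.paste_horiz (isPullback_espaceChart F U).flip
  have e : homLeft q ≫ U.1.ι = str T := homLeft_str q
  rw [e] at h
  exact h.flip

section Trivial

variable {F} {T : X.Etale} {A : Type u} {s : A → F.obj (op T)}

/-- The ring of natural functions on a trivialised presheaf. -/
noncomputable def natRingPiEquiv (hs : IsTriv F s) : natRing F T ≃+* (A → fn T) :=
  (natRingEquiv F T).trans (RingEquiv.ofBijective _ hs.bijective_eval)

theorem natRingPiEquiv_apply (hs : IsTriv F s) (b : natRing F T) (a : A) :
    natRingPiEquiv hs b a = (natEval (𝟙 T) (s a)).hom b := rfl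

theorem natRingPiEquiv_natConst (hs : IsTriv F s) (c : fn T) (a : A) :
    natRingPiEquiv hs ((natConst F T).hom c) a = c := by
  rw [natRingPiEquiv_apply]
  exact (congrArg (fun φ ↦ φ.hom c) (natConst_natEval (𝟙 T) (s a))).trans (fnMap_id_apply c)

theorem finite_natConst [Finite A] (hs : IsTriv F s) : (natConst F T).hom.Finite := by
  algebraize [(natConst F T).hom]
  let e : (A → fn T) ≃ₗ[fn T] natRing F T :=
    { (natRingPiEquiv hs).symm with
      map_smul' := fun a b ↦ (natRingPiEquiv hs).injective (by
        refine ((natRingPiEquiv hs).apply_symm_apply _).trans ?_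
        rw [Algebra.smul_def]
        refine Eq.trans ?_ (map_mul (natRingPiEquiv hs) _ _).symm
        refine funext fun x ↦ ?_
        change a * b x = _ * _
        refine congrArg₂ (· * ·) ?_ ?_
        · exact (natRingPiEquiv_natConst hs a x).symm
        · exact (congrFun ((natRingPiEquiv hs).apply_symm_apply b) x).symm) }
  exact Module.Finite.equiv e

theorem etale_natConst [Finite A] (hs : IsTriv F s) : (natConst F T).hom.Etale := by
  algebraize [(natConst F T).hom]
  let e : natRing F T ≃ₐ[fn T] (A → fn T) :=
    { natRingPiEquiv hs with
      commutes' := fun c ↦ funext fun a ↦ natRingPiEquiv_natConst hs c a }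
  have : Algebra.Etale (fn T) (A → fn T) := inferInstance
  exact Algebra.Etale.of_equiv e.symm

theorem isFinite_specStr [IsAffine T.left] [Finite A] (hs : IsTriv F s) :
    IsFinite (specStr F T) := by
  have : IsFinite (Spec.map (natConst F T)) := (IsFinite.SpecMap_iff _).2 (finite_natConst hs)
  unfold specStr
  infer_instance

theorem etale_specStr [IsAffine T.left] [Finite A] (hs : IsTriv F s) :
    Etale (specStr F T) := by
  have : Etale (Spec.map (natConst F T)) :=
    (HasRingHomProperty.Spec_iff (P := @Etale)).2 (etale_natConst hs)
  unfold specStr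
  infer_instance

end Trivial

theorem exists_isTriv_over_etOpen (x : X) :
    ∃ (U : X.AffineZariskiSite) (T : X.Etale) (q : T ⟶ etOpen U.1) (z : T.left),
      IsAffine T.left ∧ str T z = x ∧
      ∃ (A : Type u) (_ : Finite A) (s : A → F.obj (op T)), IsTriv F s := by
  obtain ⟨U, hU, hx⟩ : ∃ U : X.Opens, IsAffineOpen U ∧ x ∈ U := by
    obtain ⟨_, ⟨W, hW, rfl⟩, hxW, -⟩ := X.isBasis_affineOpens.exists_subset_of_mem_open
      (Set.mem_univ x) isOpen_univ
    exact ⟨W, hW, hxW⟩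
  obtain ⟨T, q, z, hT, hz, A, hA, s, hs⟩ := exists_isTriv_affine F (etOpen U) ⟨x, hx⟩
  refine ⟨⟨U, hU⟩, T, q, z, hT, ?_, A, hA, s, hs⟩
  rw [← homLeft_str q, Scheme.Hom.comp_apply, hz]
  rfl

instance : IsAffineHom (espaceStr F) := by
  rw [IsZariskiLocalAtTarget.iff_of_openCover (P := @IsAffineHom)
    (Scheme.AffineZariskiSite.directedCover X)]
  intro U
  change IsAffineHom (pullback.snd (espaceStr F) U.1.ι)
  have : IsAffine U.1.toScheme := U.2
  have : IsAffineHom (specStr F (etOpen U.1)) := by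
    unfold specStr
    infer_instance
  rw [← (IsPullback.of_hasPullback (espaceStr F) U.1.ι).flip.isoIsPullback_hom_fst _ _
    (isPullback_espaceChart F U)]
  have : MorphismProperty.RespectsIso.{u} @IsAffineHom :=
    isZariskiLocalAtTarget_isAffineHom.toRespects
  exact (MorphismProperty.cancel_left_of_respectsIso @IsAffineHom _ (specStr F (etOpen U.1))).2
    ‹_›

instance : Etale (espaceStr F) := of_forall_isPullback @Etale _ fun x ↦ by
  obtain ⟨U, T, q, z, hT, hz, A, hA, s, hs⟩ := exists_isTriv_over_etOpen F x
  exact ⟨T, z, _, _, _, hz, isPullback_espaceStr F q, etale_specStr hs⟩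

/-- Finite means integral and locally of finite type, and integral means affine and universally
closed. Affineness is visible on Zariski charts; universal closedness descends along the
trivialising étale neighbourhoods. -/
instance : IsFinite (espaceStr F) := by
  have : UniversallyClosed (espaceStr F) := of_forall_isPullback @UniversallyClosed _ fun x ↦ by
    obtain ⟨U, T, q, z, hT, hz, A, hA, s, hs⟩ := exists_isTriv_over_etOpen F x
    have := isFinite_specStr hs
    exact ⟨T, z, _, _, _, hz, isPullback_espaceStr F q, inferInstance⟩
  exact (IsFinite.iff_isIntegralHom_and_locallyOfFiniteType _).2
    ⟨IsIntegralHom.iff_universallyClosed_and_isAffineHom.2 ⟨this, inferInstance⟩, inferInstance⟩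

end TameSite

/-! ### Sections of a presheaf as morphisms to its scheme of sections -/

namespace TameSite

section ToSpec

variable {Y : Scheme.{u}} {R : CommRingCat.{u}}

/-- The morphism to an affine scheme given by a ring homomorphism to the global functions. -/
noncomputable def toSpec (ψ : R ⟶ Γ(Y, ⊤)) : Y ⟶ Spec R := Y.toSpecΓ ≫ Spec.map ψ

theorem bijective_toSpec : Function.Bijective (toSpec : (R ⟶ Γ(Y, ⊤)) → (Y ⟶ Spec R)) := by
  have h : (toSpec : (R ⟶ Γ(Y, ⊤)) → (Y ⟶ Spec R)) =
      fun ψ ↦ ΓSpec.adjunction.homEquiv Y (op R) ψ.op :=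
    funext fun ψ ↦ (Adjunction.homEquiv_unit ..).symm
  rw [h]
  exact ((ΓSpec.adjunction.homEquiv Y (op R)).bijective).comp Quiver.Hom.opEquiv.bijective

theorem toSpec_SpecMap {R' : CommRingCat.{u}} (ψ : R ⟶ Γ(Y, ⊤)) (r : R' ⟶ R) :
    toSpec ψ ≫ Spec.map r = toSpec (r ≫ ψ) := by
  unfold toSpec
  rw [Category.assoc, Spec.map_comp]

theorem comp_toSpec {Z : Scheme.{u}} (k : Z ⟶ Y) (ψ : R ⟶ Γ(Y, ⊤)) :
    k ≫ toSpec ψ = toSpec (ψ ≫ k.appTop) := by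
  unfold toSpec
  rw [Scheme.toSpecΓ_naturality_assoc, Spec.map_comp]

theorem toSpec_appTop_isoSpec_inv {W : Scheme.{u}} [IsAffine W] (g : Y ⟶ W) :
    toSpec g.appTop ≫ W.isoSpec.inv = g := by
  unfold toSpec
  rw [Category.assoc, ← Scheme.toSpecΓ_naturality_assoc]
  exact (congrArg _ W.isoSpec.hom_inv_id).trans (Category.comp_id _)

theorem exists_mem_basicOpen_of_sum_eq_one {ι : Type*} [Fintype ι] {e : ι → Γ(Y, ⊤)}
    (he : ∑ i, e i = 1) (x : Y) : ∃ i, x ∈ Y.basicOpen (e i) := by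
  have h : IsUnit (∑ i, Y.presheaf.germ ⊤ x trivial (e i)) := by
    rw [← map_sum, he, map_one]
    exact isUnit_one
  obtain ⟨i, -, hi⟩ := IsLocalRing.exists_of_isUnit_sum h
  exact ⟨i, (Y.mem_basicOpen'' _ x).2 ⟨trivial, hi⟩⟩

/-- The pullback of `e` is invertible at every point, and an invertible idempotent is `1`. -/
theorem appTop_eq_one_of_range_subset {Z : Scheme.{u}} (h : Z ⟶ Y) {e : Γ(Y, ⊤)} (he : e * e = e)
    (hr : Set.range h ⊆ Y.basicOpen e) : h.appTop.hom e = 1 := by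
  have hu : IsUnit (h.appTop.hom e) := by
    refine RingedSpace.isUnit_of_isUnit_germ Z.toRingedSpace ⊤ _ fun z _ ↦ ?_
    have : z ∈ Z.basicOpen (h.appTop.hom e) := by
      rw [← Scheme.preimage_basicOpen_top]
      exact hr ⟨z, rfl⟩
    exact ((Z.mem_basicOpen'' _ z).1 this).2
  refine hu.mul_left_cancel ?_
  rw [← map_mul, he, mul_one]

end ToSpec

variable {X : Scheme.{u}} (F : X.Etaleᵒᵖ ⥤ Type u) [IsLocallyTrivial F]
variable {U U' W W' : X.Etale}

variable {F} in
/-- The point of the spectrum of the ring of natural functions given by a section. -/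
noncomputable def evHom (g : U ⟶ W) (t : F.obj (op U)) : U.left ⟶ Spec (natRing F W) :=
  toSpec (natEval g t)

theorem evHom_SpecMap_natRes (q : W' ⟶ W) (g : U ⟶ W') (t : F.obj (op U)) :
    evHom g t ≫ Spec.map (natRes F q) = evHom (g ≫ q) t := by
  unfold evHom
  rw [toSpec_SpecMap, natRes_natEval]

theorem homLeft_evHom (k : U' ⟶ U) (g : U ⟶ W) (t : F.obj (op U)) :
    homLeft k ≫ evHom g t = evHom (k ≫ g) (secMap F k t) := by
  refine (comp_toSpec _ _).trans ?_
  exact congrArg toSpec (natEval_fnMap k g t)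

theorem evHom_specStr [IsAffine W.left] (g : U ⟶ W) (t : F.obj (op U)) :
    evHom g t ≫ specStr F W = homLeft g := by
  unfold specStr evHom
  rw [← Category.assoc, toSpec_SpecMap, natConst_natEval]
  exact toSpec_appTop_isoSpec_inv (homLeft g)

theorem exists_hom_etOpen {O : X.Opens} (h : ∀ x : U.left, str U x ∈ O) :
    Nonempty (U ⟶ etOpen O) := by
  have hr : Set.range (str U) ⊆ Set.range O.ι := by
    rintro _ ⟨x, rfl⟩
    rw [Scheme.Opens.range_ι]
    exact h x
  have : IsOpenImmersion O.ι := inferInstance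
  obtain ⟨c, hc⟩ : ∃ c : U.left ⟶ O.toScheme, c ≫ O.ι = str U :=
    ⟨_, IsOpenImmersion.lift_fac O.ι (str U) hr⟩
  exact ⟨mkHom (U := etOpen O) c hc⟩

theorem etOpen_hom_unique {O : X.Opens} (g h : U ⟶ etOpen O) : g = h :=
  homLeft_injective ((cancel_mono O.ι).1 ((homLeft_str g).trans (homLeft_str h).symm))

theorem str_mem_of_hom {O : X.Opens} (g : U ⟶ etOpen O) (x : U.left) : str U x ∈ O := by
  rw [← homLeft_str g, Scheme.Hom.comp_apply]
  exact (homLeft g x).2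

/-- Two affine opens of `X` share, around each common point, an open that is basic in both. Over it
both sides restrict to the evaluation at the restricted section. -/
theorem evHom_espaceChart_eq {V V' : X.AffineZariskiSite} (g : U ⟶ etOpen V.1)
    (g' : U ⟶ etOpen V'.1) (t : F.obj (op U)) :
    evHom g t ≫ espaceChart F V = evHom g' t ≫ espaceChart F V' := by
  refine hom_ext_of_locally fun x ↦ ?_
  obtain ⟨a, b, hab, hx⟩ := exists_basicOpen_le_affine_inter V.2 V'.2 (str U x)
    ⟨str_mem_of_hom g x, str_mem_of_hom g' x⟩
  let O : X.AffineZariskiSite := V.basicOpen a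
  have hO : O ≤ V := V.basicOpen_le a
  have hO' : O ≤ V' := by
    have : O = V'.basicOpen b := Subtype.ext hab
    rw [this]; exact V'.basicOpen_le b
  obtain ⟨Z, h, z, -, -, hz, hr⟩ := exists_isAffine_openEtale (O := (str U) ⁻¹ᵁ O.1) hx
  refine ⟨Z, h, z, hz, ?_⟩
  obtain ⟨k⟩ : Nonempty (Z ⟶ etOpen O.1) := exists_hom_etOpen fun y ↦ by
    rw [← homLeft_str h, Scheme.Hom.comp_apply]
    exact hr ⟨y, rfl⟩
  have key (V : X.AffineZariskiSite) (hO : O ≤ V) (g : U ⟶ etOpen V.1) :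
      homLeft h ≫ evHom g t ≫ espaceChart F V = evHom k (secMap F h t) ≫ espaceChart F O := by
    rw [← natRes_espaceChart F hO, ← Category.assoc, ← Category.assoc, homLeft_evHom,
      evHom_SpecMap_natRes]
    exact congrArg (fun g ↦ evHom g _ ≫ _) (etOpen_hom_unique _ _)
  exact (key V hO g).trans (key V' hO' g').symm

/-- The scheme of sections as an étale `X`-scheme. -/
noncomputable def espaceEt : X.Etale := mkEtale (espaceStr F)

theorem evHom_espaceChart_str {V : X.AffineZariskiSite} (g : U ⟶ etOpen V.1) (t : F.obj (op U)) :
    (evHom g t ≫ espaceChart F V) ≫ espaceStr F = str U := by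
  rw [Category.assoc, ← (isPullback_espaceChart F V).w]
  refine (Category.assoc _ _ _).symm.trans ?_
  rw [evHom_specStr]
  exact homLeft_str g

theorem exists_hom_etOpen_locally (x : U.left) :
    ∃ (Z : X.Etale) (h : Z ⟶ U) (z : Z.left) (V : X.AffineZariskiSite) (_ : Z ⟶ etOpen V.1),
      IsAffine Z.left ∧ IsOpenImmersion (homLeft h) ∧ homLeft h z = x := by
  obtain ⟨_, ⟨W, hW, rfl⟩, hxW, -⟩ := X.isBasis_affineOpens.exists_subset_of_mem_open
    (Set.mem_univ (str U x)) isOpen_univ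
  obtain ⟨Z, h, z, hZ, ho, hz, hr⟩ := exists_isAffine_openEtale (O := (str U) ⁻¹ᵁ W) hxW
  obtain ⟨k⟩ : Nonempty (Z ⟶ etOpen W) := exists_hom_etOpen fun y ↦ by
    rw [← homLeft_str h, Scheme.Hom.comp_apply]
    exact hr ⟨y, rfl⟩
  exact ⟨Z, h, z, ⟨W, hW⟩, k, hZ, ho, hz⟩

theorem exists_toEspace (t : F.obj (op U)) : ∃ φ : U ⟶ espaceEt F, ∀ ⦃Z : X.Etale⦄ (h : Z ⟶ U)
    (V : X.AffineZariskiSite) (g : Z ⟶ etOpen V.1),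
      homLeft h ≫ homLeft φ = evHom g (secMap F h t) ≫ espaceChart F V := by
  obtain ⟨φ, hφ⟩ := exists_hom_of_locally (U := U) (Y := espace F)
    (fun Z h c ↦ ∃ (V : X.AffineZariskiSite) (g : Z ⟶ etOpen V.1),
      c = evHom g (secMap F h t) ≫ espaceChart F V) (by
    rintro Z Z' h _ k ⟨V, g, rfl⟩
    refine ⟨V, k ≫ g, ?_⟩
    rw [secMap_comp, ← homLeft_evHom, Category.assoc]) (by
    rintro Z h _ _ ⟨V, g, rfl⟩ ⟨V', g', rfl⟩
    exact evHom_espaceChart_eq F g g' _) (fun x ↦ by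
    obtain ⟨Z, h, z, V, g, -, -, hz⟩ := exists_hom_etOpen_locally x
    exact ⟨Z, h, z, _, hz, V, g, rfl⟩)
  refine ⟨mkHom φ (hom_ext_of_locally fun x ↦ ?_), fun Z h V g ↦ hφ h _ ⟨V, g, rfl⟩⟩
  obtain ⟨Z, h, z, V, g, -, -, hz⟩ := exists_hom_etOpen_locally x
  refine ⟨Z, h, z, hz, ?_⟩
  have e := evHom_espaceChart_str F g (secMap F h t)
  rw [← hφ h _ ⟨V, g, rfl⟩, Category.assoc] at e
  exact e.trans (homLeft_str h).symm

/-- The section of the scheme of sections given by a section of the presheaf. -/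
noncomputable def toEspace (t : F.obj (op U)) : U ⟶ espaceEt F := (exists_toEspace F t).choose

theorem homLeft_toEspace (t : F.obj (op U)) {Z : X.Etale} (h : Z ⟶ U) {V : X.AffineZariskiSite}
    (g : Z ⟶ etOpen V.1) :
    homLeft h ≫ homLeft (toEspace F t) = evHom g (secMap F h t) ≫ espaceChart F V :=
  (exists_toEspace F t).choose_spec h V g

theorem toEspace_eq (t : F.obj (op U)) {V : X.AffineZariskiSite} (g : U ⟶ etOpen V.1) :
    homLeft (toEspace F t) = evHom g t ≫ espaceChart F V := by
  have := homLeft_toEspace F t (𝟙 U) g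
  rwa [homLeft_id, Category.id_comp, secMap_id] at this

theorem toEspace_secMap (t : F.obj (op U)) {Z : X.Etale} (h : Z ⟶ U) :
    toEspace F (secMap F h t) = h ≫ toEspace F t :=
  homLeft_injective (hom_ext_of_locally fun x ↦ by
    obtain ⟨Z', h', z, V, g, -, -, hz⟩ := exists_hom_etOpen_locally x
    refine ⟨Z', h', z, hz, ?_⟩
    refine (homLeft_toEspace F _ h' g).trans ?_
    rw [← secMap_comp, ← homLeft_toEspace F t (h' ≫ h) g, homLeft_comp, homLeft_comp,
      Category.assoc])

section Local

variable {F} {T : X.Etale} {V : X.AffineZariskiSite} [IsAffine T.left]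

theorem toEspace_eq_iff (q : T ⟶ etOpen V.1) (g : U ⟶ T) (t t' : F.obj (op U)) :
    toEspace F t = toEspace F t' ↔ natEval g t = natEval g t' := by
  constructor
  · intro e
    refine bijective_toSpec.1 ((isPullback_espaceStr F q).hom_ext ?_ ?_)
    · exact (evHom_specStr F g t).trans (evHom_specStr F g t').symm
    · have e' := congrArg homLeft e
      rw [toEspace_eq F t (g ≫ q), toEspace_eq F t' (g ≫ q), ← evHom_SpecMap_natRes,
        ← evHom_SpecMap_natRes, Category.assoc, Category.assoc] at e'
      exact e'
  · intro e
    refine homLeft_injective ?_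
    rw [toEspace_eq F t (g ≫ q), toEspace_eq F t' (g ≫ q), ← evHom_SpecMap_natRes,
      ← evHom_SpecMap_natRes]
    unfold evHom
    rw [e]

variable {A : Type u} {s : A → F.obj (op T)}

open Classical in
/-- The idempotents corresponding to the sections that trivialise the presheaf. -/
noncomputable def IsTriv.idem (hs : IsTriv F s) (a : A) : natRing F T :=
  (natRingPiEquiv hs).symm (Pi.single a 1)

open Classical in
theorem IsTriv.natEval_natRing (hs : IsTriv F s) {Z : X.Etale} (g : Z ⟶ T) (a : A)
    (b : natRing F T) :
    (natEval g (secMap F g (s a))).hom b = fnMap g (natRingPiEquiv hs b a) := by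
  have := congrArg (fun φ ↦ φ.hom b) (natEval_fnMap g (𝟙 T) (s a))
  rw [Category.comp_id] at this
  exact this.symm

open Classical in
theorem IsTriv.natRingPiEquiv_idem (hs : IsTriv F s) (a : A) :
    natRingPiEquiv hs (hs.idem a) = Pi.single a 1 :=
  (natRingPiEquiv hs).apply_symm_apply _

/-- Locally `t` and `t'` are restrictions of some `s a` and `s a'`. If `a ≠ a'`, the idempotent of
`a` takes the value `1` at one and `0` at the other, whereas equal morphisms give equal values of
all natural functions. -/
theorem IsTriv.exists_secMap_eq_of_toEspace_eq (hs : IsTriv F s) (q : T ⟶ etOpen V.1) (g : U ⟶ T)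
    {t t' : F.obj (op U)} (e : toEspace F t = toEspace F t') (x : U.left) :
    ∃ (Z : X.Etale) (h : Z ⟶ U) (z : Z.left), IsOpenImmersion (homLeft h) ∧ homLeft h z = x ∧
      secMap F h t = secMap F h t' := by
  obtain ⟨Z, h, z, a, ho, hz, e₁⟩ := hs.exists_map_eq U g t x
  obtain ⟨Z', h', z', a', ho', hz', e₂⟩ := hs.exists_map_eq Z (h ≫ g) (secMap F h t') z
  rw [← secMap_comp, ← Category.assoc] at e₂
  have e₁' : secMap F (h' ≫ h) t = secMap F ((h' ≫ h) ≫ g) (s a) := by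
    rw [secMap_comp, e₁, ← secMap_comp, Category.assoc]
  refine ⟨Z', h' ≫ h, z', ?_, ?_, ?_⟩
  · rw [homLeft_comp]
    infer_instance
  · rw [homLeft_comp, Scheme.Hom.comp_apply, hz', hz]
  rw [e₁', e₂]
  suffices a = a' by rw [this]
  by_contra hne
  have e' := congrArg (fun φ ↦ (h' ≫ h) ≫ φ) e
  simp only [← toEspace_secMap] at e'
  rw [toEspace_eq_iff q ((h' ≫ h) ≫ g), e₁', e₂] at e'
  have e'' := congrArg (fun φ ↦ φ.hom (hs.idem a)) e'
  have : Nonempty Z'.left := ⟨z'⟩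
  simp only [hs.natEval_natRing, hs.natRingPiEquiv_idem] at e''
  classical
  rw [Pi.single_eq_same, Pi.single_eq_of_ne (Ne.symm hne), map_one, map_zero] at e''
  have : Nonempty (⊤ : Z'.left.Opens) := ⟨⟨z', trivial⟩⟩
  have : Nontrivial (fn Z') := Scheme.component_nontrivial Z'.left ⊤
  exact one_ne_zero (α := fn Z') e''

open Classical in
theorem IsTriv.natConst_mul_idem (hs : IsTriv F s) (b : natRing F T) (a : A) :
    (natConst F T).hom (natRingPiEquiv hs b a) * hs.idem a = b * hs.idem a := by
  refine (natRingPiEquiv hs).injective ?_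
  rw [map_mul, map_mul, hs.natRingPiEquiv_idem]
  refine funext fun a' ↦ ?_
  have := natRingPiEquiv_natConst hs (natRingPiEquiv hs b a) a'
  by_cases haa : a' = a
  · subst haa
    exact congrArg (· * _) this
  · simp [haa]

/-- The ring of natural functions is a product of copies of `fn T`. A homomorphism sending the
idempotent of `a` to `1` only sees the factor `a`, so its restriction to `fn T` determines it. -/
theorem IsTriv.natEval_eq_of_idem (hs : IsTriv F s) {g : U ⟶ T} {a : A}
    {ψ : natRing F T ⟶ CommRingCat.of (fn U)} (hψ : natConst F T ≫ ψ = CommRingCat.ofHom (fnMap g))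
    (h : ψ.hom (hs.idem a) = 1) : natEval g (secMap F g (s a)) = ψ := by
  ext b
  refine (hs.natEval_natRing g a b).trans ?_
  have e := congrArg ψ.hom (hs.natConst_mul_idem b a)
  rw [map_mul, map_mul, h, mul_one, mul_one] at e
  exact (congrArg (fun φ ↦ φ.hom (natRingPiEquiv hs b a)) hψ).symm.trans e

/-- Sections of the scheme of sections as ring homomorphisms. -/
theorem exists_toSpec_eq (q : T ⟶ etOpen V.1) (g : U ⟶ T) (y : U ⟶ espaceEt F) :
    ∃ ψ : natRing F T ⟶ CommRingCat.of (fn U), natConst F T ≫ ψ = CommRingCat.ofHom (fnMap g) ∧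
      toSpec ψ ≫ Spec.map (natRes F q) ≫ espaceChart F V = homLeft y := by
  have hw : homLeft g ≫ str T = homLeft y ≫ espaceStr F :=
    (homLeft_str g).trans (homLeft_str y).symm
  obtain ⟨ψ, hψ⟩ := bijective_toSpec.2 ((isPullback_espaceStr F q).lift _ _ hw)
  refine ⟨ψ, bijective_toSpec.1 ?_, ?_⟩
  · rw [← cancel_mono T.left.isoSpec.inv, ← toSpec_SpecMap, hψ, Category.assoc]
    exact ((isPullback_espaceStr F q).lift_fst _ _ _).trans
      (toSpec_appTop_isoSpec_inv (homLeft g)).symm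
  · rw [hψ]
    exact (isPullback_espaceStr F q).lift_snd _ _ _

/-- There are finitely many idempotents and they add up to `1`, so one of them is invertible in the
local ring at `x`, hence equal to `1` near `x`. -/
theorem IsTriv.exists_openImmersion_eq_one [Finite A] (hs : IsTriv F s)
    (ψ : natRing F T ⟶ CommRingCat.of (fn U)) (x : U.left) :
    ∃ (Z : X.Etale) (h : Z ⟶ U) (z : Z.left) (a : A), IsOpenImmersion (homLeft h) ∧
      homLeft h z = x ∧ fnMap h (ψ.hom (hs.idem a)) = 1 := by
  classical
  have := Fintype.ofFinite A
  have hsum : ∑ a, ψ.hom (hs.idem a) = 1 := by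
    rw [← map_sum, ← map_one ψ.hom]
    refine congrArg ψ.hom ((natRingPiEquiv hs).injective ?_)
    rw [map_sum, map_one]
    simp only [hs.natRingPiEquiv_idem]
    exact Finset.univ_sum_single 1
  obtain ⟨a, ha⟩ := exists_mem_basicOpen_of_sum_eq_one hsum x
  obtain ⟨Z, h, z, -, ho, hz, hr⟩ := exists_isAffine_openEtale ha
  refine ⟨Z, h, z, a, ho, hz, appTop_eq_one_of_range_subset (homLeft h) ?_ hr⟩
  rw [← map_mul]
  refine congrArg ψ.hom ((natRingPiEquiv hs).injective ?_)
  rw [map_mul, hs.natRingPiEquiv_idem, ← Pi.single_mul, one_mul]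

theorem evHom_eq_of_natEval_eq {W : X.Etale} (g : U ⟶ T) (t : F.obj (op U)) (h : U ⟶ W)
    {ψ : natRing F T ⟶ CommRingCat.of (fn W)}
    (e : natEval g t = ψ ≫ CommRingCat.ofHom (fnMap h)) : evHom g t = homLeft h ≫ toSpec ψ := by
  refine Eq.trans ?_ (comp_toSpec (homLeft h) ψ).symm
  exact congrArg toSpec e

theorem comp_toSpec_espaceChart (q : T ⟶ etOpen V.1) (g : U ⟶ T) (t : F.obj (op U))
    {W : X.Etale} (h : U ⟶ W) {ψ : natRing F T ⟶ CommRingCat.of (fn W)}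
    (e : natEval g t = ψ ≫ CommRingCat.ofHom (fnMap h)) {y : W ⟶ espaceEt F}
    (hψ : toSpec ψ ≫ Spec.map (natRes F q) ≫ espaceChart F V = homLeft y) :
    h ≫ y = toEspace F t := by
  have h₁ := toEspace_eq F t (g ≫ q)
  rw [← evHom_SpecMap_natRes, evHom_eq_of_natEval_eq g t h e, Category.assoc, Category.assoc,
    hψ] at h₁
  exact homLeft_injective h₁.symm

/-- Over the chart `y` is a ring homomorphism `ψ` out of the natural functions. Near `x` it sends
one idempotent to `1`, so it is evaluation at the section with that index. -/
theorem IsTriv.exists_toEspace_eq [Finite A] (hs : IsTriv F s) (q : T ⟶ etOpen V.1) (g : U ⟶ T)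
    (y : U ⟶ espaceEt F) (x : U.left) :
    ∃ (Z : X.Etale) (h : Z ⟶ U) (z : Z.left) (t : F.obj (op Z)), IsOpenImmersion (homLeft h) ∧
      homLeft h z = x ∧ h ≫ y = toEspace F t := by
  obtain ⟨ψ, hψc, hψ⟩ := exists_toSpec_eq q g y
  obtain ⟨Z, h, z, a, ho, hz, he⟩ := hs.exists_openImmersion_eq_one ψ x
  have key : natConst F T ≫ ψ ≫ CommRingCat.ofHom (fnMap h) =
      CommRingCat.ofHom (fnMap (h ≫ g)) := by
    rw [← Category.assoc, hψc, fnMap_comp, ← CommRingCat.ofHom_comp]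
  exact ⟨Z, h, z, secMap F (h ≫ g) (s a), ho, hz,
    comp_toSpec_espaceChart q (h ≫ g) _ h (hs.natEval_eq_of_idem key he) hψ⟩

end Local

end TameSite

/-! ### Equality loci and local triviality of finite étale schemes -/

namespace TameSite

section Equalizer

/-- The locus is the preimage of the diagonal of `π`, which is an open immersion because `π` is
étale and a closed one because `π` is separated. -/
theorem exists_isClopen_equalizer {U Y X : Scheme.{u}} (π : Y ⟶ X) [Etale π] [IsSeparated π]
    (a b : U ⟶ Y) (h : a ≫ π = b ≫ π) : ∃ E : Set U, IsClopen E ∧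
      ∀ (W : Scheme.{u}) (t : W ⟶ U), t ≫ a = t ≫ b ↔ Set.range t ⊆ E := by
  let l : U ⟶ pullback π π := pullback.lift a b h
  have hl₁ : l ≫ pullback.fst π π = a := pullback.lift_fst _ _ _
  have hl₂ : l ≫ pullback.snd π π = b := pullback.lift_snd _ _ _
  let i := pullback.fst l (pullback.diagonal π)
  have hi : i ≫ l = pullback.snd _ _ ≫ pullback.diagonal π := pullback.condition
  refine ⟨Set.range i, ⟨i.isClosedEmbedding.isClosed_range, i.isOpenEmbedding.isOpen_range⟩,
    fun W t ↦ ⟨fun e ↦ ?_, fun e ↦ ?_⟩⟩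
  · have : t = pullback.lift t (t ≫ a) (by
      refine pullback.hom_ext ?_ ?_
      · rw [Category.assoc, hl₁, Category.assoc, pullback.diagonal_fst, Category.comp_id]
      · rw [Category.assoc, hl₂, Category.assoc, pullback.diagonal_snd, Category.comp_id, e]) ≫ i :=
        (pullback.lift_fst _ _ _).symm
    rw [this]
    rintro _ ⟨x, rfl⟩
    exact ⟨_, (Scheme.Hom.comp_apply _ _ _).symm⟩
  · have hia : i ≫ a = pullback.snd _ _ := by
      rw [← hl₁, ← Category.assoc, hi, Category.assoc, pullback.diagonal_fst, Category.comp_id]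
    have hib : i ≫ b = pullback.snd _ _ := by
      rw [← hl₂, ← Category.assoc, hi, Category.assoc, pullback.diagonal_snd, Category.comp_id]
    rw [← IsOpenImmersion.lift_fac i t e, Category.assoc, Category.assoc, hia, hib]

variable {X : Scheme.{u}} {U V Y : X.Etale} [IsFinite (str Y)]

/-- The locus where two morphisms to a finite étale scheme agree. -/
def eqLocus (a b : U ⟶ Y) : Set U.left :=
  (exists_isClopen_equalizer (str Y) (homLeft a) (homLeft b)
    ((homLeft_str a).trans (homLeft_str b).symm)).choose

theorem isClopen_eqLocus (a b : U ⟶ Y) : IsClopen (eqLocus a b) :=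
  (exists_isClopen_equalizer (str Y) (homLeft a) (homLeft b)
    ((homLeft_str a).trans (homLeft_str b).symm)).choose_spec.1

theorem comp_homLeft_eq_iff (a b : U ⟶ Y) {W : Scheme.{u}} (t : W ⟶ U.left) :
    t ≫ homLeft a = t ≫ homLeft b ↔ Set.range t ⊆ eqLocus a b :=
  (exists_isClopen_equalizer (str Y) (homLeft a) (homLeft b)
    ((homLeft_str a).trans (homLeft_str b).symm)).choose_spec.2 W t

theorem range_SpecField {K : Type u} [Field K] {W : Scheme.{u}} (t : Spec (.of K) ⟶ W) :
    Set.range t = {t default} := by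
  ext x
  constructor
  · rintro ⟨y, rfl⟩
    rw [Subsingleton.elim y default]
    rfl
  · rintro rfl
    exact ⟨_, rfl⟩

theorem default_mem_eqLocus_iff {K : Type u} [Field K] (a b : U ⟶ Y) (t : Spec (.of K) ⟶ U.left) :
    t default ∈ eqLocus a b ↔ t ≫ homLeft a = t ≫ homLeft b := by
  rw [comp_homLeft_eq_iff, range_SpecField, Set.singleton_subset_iff]

theorem comp_eq_iff (a b : U ⟶ Y) (h : V ⟶ U) :
    h ≫ a = h ≫ b ↔ Set.range (homLeft h) ⊆ eqLocus a b := by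
  rw [← comp_homLeft_eq_iff, ← homLeft_comp, ← homLeft_comp]
  exact ⟨congrArg _, homLeft_injective⟩

theorem mem_eqLocus_iff (a b : U ⟶ Y) (x : U.left) : x ∈ eqLocus a b ↔
    U.left.fromSpecResidueField x ≫ homLeft a = U.left.fromSpecResidueField x ≫ homLeft b := by
  rw [comp_homLeft_eq_iff, Scheme.range_fromSpecResidueField, Set.singleton_subset_iff]

theorem mem_eqLocus_comp_iff (a b : U ⟶ Y) (h : V ⟶ U) (x : V.left) :
    x ∈ eqLocus (h ≫ a) (h ≫ b) ↔ homLeft h x ∈ eqLocus a b := by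
  have e := comp_homLeft_eq_iff a b (V.left.fromSpecResidueField x ≫ homLeft h)
  have hr : Set.range (V.left.fromSpecResidueField x ≫ homLeft h) = {homLeft h x} := by
    rw [Scheme.Hom.comp_base, TopCat.coe_comp, Set.range_comp, Scheme.range_fromSpecResidueField,
      Set.image_singleton]
  rw [hr, Set.singleton_subset_iff] at e
  rw [mem_eqLocus_iff, ← e, homLeft_comp, homLeft_comp, Category.assoc, Category.assoc]

theorem eqLocus_comm (a b : U ⟶ Y) : eqLocus a b = eqLocus b a := by
  ext x
  rw [mem_eqLocus_iff, mem_eqLocus_iff, eq_comm]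

theorem mem_eqLocus_trans {a b c : U ⟶ Y} {x : U.left} (h : x ∈ eqLocus a b)
    (h' : x ∈ eqLocus b c) : x ∈ eqLocus a c := by
  rw [mem_eqLocus_iff] at h h' ⊢
  exact h.trans h'

end Equalizer

variable {X : Scheme.{u}}

section Prod

variable {U V W : X.Etale}

/-- The product of étale `X`-schemes. -/
noncomputable def prd (U V : X.Etale) : X.Etale := fib (toTop U) (toTop V)

/-- The first projection. -/
noncomputable def prdFst (U V : X.Etale) : prd U V ⟶ U := fibFst _ _

/-- The second projection. -/
noncomputable def prdSnd (U V : X.Etale) : prd U V ⟶ V := fibSnd _ _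

/-- The morphism to a product. -/
noncomputable def prdLift (a : W ⟶ U) (b : W ⟶ V) : W ⟶ prd U V :=
  fibLift _ _ a b (toTop_unique _ _)

theorem prdLift_fst (a : W ⟶ U) (b : W ⟶ V) : prdLift a b ≫ prdFst U V = a := fibLift_fst ..

theorem prdLift_snd (a : W ⟶ U) (b : W ⟶ V) : prdLift a b ≫ prdSnd U V = b := fibLift_snd ..

theorem prd_hom_ext {a b : W ⟶ prd U V} (h : a ≫ prdFst U V = b ≫ prdFst U V)
    (h' : a ≫ prdSnd U V = b ≫ prdSnd U V) : a = b := fib_hom_ext h h'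

theorem isPullback_prd (U V : X.Etale) :
    IsPullback (homLeft (prdFst U V)) (homLeft (prdSnd U V)) (str U) (str V) :=
  isPullback_fib (toTop U) (toTop V)

instance [IsFinite (str U)] : IsFinite (homLeft (prdSnd U V)) :=
  MorphismProperty.of_isPullback (P := @IsFinite) (isPullback_prd U V) inferInstance

end Prod

/-- Equality loci are open, so agreement of a morphism with some `s a` at one point spreads to a
neighbourhood; pointwise hypotheses therefore suffice. -/
theorem isTriv_yoneda {T Y : X.Etale} [IsFinite (str Y)] {A : Type u} (s : A → (T ⟶ Y))
    (hcov : ∀ v : (prd Y T).left, ∃ a, v ∈ eqLocus (prdFst Y T) (prdSnd Y T ≫ s a))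
    (hsep : ∀ a a' (x : T.left), x ∈ eqLocus (s a) (s a') → a = a') :
    IsTriv (yoneda.obj Y) s where
  exists_map_eq U g t x := by
    obtain ⟨a, ha⟩ := hcov (homLeft (prdLift t g) x)
    rw [← mem_eqLocus_comp_iff, ← Category.assoc, prdLift_fst, prdLift_snd] at ha
    obtain ⟨Z, h, z, -, ho, hz, hr⟩ :=
      exists_isAffine_openEtale (O := ⟨_, (isClopen_eqLocus _ _).isOpen⟩) ha
    refine ⟨Z, h, z, a, ho, hz, ?_⟩
    exact ((comp_eq_iff _ _ h).2 hr).trans (Category.assoc _ _ _).symm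
  eq_of_map_eq U g hU a a' e := by
    obtain ⟨x⟩ := hU
    exact hsep a a' (homLeft g x) ((comp_eq_iff _ _ g).1 e ⟨x, rfl⟩)

theorem IsTriv.exists_mem_eqLocus {T Y U : X.Etale} [IsFinite (str Y)] {A : Type u}
    {s : A → (T ⟶ Y)} (hs : IsTriv (yoneda.obj Y) s) (g : U ⟶ T) (d : U ⟶ Y) (x : U.left) :
    ∃ a, x ∈ eqLocus d (g ≫ s a) := by
  obtain ⟨Z, h, z, a, -, rfl, e⟩ := hs.exists_map_eq U g d x
  have e' : h ≫ d = (h ≫ g) ≫ s a := e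
  exact ⟨a, (comp_eq_iff _ _ h).1 (e'.trans (Category.assoc _ _ _)) ⟨z, rfl⟩⟩

theorem IsTriv.eq_of_mem_eqLocus {T Y U : X.Etale} [IsFinite (str Y)] {A : Type u}
    {s : A → (T ⟶ Y)} (hs : IsTriv (yoneda.obj Y) s) {g : U ⟶ T} {a a' : A} {x : U.left}
    (h : x ∈ eqLocus (g ≫ s a) (g ≫ s a')) : a = a' := by
  obtain ⟨Z, k, z, -, -, hz, hr⟩ :=
    exists_isAffine_openEtale (O := ⟨_, (isClopen_eqLocus _ _).isOpen⟩) h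
  have : Nonempty Z.left := ⟨z⟩
  refine hs.eq_of_map_eq Z (k ≫ g) a a' ?_
  exact (Category.assoc _ _ _).trans (((comp_eq_iff _ _ k).2 hr).trans (Category.assoc _ _ _).symm)

section Lifts

variable {K : Type u} [Field K] (x : Spec (.of K) ⟶ X) {Y : X.Etale}

/-- The point of the fibre given by a lift. -/
noncomputable def liftPt (y : (lifts x).obj Y) : Spec (.of K) ⟶ pullback (str Y) x :=
  pullback.lift (liftHom y) (𝟙 _) ((liftHom_str y).trans (Category.id_comp _).symm)

theorem liftPt_fst (y : (lifts x).obj Y) : liftPt x y ≫ pullback.fst _ _ = liftHom y :=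
  pullback.lift_fst _ _ _

theorem liftPt_snd (y : (lifts x).obj Y) : liftPt x y ≫ pullback.snd _ _ = 𝟙 _ :=
  pullback.lift_snd _ _ _

/-- A section of an étale morphism is étale and a monomorphism, hence an open immersion. Another
section with the same image factors through it, and the factorisation is the identity. -/
theorem injective_liftPt : Function.Injective fun y : (lifts x).obj Y ↦ liftPt x y default := by
  intro y y' h
  have h₁ : Etale (liftPt x y) := by
    have : Etale (liftPt x y ≫ pullback.snd (str Y) x) := by
      rw [liftPt_snd]; infer_instance
    exact Etale.of_comp _ (pullback.snd (str Y) x)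
  have h₂ : Mono (liftPt x y) := mono_of_mono_fac (liftPt_snd x y)
  have h₃ : IsOpenImmersion (liftPt x y) := IsOpenImmersion.of_flat_of_mono _
  have hr : Set.range (liftPt x y') ⊆ Set.range (liftPt x y) := by
    rw [range_SpecField, range_SpecField]
    exact (Set.singleton_subset_singleton.2 h.symm)
  have e := IsOpenImmersion.lift_fac (liftPt x y) (liftPt x y') hr
  have e' : IsOpenImmersion.lift (liftPt x y) (liftPt x y') hr = 𝟙 _ := by
    have := congrArg (· ≫ pullback.snd _ _) e
    simpa only [Category.assoc, liftPt_snd, Category.comp_id] using this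
  rw [e', Category.id_comp] at e
  refine liftHom_injective ?_
  rw [← liftPt_fst, e, liftPt_fst]

instance [IsFinite (str Y)] : Finite ((lifts x).obj Y) := by
  have hf : IsFinite (pullback.snd (str Y) x) := inferInstance
  have h := (pullback.snd (str Y) x).finite_preimage (s := Set.univ) Set.finite_univ
  have : Finite ↥(pullback (str Y) x) := Set.finite_univ_iff.mp (by simpa using h)
  exact Finite.of_injective _ (injective_liftPt x)

/-- A finite étale scheme is trivialised near a geometric point by sections realising all the
points above it. -/
theorem exists_isTriv_shrink [IsSepClosed K] [IsFinite (str Y)] {T : X.Etale} (z : (lifts x).obj T)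
    (s : (lifts x).obj Y → (T ⟶ Y)) (hs : ∀ a, (lifts x).map (s a) z = a) :
    ∃ O : T.left.Opens, liftHom z default ∈ O ∧ ∀ (T' : X.Etale) (h : T' ⟶ T),
      Set.range (homLeft h) ⊆ O → IsTriv (yoneda.obj Y) fun a ↦ h ≫ s a := by
  have hs' (a) : liftHom z ≫ homLeft (s a) = liftHom a := by
    rw [← liftHom_map, hs]
  -- `C` consists of the points of the product lying on no graph of a section, `D` of the points of
  -- `T` where two sections meet. The image of `C` is closed because the projection is finite. The
  -- point `z` avoids it because over the separably closed `K` every point above `z` is rational,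
  -- hence on a graph. It avoids `D` because the sections pass through distinct lifts.
  let C : Set (prd Y T).left := (⋃ a, eqLocus (prdFst Y T) (prdSnd Y T ≫ s a))ᶜ
  have hC : IsClosed (homLeft (prdSnd Y T) '' C) := by
    refine (homLeft (prdSnd Y T)).isClosedMap _ ?_
    exact (isOpen_iUnion fun a ↦ (isClopen_eqLocus _ _).isOpen).isClosed_compl
  let D : Set T.left := ⋃ a, ⋃ a', ⋃ (_ : a ≠ a'), eqLocus (s a) (s a')
  have hD : IsClosed D := by
    refine isClosed_iUnion_of_finite fun a ↦ isClosed_iUnion_of_finite fun a' ↦ ?_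
    exact isClosed_iUnion_of_finite fun _ ↦ (isClopen_eqLocus _ _).isClosed
  have hzC : liftHom z default ∉ homLeft (prdSnd Y T) '' C := by
    rintro ⟨v, hv, hvz⟩
    obtain ⟨l, hl, rfl⟩ := Scheme.exists_fac_of_etale_of_isSepClosed
      (homLeft (prdSnd Y T)) (liftHom z) v hvz
    refine hv (Set.mem_iUnion.2 ⟨mkLift (l ≫ homLeft (prdFst Y T)) ?_, ?_⟩)
    · rw [Category.assoc, homLeft_str, ← liftHom_str z, ← hl, Category.assoc, homLeft_str]
    · rw [default_mem_eqLocus_iff, homLeft_comp, ← Category.assoc]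
      exact (liftHom_mkLift _ _).symm.trans ((hs' _).symm.trans (congrArg (· ≫ homLeft _) hl).symm)
  have hzD : liftHom z default ∉ D := by
    simp only [D, Set.mem_iUnion, not_exists]
    intro a a' hne h
    rw [default_mem_eqLocus_iff, hs', hs'] at h
    exact hne (liftHom_injective h)
  refine ⟨⟨(homLeft (prdSnd Y T) '' C)ᶜ ∩ Dᶜ, hC.isOpen_compl.inter hD.isOpen_compl⟩, ⟨hzC, hzD⟩,
    fun T' h hO ↦ isTriv_yoneda _ (fun v ↦ ?_) (fun a a' y hy ↦ ?_)⟩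
  · let k := prdLift (prdFst Y T') (prdSnd Y T' ≫ h)
    have hk : homLeft (prdSnd Y T) (homLeft k v) = homLeft h (homLeft (prdSnd Y T') v) := by
      rw [← Scheme.Hom.comp_apply, ← homLeft_comp, prdLift_snd, homLeft_comp,
        Scheme.Hom.comp_apply]
    have hkC : homLeft k v ∉ C := fun hc ↦ (hO ⟨homLeft (prdSnd Y T') v, rfl⟩).1 ⟨_, hc, hk⟩
    obtain ⟨a, ha⟩ := Set.mem_iUnion.1 (not_not.1 hkC)
    refine ⟨a, ?_⟩
    rw [← mem_eqLocus_comp_iff, ← Category.assoc, prdLift_fst, prdLift_snd, Category.assoc] at ha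
    exact ha
  · rw [mem_eqLocus_comp_iff] at hy
    by_contra hne
    exact (hO ⟨y, rfl⟩).2 (Set.mem_iUnion.2 ⟨a, Set.mem_iUnion.2 ⟨a', Set.mem_iUnion.2 ⟨hne, hy⟩⟩⟩)

end Lifts

end TameSite

/-! ### The universal property of the scheme of sections -/

namespace TameSite

variable {X : Scheme.{u}} {F : X.Etaleᵒᵖ ⥤ Type u} [IsLocallyTrivial F] {U : X.Etale}

theorem exists_toEspace_locally (y : U ⟶ espaceEt F) (x : U.left) :
    ∃ (Z : X.Etale) (h : Z ⟶ U) (z : Z.left) (t : F.obj (op Z)), homLeft h z = x ∧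
      h ≫ y = toEspace F t := by
  obtain ⟨V, T, q, z, hT, hz, A, hA, s, hs⟩ := exists_isTriv_over_etOpen F (str U x)
  obtain ⟨w, hw, -⟩ := exists_fib_apply_eq (toTop U) (toTop T) x z hz.symm
  obtain ⟨Z, h, z', t, -, hz', e⟩ := hs.exists_toEspace_eq q (prdSnd U T) (prdFst U T ≫ y) w
  refine ⟨Z, h ≫ prdFst U T, z', t, ?_, (Category.assoc _ _ _).trans e⟩
  rw [homLeft_comp, Scheme.Hom.comp_apply, hz']
  exact hw

theorem exists_secMap_eq_locally {t t' : F.obj (op U)} (e : toEspace F t = toEspace F t')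
    (x : U.left) : ∃ (Z : X.Etale) (h : Z ⟶ U) (z : Z.left), homLeft h z = x ∧
      secMap F h t = secMap F h t' := by
  obtain ⟨V, T, q, z, hT, hz, A, hA, s, hs⟩ := exists_isTriv_over_etOpen F (str U x)
  obtain ⟨w, hw, -⟩ := exists_fib_apply_eq (toTop U) (toTop T) x z hz.symm
  have e' : toEspace F (secMap F (prdFst U T) t) = toEspace F (secMap F (prdFst U T) t') := by
    rw [toEspace_secMap, toEspace_secMap, e]
  obtain ⟨Z, h, z', -, hz', e''⟩ := hs.exists_secMap_eq_of_toEspace_eq q (prdSnd U T) e' w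
  refine ⟨Z, h ≫ prdFst U T, z', ?_, ?_⟩
  · rw [homLeft_comp, Scheme.Hom.comp_apply, hz']
    exact hw
  · rw [secMap_comp, e'', secMap_comp]

/-- Equality of morphisms of étale `X`-schemes is étale local. -/
theorem etale_hom_ext_of_locally {U Y : X.Etale} {a b : U ⟶ Y} (H : ∀ x : U.left,
    ∃ (Z : X.Etale) (h : Z ⟶ U) (z : Z.left), homLeft h z = x ∧ h ≫ a = h ≫ b) : a = b :=
  homLeft_injective (hom_ext_of_locally fun x ↦ by
    obtain ⟨Z, h, z, hz, e⟩ := H x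
    exact ⟨Z, h, z, hz, by rw [← homLeft_comp, e, homLeft_comp]⟩)

theorem espaceEt_hom_ext {Z : X.Etale} {a b : espaceEt F ⟶ Z}
    (h : ∀ (U : X.Etale) (t : F.obj (op U)), toEspace F t ≫ a = toEspace F t ≫ b) : a = b :=
  etale_hom_ext_of_locally fun x ↦ by
    obtain ⟨W, k, w, t, hw, e⟩ := exists_toEspace_locally (𝟙 (espaceEt F)) x
    rw [Category.comp_id] at e
    exact ⟨W, k, w, hw, by rw [e, h]⟩

/-- Schemes carrying a section of `F` cover the scheme of sections, and `η` prescribes the morphism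
on each of them. The prescriptions match, because two sections with the same image agree étale
locally. -/
theorem exists_espaceDesc {Z : X.Etale} (η : F ⟶ yoneda.obj Z) :
    ∃ φ : espaceEt F ⟶ Z, ∀ (U : X.Etale) (t : F.obj (op U)),
      toEspace F t ≫ φ = η.app (op U) t := by
  have hη {U V : X.Etale} (h : V ⟶ U) (t : F.obj (op U)) :
      η.app (op V) (secMap F h t) = h ≫ η.app (op U) t :=
    ConcreteCategory.congr_hom (η.naturality h.op) t
  obtain ⟨φ, hφ⟩ := exists_hom_of_locally (U := espaceEt F) (Y := Z.left)
    (fun W h c ↦ ∃ t : F.obj (op W), h = toEspace F t ∧ c = homLeft (η.app (op W) t))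
    (by
      rintro W W' _ _ k ⟨t, rfl, rfl⟩
      refine ⟨secMap F k t, (toEspace_secMap F t k).symm, ?_⟩
      rw [hη, homLeft_comp])
    (by
      rintro W _ _ _ ⟨t, rfl, rfl⟩ ⟨t', e, rfl⟩
      refine hom_ext_of_locally fun x ↦ ?_
      obtain ⟨W', k, w, hw, e'⟩ := exists_secMap_eq_locally e x
      exact ⟨W', k, w, hw, by rw [← homLeft_comp, ← homLeft_comp, ← hη, ← hη, e']⟩)
    (fun x ↦ by
      obtain ⟨W, k, w, t, hw, e⟩ := exists_toEspace_locally (𝟙 (espaceEt F)) x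
      rw [Category.comp_id] at e
      exact ⟨W, k, w, _, hw, t, e, rfl⟩)
  have hφ' (U : X.Etale) (t : F.obj (op U)) :
      homLeft (toEspace F t) ≫ φ = homLeft (η.app (op U) t) := hφ _ _ ⟨t, rfl, rfl⟩
  refine ⟨mkHom φ (hom_ext_of_locally fun x ↦ ?_), fun U t ↦ homLeft_injective (hφ' U t)⟩
  obtain ⟨W, k, w, t, hw, e⟩ := exists_toEspace_locally (𝟙 (espaceEt F)) x
  rw [Category.comp_id] at e
  refine ⟨W, k, w, hw, ?_⟩
  have := hφ' W t
  rw [e, ← Category.assoc, this]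
  exact (homLeft_str _).trans (homLeft_str _).symm

/-- The universal property of the scheme of sections. -/
noncomputable def espaceDesc {Z : X.Etale} (η : F ⟶ yoneda.obj Z) : espaceEt F ⟶ Z :=
  (exists_espaceDesc η).choose

theorem toEspace_espaceDesc {Z : X.Etale} (η : F ⟶ yoneda.obj Z) (t : F.obj (op U)) :
    toEspace F t ≫ espaceDesc η = η.app (op U) t :=
  (exists_espaceDesc η).choose_spec U t

instance : IsFinite (str (espaceEt F)) := inferInstanceAs (IsFinite (espaceStr F))

end TameSite

/-! ### Fibres of tame covers and finite limits -/

namespace TameSite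

variable {X S : Scheme.{u}} {f : X ⟶ S} {p : TamePoint f}

/-- A field extension is faithfully flat, so the map on spectra is an epimorphism of schemes. -/
theorem eq_of_SpecMap_comp_eq {k Ω : Type u} [Field k] [Field Ω] (i : k →+* Ω) {W : Scheme.{u}}
    {a b : Spec (.of k) ⟶ W}
    (h : Spec.map (CommRingCat.ofHom i) ≫ a = Spec.map (CommRingCat.ofHom i) ≫ b) : a = b := by
  have h₁ : Flat (Spec.map (CommRingCat.ofHom i)) := inferInstance
  have h₂ : Surjective (Spec.map (CommRingCat.ofHom i)) := inferInstance
  have := Flat.epi_of_flat_of_surjective (Spec.map (CommRingCat.ofHom i))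
  exact (cancel_epi _).1 h

/-- Field-valued points exist over any two points with the same image. -/
theorem exists_SpecField_hom {k : Type u} [Field k] {W Z : Scheme.{u}} (g : W ⟶ Z)
    (t : Spec (.of k) ⟶ Z) (w : W) (hw : g w = t default) :
    ∃ (Ω : Type u) (_ : Field Ω) (i : k →+* Ω) (y : Spec (.of Ω) ⟶ W),
      y default = w ∧ y ≫ g = Spec.map (CommRingCat.ofHom i) ≫ t := by
  obtain ⟨v, hv, -⟩ := Scheme.Pullback.exists_preimage_pullback (f := g) (g := t) w default hw
  let c := (pullback g t).fromSpecResidueField v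
  refine ⟨(pullback g t).residueField v, inferInstance, (Spec.preimage (c ≫ pullback.snd g t)).hom,
    c ≫ pullback.fst g t, ?_, ?_⟩
  · rw [← hv]
    have : c default ∈ Set.range c := ⟨_, rfl⟩
    rw [Scheme.range_fromSpecResidueField] at this
    exact congrArg _ this
  · rw [Category.assoc, pullback.condition, ← Category.assoc]
    exact congrArg (· ≫ t) (Spec.map_preimage _).symm

variable {Y : X.Etale}

theorem SplitAt.exists_liftPt_eq (h : SplitAt p Y) (w : ↥(pullback (str Y) p.pt)) :
    ∃ z : (lifts p.pt).obj Y, liftPt p.pt z default = w := by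
  obtain ⟨Ω, _, i, y, hy, e⟩ := exists_SpecField_hom (pullback.snd (str Y) p.pt) (𝟙 _) w
    (Subsingleton.elim _ _)
  rw [Category.comp_id] at e
  obtain ⟨z, hz⟩ := h Ω i (y ≫ pullback.fst _ _) (by
    rw [Category.assoc, pullback.condition, ← Category.assoc, e])
  have : Spec.map (CommRingCat.ofHom i) ≫ liftPt p.pt z = y := by
    refine pullback.hom_ext ?_ ?_
    · rw [Category.assoc, liftPt_fst, hz]
    · rw [Category.assoc, liftPt_snd, Category.comp_id, e]
  refine ⟨z, ?_⟩
  rw [← hy, ← this, Scheme.Hom.comp_apply]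
  exact congrArg _ (Subsingleton.elim _ _)

theorem SplitAt.exists_lift (h : SplitAt p Y) (y : Y.left) (hy : str Y y = p.pt default) :
    ∃ z : (lifts p.pt).obj Y, liftHom z default = y := by
  obtain ⟨w, hw, -⟩ := Scheme.Pullback.exists_preimage_pullback (f := str Y) (g := p.pt) y _ hy
  obtain ⟨z, rfl⟩ := h.exists_liftPt_eq w
  refine ⟨z, ?_⟩
  rw [← liftPt_fst, Scheme.Hom.comp_apply]
  exact hw

section FT

instance (Y : FT f) : IsFinite (str Y.obj) := (isFiniteTameCover_iff.1 Y.property).1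

theorem FT.splitAt (Y : FT f) (p : TamePoint f) : SplitAt p Y.obj :=
  (isFiniteTameCover_iff.1 Y.property).2 p

/-- Construct a finite tame cover. -/
def FT.mk' (Y : X.Etale) [h : IsFinite (str Y)] (hs : ∀ p : TamePoint f, SplitAt p Y) : FT f :=
  ⟨Y, isFiniteTameCover_iff.2 ⟨h, hs⟩⟩

theorem FT.surjective_str [ConnectedSpace X] (Y : FT f) [Nonempty Y.obj.left] :
    Function.Surjective (str Y.obj) := by
  have : IsClopen (Set.range (str Y.obj)) :=
    ⟨(str Y.obj).isClosedMap.isClosed_range, (str Y.obj).isOpenMap.isOpen_range⟩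
  exact Set.range_eq_univ.1 ((isClopen_iff.1 this).resolve_left (Set.range_nonempty _).ne_empty)

theorem FT.nonempty_lifts [ConnectedSpace X] (Y : FT f) [Nonempty Y.obj.left] (p : TamePoint f) :
    Nonempty ((lifts p.pt).obj Y.obj) := by
  obtain ⟨y, hy⟩ := Y.surjective_str (p.pt default)
  obtain ⟨z, -⟩ := (Y.splitAt p).exists_lift y hy
  exact ⟨z⟩

/-- A lift is a section of the fibre, so its image is an open and closed point and is a whole
component; distinct lifts thus give distinct components. Every point of the fibre comes from a lift
because tame covers are split by tame points. -/
theorem bijective_componentOfLift (p : TamePoint f) (Y : FT f) :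
    Function.Bijective (componentOfLift p Y) := by
  constructor
  · intro z z' h
    refine injective_liftPt p.pt ?_
    have h₁ : Etale (liftPt p.pt z) := by
      have : Etale (liftPt p.pt z ≫ pullback.snd (str Y.obj) p.pt) := by
        rw [liftPt_snd]; infer_instance
      exact Etale.of_comp _ (pullback.snd (str Y.obj) p.pt)
    have h₂ : IsClosedImmersion (liftPt p.pt z) := by
      have : IsClosedImmersion (liftPt p.pt z ≫ pullback.snd (str Y.obj) p.pt) := by
        rw [liftPt_snd]; infer_instance
      exact IsClosedImmersion.of_comp _ (pullback.snd (str Y.obj) p.pt)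
    have hc : IsClopen {liftPt p.pt z default} := by
      rw [← range_SpecField]
      exact ⟨(liftPt p.pt z).isClosedEmbedding.isClosed_range,
        (liftPt p.pt z).isOpenMap.isOpen_range⟩
    have h' : liftPt p.pt z' default ∈ connectedComponent (liftPt p.pt z default) :=
      ConnectedComponents.coe_eq_coe'.1 h.symm
    exact (hc.connectedComponent_subset rfl h').symm
  · intro c
    obtain ⟨w, rfl⟩ := ConnectedComponents.surjective_coe c
    obtain ⟨z, rfl⟩ := (Y.splitAt p).exists_liftPt_eq w
    exact ⟨z, rfl⟩

theorem componentOfLift_naturality (p : TamePoint f) {Y Z : FT f} (g : Y ⟶ Z)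
    (y : (lifts p.pt).obj Y.obj) :
    (fibreFunctor p).map g (componentOfLift p Y y) =
      componentOfLift p Z ((lifts p.pt).map g.hom y) := by
  have e : liftPt p.pt y ≫ fibreMap p.pt g = liftPt p.pt ((lifts p.pt).map g.hom y) := by
    refine pullback.hom_ext ?_ ?_
    · refine Eq.trans ?_ (liftPt_fst p.pt _).symm
      refine (Category.assoc _ _ _).trans ((congrArg _ (fibreMap_fst p.pt g)).trans ?_)
      refine (Category.assoc _ _ _).symm.trans ((congrArg (· ≫ _) (liftPt_fst p.pt y)).trans ?_)
      exact (liftHom_map g.hom y).symm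
    · refine Eq.trans ?_ (liftPt_snd p.pt _).symm
      refine (Category.assoc _ _ _).trans ((congrArg _ (fibreMap_snd p.pt g)).trans ?_)
      exact liftPt_snd p.pt y
  change (_root_.ConnectedComponents.mk (fibreMap p.pt g (liftPt p.pt y default)) :
    _root_.ConnectedComponents (fibreScheme p.pt Z)) = ConnectedComponents.mk (liftPt p.pt _ default)
  rw [← e]
  rfl

/-- The fibre functor in terms of lifts. -/
noncomputable def fibreFunctorIso (p : TamePoint f) :
    ObjectProperty.ι (IsFiniteTameCover f) ⋙ lifts p.pt ≅ fibreFunctor p ⋙ FintypeCat.incl :=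
  NatIso.ofComponents (fun Y ↦ (Equiv.ofBijective _ (bijective_componentOfLift p Y)).toIso)
    fun g ↦ by
      ext y
      exact (componentOfLift_naturality p g y).symm

end FT

section Limits

theorem IsFiniteTameCover.of_iso {Y Z : X.Etale} (e : Y ≅ Z) (h : IsFiniteTameCover f Y) :
    IsFiniteTameCover f Z := by
  obtain ⟨h₁, h₂⟩ := isFiniteTameCover_iff.1 h
  have he : homLeft e.inv ≫ homLeft e.hom = 𝟙 _ := by
    rw [← homLeft_comp, e.inv_hom_id, homLeft_id]
  have he' : homLeft e.hom ≫ homLeft e.inv = 𝟙 _ := by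
    rw [← homLeft_comp, e.hom_inv_id, homLeft_id]
  have : IsIso (homLeft e.inv) := ⟨_, he, he'⟩
  refine isFiniteTameCover_iff.2 ⟨?_, fun p Ω _ i y hy ↦ ?_⟩
  · rw [← homLeft_str e.inv]
    infer_instance
  · obtain ⟨z, hz⟩ := h₂ p Ω i (y ≫ homLeft e.inv) (by rw [Category.assoc, homLeft_str, hy])
    refine ⟨(lifts p.pt).map e.hom z, ?_⟩
    rw [liftHom_map, ← Category.assoc, hz, Category.assoc, he, Category.comp_id]

theorem isFiniteTameCover_topEtale : IsFiniteTameCover f (topEtale X) := by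
  have : IsFinite (str (topEtale X)) := inferInstanceAs (IsFinite (𝟙 X))
  refine isFiniteTameCover_iff.2 ⟨this, fun p Ω _ i y hy ↦
    ⟨mkLift (U := topEtale X) p.pt (Category.comp_id _), ?_⟩⟩
  exact hy.symm.trans (Category.comp_id _)

theorem SplitAt.fib {U V W : X.Etale} {g : V ⟶ U} {h : W ⟶ U} (hV : SplitAt p V)
    (hW : SplitAt p W) : SplitAt p (fib g h) := by
  intro Ω _ i y hy
  obtain ⟨z₁, h₁⟩ := hV Ω i (y ≫ homLeft (fibFst g h)) (by rw [Category.assoc, homLeft_str, hy])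
  obtain ⟨z₂, h₂⟩ := hW Ω i (y ≫ homLeft (fibSnd g h)) (by rw [Category.assoc, homLeft_str, hy])
  have hz : liftHom z₁ ≫ homLeft g = liftHom z₂ ≫ homLeft h := eq_of_SpecMap_comp_eq i (by
    rw [← Category.assoc, h₁, ← Category.assoc, h₂, Category.assoc, Category.assoc,
      (isPullback_fib g h).w])
  refine ⟨mkLift ((isPullback_fib g h).lift _ _ hz) ?_, ?_⟩
  · rw [← homLeft_str (fibFst g h), ← Category.assoc, (isPullback_fib g h).lift_fst, liftHom_str]
  · rw [liftHom_mkLift]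
    refine (isPullback_fib g h).hom_ext ?_ ?_
    · rw [Category.assoc, (isPullback_fib g h).lift_fst, h₁]
    · rw [Category.assoc, (isPullback_fib g h).lift_snd, h₂]

instance {U V W : X.Etale} (g : V ⟶ U) (h : W ⟶ U) [IsFinite (str U)] [IsFinite (str V)]
    [IsFinite (str W)] : IsFinite (str (fib g h)) := by
  have : IsFinite (homLeft h ≫ str U) := by rw [homLeft_str]; infer_instance
  have : IsFinite (homLeft h) := IsFinite.of_comp _ (str U)
  have : IsFinite (homLeft (fibFst g h)) :=
    MorphismProperty.of_isPullback (P := @IsFinite) (isPullback_fib g h).flip this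
  rw [← homLeft_str (fibFst g h)]
  infer_instance

theorem IsFiniteTameCover.fib {U V W : X.Etale} {g : V ⟶ U} {h : W ⟶ U}
    (hU : IsFiniteTameCover f U) (hV : IsFiniteTameCover f V) (hW : IsFiniteTameCover f W) :
    IsFiniteTameCover f (fib g h) := by
  have := (isFiniteTameCover_iff.1 hU).1
  have := (isFiniteTameCover_iff.1 hV).1
  have := (isFiniteTameCover_iff.1 hW).1
  exact isFiniteTameCover_iff.2 ⟨inferInstance, fun p ↦
    ((isFiniteTameCover_iff.1 hV).2 p).fib ((isFiniteTameCover_iff.1 hW).2 p)⟩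

instance :
    ObjectProperty.IsClosedUnderLimitsOfShape (IsFiniteTameCover f) (Discrete PEmpty.{1}) where
  limitsOfShape_le := by
    rintro Y ⟨h⟩
    let s : topEtale X ⟶ Y := h.isLimit.lift ⟨_, ⟨fun j ↦ j.as.elim, fun j ↦ j.as.elim⟩⟩
    refine isFiniteTameCover_topEtale.of_iso ⟨s, toTop Y, toTop_unique _ _, ?_⟩
    exact h.isLimit.hom_ext fun j ↦ j.as.elim

instance : ObjectProperty.IsClosedUnderLimitsOfShape (IsFiniteTameCover f) WalkingCospan where
  limitsOfShape_le := by
    rintro Y ⟨h⟩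
    have hp : IsPullback (h.π.app .left) (h.π.app .right) (h.diag.map WalkingCospan.Hom.inl)
      (h.diag.map WalkingCospan.Hom.inr) := IsPullback.of_isLimit_cone h.isLimit
    have hf := IsFiniteTameCover.fib (g := h.diag.map WalkingCospan.Hom.inl)
      (h := h.diag.map WalkingCospan.Hom.inr) (h.prop_diag_obj _) (h.prop_diag_obj _)
      (h.prop_diag_obj _)
    refine hf.of_iso ⟨hp.lift _ _ (fib_condition _ _), fibLift _ _ _ _ hp.w, ?_, ?_⟩
    · exact fib_hom_ext (by simp) (by simp)
    · exact hp.hom_ext (by simp) (by simp)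

instance : HasTerminal (FT f) := hasLimitsOfShape_of_closedUnderLimits _ _

instance : HasPullbacks (FT f) := hasLimitsOfShape_of_closedUnderLimits _ _

instance {K : Type u} [Field K] (x : Spec (.of K) ⟶ X) : PreservesFiniteLimits (lifts x) := by
  unfold lifts
  infer_instance

/-- With finiteness forgotten, the fibre functor becomes the functor of lifts, which is
corepresentable on schemes over `X`; and `FintypeCat.incl` reflects limits. -/
theorem preservesLimitsOfShape_fibreFunctor (p : TamePoint f) (J : Type) [SmallCategory J]
    [FinCategory J] [ObjectProperty.IsClosedUnderLimitsOfShape (IsFiniteTameCover f) J] :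
    PreservesLimitsOfShape J (fibreFunctor p) := by
  have : PreservesLimitsOfShape J (ObjectProperty.ι (IsFiniteTameCover f)) := inferInstance
  have : PreservesLimitsOfShape J (fibreFunctor p ⋙ FintypeCat.incl) :=
    preservesLimitsOfShape_of_natIso (fibreFunctorIso p)
  exact preservesLimitsOfShape_of_reflects_of_preserves _ FintypeCat.incl

end Limits

end TameSite

/-! ### Finite colimits of finite tame covers -/

namespace TameSite

variable {X S : Scheme.{u}} {f : X ⟶ S} {J : Type u} [SmallCategory J]

section Presheaf

variable (D : J ⥤ X.Etale)

/-- The presheaf colimit of a diagram of étale `X`-schemes. -/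
noncomputable def colimPsh : X.Etaleᵒᵖ ⥤ Type u := colimit (D ⋙ yoneda)

/-- The section of the colimit defined by a morphism to an object of the diagram. -/
noncomputable def cls {U : X.Etale} (j : J) (d : U ⟶ D.obj j) : (colimPsh D).obj (op U) :=
  (colimit.ι (D ⋙ yoneda) j).app (op U) d

variable {D} {U V : X.Etale}

theorem secMap_cls (h : V ⟶ U) {j : J} (d : U ⟶ D.obj j) :
    secMap (colimPsh D) h (cls D j d) = cls D j (h ≫ d) :=
  (ConcreteCategory.congr_hom ((colimit.ι (D ⋙ yoneda) j).naturality h.op) d).symm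

theorem cls_comp {j k : J} (φ : j ⟶ k) (d : U ⟶ D.obj j) : cls D k (d ≫ D.map φ) = cls D j d :=
  ConcreteCategory.congr_hom (NatTrans.congr_app (colimit.w (D ⋙ yoneda) φ) (op U)) d

theorem exists_cls_eq (t : (colimPsh D).obj (op U)) : ∃ j d, cls D j d = t :=
  Types.jointly_surjective _ (isColimitOfPreserves ((evaluation _ _).obj (op U))
    (colimit.isColimit (D ⋙ yoneda))) t

theorem exists_cls_desc {A : Type u} (φ : ∀ j, (U ⟶ D.obj j) → A)
    (hφ : ∀ {j k} (g : j ⟶ k) (d : U ⟶ D.obj j), φ k (d ≫ D.map g) = φ j d) :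
    ∃ Φ : (colimPsh D).obj (op U) → A, ∀ j d, Φ (cls D j d) = φ j d := by
  let c : Cocone ((D ⋙ yoneda) ⋙ (evaluation _ _).obj (op U)) :=
    ⟨A, { app := fun j ↦ ↾(φ j)
          naturality := fun j k g ↦ by ext d; exact hφ g d }⟩
  have hc := isColimitOfPreserves ((evaluation _ _).obj (op U)) (colimit.isColimit (D ⋙ yoneda))
  exact ⟨hc.desc c, fun j d ↦ ConcreteCategory.congr_hom (hc.fac c j) d⟩

end Presheaf

section Trivial

variable [FinCategory J] (D : J ⥤ X.Etale) [∀ j, IsFinite (str (D.obj j))]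

instance {K : Type u} [Field K] (x : Spec (.of K) ⟶ X) (j : J) :
    Finite ((D ⋙ lifts x).obj j) :=
  inferInstanceAs (Finite ((lifts x).obj (D.obj j)))

instance finite_colimit_lifts {K : Type u} [Field K] (x : Spec (.of K) ⟶ X) :
    Finite (colimit (D ⋙ lifts x) : Type u) :=
  Finite.of_surjective (fun a : Σ j, (D ⋙ lifts x).obj j ↦
    colimit.ι (D ⋙ lifts x) a.1 a.2) fun a ↦ by
    obtain ⟨j, b, rfl⟩ := Types.jointly_surjective' a
    exact ⟨⟨j, b⟩, rfl⟩

/-- Compatible sections through all the points of a finite diagram over a geometric point. -/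
theorem exists_compatible_sections {K : Type u} [Field K] (x : Spec (.of K) ⟶ X) :
    ∃ (T : X.Etale) (z : (lifts x).obj T) (s : ∀ j, (lifts x).obj (D.obj j) → (T ⟶ D.obj j)),
      (∀ j a, (lifts x).map (s j a) z = a) ∧
      ∀ {j k} (g : j ⟶ k) (a), s j a ≫ D.map g = s k ((lifts x).map (D.map g) a) := by
  have : Finite (D ⋙ lifts x).Elements := inferInstanceAs (Finite (Σ j, (D ⋙ lifts x).obj j))
  have (a b : (D ⋙ lifts x).Elements) : Finite (a ⟶ b) := Subtype.finite
  have : FinCategory (D ⋙ lifts x).Elements :=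
    { fintypeObj := Fintype.ofFinite _, fintypeHom := fun _ _ ↦ Fintype.ofFinite _ }
  -- The finite category of all points of the diagram over `x` maps to the cofiltered category of
  -- étale neighbourhoods. A cone over it is one neighbourhood with compatible sections through all
  -- these points.
  obtain ⟨c⟩ := IsCofiltered.cone_nonempty (Functor.Elements.precomp D (lifts x))
  refine ⟨c.pt.1, c.pt.2, fun j a ↦ (c.π.app ⟨j, a⟩).val, fun j a ↦ (c.π.app ⟨j, a⟩).2,
    fun {j k} g a ↦ ?_⟩
  let m : (D ⋙ lifts x).elementsMk j a ⟶ (D ⋙ lifts x).elementsMk k ((lifts x).map (D.map g) a) :=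
    ⟨g, rfl⟩
  exact congrArg Subtype.val (c.w m)

/-- The value set is the colimit of the fibres. To separate two of its elements over a nonempty `U`,
fix a point `y` of `U`: sending a morphism `U ⟶ D.obj j` to the index of the section it meets at `y`
respects the diagram, so it defines a map `Φ` on the sections of the colimit over `U`. -/
theorem exists_isTriv_colimPsh {T : X.Etale} {K : Type u} [Field K] (x : Spec (.of K) ⟶ X)
    (s : ∀ j, (lifts x).obj (D.obj j) → (T ⟶ D.obj j))
    (hs : ∀ j, IsTriv (yoneda.obj (D.obj j)) (s j))
    (hs' : ∀ {j k} (g : j ⟶ k) (a), s j a ≫ D.map g = s k ((lifts x).map (D.map g) a)) :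
    ∃ s' : (colimit (D ⋙ lifts x) : Type u) → (colimPsh D).obj (op T), IsTriv (colimPsh D) s' := by
  let c : Cocone (D ⋙ lifts x) :=
    ⟨(colimPsh D).obj (op T), { app := fun j ↦ ↾(fun a ↦ cls D j (s j a))
                                naturality := fun j k g ↦ by
                                  ext a
                                  exact (congrArg (cls D k) (hs' g a).symm).trans (cls_comp g _) }⟩
  have hc (j) (a) : colimit.desc _ c (colimit.ι (D ⋙ lifts x) j a) = cls D j (s j a) :=
    ConcreteCategory.congr_hom (colimit.ι_desc c j) a
  refine ⟨colimit.desc _ c, ⟨fun U g t y ↦ ?_, fun U g hU α α' e ↦ ?_⟩⟩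
  · obtain ⟨j, d, rfl⟩ := exists_cls_eq t
    obtain ⟨Z, h, z, a, ho, hz, e⟩ := (hs j).exists_map_eq U g d y
    refine ⟨Z, h, z, colimit.ι (D ⋙ lifts x) j a, ho, hz, ?_⟩
    rw [hc, secMap_cls, secMap_cls]
    exact congrArg (cls D j) e
  · obtain ⟨y⟩ := hU
    choose a ha using fun j (d : U ⟶ D.obj j) ↦ (hs j).exists_mem_eqLocus g d y
    obtain ⟨Φ, hΦ⟩ := exists_cls_desc (D := D) (U := U)
      (fun j d ↦ colimit.ι (D ⋙ lifts x) j (a j d)) (fun {j k} φ d ↦ by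
        have h₁ := ha k (d ≫ D.map φ)
        have h₂ : y ∈ eqLocus (d ≫ D.map φ) ((g ≫ s j (a j d)) ≫ D.map φ) := by
          have := ha j d
          rw [mem_eqLocus_iff] at this ⊢
          rw [homLeft_comp, homLeft_comp, ← Category.assoc, this, Category.assoc]
        rw [Category.assoc, hs'] at h₂
        rw [eqLocus_comm] at h₂
        rw [← (hs k).eq_of_mem_eqLocus (mem_eqLocus_trans h₂ h₁)]
        exact ConcreteCategory.congr_hom (colimit.w (D ⋙ lifts x) φ) (a j d))
    have key (α) : Φ (secMap (colimPsh D) g (colimit.desc _ c α)) = α := by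
      obtain ⟨j, b, rfl⟩ := Types.jointly_surjective' α
      rw [hc, secMap_cls, hΦ]
      exact congrArg _ ((hs j).eq_of_mem_eqLocus (ha j (g ≫ s j b))).symm
    rw [← key α, e, key]

instance isLocallyTrivial_colimPsh : IsLocallyTrivial (colimPsh D) where
  exists_isTriv x := by
    let K := SeparableClosure (X.residueField x)
    let t : Spec (.of K) ⟶ X :=
      Spec.map (CommRingCat.ofHom (algebraMap (X.residueField x) K)) ≫ X.fromSpecResidueField x
    have ht : t default = x := by
      have : t default ∈ Set.range (X.fromSpecResidueField x) :=
        ⟨Spec.map (CommRingCat.ofHom (algebraMap (X.residueField x) K)) default,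
          (Scheme.Hom.comp_apply _ _ _).symm⟩
      rwa [Scheme.range_fromSpecResidueField] at this
    obtain ⟨T, z, s, hs, hs'⟩ := exists_compatible_sections D t
    choose O hO hO' using fun j ↦ exists_isTriv_shrink t z (s j) (hs j)
    let O' : T.left.Opens := ⟨⋂ j, (O j : Set T.left), isOpen_iInter_of_finite fun j ↦ (O j).isOpen⟩
    have hzO : liftHom z default ∈ O' := Set.mem_iInter.2 hO
    obtain ⟨z', hz'⟩ := exists_openIncl_eq hzO
    obtain ⟨s', h⟩ := exists_isTriv_colimPsh (T := openEtale O') D t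
      (fun j a ↦ openIncl O' ≫ s j a) (fun j ↦ hO' j _ _ (by
        rintro _ ⟨y, rfl⟩
        exact Set.mem_iInter.1 y.2 j)) (fun g a ↦ by rw [Category.assoc, hs'])
    refine ⟨_, z', ?_, _, inferInstance, s', h⟩
    rw [← homLeft_str (openIncl O'), Scheme.Hom.comp_apply, hz', ← Scheme.Hom.comp_apply,
      liftHom_str, ht]

end Trivial

section Colimit

variable [FinCategory J] (D : J ⥤ X.Etale) [∀ j, IsFinite (str (D.obj j))]

/-- The coprojections to the scheme representing the colimit. -/
noncomputable def colimIncl (j : J) : D.obj j ⟶ espaceEt (colimPsh D) :=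
  toEspace (colimPsh D) (cls D j (𝟙 _))

theorem toEspace_cls {U : X.Etale} (j : J) (d : U ⟶ D.obj j) :
    toEspace (colimPsh D) (cls D j d) = d ≫ colimIncl D j := by
  unfold colimIncl
  rw [← toEspace_secMap, secMap_cls, Category.comp_id]

theorem map_colimIncl {j k : J} (φ : j ⟶ k) : D.map φ ≫ colimIncl D k = colimIncl D j := by
  rw [← toEspace_cls, ← Category.id_comp (D.map φ), cls_comp]
  rfl

/-- Étale locally the colimit is covered by the objects of the diagram. After enlarging the field,
the point lifts to some `D.obj j`, where `SplitAt` makes it rational over the field of `p`. -/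
theorem exists_lift_colimIncl {p : TamePoint f} (hD : ∀ j, SplitAt p (D.obj j)) {Ω : Type u}
    [Field Ω] (i : p.field →+* Ω) (y : Spec (.of Ω) ⟶ (espaceEt (colimPsh D)).left)
    (hy : y ≫ str _ = Spec.map (CommRingCat.ofHom i) ≫ p.pt) :
    ∃ (j : J) (w : (lifts p.pt).obj (D.obj j)),
      Spec.map (CommRingCat.ofHom i) ≫ liftHom ((lifts p.pt).map (colimIncl D j) w) = y := by
  obtain ⟨Z, h, z, t, hz, e⟩ := exists_toEspace_locally (𝟙 (espaceEt (colimPsh D))) (y default)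
  obtain ⟨j, d, rfl⟩ := exists_cls_eq t
  rw [Category.comp_id, toEspace_cls] at e
  obtain ⟨Ω', _, i', y', -, e'⟩ := exists_SpecField_hom (homLeft h) y z hz
  obtain ⟨w, hw⟩ := hD j Ω' (i'.comp i) (y' ≫ homLeft d) (by
    rw [Category.assoc, homLeft_str, ← homLeft_str h, ← Category.assoc, e', Category.assoc, hy,
      CommRingCat.ofHom_comp, Spec.map_comp, Category.assoc])
  refine ⟨j, w, eq_of_SpecMap_comp_eq i' ?_⟩
  rw [liftHom_map, ← e', e, homLeft_comp, ← Category.assoc y', ← hw, CommRingCat.ofHom_comp,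
    Spec.map_comp]
  simp only [Category.assoc]

theorem isFiniteTameCover_colimit (hD : ∀ j, IsFiniteTameCover f (D.obj j)) :
    IsFiniteTameCover f (espaceEt (colimPsh D)) :=
  isFiniteTameCover_iff.2 ⟨inferInstance, fun p Ω _ i y hy ↦ by
    obtain ⟨j, w, e⟩ := exists_lift_colimIncl D
      (fun j ↦ (isFiniteTameCover_iff.1 (hD j)).2 p) i y hy
    exact ⟨_, e⟩⟩

/-- The two projections of the fibre product of `D.obj j` and `D.obj k` define the same class in the
colimit presheaf on some étale neighbourhood `Z` of the point `(w, w')`. Evaluating at a point of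
`Z` over `p` gives a map `Φ` from such classes to the colimit of the fibres, taking the two
projections to the classes of `w` and `w'`. -/
theorem colimit_ι_lifts_eq {p : TamePoint f} (hD : ∀ j, SplitAt p (D.obj j)) {j k : J}
    {w : (lifts p.pt).obj (D.obj j)} {w' : (lifts p.pt).obj (D.obj k)}
    (h : (lifts p.pt).map (colimIncl D j) w = (lifts p.pt).map (colimIncl D k) w') :
    colimit.ι (D ⋙ lifts p.pt) j w = colimit.ι (D ⋙ lifts p.pt) k w' := by
  let E := fib (colimIncl D j) (colimIncl D k)
  have hw : liftHom w ≫ homLeft (colimIncl D j) = liftHom w' ≫ homLeft (colimIncl D k) := by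
    rw [← liftHom_map, h, liftHom_map]
  let e := (isPullback_fib (colimIncl D j) (colimIncl D k)).lift _ _ hw
  have he₁ : e ≫ homLeft (fibFst _ _) = liftHom w := IsPullback.lift_fst ..
  have he₂ : e ≫ homLeft (fibSnd _ _) = liftHom w' := IsPullback.lift_snd ..
  have hE : toEspace (colimPsh D) (cls D j (fibFst (colimIncl D j) (colimIncl D k))) =
      toEspace (colimPsh D) (cls D k (fibSnd (colimIncl D j) (colimIncl D k))) := by
    rw [toEspace_cls, toEspace_cls, fib_condition]
  obtain ⟨Z, g, z, hz, e'⟩ := exists_secMap_eq_locally hE (e default)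
  rw [secMap_cls, secMap_cls] at e'
  obtain ⟨Ω, _, i, y, -, hy⟩ := exists_SpecField_hom (homLeft g) e z hz
  have hyZ : y ≫ str Z = Spec.map (CommRingCat.ofHom i) ≫ p.pt := by
    rw [← homLeft_str g, ← Category.assoc, hy, ← homLeft_str (fibFst _ _), Category.assoc,
      ← Category.assoc e, he₁, liftHom_str]
  choose v hv using fun l (d : Z ⟶ D.obj l) ↦ hD l Ω i (y ≫ homLeft d) (by
    rw [Category.assoc, homLeft_str, hyZ])
  obtain ⟨Φ, hΦ⟩ := exists_cls_desc (D := D) (U := Z)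
    (fun l d ↦ colimit.ι (D ⋙ lifts p.pt) l (v l d)) (fun {l m} φ d ↦ by
      have : v m (d ≫ D.map φ) = (lifts p.pt).map (D.map φ) (v l d) := by
        refine liftHom_injective (eq_of_SpecMap_comp_eq i ?_)
        rw [hv, liftHom_map, ← Category.assoc, hv, homLeft_comp, Category.assoc]
      rw [this]
      exact ConcreteCategory.congr_hom (colimit.w (D ⋙ lifts p.pt) φ) (v l d))
  have h₁ : v j (g ≫ fibFst _ _) = w := by
    refine liftHom_injective (eq_of_SpecMap_comp_eq i ?_)
    rw [hv, homLeft_comp, ← Category.assoc, hy, Category.assoc, he₁]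
  have h₂ : v k (g ≫ fibSnd _ _) = w' := by
    refine liftHom_injective (eq_of_SpecMap_comp_eq i ?_)
    rw [hv, homLeft_comp, ← Category.assoc, hy, Category.assoc, he₂]
  rw [← h₁, ← h₂, ← hΦ, ← hΦ, e']

end Colimit

end TameSite

namespace TameSite

variable {X S : Scheme.{u}} {f : X ⟶ S} {J : Type u} [SmallCategory J] [FinCategory J]

section Colimit

section Etale

variable (D : J ⥤ X.Etale) [∀ j, IsFinite (str (D.obj j))]

theorem colimIncl_hom_ext {Z : X.Etale} {a b : espaceEt (colimPsh D) ⟶ Z}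
    (h : ∀ j, colimIncl D j ≫ a = colimIncl D j ≫ b) : a = b :=
  espaceEt_hom_ext fun U t ↦ by
    obtain ⟨j, d, rfl⟩ := exists_cls_eq t
    rw [toEspace_cls, Category.assoc, h, Category.assoc]

theorem exists_colimDesc (s : Cocone D) : ∃ φ : espaceEt (colimPsh D) ⟶ s.pt,
    ∀ j, colimIncl D j ≫ φ = s.ι.app j := by
  refine ⟨espaceDesc (colimit.desc (D ⋙ yoneda) (yoneda.mapCocone s)), fun j ↦ ?_⟩
  refine (toEspace_espaceDesc _ _).trans ?_
  have h := colimit.ι_desc (yoneda.mapCocone s) j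
  have h' : (colimit.desc (D ⋙ yoneda) (yoneda.mapCocone s)).app (op (D.obj j))
      ((colimit.ι (D ⋙ yoneda) j).app (op (D.obj j)) (𝟙 _)) =
        (yoneda.map (s.ι.app j)).app (op (D.obj j)) (𝟙 _) :=
    ConcreteCategory.congr_hom (NatTrans.congr_app h (op (D.obj j))) (𝟙 (D.obj j))
  exact h'.trans (Category.id_comp (s.ι.app j))

end Etale

variable (D : J ⥤ FT f)

instance (j : J) : IsFinite (str ((D ⋙ ObjectProperty.ι (IsFiniteTameCover f)).obj j)) :=
  inferInstanceAs (IsFinite (str (D.obj j).obj))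

/-- The colimit cocone of a finite diagram of finite tame covers. -/
noncomputable def colimCocone : Cocone D where
  pt := ⟨espaceEt (colimPsh (D ⋙ ObjectProperty.ι _)),
    isFiniteTameCover_colimit _ fun j ↦ (D.obj j).property⟩
  ι := { app := fun j ↦ ObjectProperty.homMk (colimIncl (D ⋙ ObjectProperty.ι _) j)
         naturality := fun j k φ ↦ by
          ext
          exact (map_colimIncl (D ⋙ ObjectProperty.ι _) φ).trans (Category.comp_id _).symm }

/-- The colimit cocone is a colimit cocone. -/
noncomputable def isColimitColimCocone : IsColimit (colimCocone D) where
  desc s := ObjectProperty.homMk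
    (exists_colimDesc _ ((ObjectProperty.ι (IsFiniteTameCover f)).mapCocone s)).choose
  fac s j := by
    ext
    exact (exists_colimDesc _
      ((ObjectProperty.ι (IsFiniteTameCover f)).mapCocone s)).choose_spec j
  uniq s m hm := by
    ext
    refine colimIncl_hom_ext (D ⋙ ObjectProperty.ι (IsFiniteTameCover f)) fun j ↦ ?_
    exact (congrArg (fun g ↦ g.hom) (hm j)).trans ((exists_colimDesc _
      ((ObjectProperty.ι (IsFiniteTameCover f)).mapCocone s)).choose_spec j).symm

instance : HasColimitsOfShape J (FT f) := ⟨fun D ↦ ⟨⟨_, isColimitColimCocone D⟩⟩⟩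

theorem isColimit_of_bijective_desc {K : J ⥤ Type u} (c : Cocone K)
    (h : Function.Bijective (colimit.desc K c)) : Nonempty (IsColimit c) := by
  have : IsIso ((colimit.isColimit K).desc c) := (isIso_iff_bijective _).2 h
  exact ⟨IsColimit.ofPointIso (colimit.isColimit K)⟩

theorem preservesColimit_lifts (p : TamePoint f) :
    PreservesColimit D (ObjectProperty.ι (IsFiniteTameCover f) ⋙ lifts p.pt) := by
  refine preservesColimit_of_preserves_colimit_cocone (isColimitColimCocone D)
    (isColimit_of_bijective_desc _ ⟨?_, fun z ↦ ?_⟩).some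
  · intro α β h
    obtain ⟨j, w, rfl⟩ := Types.jointly_surjective' α
    obtain ⟨k, w', rfl⟩ := Types.jointly_surjective' β
    have h₁ := ConcreteCategory.congr_hom (colimit.ι_desc (((ObjectProperty.ι
      (IsFiniteTameCover f) ⋙ lifts p.pt).mapCocone (colimCocone D))) j) w
    have h₂ := ConcreteCategory.congr_hom (colimit.ι_desc (((ObjectProperty.ι
      (IsFiniteTameCover f) ⋙ lifts p.pt).mapCocone (colimCocone D))) k) w'
    exact colimit_ι_lifts_eq (D ⋙ ObjectProperty.ι _) (fun j ↦ (D.obj j).splitAt p)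
      (h₁.symm.trans (h.trans h₂))
  · obtain ⟨j, w, e⟩ := exists_lift_colimIncl (D ⋙ ObjectProperty.ι _)
      (fun j ↦ (D.obj j).splitAt p) (RingHom.id _) (liftHom z) (by
        refine (liftHom_str z).trans ?_
        exact ((congrArg (· ≫ p.pt) (Spec.map_id _)).trans (Category.id_comp _)).symm)
    refine ⟨colimit.ι (D ⋙ ObjectProperty.ι _ ⋙ lifts p.pt) j w, ?_⟩
    have h₁ := ConcreteCategory.congr_hom (colimit.ι_desc (((ObjectProperty.ι
      (IsFiniteTameCover f) ⋙ lifts p.pt).mapCocone (colimCocone D))) j) w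
    refine h₁.trans (liftHom_injective ?_)
    exact ((congrArg (· ≫ _) (Spec.map_id _)).trans (Category.id_comp _)).symm.trans e

instance (p : TamePoint f) : PreservesColimitsOfShape J (fibreFunctor p) where
  preservesColimit {D} := by
    have := preservesColimit_lifts D p
    have : PreservesColimit D (fibreFunctor p ⋙ FintypeCat.incl) :=
      preservesColimit_of_natIso _ (fibreFunctorIso p)
    exact preservesColimit_of_reflects_of_preserves _ FintypeCat.incl

end Colimit

section Shapes

/-- The colimits were built for index categories in the universe of `X`. The shapes in the Galois
axioms are moved there by `AsSmall`. -/
theorem hasColimitsOfShape_FT {J' : Type*} [Category* J'] (e : J ≌ J') :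
    HasColimitsOfShape J' (FT f) := hasColimitsOfShape_of_equivalence e

instance {C : Type*} [Category* C] [Finite C] : Finite (AsSmall.{u} C) :=
  inferInstanceAs (Finite (ULift C))

instance {C : Type*} [Category* C] [h : ∀ a b : C, Finite (a ⟶ b)] (a b : AsSmall.{u} C) :
    Finite (a ⟶ b) :=
  inferInstanceAs (Finite (ULift (AsSmall.down.obj a ⟶ AsSmall.down.obj b)))

noncomputable instance (G : Type u) [Group G] [Finite G] :
    FinCategory (AsSmall.{u} (SingleObj G)) :=
  have (a b : SingleObj G) : Finite (a ⟶ b) := inferInstanceAs (Finite G)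
  have : Finite (SingleObj G) := inferInstanceAs (Finite Unit)
  { fintypeObj := Fintype.ofFinite _, fintypeHom := fun _ _ ↦ Fintype.ofFinite _ }

noncomputable instance (C : Type) [SmallCategory C] [FinCategory C] :
    FinCategory (AsSmall.{u} C) :=
  { fintypeObj := Fintype.ofFinite _, fintypeHom := fun _ _ ↦ Fintype.ofFinite _ }

instance (C : Type) [SmallCategory C] [FinCategory C] : HasColimitsOfShape C (FT f) :=
  hasColimitsOfShape_FT (AsSmall.equiv : C ≌ AsSmall.{u} C).symm

instance hasColimitsOfShape_singleObj (G : Type u) [Group G] [Finite G] :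
    HasColimitsOfShape (SingleObj G) (FT f) :=
  hasColimitsOfShape_FT (AsSmall.equiv : SingleObj G ≌ AsSmall.{u} (SingleObj G)).symm

instance (p : TamePoint f) (C : Type) [SmallCategory C] [FinCategory C] :
    PreservesColimitsOfShape C (fibreFunctor p) :=
  preservesColimitsOfShape_of_equiv (AsSmall.equiv : C ≌ AsSmall.{u} C).symm _

instance preservesColimitsOfShape_singleObj (p : TamePoint f) (G : Type u) [Group G] [Finite G] :
    PreservesColimitsOfShape (SingleObj G) (fibreFunctor p) :=
  preservesColimitsOfShape_of_equiv (AsSmall.equiv : SingleObj G ≌ AsSmall.{u} (SingleObj G)).symm _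

instance : HasFiniteCoproducts (FT f) := ⟨fun _ ↦ inferInstance⟩

instance (p : TamePoint f) : PreservesFiniteCoproducts (fibreFunctor p) := ⟨fun _ ↦ inferInstance⟩

instance (p : TamePoint f) : (fibreFunctor p).PreservesEpimorphisms := inferInstance

end Shapes

end TameSite

/-! ### The Galois category axioms -/

namespace TameSite

variable {X S : Scheme.{u}} {f : X ⟶ S}

section Clopen

instance isFinite_openEtale {Y : X.Etale} [IsFinite (str Y)] {O : Y.left.Opens}
    [hO : Fact (IsClosed (O : Set Y.left))] : IsFinite (str (openEtale O)) := by
  have : IsClosedImmersion O.ι := IsClosedImmersion.of_isPreimmersion _ (by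
    rw [Scheme.Opens.range_ι]
    exact hO.out)
  exact inferInstanceAs (IsFinite (O.ι ≫ str Y))

theorem SplitAt.openEtale {p : TamePoint f} {Y : X.Etale} (h : SplitAt p Y) (O : Y.left.Opens) :
    SplitAt p (openEtale O) := by
  intro Ω _ i y hy
  obtain ⟨z, hz⟩ := h Ω i (y ≫ homLeft (openIncl O)) (by rw [Category.assoc, homLeft_str, hy])
  have hr : Set.range (liftHom z) ⊆ Set.range (homLeft (openIncl O)) := by
    rw [range_SpecField, Set.singleton_subset_iff,
      Subsingleton.elim default (Spec.map (CommRingCat.ofHom i) default), ← Scheme.Hom.comp_apply,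
      hz, Scheme.Hom.comp_apply]
    exact ⟨_, rfl⟩
  have e := IsOpenImmersion.lift_fac (homLeft (openIncl O)) (liftHom z) hr
  refine ⟨mkLift (IsOpenImmersion.lift (homLeft (openIncl O)) (liftHom z) hr) ?_, ?_⟩
  · rw [← homLeft_str (openIncl O), ← Category.assoc, e, liftHom_str]
  · rw [liftHom_mkLift, ← cancel_mono (homLeft (openIncl O)), Category.assoc, e, hz]

/-- A clopen subscheme of a finite tame cover. -/
noncomputable def FT.clopen (Y : FT f) {O : Set Y.obj.left} (hO : IsClopen O) : FT f :=
  have : Fact (IsClosed ((⟨O, hO.isOpen⟩ : Y.obj.left.Opens) : Set Y.obj.left)) := ⟨hO.isClosed⟩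
  FT.mk' (openEtale (U := Y.obj) ⟨O, hO.isOpen⟩) fun p ↦ (Y.splitAt p).openEtale _

/-- The inclusion of a clopen subscheme. -/
noncomputable def FT.clopenIncl (Y : FT f) {O : Set Y.obj.left} (hO : IsClopen O) :
    (Y.clopen hO).obj ⟶ Y.obj := openIncl (U := Y.obj) ⟨O, hO.isOpen⟩

instance (Y : FT f) {O : Set Y.obj.left} (hO : IsClopen O) :
    IsOpenImmersion (homLeft (Y.clopenIncl hO)) :=
  inferInstanceAs (IsOpenImmersion (homLeft (openIncl (U := Y.obj) ⟨O, hO.isOpen⟩)))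

theorem FT.range_clopenIncl (Y : FT f) {O : Set Y.obj.left} (hO : IsClopen O) :
    Set.range (homLeft (Y.clopenIncl hO)) = O :=
  Scheme.Opens.range_ι (X := Y.obj.left) ⟨O, hO.isOpen⟩

variable [ConnectedSpace X]

/-- Clopen subsets of finite tame covers are detected by the lifts of a tame point. -/
theorem FT.exists_lift_mem (Y : FT f) (p : TamePoint f) {O : Set Y.obj.left} (hO : IsClopen O)
    (hne : O.Nonempty) : ∃ z : (lifts p.pt).obj Y.obj, liftHom z default ∈ O := by
  have : Nonempty (Y.clopen hO).obj.left := by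
    obtain ⟨y, hy⟩ := hne
    rw [← Y.range_clopenIncl hO] at hy
    exact ⟨hy.choose⟩
  obtain ⟨z⟩ := (Y.clopen hO).nonempty_lifts p
  refine ⟨(lifts p.pt).map (Y.clopenIncl hO) z, ?_⟩
  rw [liftHom_map]
  refine (Y.range_clopenIncl hO).le ⟨liftHom z default, ?_⟩
  rw [Scheme.Hom.comp_apply]

theorem FT.eq_univ_of_lifts (Y : FT f) (p : TamePoint f) {O : Set Y.obj.left} (hO : IsClopen O)
    (h : ∀ z : (lifts p.pt).obj Y.obj, liftHom z default ∈ O) : O = Set.univ := by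
  by_contra hne
  obtain ⟨z, hz⟩ := Y.exists_lift_mem p hO.compl (Set.nonempty_compl.2 hne)
  exact hz (h z)

/-- Morphisms from a finite tame cover are determined by their effect on the lifts of a tame
point. -/
theorem FT.hom_ext_of_lifts (Y : FT f) (p : TamePoint f) {Z : X.Etale} [IsFinite (str Z)]
    {a b : Y.obj ⟶ Z} (h : ∀ z, (lifts p.pt).map a z = (lifts p.pt).map b z) : a = b := by
  have := Y.eq_univ_of_lifts p (isClopen_eqLocus a b) fun z ↦ by
    rw [default_mem_eqLocus_iff, ← liftHom_map, h, liftHom_map]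
  rw [← Category.id_comp a, ← Category.id_comp b, comp_eq_iff, this]
  exact Set.subset_univ _

end Clopen

section Mono

variable {Y Z : X.Etale}

theorem mono_homLeft_of_fib_eq {g : Y ⟶ Z} (h : fibFst g g = fibSnd g g) : Mono (homLeft g) where
  right_cancellation a b e := by
    exact ((isPullback_fib g g).lift_fst a b e).symm.trans
      ((congrArg (fun k ↦ (isPullback_fib g g).lift a b e ≫ homLeft k) h).trans
        ((isPullback_fib g g).lift_snd a b e))

instance (Y Z : FT f) (g : Y.obj ⟶ Z.obj) : IsFinite (homLeft g) := by
  have : IsFinite (homLeft g ≫ str Z.obj) := by rw [homLeft_str]; infer_instance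
  exact IsFinite.of_comp _ (str Z.obj)

theorem isClopen_range_homLeft (Y Z : FT f) (g : Y.obj ⟶ Z.obj) :
    IsClopen (Set.range (homLeft g)) :=
  ⟨(homLeft g).isClosedMap.isClosed_range, (homLeft g).isOpenMap.isOpen_range⟩

/-- The fibre product of finite tame covers. -/
noncomputable def FT.fib {U V W : FT f} (g : V.obj ⟶ U.obj) (h : W.obj ⟶ U.obj) : FT f :=
  ⟨TameSite.fib g h, U.property.fib V.property W.property⟩

theorem isIso_of_homLeft {g : Y ⟶ Z} (h : IsIso (homLeft g)) : IsIso g := by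
  let k : Z ⟶ Y := mkHom (inv (homLeft g)) (by rw [IsIso.inv_comp_eq, homLeft_str])
  exact ⟨k, homLeft_injective (IsIso.hom_inv_id (homLeft g)),
    homLeft_injective (IsIso.inv_hom_id (homLeft g))⟩

theorem map_lifts_fib {K : Type u} [Field K] {x : Spec (.of K) ⟶ X} {U V W : X.Etale} (g : V ⟶ U)
    (h : W ⟶ U) (z : (lifts x).obj (TameSite.fib g h)) :
    (lifts x).map g ((lifts x).map (fibFst g h) z) =
      (lifts x).map h ((lifts x).map (fibSnd g h) z) :=
  liftHom_injective (by
    rw [liftHom_map, liftHom_map, liftHom_map, liftHom_map, Category.assoc, Category.assoc,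
      (isPullback_fib g h).w])

variable [ConnectedSpace X]

/-- Injectivity on lifts makes the two projections of the self fibre product equal, so `g` is a
monomorphism. Surjectivity on lifts makes its clopen image everything. A surjective étale
monomorphism is an isomorphism. -/
theorem isIso_of_bijective_lifts {Y Z : FT f} (p : TamePoint f) (g : Y ⟶ Z)
    (h : Function.Bijective ((lifts p.pt).map g.hom)) : IsIso g := by
  have hf : fibFst g.hom g.hom = fibSnd g.hom g.hom :=
    (FT.fib g.hom g.hom).hom_ext_of_lifts p fun z ↦ h.1 (map_lifts_fib g.hom g.hom z)
  have := mono_homLeft_of_fib_eq hf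
  have hs : Function.Surjective (homLeft g.hom) := by
    refine Set.range_eq_univ.1 (Z.eq_univ_of_lifts p (isClopen_range_homLeft Y Z g.hom) fun z ↦ ?_)
    obtain ⟨y, rfl⟩ := h.2 z
    rw [liftHom_map, Scheme.Hom.comp_apply]
    exact ⟨_, rfl⟩
  have : Surjective (homLeft g.hom) := ⟨hs⟩
  have := isIso_of_homLeft (Flat.isIso_of_surjective_of_mono (homLeft g.hom))
  exact (ObjectProperty.isIso_hom_iff g).1 this

/-- A monomorphism of finite tame covers is an open immersion with clopen image, and the complement
of the image is the other summand. -/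
theorem exists_isColimit_binaryCofan {Y Z : FT f} (i : Y ⟶ Z) [Mono i] :
    ∃ (W : FT f) (u : W ⟶ Z), Nonempty (IsColimit (BinaryCofan.mk i u)) := by
  have hf : fibFst i.hom i.hom = fibSnd i.hom i.hom := by
    let a : FT.fib i.hom i.hom ⟶ Y := ObjectProperty.homMk (fibFst i.hom i.hom)
    let b : FT.fib i.hom i.hom ⟶ Y := ObjectProperty.homMk (fibSnd i.hom i.hom)
    have : a = b := (cancel_mono i).1 (by
      ext
      exact fib_condition _ _)
    exact congrArg (fun g ↦ g.hom) this
  have := mono_homLeft_of_fib_eq hf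
  have : IsOpenImmersion (homLeft i.hom) := IsOpenImmersion.of_flat_of_mono _
  have hO := (isClopen_range_homLeft Y Z i.hom).compl
  let W := Z.clopen hO
  let u : W ⟶ Z := ObjectProperty.homMk (Z.clopenIncl hO)
  have hi {A : X.Etale} {k k' : A ⟶ Y.obj} (e : k ≫ i.hom = k' ≫ i.hom) : k = k' :=
    homLeft_injective ((cancel_mono (homLeft i.hom)).1 (by rw [← homLeft_comp, e, homLeft_comp]))
  have hu {A : X.Etale} {k k' : A ⟶ W.obj} (e : k ≫ u.hom = k' ≫ u.hom) : k = k' :=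
    homLeft_injective ((cancel_mono (homLeft (Z.clopenIncl hO))).1
      (by rw [← homLeft_comp, ← homLeft_comp]; exact congrArg homLeft e))
  have hiu {A : X.Etale} {k : A ⟶ Y.obj} {k' : A ⟶ W.obj} (e : k ≫ i.hom = k' ≫ u.hom)
      (x : A.left) : False := by
    have h₁ : homLeft (k ≫ i.hom) x ∈ Set.range (homLeft i.hom) := by
      rw [homLeft_comp, Scheme.Hom.comp_apply]
      exact ⟨_, rfl⟩
    have h₂ : homLeft (k' ≫ u.hom) x ∈ Set.range (homLeft (Z.clopenIncl hO)) := by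
      rw [homLeft_comp, Scheme.Hom.comp_apply]
      exact ⟨_, rfl⟩
    rw [← e, Z.range_clopenIncl hO] at h₂
    exact h₂ h₁
  have hcov (z : Z.obj.left) : (∃ y, homLeft i.hom y = z) ∨ ∃ w, homLeft u.hom w = z := by
    by_cases h : z ∈ Set.range (homLeft i.hom)
    · exact Or.inl h
    · exact Or.inr ((Z.range_clopenIncl hO).ge h)
  have hdesc {T : FT f} (a : Y ⟶ T) (b : W ⟶ T) : ∃ m : Z ⟶ T, i ≫ m = a ∧ u ≫ m = b := by
    obtain ⟨φ, hφ⟩ := exists_hom_of_locally (U := Z.obj) (Y := T.obj.left)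
      (fun A h c ↦ (∃ k, k ≫ i.hom = h ∧ c = homLeft (k ≫ a.hom)) ∨
        ∃ k, k ≫ u.hom = h ∧ c = homLeft (k ≫ b.hom))
      (by
        rintro A A' _ _ l (⟨k, rfl, rfl⟩ | ⟨k, rfl, rfl⟩)
        · exact Or.inl ⟨l ≫ k, Category.assoc _ _ _, by rw [Category.assoc, homLeft_comp l]⟩
        · exact Or.inr ⟨l ≫ k, Category.assoc _ _ _, by rw [Category.assoc, homLeft_comp l]⟩)
      (by
        rintro A _ _ _ (⟨k, rfl, rfl⟩ | ⟨k, rfl, rfl⟩) (⟨k', e, rfl⟩ | ⟨k', e, rfl⟩)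
        · rw [hi e]
        · exact hom_ext_of_locally fun x ↦ (hiu e.symm x).elim
        · exact hom_ext_of_locally fun x ↦ (hiu e x).elim
        · rw [hu e])
      (fun z ↦ by
        obtain ⟨y, hy⟩ | ⟨w, hw⟩ := hcov z
        · exact ⟨_, i.hom, y, _, hy, Or.inl ⟨𝟙 _, Category.id_comp _, rfl⟩⟩
        · exact ⟨_, u.hom, w, _, hw, Or.inr ⟨𝟙 _, Category.id_comp _, rfl⟩⟩)
    have h₁ : homLeft i.hom ≫ φ = homLeft a.hom :=
      hφ _ _ (Or.inl ⟨𝟙 _, Category.id_comp _, by rw [Category.id_comp]⟩)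
    have h₂ : homLeft u.hom ≫ φ = homLeft b.hom :=
      hφ _ _ (Or.inr ⟨𝟙 _, Category.id_comp _, by rw [Category.id_comp]⟩)
    have hw : φ ≫ str T.obj = str Z.obj := hom_ext_of_locally fun z ↦ by
      obtain ⟨y, hy⟩ | ⟨w, hw⟩ := hcov z
      · exact ⟨_, i.hom, y, hy, by rw [← Category.assoc, h₁, homLeft_str, homLeft_str]⟩
      · exact ⟨_, u.hom, w, hw, by rw [← Category.assoc, h₂, homLeft_str, homLeft_str]⟩
    refine ⟨ObjectProperty.homMk (mkHom φ hw), ?_, ?_⟩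
    · ext
      exact homLeft_injective h₁
    · ext
      exact homLeft_injective h₂
  choose desc h₁ h₂ using @hdesc
  refine ⟨W, u, ⟨BinaryCofan.IsColimit.mk _ desc h₁ h₂ fun a b m hm hm' ↦ ?_⟩⟩
  have e₁ : i ≫ m = i ≫ desc a b := hm.trans (h₁ a b).symm
  have e₂ : u ≫ m = u ≫ desc a b := hm'.trans (h₂ a b).symm
  ext
  refine etale_hom_ext_of_locally fun z ↦ ?_
  obtain ⟨y, hy⟩ | ⟨w, hw⟩ := hcov z
  · exact ⟨_, i.hom, y, hy, congrArg (fun g ↦ g.hom) e₁⟩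
  · exact ⟨_, u.hom, w, hw, congrArg (fun g ↦ g.hom) e₂⟩

end Mono

section Galois

variable [ConnectedSpace X]

instance : PreGaloisCategory (FT f) where
  hasQuotientsByFiniteGroups G _ _ := hasColimitsOfShape_singleObj G
  monoInducesIsoOnDirectSummand i _ := exists_isColimit_binaryCofan i

instance (p : TamePoint f) : (fibreFunctor p).ReflectsIsomorphisms where
  reflects {Y Z} g _ := isIso_of_bijective_lifts p g (by
    have h : Function.Bijective ((fibreFunctor p).map g) :=
      ConcreteCategory.bijective_of_isIso ((fibreFunctor p).map g)
    have e : (fibreFunctor p).map g ∘ componentOfLift p Y =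
        componentOfLift p Z ∘ (lifts p.pt).map g.hom :=
      funext fun y ↦ componentOfLift_naturality p g y
    refine (Function.Bijective.of_comp_iff' (bijective_componentOfLift p Z) _).1 ?_
    rw [← e]
    exact h.comp (bijective_componentOfLift p Y))

instance (p : TamePoint f) : PreGaloisCategory.FiberFunctor (fibreFunctor p) where
  preservesTerminalObjects := preservesLimitsOfShape_fibreFunctor p _
  preservesQuotientsByFiniteGroups G _ _ := preservesColimitsOfShape_singleObj p G
  preservesPullbacks := preservesLimitsOfShape_fibreFunctor p _

end Galois

end TameSite

/-! ### Tame points and tame coverings -/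

namespace TameSite

variable {X S : Scheme.{u}} {f : X ⟶ S}

section TamePoints

/-- Every element of `Val_S X` comes from a tame point. -/
theorem exists_tamePoint {ξ : ValuedPoint X} (h : ξ.IsOver f) :
    ∃ (p : TamePoint f) (a : X.residueField ξ.pt ⟶ .of p.field),
      p.pt = Spec.map a ≫ X.fromSpecResidueField ξ.pt ∧ p.val.comap a.hom = ξ.val := by
  obtain ⟨x, v⟩ := ξ
  obtain ⟨V, rfl⟩ := exists_valuationSubring_comap_eq
    (algebraMap (X.residueField x) (SeparableClosure (X.residueField x))) v
  obtain ⟨k, hk, -⟩ := exists_isTameClosed (K := X.residueField x) V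
  have hval : (V.comap (algebraMap k (SeparableClosure (X.residueField x)))).comap
      (algebraMap (X.residueField x) k) = V.comap (algebraMap (X.residueField x) _) := by
    rw [ValuationSubring.comap_comap, ← IsScalarTower.algebraMap_eq]
  let a : X.residueField x ⟶ .of k := CommRingCat.ofHom (algebraMap (X.residueField x) k)
  have hS : IsSValuation ((Spec.map a ≫ X.fromSpecResidueField x) ≫ f)
      (V.comap (algebraMap k _)) := by
    rw [isSValuation_fromSpecResidueField_iff]
    exact hval ▸ h
  exact ⟨{ field := k, pt := _, val := _, isSValuation := hS,
           bijective_of_isTamelyRamified := hk }, a, rfl, hval⟩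

/-- Through the trivial valuation every point of every étale `X`-scheme underlies a tame point. -/
theorem isSValuation_top {K : Type u} [Field K] (t : Spec (.of K) ⟶ S) :
    IsSValuation t (⊤ : ValuationSubring K) := by
  let i : K →+* (⊤ : ValuationSubring K) := (RingHom.id K).codRestrict _ fun _ ↦ trivial
  refine ⟨Spec.map (CommRingCat.ofHom i) ≫ t, ?_⟩
  rw [← Category.assoc, ← Spec.map_comp, ← CommRingCat.ofHom_comp]
  exact (congrArg (· ≫ t) (Spec.map_id _)).trans (Category.id_comp _)

theorem exists_tamePoint_lift (U : X.Etale) (u : U.left) :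
    ∃ (p : TamePoint f) (z : (lifts p.pt).obj U), liftHom z default = u := by
  obtain ⟨p, a, hp, -⟩ := exists_tamePoint (f := str U ≫ f) (ξ := ⟨u, ⊤⟩) (isSValuation_top _)
  refine ⟨{ field := p.field, pt := p.pt ≫ str U, val := p.val,
            isSValuation := by rw [Category.assoc]; exact p.isSValuation,
            bijective_of_isTamelyRamified := p.bijective_of_isTamelyRamified },
    mkLift p.pt rfl, (congrArg (fun t : Spec (.of p.field) ⟶ U.left ↦ t default) hp).trans
      (SpecMap_fromSpecResidueField_apply a _)⟩

end TamePoints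

section Coverings

theorem exists_valuedPoint_map_eq {Y : Scheme.{u}} (g : Y ⟶ X) (ξ : ValuedPoint X) (y : Y)
    (h : g y = ξ.pt) : ∃ η : ValuedPoint Y, η.map g = ξ := by
  obtain ⟨x, v⟩ := ξ
  obtain rfl : g y = x := h
  obtain ⟨w, hw⟩ := exists_valuationSubring_comap_eq (g.residueFieldMap y).hom v
  exact ⟨⟨y, w⟩, congrArg (ValuedPoint.mk (g y)) hw⟩

/-- Any valuation extends to the residue field of a preimage of its center, so it is enough that
each point has one preimage on a member that is tame everywhere. -/
theorem mem_tamePrecoverage {U : X.Etale} {R : Presieve U}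
    (h : ∀ x : U.left, ∃ (V : X.Etale) (g : V ⟶ U), R g ∧ (∃ y, homLeft g y = x) ∧
      ∀ η : ValuedPoint V.left, η.IsOver (str V ≫ f) → η.IsTame (homLeft g)) :
    R ∈ tamePrecoverage f U := by
  refine ⟨fun x ↦ ?_, fun ξ hξ ↦ ?_⟩
  · obtain ⟨V, g, hg, hy, -⟩ := h x
    exact ⟨V, g, hg, hy⟩
  · obtain ⟨V, g, hg, ⟨y, hy⟩, ht⟩ := h ξ.pt
    obtain ⟨η, rfl⟩ := exists_valuedPoint_map_eq (homLeft g) ξ y hy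
    have hη : η.IsOver (str V ≫ f) := by
      rw [← homLeft_str_assoc g]
      exact (ValuedPoint.isOver_map_iff (str U ≫ f) (homLeft g) η).1 hξ
    exact ⟨V, g, hg, η, hη, rfl, ht η hη⟩

/-- The factorisation criterion avoids computing degrees: a point of `U` over the small field lands
in the image of `V`, since it does so over the large one. -/
theorem isTame_of_isOpenImmersion {U V : X.Etale} (g : V ⟶ U) [IsOpenImmersion (homLeft g)]
    (η : ValuedPoint V.left) (hη : η.IsOver (str V ≫ f)) : η.IsTame (homLeft g) := by
  refine isTame_of_exists_factor (f := str U ≫ f) (homLeft g) (fun p Ω _ i y hy ↦ ?_) η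
    (by rwa [homLeft_str_assoc])
  have hr : Set.range p.pt ⊆ Set.range (homLeft g) := by
    rw [range_SpecField, Set.singleton_subset_iff,
      Subsingleton.elim default (Spec.map (CommRingCat.ofHom i) default), ← Scheme.Hom.comp_apply,
      ← hy, Scheme.Hom.comp_apply]
    exact ⟨_, rfl⟩
  refine ⟨IsOpenImmersion.lift (homLeft g) p.pt hr, ?_⟩
  rw [← cancel_mono (homLeft g), Category.assoc, IsOpenImmersion.lift_fac, hy]

/-- Zariski coverings are tame coverings. -/
theorem mem_tameTopology_of_isOpenImmersion {U : X.Etale} {S : Sieve U}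
    (h : ∀ x : U.left, ∃ (V : X.Etale) (g : V ⟶ U) (v : V.left), IsOpenImmersion (homLeft g) ∧
      homLeft g v = x ∧ S g) : S ∈ tameTopology f U := by
  let R : Presieve U := fun V g ↦ IsOpenImmersion (homLeft g) ∧ S g
  have hR : R ∈ tamePrecoverage f U := mem_tamePrecoverage fun x ↦ by
    obtain ⟨V, g, v, hg, hv, hS⟩ := h x
    exact ⟨V, g, ⟨hg, hS⟩, ⟨v, hv⟩, isTame_of_isOpenImmersion g⟩
  refine GrothendieckTopology.superset_covering _ ?_ (Precoverage.generate_mem_toGrothendieck hR)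
  rw [Sieve.generate_le_iff]
  exact fun V g hg ↦ hg.2

theorem FT.singleton_mem_tamePrecoverage [ConnectedSpace X] (Y : FT f) [Nonempty Y.obj.left]
    (g : Y.obj ⟶ topEtale X) : Presieve.singleton g ∈ tamePrecoverage f (topEtale X) :=
  mem_tamePrecoverage fun x ↦ by
    obtain rfl : g = toTop Y.obj := toTop_unique _ _
    obtain ⟨y, hy⟩ := Y.surjective_str x
    exact ⟨Y.obj, _, Presieve.singleton_self _, ⟨y, hy⟩, Y.property.2⟩

/-- Representable presheaves are sheaves on the tame site. -/
theorem isSheaf_yoneda (Y : X.Etale) : Presieve.IsSheaf (tameTopology f) (yoneda.obj Y) := by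
  refine (Precoverage.isSheaf_toGrothendieck_iff _).2 fun {U V} q R hR t ht ↦ ?_
  let S := (Sieve.generate R).pullback q
  have hcov (x : V.left) : ∃ (Z : X.Etale) (h : Z ⟶ V) (z : Z.left), homLeft h z = x ∧ S h := by
    obtain ⟨W, g, hg, w, hw⟩ := hR.1 (homLeft q x)
    obtain ⟨z, hz, -⟩ := exists_fib_apply_eq q g x w hw.symm
    exact ⟨_, fibFst q g, z, hz, W, fibSnd q g, g, hg, (fib_condition q g).symm⟩
  obtain ⟨φ, hφ⟩ := exists_hom_of_locally (U := V) (Y := Y.left)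
    (fun Z h c ↦ ∃ hh : S h, c = homLeft (t h hh))
    (by
      rintro Z Z' h _ k ⟨hh, rfl⟩
      refine ⟨S.downward_closed hh k, ?_⟩
      have e : k ≫ t h hh = 𝟙 _ ≫ t (k ≫ h) (S.downward_closed hh k) :=
        ht k (𝟙 _) hh (S.downward_closed hh k) (Category.id_comp _).symm
      rw [Category.id_comp] at e
      rw [← e, homLeft_comp])
    (by
      rintro Z h _ _ ⟨hh, rfl⟩ ⟨_, rfl⟩
      rfl)
    (fun x ↦ by
      obtain ⟨Z, h, z, hz, hh⟩ := hcov x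
      exact ⟨Z, h, z, _, hz, hh, rfl⟩)
  have hw : φ ≫ str Y = str V := hom_ext_of_locally fun x ↦ by
    obtain ⟨Z, h, z, hz, hh⟩ := hcov x
    exact ⟨Z, h, z, hz, by rw [← Category.assoc, hφ h _ ⟨hh, rfl⟩, homLeft_str, homLeft_str]⟩
  refine ⟨mkHom φ hw, fun Z h hh ↦ homLeft_injective (hφ h _ ⟨hh, rfl⟩), fun ψ hψ ↦ ?_⟩
  refine homLeft_injective (hom_ext_of_locally fun x ↦ ?_)
  obtain ⟨Z, h, z, hz, hh⟩ := hcov x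
  refine ⟨Z, h, z, hz, ?_⟩
  have e : h ≫ ψ = t h hh := hψ h hh
  exact ((homLeft_comp h ψ).symm.trans (congrArg homLeft e)).trans (hφ h _ ⟨hh, rfl⟩).symm

end Coverings

end TameSite

/-! ### Germs and stalks -/

namespace TameSite

variable {X S : Scheme.{u}} {f : X ⟶ S}

section Germs

variable {K : Type u} [Field K] {x : Spec (.of K) ⟶ X} {U V : X.Etale}

/-- The restriction of a section of a presheaf of abelian groups. -/
def resHom (F : X.Etaleᵒᵖ ⥤ Ab.{u}) (g : V ⟶ U) : F.obj (op U) →+ F.obj (op V) := (F.map g.op).hom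

theorem resHom_id (F : X.Etaleᵒᵖ ⥤ Ab.{u}) (s : F.obj (op U)) : resHom F (𝟙 U) s = s :=
  ConcreteCategory.congr_hom (F.map_id (op U)) s

theorem resHom_comp (F : X.Etaleᵒᵖ ⥤ Ab.{u}) {W : X.Etale} (h : W ⟶ V) (g : V ⟶ U)
    (s : F.obj (op U)) : resHom F (h ≫ g) s = resHom F h (resHom F g s) :=
  ConcreteCategory.congr_hom (F.map_comp g.op h.op) s

/-- The germ of a section, as an element of the stalk. -/
noncomputable def germHom (F : X.Etaleᵒᵖ ⥤ Ab.{u}) (y : (lifts x).obj U) :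
    F.obj (op U) →+ (stalk x).obj F := (germ x F U y).hom

variable (F : X.Etaleᵒᵖ ⥤ Ab.{u})

theorem germHom_map (g : V ⟶ U) (y : (lifts x).obj V) (s : F.obj (op U)) :
    germHom F ((lifts x).map g y) s = germHom F y (resHom F g s) := by
  let a : (lifts x).Elements := ⟨V, y⟩
  let b : (lifts x).Elements := ⟨U, (lifts x).map g y⟩
  let j : a ⟶ b := ⟨g, rfl⟩
  exact (ConcreteCategory.congr_hom
    (colimit.w ((CategoryOfElements.π (lifts x)).op ⋙ F) j.op) s).symm

theorem stalk_map_germHom {F G : X.Etaleᵒᵖ ⥤ Ab.{u}} (φ : F ⟶ G) (y : (lifts x).obj U)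
    (s : F.obj (op U)) :
    ((stalk x).map φ).hom (germHom F y s) = germHom G y ((φ.app (op U)).hom s) :=
  ConcreteCategory.congr_hom (ι_colimMap
    (Functor.whiskerLeft (CategoryOfElements.π (lifts x)).op φ) (op ⟨U, y⟩)) s

/-- The index category of the stalk is not small but receives a final functor from a small filtered
category; hence stalks can be described by elements. -/
instance : PreservesColimitsOfShape (lifts x).Elementsᵒᵖ (forget Ab.{u}) :=
  Functor.Final.preservesColimitsOfShape_of_final
    (FinallySmall.fromFilteredFinalModel.{u} (lifts x).Elementsᵒᵖ) _

theorem exists_germHom_eq (a : (stalk x).obj F) :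
    ∃ (U : X.Etale) (y : (lifts x).obj U) (s : F.obj (op U)), germHom F y s = a := by
  obtain ⟨j, s, h⟩ := Concrete.colimit_exists_rep ((CategoryOfElements.π (lifts x)).op ⋙ F) a
  exact ⟨_, j.unop.2, s, h⟩

theorem exists_resHom_eq_of_germHom_eq {y : (lifts x).obj U} {z : (lifts x).obj V}
    {s : F.obj (op U)} {t : F.obj (op V)} (h : germHom F y s = germHom F z t) :
    ∃ (W : X.Etale) (a : W ⟶ U) (b : W ⟶ V) (w : (lifts x).obj W), (lifts x).map a w = y ∧
      (lifts x).map b w = z ∧ resHom F a s = resHom F b t := by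
  obtain ⟨k, a, b, e⟩ := Concrete.colimit_exists_of_rep_eq
    ((CategoryOfElements.π (lifts x)).op ⋙ F) _ _ h
  exact ⟨_, a.unop.1, b.unop.1, k.unop.2, a.unop.2, b.unop.2, e⟩

theorem exists_resHom_eq_of_germHom_eq_same {y : (lifts x).obj U} {s t : F.obj (op U)}
    (h : germHom F y s = germHom F y t) :
    ∃ (W : X.Etale) (a : W ⟶ U) (w : (lifts x).obj W), (lifts x).map a w = y ∧
      resHom F a s = resHom F a t := by
  obtain ⟨W, a, b, w, ha, hb, e⟩ := exists_resHom_eq_of_germHom_eq F h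
  let j : (lifts x).Elements := ⟨W, w⟩
  let i : (lifts x).Elements := ⟨U, y⟩
  let a' : j ⟶ i := ⟨a, ha⟩
  let b' : j ⟶ i := ⟨b, hb⟩
  have hc : (IsCofiltered.eqHom a' b').1 ≫ a = (IsCofiltered.eqHom a' b').1 ≫ b :=
    congrArg Subtype.val (IsCofiltered.eq_condition a' b')
  refine ⟨_, (IsCofiltered.eqHom a' b').1 ≫ a, (IsCofiltered.eq a' b').2,
    (IsCofiltered.eqHom a' b' ≫ a').2, ?_⟩
  rw [resHom_comp, e, ← resHom_comp, hc]

end Germs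

end TameSite

/-! ### Constant sheaves as locally constant functions -/

namespace TameSite

variable {X S : Scheme.{u}} {f : X ⟶ S}

/-- The sections over `U`-schemes `V` of the presheaf `F` are the locally constant functions
`V → A`. -/
structure IsConstOver (F : X.Etaleᵒᵖ ⥤ Ab.{u}) (U : X.Etale) (A : Type u) [AddCommGroup A]
    (ev : ∀ {V : X.Etale} (_ : V ⟶ U), F.obj (op V) →+ (V.left → A)) : Prop where
  injective {V : X.Etale} (g : V ⟶ U) : Function.Injective (ev g)
  isLocallyConstant {V : X.Etale} (g : V ⟶ U) (t : F.obj (op V)) : _root_.IsLocallyConstant (ev g t)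
  exists_eq {V : X.Etale} (g : V ⟶ U) (φ : V.left → A) (_ : _root_.IsLocallyConstant φ) :
    ∃ t, ev g t = φ
  naturality {V W : X.Etale} (g : V ⟶ U) (h : W ⟶ V) (t : F.obj (op V)) (x : W.left) :
    ev (h ≫ g) (resHom F h t) x = ev g t (homLeft h x)

section Restrict

variable (U : X.Etale)

/-- A `U`-scheme as an object of the étale site of `U`. -/
def overOf {V : X.Etale} (g : V ⟶ U) : U.left.Etale := mkEtale (homLeft g)

/-- The isomorphism is the identity on underlying schemes. It is needed because the two structure
morphisms to `X`, one of them composed through `U`, are equal but not by definition. -/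
def overOfIso {V : X.Etale} (g : V ⟶ U) : (composeToBase U).obj (overOf U g) ⟶ V :=
  mkHom (𝟙 V.left) ((Category.id_comp _).trans (homLeft_str g).symm)

def overOfInv {V : X.Etale} (g : V ⟶ U) : V ⟶ (composeToBase U).obj (overOf U g) :=
  mkHom (𝟙 V.left) ((Category.id_comp _).trans (homLeft_str g))

theorem overOfIso_inv {V : X.Etale} (g : V ⟶ U) : overOfIso U g ≫ overOfInv U g = 𝟙 _ :=
  homLeft_injective (Category.id_comp _)

theorem overOfInv_iso {V : X.Etale} (g : V ⟶ U) : overOfInv U g ≫ overOfIso U g = 𝟙 _ :=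
  homLeft_injective (Category.id_comp _)

def overOfMap {V W : X.Etale} (g : V ⟶ U) (h : W ⟶ V) : overOf U (h ≫ g) ⟶ overOf U g :=
  mkHom (U := overOf U g) (V := overOf U (h ≫ g)) (show W.left ⟶ V.left from homLeft h) rfl

theorem overOfMap_comp_iso {V W : X.Etale} (g : V ⟶ U) (h : W ⟶ V) :
    (composeToBase U).map (overOfMap U g h) ≫ overOfIso U g = overOfIso U (h ≫ g) ≫ h :=
  homLeft_injective ((Category.comp_id (homLeft h)).trans (Category.id_comp (homLeft h)).symm)

variable {U} {F : X.Etaleᵒᵖ ⥤ Ab.{u}}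

theorem exists_isConstOver {A : Ab.{u}} (e : restrict U F ≅ constantEtaleSheaf U.left A) :
    ∃ ev : ∀ {V : X.Etale} (_ : V ⟶ U), F.obj (op V) →+ (V.left → A), IsConstOver F U A ev := by
  letI : TopologicalSpace A := ⊥
  haveI : DiscreteTopology A := ⟨rfl⟩
  let e' {V : X.Etale} (g : V ⟶ U) : F.obj (op ((composeToBase U).obj (overOf U g))) ≃+
      C(V.left, A) := (e.app (op (overOf U g))).addCommGroupIsoToAddEquiv
  let i {V : X.Etale} (g : V ⟶ U) : F.obj (op V) →+ C(V.left, A) :=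
    (e' g).toAddMonoidHom.comp (resHom F (overOfIso U g))
  have hi {V : X.Etale} (g : V ⟶ U) : Function.Bijective (i g) := by
    refine (e' g).bijective.comp (Function.bijective_iff_has_inverse.2
      ⟨resHom F (overOfInv U g), fun s ↦ ?_, fun s ↦ ?_⟩)
    · rw [← resHom_comp, overOfInv_iso, resHom_id]
    · rw [← resHom_comp, overOfIso_inv, resHom_id]
  let c (V : X.Etale) : C(V.left, A) →+ (V.left → A) :=
    { toFun := fun φ ↦ φ, map_zero' := rfl, map_add' := fun _ _ ↦ rfl }
  refine ⟨fun {V} g ↦ (c V).comp (i g), fun g ↦ ?_, fun g t ↦ ?_, fun g φ hφ ↦ ?_, fun g h t x ↦ ?_⟩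
  · exact (DFunLike.coe_injective (F := C(_, A))).comp (hi g).1
  · exact (IsLocallyConstant.iff_continuous _).2 (i g t).continuous
  · obtain ⟨t, ht⟩ := (hi g).2 ⟨φ, hφ.continuous⟩
    exact ⟨t, congrArg (fun φ : C(_, A) ↦ (φ : _ → A)) ht⟩
  · have h₁ : i (h ≫ g) (resHom F h t) = e' (h ≫ g)
        (resHom F ((composeToBase U).map (overOfMap U g h)) (resHom F (overOfIso U g) t)) := by
      change e' (h ≫ g) (resHom F (overOfIso U (h ≫ g)) (resHom F h t)) = _
      rw [← resHom_comp, ← resHom_comp, overOfMap_comp_iso]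
    have h₂ := ConcreteCategory.congr_hom (e.hom.naturality (overOfMap U g h).op)
      (resHom F (overOfIso U g) t)
    exact congrArg (fun φ : C(_, A) ↦ φ x) (h₁.trans h₂)

end Restrict

end TameSite

/-! ### Locally constant sheaves are represented by finite tame covers -/

namespace TameSite

variable {X S : Scheme.{u}} {f : X ⟶ S}

section Const

variable {U : X.Etale} {F : X.Etaleᵒᵖ ⥤ Ab.{u}} {A : Type u} [AddCommGroup A]
  {ev : ∀ {V : X.Etale} (_ : V ⟶ U), F.obj (op V) →+ (V.left → A)}

theorem IsConstOver.exists_isTriv (h : IsConstOver F U A ev) :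
    ∃ s : A → (F ⋙ forget Ab).obj (op U), IsTriv (F ⋙ forget Ab) s := by
  choose s hs using fun a ↦ h.exists_eq (𝟙 U) (fun _ ↦ a) (IsLocallyConstant.const a)
  have hs' {V : X.Etale} (g : V ⟶ U) (a : A) (x : V.left) : ev g (resHom F g (s a)) x = a := by
    have := h.naturality (𝟙 U) g (s a) x
    rw [Category.comp_id, hs] at this
    exact this
  refine ⟨s, fun V g t x ↦ ?_, fun V g hV a a' e ↦ ?_⟩
  · let O : V.left.Opens := ⟨ev g t ⁻¹' {ev g t x}, h.isLocallyConstant g t _⟩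
    obtain ⟨z, hz⟩ := exists_openIncl_eq (O := O) (x := x) rfl
    refine ⟨_, openIncl O, z, ev g t x, inferInstance, hz, h.injective (openIncl O ≫ g) ?_⟩
    funext y
    refine (h.naturality g (openIncl O) t y).trans (Eq.trans ?_ (hs' _ _ y).symm)
    exact y.2
  · obtain ⟨x⟩ := hV
    have e' : resHom F g (s a) = resHom F g (s a') := e
    rw [← hs' g a x, e', hs' g a' x]

/-- This embeds the value set of a trivialisation in a stalk, which is how finiteness of stalks
becomes finiteness of the value set. -/
theorem IsTriv.injective_germHom {s : A → (F ⋙ forget Ab).obj (op U)}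
    (h : IsTriv (F ⋙ forget Ab) s) {K : Type u} [Field K] {x : Spec (.of K) ⟶ X}
    (z : (lifts x).obj U) : Function.Injective fun a ↦ germHom F z (s a) := by
  intro a a' e
  obtain ⟨W, g, w, -, hg⟩ := exists_resHom_eq_of_germHom_eq_same F e
  have : Nonempty W.left := ⟨liftHom w default⟩
  exact h.eq_of_map_eq W g a a' hg

end Const

section LocConst

variable {F : Sheaf (tameTopology f) Ab.{u}}

theorem isSheaf_forget (F : Sheaf (tameTopology f) Ab.{u}) :
    Presieve.IsSheaf (tameTopology f) (F.obj ⋙ forget Ab) :=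
  Presieve.isSheaf_iso _ (Functor.isoWhiskerLeft F.obj AddCommGrpCat.coyonedaObjIsoForget)
    (F.property _)

/-- A covering by objects over which the sheaf is trivial. -/
theorem exists_isTriv_covering (hF : IsLocallyConstant f F) (hs : HasFiniteStalks f F) :
    ∃ R ∈ tamePrecoverage f (topEtale X), ∀ ⦃T : X.Etale⦄ (g : T ⟶ topEtale X), R g → T.left →
      ∃ (A : Type u) (_ : Finite A) (s : A → (F.obj ⋙ forget Ab).obj (op T)),
        IsTriv (F.obj ⋙ forget Ab) s := by
  obtain ⟨R, hR, H⟩ := hF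
  refine ⟨R, hR, fun T g hg t ↦ ?_⟩
  obtain ⟨A, ⟨e⟩⟩ := H g hg
  obtain ⟨ev, hev⟩ := exists_isConstOver e
  obtain ⟨s, h⟩ := hev.exists_isTriv
  -- The point `t` matters: it carries a tame point, whose finite stalk contains `A`. Over an empty
  -- `T` nothing bounds `A`.
  obtain ⟨p, z, -⟩ := exists_tamePoint_lift (f := f) T t
  have := hs p
  exact ⟨A, Finite.of_injective _ (h.injective_germHom z), s, h⟩

theorem isLocallyTrivial_of_isLocallyConstant (hF : IsLocallyConstant f F)
    (hs : HasFiniteStalks f F) : IsLocallyTrivial (F.obj ⋙ forget Ab) where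
  exists_isTriv x := by
    obtain ⟨R, hR, H⟩ := exists_isTriv_covering hF hs
    obtain ⟨T, g, hg, t, ht⟩ := hR.1 x
    exact ⟨T, t, (congrArg (fun k : T.left ⟶ X ↦ k t) (homLeft_str g).symm).trans ht,
      H g hg t⟩

/-- A property of sections that holds Zariski locally over the members of a tame covering of `X`
defines a covering sieve. -/
theorem mem_tameTopology_of_locally {R : Presieve (topEtale X)}
    (hR : R ∈ tamePrecoverage f (topEtale X)) {U : X.Etale} {S : Sieve U}
    (h : ∀ ⦃T : X.Etale⦄ (g : T ⟶ topEtale X) (_ : R g) ⦃Z : X.Etale⦄ (l : Z ⟶ U) (k : Z ⟶ T)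
      (x : Z.left), ∃ (W : X.Etale) (m : W ⟶ Z) (w : W.left), IsOpenImmersion (homLeft m) ∧
        homLeft m w = x ∧ S (m ≫ l)) : S ∈ tameTopology f U := by
  refine (tameTopology f).transitive ((tameTopology f).pullback_stable (toTop U)
    (Precoverage.generate_mem_toGrothendieck hR)) _ ?_
  rintro Z l ⟨T, k, g, hg, -⟩
  exact mem_tameTopology_of_isOpenImmersion fun x ↦ h g hg l k x

theorem exists_affine_over {T Z : X.Etale} (k : Z ⟶ T) (x : Z.left) :
    ∃ (W V : X.Etale) (m : W ⟶ Z) (w : W.left) (g : W ⟶ V) (i : V ⟶ T)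
      (O : X.AffineZariskiSite) (_ : V ⟶ etOpen O.1), IsAffine V.left ∧
      IsOpenImmersion (homLeft m) ∧ homLeft m w = x ∧ m ≫ k = g ≫ i := by
  obtain ⟨V, i, v, O, q, hV, hi, hv⟩ := exists_hom_etOpen_locally (homLeft k x)
  obtain ⟨w, hw, -⟩ := exists_fib_apply_eq k i x v hv.symm
  have : IsOpenImmersion (homLeft (fibFst k i)) :=
    MorphismProperty.of_isPullback (P := @IsOpenImmersion) (isPullback_fib k i).flip hi
  exact ⟨_, V, fibFst k i, w, fibSnd k i, i, O, q, hV, this, hw, fib_condition k i⟩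

variable [IsLocallyTrivial (F.obj ⋙ forget Ab)]

/-- Two sections with the same morphism agree Zariski locally over each member of the trivialising
tame covering. This gives a tame covering sieve; agreement on an arbitrary étale covering would not
suffice, as `F` is only known to be a sheaf for the tame topology. -/
theorem injective_toEspace (hF : IsLocallyConstant f F) (hs : HasFiniteStalks f F) (U : X.Etale) :
    Function.Injective fun t : (F.obj ⋙ forget Ab).obj (op U) ↦
      toEspace (F.obj ⋙ forget Ab) t := by
  intro t t' e
  obtain ⟨R, hR, H⟩ := exists_isTriv_covering hF hs
  let S : Sieve U :=
    { arrows := fun Z l ↦ secMap (F.obj ⋙ forget Ab) l t = secMap (F.obj ⋙ forget Ab) l t'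
      downward_closed := fun {Z W l} h m ↦ by rw [secMap_comp, h, secMap_comp] }
  have hS : S ∈ tameTopology f U := by
    refine mem_tameTopology_of_locally hR fun T g hg Z l k x ↦ ?_
    obtain ⟨A, _, s, h⟩ := H g hg (homLeft k x)
    obtain ⟨W, V, m, w, n, i, O, q, hV, hm, rfl, -⟩ := exists_affine_over k x
    obtain ⟨W', m', w', hm', rfl, hW'⟩ := (h.pullback i).exists_secMap_eq_of_toEspace_eq q n
      (t := secMap _ (m ≫ l) t) (t' := secMap _ (m ≫ l) t') (by
        rw [toEspace_secMap, toEspace_secMap]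
        exact congrArg _ e) w
    refine ⟨W', m' ≫ m, w', ?_, ?_, ?_⟩
    · rw [homLeft_comp]
      infer_instance
    · rw [homLeft_comp, Scheme.Hom.comp_apply]
    · rw [← secMap_comp, ← secMap_comp] at hW'
      change secMap _ _ _ = secMap _ _ _
      rw [Category.assoc, hW']
  exact (isSheaf_forget F S hS).isSeparatedFor.ext fun Z l hl ↦ hl

/-- Sections inducing the morphism exist on a tame covering sieve. By injectivity they agree on
overlaps, so they glue. -/
theorem surjective_toEspace (hF : IsLocallyConstant f F) (hs : HasFiniteStalks f F) (U : X.Etale) :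
    Function.Surjective fun t : (F.obj ⋙ forget Ab).obj (op U) ↦
      toEspace (F.obj ⋙ forget Ab) t := by
  intro y
  obtain ⟨R, hR, H⟩ := exists_isTriv_covering hF hs
  let S : Sieve U :=
    { arrows := fun Z l ↦ ∃ t : (F.obj ⋙ forget Ab).obj (op Z),
        l ≫ y = toEspace (F.obj ⋙ forget Ab) t
      downward_closed := fun {Z W l} ⟨t, h⟩ m ↦
        ⟨secMap _ m t, by rw [Category.assoc, h, toEspace_secMap]⟩ }
  have hS : S ∈ tameTopology f U := by
    refine mem_tameTopology_of_locally hR fun T g hg Z l k x ↦ ?_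
    obtain ⟨A, _, s, h⟩ := H g hg (homLeft k x)
    obtain ⟨W, V, m, w, n, i, O, q, hV, hm, rfl, -⟩ := exists_affine_over k x
    obtain ⟨W', m', w', t, hm', rfl, hW'⟩ := (h.pullback i).exists_toEspace_eq q n
      (m ≫ l ≫ y) w
    refine ⟨W', m' ≫ m, w', ?_, ?_, t, ?_⟩
    · rw [homLeft_comp]
      infer_instance
    · rw [homLeft_comp, Scheme.Hom.comp_apply]
    · rw [Category.assoc, Category.assoc, hW']
  choose t ht using fun (Z : X.Etale) (l : Z ⟶ U) (h : S l) ↦ h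
  obtain ⟨s, hs', -⟩ := isSheaf_forget F S hS (fun Z l h ↦ t Z l h)
    (fun Z₁ Z₂ W k₁ k₂ l₁ l₂ h₁ h₂ e ↦ injective_toEspace hF hs W (by
      have e₁ := toEspace_secMap (F.obj ⋙ forget Ab) (t Z₁ l₁ h₁) k₁
      have e₂ := toEspace_secMap (F.obj ⋙ forget Ab) (t Z₂ l₂ h₂) k₂
      rw [← ht, ← Category.assoc] at e₁ e₂
      exact e₁.trans ((congrArg (· ≫ y) e).trans e₂.symm)))
  refine ⟨s, (isSheaf_yoneda (f := f) _ S hS).isSeparatedFor.ext fun Z l hl ↦ ?_⟩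
  have e : secMap (F.obj ⋙ forget Ab) l s = t Z l hl := hs' l hl
  exact (toEspace_secMap _ s l).symm.trans ((congrArg _ e).trans (ht Z l hl).symm)

/-- A tame point `p` lifts to a member `T` of the trivialising covering. Over `T` the scheme of
sections is covered by the images of the sections `s a`, so a point over `p` with values in an
extension field lies on one of them and comes from the lift of `p`. -/
theorem isFiniteTameCover_espaceEt (hF : IsLocallyConstant f F) (hs : HasFiniteStalks f F) :
    IsFiniteTameCover f (espaceEt (F.obj ⋙ forget Ab)) := by
  refine isFiniteTameCover_iff.2 ⟨inferInstance, fun p Ω _ i y hy ↦ ?_⟩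
  obtain ⟨R, hR, H⟩ := exists_isTriv_covering hF hs
  obtain ⟨T, g, hg, z, -⟩ := exists_map_lifts_eq hR p (mkLift p.pt (Category.comp_id _))
  obtain ⟨A, _, s, h⟩ := H g hg (liftHom z default)
  let Y := espaceEt (F.obj ⋙ forget Ab)
  let w : Spec (.of Ω) ⟶ (prd Y T).left := (isPullback_prd Y T).lift y
    (Spec.map (CommRingCat.ofHom i) ≫ liftHom z) (by rw [hy, Category.assoc, liftHom_str])
  have hw₁ : w ≫ homLeft (prdFst Y T) = y := (isPullback_prd Y T).lift_fst _ _ _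
  have hw₂ : w ≫ homLeft (prdSnd Y T) = Spec.map (CommRingCat.ofHom i) ≫ liftHom z :=
    (isPullback_prd Y T).lift_snd _ _ _
  obtain ⟨t, ht⟩ := surjective_toEspace hF hs _ (prdFst Y T)
  obtain ⟨Z, m, v, a, -, hv, e⟩ := h.exists_map_eq _ (prdSnd Y T) t (w default)
  have e' : m ≫ prdFst Y T = m ≫ prdSnd Y T ≫ toEspace _ (s a) := by
    rw [← ht, ← toEspace_secMap, e, toEspace_secMap, Category.assoc]
  have hm := (comp_eq_iff _ _ _).1 e' ⟨v, hv⟩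
  rw [default_mem_eqLocus_iff, hw₁, homLeft_comp, ← Category.assoc, hw₂, Category.assoc] at hm
  exact ⟨(lifts p.pt).map (toEspace _ (s a)) z, hm.symm⟩

end LocConst

section Representable

/-- The presheaf `F` is represented by the finite tame cover `Y`, with universal section `ξ`. -/
def IsUniversal (F : X.Etaleᵒᵖ ⥤ Ab.{u}) {Y : FT f} (ξ : F.obj (op Y.obj)) : Prop :=
  ∀ U : X.Etale, Function.Bijective fun g : U ⟶ Y.obj ↦ resHom F g ξ

theorem exists_isUniversal (F : LocConstFin f) :
    ∃ (Y : FT f) (ξ : F.obj.obj.obj (op Y.obj)), IsUniversal F.obj.obj ξ := by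
  have hF := F.property.1
  have hs := F.property.2
  have := isLocallyTrivial_of_isLocallyConstant hF hs
  obtain ⟨ξ, hξ⟩ := surjective_toEspace hF hs _ (𝟙 (espaceEt (F.obj.obj ⋙ forget Ab)))
  have key {U : X.Etale} (g : U ⟶ espaceEt (F.obj.obj ⋙ forget Ab)) :
      toEspace (F.obj.obj ⋙ forget Ab) (secMap _ g ξ) = g := by
    rw [toEspace_secMap]
    exact (congrArg (g ≫ ·) hξ).trans (Category.comp_id g)
  refine ⟨⟨_, isFiniteTameCover_espaceEt hF hs⟩, ξ, fun U ↦ ⟨fun g g' e ↦ ?_, fun t ↦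
    ⟨toEspace (F.obj.obj ⋙ forget Ab) t, injective_toEspace hF hs U (key _)⟩⟩⟩
  exact (key g).symm.trans ((congrArg (toEspace (F.obj.obj ⋙ forget Ab)) e).trans (key g'))

end Representable

end TameSite

/-! ### Trivialisation of finite tame covers by Galois covers -/

namespace TameSite

variable {X S : Scheme.{u}} {f : X ⟶ S}

section Const

variable {U : X.Etale} {F : X.Etaleᵒᵖ ⥤ Ab.{u}} {A : Ab.{u}}
  {ev : ∀ {V : X.Etale} (_ : V ⟶ U), F.obj (op V) →+ (V.left → A)}

/-- The structure morphism of an étale `U`-scheme. -/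
def overHom (V : U.left.Etale) : (composeToBase U).obj V ⟶ U := mkHom (str V) rfl

theorem map_comp_overHom {V W : U.left.Etale} (h : W ⟶ V) :
    (composeToBase U).map h ≫ overHom V = overHom W :=
  homLeft_injective (homLeft_str h)

theorem IsConstOver.nonempty_iso (h : IsConstOver F U A ev) :
    Nonempty (restrict U F ≅ constantEtaleSheaf U.left A) := by
  letI : TopologicalSpace A := ⊥
  haveI : DiscreteTopology A := ⟨rfl⟩
  let i (V : U.left.Etale) : F.obj (op ((composeToBase U).obj V)) →+ C(V.left, A) :=
    { toFun := fun t ↦ ⟨ev (overHom V) t,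
        (IsLocallyConstant.iff_continuous _).1 (h.isLocallyConstant _ t)⟩
      map_zero' := ContinuousMap.ext fun x ↦ congrFun (map_zero (ev (overHom V))) x
      map_add' := fun s t ↦ ContinuousMap.ext fun x ↦ congrFun (map_add (ev (overHom V)) s t) x }
  have hi (V : U.left.Etale) : Function.Bijective (i V) := by
    refine ⟨fun s t e ↦ h.injective _ (congrArg (fun φ : C(V.left, A) ↦ (φ : _ → A)) e),
      fun φ ↦ ?_⟩
    obtain ⟨t, ht⟩ := h.exists_eq (overHom V) φ
      ((IsLocallyConstant.iff_continuous _).2 φ.continuous)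
    exact ⟨t, ContinuousMap.ext fun x ↦ congrFun ht x⟩
  refine ⟨NatIso.ofComponents (fun V ↦ (AddEquiv.ofBijective _ (hi V.unop)).toAddCommGrpIso)
    fun {V W} k ↦ ?_⟩
  ext t
  refine ContinuousMap.ext fun x ↦ ?_
  have e := h.naturality (overHom V.unop) ((composeToBase U).map k.unop) t x
  rw [map_comp_overHom] at e
  exact e

end Const

section Galois

theorem default_mem_eqLocus_of_map_eq {K : Type u} [Field K] {t : Spec (.of K) ⟶ X}
    {U Z : X.Etale} [IsFinite (str Z)] {a b : U ⟶ Z} {z : (lifts t).obj U}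
    (h : (lifts t).map a z = (lifts t).map b z) : liftHom z default ∈ eqLocus a b := by
  rw [default_mem_eqLocus_iff, ← liftHom_map, h, liftHom_map]

theorem map_eq_of_default_mem_eqLocus {K : Type u} [Field K] {t : Spec (.of K) ⟶ X}
    {U Z : X.Etale} [IsFinite (str Z)] {a b : U ⟶ Z} {z : (lifts t).obj U}
    (h : liftHom z default ∈ eqLocus a b) : (lifts t).map a z = (lifts t).map b z :=
  liftHom_injective ((default_mem_eqLocus_iff a b _).1 h)

/-- The product of two finite tame covers. -/
noncomputable def FT.prd (Y Z : FT f) : FT f :=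
  ⟨TameSite.prd Y.obj Z.obj, isFiniteTameCover_topEtale.fib Y.property Z.property⟩

theorem exists_lift_prd {K : Type u} [Field K] {t : Spec (.of K) ⟶ X} {U V : X.Etale}
    (y : (lifts t).obj U) (z : (lifts t).obj V) : ∃ w : (lifts t).obj (TameSite.prd U V),
      (lifts t).map (prdFst U V) w = y ∧ (lifts t).map (prdSnd U V) w = z := by
  have e : liftHom y ≫ str U = liftHom z ≫ str V := by rw [liftHom_str, liftHom_str]
  have h₁ := (isPullback_prd U V).lift_fst _ _ e
  refine ⟨mkLift ((isPullback_prd U V).lift _ _ e) ?_, liftHom_injective ?_, liftHom_injective ?_⟩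
  · rw [← homLeft_str (prdFst U V), ← Category.assoc, h₁, liftHom_str]
  · rw [liftHom_map, liftHom_mkLift, h₁]
  · rw [liftHom_map, liftHom_mkLift, (isPullback_prd U V).lift_snd]

variable [ConnectedSpace X]

instance : GaloisCategory (FT f) where
  hasFiberFunctor := by
    have : Nonempty (TamePoint f) := by
      obtain ⟨x⟩ : Nonempty X := inferInstance
      obtain ⟨p, -⟩ := exists_tamePoint_lift (f := f) (topEtale X) x
      exact ⟨p⟩
    exact ⟨fibreFunctor this.some, ⟨inferInstance⟩⟩

/-- The evaluation at a lift to a suitable connected finite tame cover is bijective. -/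
theorem FT.exists_bijective_evaluation (Y : FT f) (p : TamePoint f) :
    ∃ (Q : FT f) (_ : Nonempty Q.obj.left), ∀ z : (lifts p.pt).obj Q.obj,
      Function.Bijective fun a : Q.obj ⟶ Y.obj ↦ (lifts p.pt).map a z := by
  -- Evaluation is bijective at the point `q` of this Galois object. Connectedness of `Q` gives
  -- injectivity at every other lift, and transitivity of the fundamental group on the fibre gives
  -- surjectivity there.
  obtain ⟨Q, q, hQ, hq⟩ := PreGaloisCategory.exists_galois_representative (fibreFunctor p) Y
  have hne : Nonempty Q.obj.left := by
    obtain ⟨z, -⟩ := (bijective_componentOfLift p Q).2 q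
    exact ⟨liftHom z default⟩
  refine ⟨Q, hne, fun z ↦ ⟨fun a b h ↦ ?_, fun y ↦ ?_⟩⟩
  · let a' : Q ⟶ Y := ObjectProperty.homMk a
    let b' : Q ⟶ Y := ObjectProperty.homMk b
    have := PreGaloisCategory.evaluation_injective_of_isConnected (fibreFunctor p) Q Y
      (componentOfLift p Q z) (a₁ := a') (a₂ := b')
      ((componentOfLift_naturality p a' z).trans ((congrArg _ h).trans
        (componentOfLift_naturality p b' z).symm))
    exact congrArg (fun g ↦ g.hom) this
  · obtain ⟨σ, hσ⟩ := MulAction.exists_smul_eq (Aut (fibreFunctor p)) q (componentOfLift p Q z)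
    obtain ⟨a, ha⟩ := hq.2 (σ⁻¹ • componentOfLift p Y y)
    refine ⟨a.hom, (bijective_componentOfLift p Y).1 ?_⟩
    refine (componentOfLift_naturality p a z).symm.trans ?_
    rw [← hσ]
    refine (ConcreteCategory.congr_hom (σ.hom.naturality a) q).symm.trans ?_
    exact (congrArg (fun c ↦ σ • c) ha).trans (smul_inv_smul σ _)

/-- Every finite tame cover is trivialized by a finite tame cover. -/
theorem FT.exists_trivialization (Y : FT f) : ∃ (Q : FT f) (_ : Nonempty Q.obj.left),
    ∀ (U : X.Etale) (g : U ⟶ Q.obj) (t : U ⟶ Y.obj) (x : U.left),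
      ∃! a : Q.obj ⟶ Y.obj, x ∈ eqLocus t (g ≫ a) := by
  obtain ⟨x⟩ : Nonempty X := inferInstance
  obtain ⟨p, -⟩ := exists_tamePoint_lift (f := f) (topEtale X) x
  obtain ⟨Q, hne, hb⟩ := Y.exists_bijective_evaluation p
  have hfin : Finite (Q.obj ⟶ Y.obj) := by
    obtain ⟨z⟩ := Q.nonempty_lifts p
    exact Finite.of_injective _ (hb z).1
  -- A finite union of equality loci is clopen in the product cover, and it contains all lifts of
  -- `p` by surjectivity of evaluation; clopen subsets are detected on such lifts.
  have hcov : ⋃ a : Q.obj ⟶ Y.obj, eqLocus (prdFst Y.obj Q.obj) (prdSnd Y.obj Q.obj ≫ a) =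
      Set.univ := by
    refine (Y.prd Q).eq_univ_of_lifts p (isClopen_iUnion_of_finite fun a ↦ isClopen_eqLocus _ _)
      fun z ↦ ?_
    obtain ⟨a, ha⟩ := (hb ((lifts p.pt).map (prdSnd Y.obj Q.obj) z)).2
      ((lifts p.pt).map (prdFst Y.obj Q.obj) z)
    exact Set.mem_iUnion.2 ⟨a, default_mem_eqLocus_of_map_eq ha.symm⟩
  refine ⟨Q, hne, fun U g t x ↦ ?_⟩
  obtain ⟨a, ha⟩ := Set.mem_iUnion.1 (hcov.ge (Set.mem_univ (homLeft (prdLift t g) x)))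
  rw [← mem_eqLocus_comp_iff, ← Category.assoc, prdLift_fst, prdLift_snd] at ha
  refine ⟨a, ha, fun b hb' ↦ ?_⟩
  rw [eqLocus_comm] at ha
  obtain ⟨z, hz⟩ := Q.exists_lift_mem p (isClopen_eqLocus a b)
    ⟨_, (mem_eqLocus_comp_iff a b g x).1 (mem_eqLocus_trans ha hb')⟩
  exact ((hb z).1 (map_eq_of_default_mem_eqLocus hz)).symm

end Galois

end TameSite

/-! ### Sheaves represented by finite tame covers -/

namespace TameSite

variable {X S : Scheme.{u}} {f : X ⟶ S} {F : X.Etaleᵒᵖ ⥤ Ab.{u}} {Y : FT f}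
  {ξ : F.obj (op Y.obj)}

section Universal

theorem IsUniversal.isSheaf (h : IsUniversal F ξ) : Presheaf.IsSheaf (tameTopology f) F := by
  refine Presheaf.isSheaf_of_isSheaf_comp _ _ (forget Ab) ?_
  refine (isSheaf_iff_isSheaf_of_type _ _).2 ?_
  have e : yoneda.obj Y.obj ≅ F ⋙ forget Ab :=
    NatIso.ofComponents (fun U ↦ (Equiv.ofBijective _ (h U.unop)).toIso) fun {U V} k ↦ by
      ext g
      exact resHom_comp F k.unop g ξ
  exact Presieve.isSheaf_iso _ e (isSheaf_yoneda Y.obj)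

variable {K : Type u} [Field K] {x : Spec (.of K) ⟶ X}

theorem IsUniversal.bijective_germHom (h : IsUniversal F ξ) :
    Function.Bijective fun z : (lifts x).obj Y.obj ↦ germHom F z ξ := by
  refine ⟨fun z z' e ↦ ?_, fun a ↦ ?_⟩
  · obtain ⟨W, a, b, w, rfl, rfl, e'⟩ := exists_resHom_eq_of_germHom_eq F e
    rw [(h W).1 e']
  · obtain ⟨U, y, s, rfl⟩ := exists_germHom_eq F a
    obtain ⟨g, rfl⟩ := (h U).2 s
    exact ⟨(lifts x).map g y, germHom_map F g y ξ⟩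

theorem IsUniversal.finite_stalk (h : IsUniversal F ξ) : Finite ((stalk x).obj F) :=
  Finite.of_surjective _ h.bijective_germHom.2

variable {U V : X.Etale}

namespace IsUniversal

variable (h : IsUniversal F ξ)

/-- The classifying morphism of a section. -/
noncomputable def classify (s : F.obj (op U)) : U ⟶ Y.obj := ((h U).2 s).choose

theorem resHom_classify (s : F.obj (op U)) : resHom F (h.classify s) ξ = s :=
  ((h U).2 s).choose_spec

theorem classify_resHom_self (g : U ⟶ Y.obj) : h.classify (resHom F g ξ) = g :=
  (h U).1 (h.resHom_classify _)

theorem classify_injective {s t : F.obj (op U)} (e : h.classify s = h.classify t) : s = t := by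
  rw [← h.resHom_classify s, ← h.resHom_classify t, e]

theorem classify_resHom (g : V ⟶ U) (s : F.obj (op U)) :
    h.classify (resHom F g s) = g ≫ h.classify s := by
  rw [← h.classify_resHom_self (g ≫ h.classify s), resHom_comp, h.resHom_classify]

/-- The locus where two sections agree. -/
def locus (s t : F.obj (op U)) : Set U.left := eqLocus (h.classify s) (h.classify t)

theorem isOpen_locus (s t : F.obj (op U)) : IsOpen (h.locus s t) := (isClopen_eqLocus _ _).isOpen

theorem resHom_eq_iff (s t : F.obj (op U)) (g : V ⟶ U) :
    resHom F g s = resHom F g t ↔ Set.range (homLeft g) ⊆ h.locus s t := by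
  refine Iff.trans ⟨fun e ↦ ?_, fun e ↦ h.classify_injective ?_⟩ (comp_eq_iff _ _ g)
  · rw [← h.classify_resHom, ← h.classify_resHom, e]
  · rw [h.classify_resHom, h.classify_resHom, e]

theorem eq_of_locus_eq_univ {s t : F.obj (op U)} (e : ∀ x, x ∈ h.locus s t) : s = t := by
  rw [← resHom_id F s, ← resHom_id F t, h.resHom_eq_iff]
  exact fun x _ ↦ e x

theorem mem_locus_resHom_iff (s t : F.obj (op U)) (g : V ⟶ U) (x : V.left) :
    x ∈ h.locus (resHom F g s) (resHom F g t) ↔ homLeft g x ∈ h.locus s t := by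
  rw [locus, h.classify_resHom, h.classify_resHom, mem_eqLocus_comp_iff, locus]

/-- Additivity is available for restrictions of sections, not for their values at points. Both
equalities are therefore first realised on a common open neighbourhood. -/
theorem mem_locus_add {s t s' t' : F.obj (op U)} {x : U.left} (h₁ : x ∈ h.locus s t)
    (h₂ : x ∈ h.locus s' t') : x ∈ h.locus (s + s') (t + t') := by
  let O : U.left.Opens :=
    ⟨h.locus s t ∩ h.locus s' t', (h.isOpen_locus _ _).inter (h.isOpen_locus _ _)⟩
  obtain ⟨z, rfl⟩ := exists_openIncl_eq (O := O) ⟨h₁, h₂⟩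
  refine (h.resHom_eq_iff _ _ (openIncl O)).1 ?_ ⟨z, rfl⟩
  rw [map_add, map_add, (h.resHom_eq_iff s t (openIncl O)).2,
    (h.resHom_eq_iff s' t' (openIncl O)).2]
  · rintro _ ⟨y, rfl⟩
    exact y.2.2
  · rintro _ ⟨y, rfl⟩
    exact y.2.1

theorem mem_locus_trans {s t r : F.obj (op U)} {x : U.left} (h₁ : x ∈ h.locus s t)
    (h₂ : x ∈ h.locus t r) : x ∈ h.locus s r := mem_eqLocus_trans h₁ h₂

theorem mem_locus_self (s : F.obj (op U)) (x : U.left) : x ∈ h.locus s s :=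
  (h.resHom_eq_iff s s (𝟙 U)).1 rfl ⟨x, rfl⟩

theorem mem_locus_symm {s t : F.obj (op U)} {x : U.left} (h₁ : x ∈ h.locus s t) :
    x ∈ h.locus t s := by rwa [locus, eqLocus_comm]

/-- Locally constant families of sections glue. -/
theorem exists_glue {T : X.Etale} (g : U ⟶ T) (φ : U.left → F.obj (op T))
    (hφ : _root_.IsLocallyConstant φ) :
    ∃ t : F.obj (op U), ∀ x, x ∈ h.locus t (resHom F g (φ x)) := by
  have hex (x : U.left) : ∃ (Z : X.Etale) (k : Z ⟶ U) (z : Z.left), homLeft k z = x ∧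
      ∃ a : F.obj (op T), ∀ y, φ (homLeft k y) = a := by
    let O : U.left.Opens := ⟨φ ⁻¹' {φ x}, hφ _⟩
    obtain ⟨z, hz⟩ := exists_openIncl_eq (O := O) (x := x) rfl
    exact ⟨_, openIncl O, z, hz, φ x, fun y ↦ y.2⟩
  let P : ∀ ⦃Z : X.Etale⦄, (Z ⟶ U) → (Z.left ⟶ Y.obj.left) → Prop := fun Z k c ↦
    ∃ s : F.obj (op Z), c = homLeft (h.classify s) ∧
      ∀ z, z ∈ h.locus s (resHom F (k ≫ g) (φ (homLeft k z)))
  have hP {Z : X.Etale} (k : Z ⟶ U) (a) (ha : ∀ y, φ (homLeft k y) = a) :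
      P k (homLeft (h.classify (resHom F (k ≫ g) a))) :=
    ⟨_, rfl, fun z ↦ by rw [ha]; exact h.mem_locus_self _ _⟩
  obtain ⟨ψ, hψ⟩ := exists_hom_of_locally P
    (by
      rintro Z Z' k _ l ⟨s, rfl, hs⟩
      refine ⟨resHom F l s, by rw [h.classify_resHom, homLeft_comp], fun z ↦ ?_⟩
      rw [Category.assoc, resHom_comp, h.mem_locus_resHom_iff, homLeft_comp, Scheme.Hom.comp_apply]
      exact hs _)
    (by
      rintro Z k _ _ ⟨s, rfl, hs⟩ ⟨t, rfl, ht⟩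
      rw [h.eq_of_locus_eq_univ fun x ↦ h.mem_locus_trans (hs x) (h.mem_locus_symm (ht x))])
    (fun x ↦ by
      obtain ⟨Z, k, z, hz, a, ha⟩ := hex x
      exact ⟨Z, k, z, _, hz, hP k a ha⟩)
  have hw : ψ ≫ str Y.obj = str U := hom_ext_of_locally fun x ↦ by
    obtain ⟨Z, k, z, hz, a, ha⟩ := hex x
    exact ⟨Z, k, z, hz, by
      rw [← Category.assoc, hψ k _ (hP k a ha), homLeft_str, homLeft_str]⟩
  refine ⟨resHom F (mkHom ψ hw) ξ, fun x ↦ ?_⟩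
  obtain ⟨Z, k, z, rfl, a, ha⟩ := hex x
  rw [ha]
  refine (h.resHom_eq_iff _ _ k).1 ?_ ⟨z, rfl⟩
  rw [← resHom_comp, ← resHom_comp]
  have e : k ≫ mkHom ψ hw = h.classify (resHom F (k ≫ g) a) :=
    homLeft_injective (hψ k _ (hP k a ha))
  rw [e, h.resHom_classify]

variable [ConnectedSpace X]

/-- Over the trivialising cover `Q` a section agrees, at each point, with the restriction of exactly
one element of `F(Q)`, and `ev` records that element. Uniqueness yields additivity and naturality,
openness of the loci yields local constancy, and gluing yields all locally constant functions. -/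
theorem exists_isConstOver (h : IsUniversal F ξ) : ∃ (Q : FT f) (_ : Nonempty Q.obj.left)
    (ev : ∀ {V : X.Etale} (_ : V ⟶ Q.obj), F.obj (op V) →+ (V.left → F.obj (op Q.obj))),
      IsConstOver F Q.obj (F.obj (op Q.obj)) ev := by
  obtain ⟨Q, hQ, hu⟩ := Y.exists_trivialization
  have hu' (V : X.Etale) (g : V ⟶ Q.obj) (t : F.obj (op V)) (x : V.left) :
      ∃ a : F.obj (op Q.obj), x ∈ h.locus t (resHom F g a) ∧
        ∀ b, x ∈ h.locus t (resHom F g b) → b = a := by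
    obtain ⟨a, ha, hua⟩ := hu V g (h.classify t) x
    refine ⟨resHom F a ξ, ?_, fun b hb ↦ ?_⟩
    · rwa [locus, h.classify_resHom, h.classify_resHom_self]
    · rw [locus, h.classify_resHom] at hb
      rw [← hua (h.classify b) hb, h.resHom_classify]
  choose v hv huv using hu'
  refine ⟨Q, hQ, fun {V} g ↦ AddMonoidHom.mk' (v V g) fun s t ↦ funext fun x ↦
    (huv V g _ x _ ?_).symm, fun {V} g s t e ↦ h.eq_of_locus_eq_univ fun x ↦ ?_,
    fun {V} g t ↦ (IsLocallyConstant.iff_exists_open _).2 fun x ↦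
      ⟨h.locus t (resHom F g (v V g t x)), h.isOpen_locus _ _, hv V g t x, fun y hy ↦
        (huv V g t y _ hy).symm⟩,
    fun {V} g φ hφ ↦ ?_, fun {V W} g k t x ↦ (huv W (k ≫ g) _ x _ ?_).symm⟩
  · rw [Pi.add_apply, map_add]
    exact h.mem_locus_add (hv V g s x) (hv V g t x)
  · have e' : v V g s = v V g t := e
    have h₁ := hv V g s x
    rw [e'] at h₁
    exact h.mem_locus_trans h₁ (h.mem_locus_symm (hv V g t x))
  · obtain ⟨t, ht⟩ := h.exists_glue g φ hφ
    exact ⟨t, funext fun x ↦ (huv V g t x _ (ht x)).symm⟩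
  · rw [resHom_comp, h.mem_locus_resHom_iff]
    exact hv V g t _

end IsUniversal

/-- A presheaf of abelian groups represented by a finite tame cover, as a locally constant sheaf
with finite stalks. -/
def IsUniversal.toLocConstFin [ConnectedSpace X] (h : IsUniversal F ξ) : LocConstFin f :=
  ⟨⟨F, h.isSheaf⟩, by
    obtain ⟨Q, hQ, ev, hev⟩ := h.exists_isConstOver
    refine ⟨_, Q.singleton_mem_tamePrecoverage (toTop Q.obj), ?_⟩
    rintro _ _ ⟨⟩
    exact ⟨_, hev.nonempty_iso⟩, fun _ ↦ h.finite_stalk⟩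

end Universal

end TameSite

/-! ### The monodromy action on stalks -/

namespace TameSite

variable {X S : Scheme.{u}} {f : X ⟶ S} {p : TamePoint f}

section Act

open scoped PreGaloisCategory

variable {Y Z : FT f}

/-- The action of the tame fundamental group on the lifts of the tame point. -/
noncomputable def act (γ : tamePi1 p) (y : (lifts p.pt).obj Y.obj) : (lifts p.pt).obj Y.obj :=
  ((bijective_componentOfLift p Y).2 (γ.hom.app Y (componentOfLift p Y y))).choose

theorem componentOfLift_act (γ : tamePi1 p) (y : (lifts p.pt).obj Y.obj) :
    componentOfLift p Y (act γ y) = γ.hom.app Y (componentOfLift p Y y) :=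
  ((bijective_componentOfLift p Y).2 (γ.hom.app Y (componentOfLift p Y y))).choose_spec

theorem act_eq_iff (γ : tamePi1 p) (y y' : (lifts p.pt).obj Y.obj) :
    act γ y = y' ↔ γ.hom.app Y (componentOfLift p Y y) = componentOfLift p Y y' := by
  rw [← componentOfLift_act, (bijective_componentOfLift p Y).1.eq_iff]

theorem act_one (y : (lifts p.pt).obj Y.obj) : act (1 : tamePi1 p) y = y :=
  (act_eq_iff _ _ _).2 rfl

theorem act_mul (γ γ' : tamePi1 p) (y : (lifts p.pt).obj Y.obj) :
    act (γ * γ') y = act γ (act γ' y) := by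
  rw [act_eq_iff, componentOfLift_act, componentOfLift_act]
  rfl

theorem map_act (γ : tamePi1 p) (g : Y.obj ⟶ Z.obj) (y : (lifts p.pt).obj Y.obj) :
    (lifts p.pt).map g (act γ y) = act γ ((lifts p.pt).map g y) := by
  let g' : Y ⟶ Z := ObjectProperty.homMk g
  refine ((act_eq_iff _ _ _).2 ?_).symm
  refine Eq.trans ?_ (componentOfLift_naturality p g' (act γ y))
  rw [componentOfLift_act]
  exact (congrArg (γ.hom.app Z) (componentOfLift_naturality p g' y)).symm.trans
    (ConcreteCategory.congr_hom (γ.hom.naturality g') (componentOfLift p Y y))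

theorem isOpen_setOf_act_eq (y y' : (lifts p.pt).obj Y.obj) :
    IsOpen {γ : tamePi1 p | act γ y = y'} := by
  have h := (continuous_id (X := tamePi1 p)).smul
    (continuous_const (y := (componentOfLift p Y y : (fibreFunctor p).obj Y)))
  have e : {γ : tamePi1 p | act γ y = y'} =
      (fun γ : tamePi1 p ↦ id γ • (componentOfLift p Y y : (fibreFunctor p).obj Y)) ⁻¹'
        {componentOfLift p Y y'} := Set.ext fun γ ↦ act_eq_iff γ y y'
  rw [e]
  exact (isOpen_discrete _).preimage h

end Act

section Monodromy

variable (F : LocConstFin f)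

/-- A finite tame cover representing `F`. -/
noncomputable def coverOf : FT f := (exists_isUniversal F).choose

/-- The universal section of `F`. -/
noncomputable def univSec : F.obj.obj.obj (op (coverOf F).obj) :=
  (exists_isUniversal F).choose_spec.choose

theorem isUniversal_univSec : IsUniversal F.obj.obj (univSec F) :=
  (exists_isUniversal F).choose_spec.choose_spec

/-- The lifts of the tame point to the cover representing `F` are the elements of the stalk. -/
noncomputable def stalkEquiv (p : TamePoint f) :
    (lifts p.pt).obj (coverOf F).obj ≃ (stalk p.pt).obj F.obj.obj :=
  Equiv.ofBijective _ (isUniversal_univSec F).bijective_germHom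

theorem stalkEquiv_apply (z : (lifts p.pt).obj (coverOf F).obj) :
    stalkEquiv F p z = germHom F.obj.obj z (univSec F) := rfl

/-- The action of the tame fundamental group on the stalk, as a map. -/
noncomputable def monodromyFun (γ : tamePi1 p) (a : (stalk p.pt).obj F.obj.obj) :
    (stalk p.pt).obj F.obj.obj := stalkEquiv F p (act γ ((stalkEquiv F p).symm a))

/-- Every section is the pullback of the universal one along a morphism of covers, and the action on
lifts commutes with such morphisms. -/
theorem monodromyFun_germHom (γ : tamePi1 p) {Y : FT f} (y : (lifts p.pt).obj Y.obj)
    (s : F.obj.obj.obj (op Y.obj)) :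
    monodromyFun F γ (germHom F.obj.obj y s) = germHom F.obj.obj (act γ y) s := by
  obtain ⟨g, rfl⟩ := (isUniversal_univSec F Y.obj).2 s
  have e (z : (lifts p.pt).obj Y.obj) : germHom F.obj.obj z (resHom F.obj.obj g (univSec F)) =
      stalkEquiv F p ((lifts p.pt).map g z) := (germHom_map _ g z _).symm
  exact (congrArg (monodromyFun F γ) (e y)).trans ((congrArg (stalkEquiv F p) ((congrArg (act γ)
    ((stalkEquiv F p).symm_apply_apply _)).trans (map_act γ g y).symm)).trans (e _).symm)

/-- Any two sections come from a finite tame cover. -/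
theorem exists_resHom_eq_FT {U : X.Etale} (s t : F.obj.obj.obj (op U)) :
    ∃ (Y : FT f) (k : U ⟶ Y.obj) (s' t' : F.obj.obj.obj (op Y.obj)),
      resHom F.obj.obj k s' = s ∧ resHom F.obj.obj k t' = t := by
  have h := isUniversal_univSec F
  let Y := (coverOf F).obj
  let k : U ⟶ prd Y Y := prdLift (h.classify s) (h.classify t)
  have hs : resHom F.obj.obj k (resHom F.obj.obj (prdFst Y Y) (univSec F)) = s := by
    rw [← resHom_comp, prdLift_fst, h.resHom_classify]
  have ht : resHom F.obj.obj k (resHom F.obj.obj (prdSnd Y Y) (univSec F)) = t := by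
    rw [← resHom_comp, prdLift_snd, h.resHom_classify]
  exact ⟨(coverOf F).prd (coverOf F), k, _, _, hs, ht⟩

/-- The self-product of the representing cover carries two universal sections at once. Realising
both germs at one lift of one cover is what makes the action additive. -/
theorem exists_germHom_eq_FT (a b : (stalk p.pt).obj F.obj.obj) :
    ∃ (Y : FT f) (y : (lifts p.pt).obj Y.obj) (s t : F.obj.obj.obj (op Y.obj)),
      germHom F.obj.obj y s = a ∧ germHom F.obj.obj y t = b := by
  obtain ⟨y, rfl⟩ := (stalkEquiv F p).surjective a
  obtain ⟨z, rfl⟩ := (stalkEquiv F p).surjective b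
  obtain ⟨w, rfl, rfl⟩ := exists_lift_prd y z
  exact ⟨(coverOf F).prd (coverOf F), w, resHom F.obj.obj (prdFst _ _) (univSec F),
    resHom F.obj.obj (prdSnd _ _) (univSec F), (germHom_map _ _ w _).symm,
    (germHom_map _ _ w _).symm⟩

theorem monodromyFun_add (γ : tamePi1 p) (a b : (stalk p.pt).obj F.obj.obj) :
    monodromyFun F γ (a + b) = monodromyFun F γ a + monodromyFun F γ b := by
  obtain ⟨Y, y, s, t, rfl, rfl⟩ := exists_germHom_eq_FT F a b
  rw [← map_add, monodromyFun_germHom, monodromyFun_germHom, monodromyFun_germHom, map_add]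

/-- The action of the tame fundamental group on the stalk. -/
noncomputable def monodromy (p : TamePoint f) : Action Ab.{u} (tamePi1 p) where
  V := (stalk p.pt).obj F.obj.obj
  ρ :=
    { toFun := fun γ ↦ AddCommGrpCat.ofHom (AddMonoidHom.mk' (monodromyFun F γ)
        (monodromyFun_add F γ))
      map_one' := by
        refine AddCommGrpCat.hom_ext (AddMonoidHom.ext fun a ↦ ?_)
        obtain ⟨y, rfl⟩ := (stalkEquiv F p).surjective a
        exact (monodromyFun_germHom F _ y _).trans (by rw [act_one]; rfl)
      map_mul' := fun γ γ' ↦ by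
        refine AddCommGrpCat.hom_ext (AddMonoidHom.ext fun a ↦ ?_)
        obtain ⟨y, rfl⟩ := (stalkEquiv F p).surjective a
        refine (monodromyFun_germHom F _ y _).trans ?_
        rw [act_mul, ← monodromyFun_germHom, ← monodromyFun_germHom]
        rfl }

theorem monodromy_germHom (γ : tamePi1 p) {Y : FT f} (y : (lifts p.pt).obj Y.obj)
    (s : F.obj.obj.obj (op Y.obj)) :
    ((monodromy F p).ρ γ).hom (germHom F.obj.obj y s) = germHom F.obj.obj (act γ y) s :=
  monodromyFun_germHom F γ y s

theorem isOpen_stabilizer_monodromy (a : (monodromy F p).V) :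
    IsOpen {γ : tamePi1 p | ((monodromy F p).ρ γ).hom a = a} := by
  obtain ⟨y, rfl⟩ := (stalkEquiv F p).surjective a
  convert isOpen_setOf_act_eq y y using 3 with γ
  exact Iff.trans (iff_of_eq (congrArg (· = _) (monodromy_germHom F γ y (univSec F))))
    (stalkEquiv F p).injective.eq_iff

/-- The finite discrete module attached to a locally constant sheaf with finite stalks. -/
noncomputable def toModule (p : TamePoint f) : LocConstFin f ⥤ FinDiscMod.{u} (tamePi1 p) where
  obj F := ⟨monodromy F p, F.property.2 p, isOpen_stabilizer_monodromy F⟩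
  map {F G} φ := ObjectProperty.homMk
    { hom := (stalk p.pt).map φ.hom.hom
      comm := fun γ ↦ by
        ext a
        obtain ⟨y, rfl⟩ := (stalkEquiv F p).surjective a
        refine (congrArg ((stalk p.pt).map φ.hom.hom).hom
          (monodromy_germHom F γ y (univSec F))).trans ?_
        refine (stalk_map_germHom φ.hom.hom _ _).trans ?_
        refine (monodromy_germHom G γ y _).symm.trans ?_
        exact congrArg ((monodromy G p).ρ γ).hom (stalk_map_germHom φ.hom.hom y _).symm }
  map_id F := by
    ext : 2
    exact (stalk p.pt).map_id _
  map_comp φ ψ := by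
    ext : 2
    exact (stalk p.pt).map_comp _ _

end Monodromy

end TameSite

/-! ### Full faithfulness -/

namespace TameSite

variable {X S : Scheme.{u}} {f : X ⟶ S} [ConnectedSpace X] {p : TamePoint f}

section Faithful

variable {F G : LocConstFin f}

theorem germHom_eq_stalkEquiv (F : LocConstFin f) {U : X.Etale} (z : (lifts p.pt).obj U)
    (s : F.obj.obj.obj (op U)) : germHom F.obj.obj z s =
      stalkEquiv F p ((lifts p.pt).map ((isUniversal_univSec F).classify s) z) := by
  rw [stalkEquiv_apply, germHom_map, (isUniversal_univSec F).resHom_classify]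

/-- A section over a finite tame cover is determined by its germs at the lifts of a tame point. -/
theorem eq_of_germHom_eq {Y : FT f} {s t : F.obj.obj.obj (op Y.obj)}
    (h : ∀ y : (lifts p.pt).obj Y.obj, germHom F.obj.obj y s = germHom F.obj.obj y t) : s = t := by
  refine (isUniversal_univSec F).classify_injective (Y.hom_ext_of_lifts p fun y ↦ ?_)
  have e := h y
  rw [germHom_eq_stalkEquiv, germHom_eq_stalkEquiv] at e
  exact (stalkEquiv F p).injective e

theorem app_resHom {F G : X.Etaleᵒᵖ ⥤ Ab.{u}} (φ : F ⟶ G) {U V : X.Etale} (g : V ⟶ U)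
    (s : F.obj (op U)) : (φ.app (op V)).hom (resHom F g s) = resHom G g ((φ.app (op U)).hom s) :=
  ConcreteCategory.congr_hom (φ.naturality g.op) s

instance : (toModule p : LocConstFin f ⥤ _).Faithful where
  map_injective {F G φ ψ} h := by
    have h' : (stalk p.pt).map φ.hom.hom = (stalk p.pt).map ψ.hom.hom :=
      congrArg (fun m ↦ m.hom.hom) h
    have e : (φ.hom.hom.app _).hom (univSec F) = (ψ.hom.hom.app _).hom (univSec F) :=
      eq_of_germHom_eq (p := p) fun y ↦ by
        rw [← stalk_map_germHom, ← stalk_map_germHom, h']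
    refine ObjectProperty.hom_ext _ (ObjectProperty.hom_ext _ (NatTrans.ext (funext fun U ↦
      AddCommGrpCat.hom_ext (AddMonoidHom.ext fun t ↦ ?_))))
    obtain ⟨g, rfl⟩ := (isUniversal_univSec F U.unop).2 t
    exact (app_resHom φ.hom.hom g _).trans ((congrArg (resHom G.obj.obj g) e).trans
      (app_resHom ψ.hom.hom g _).symm)

end Faithful

section Full

/-- This is the fullness of the fibre functor of a Galois category, as a functor to finite sets with
action, translated from components of the fibre to lifts. -/
theorem exists_hom_of_equivariant {Y Z : FT f}
    (μ : (lifts p.pt).obj Y.obj → (lifts p.pt).obj Z.obj)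
    (h : ∀ (γ : tamePi1 p) y, μ (act γ y) = act γ (μ y)) :
    ∃ g : Y.obj ⟶ Z.obj, ∀ y, (lifts p.pt).map g y = μ y := by
  let eY := Equiv.ofBijective _ (bijective_componentOfLift p Y)
  let eZ := Equiv.ofBijective _ (bijective_componentOfLift p Z)
  let m : (PreGaloisCategory.functorToAction (fibreFunctor p)).obj Y ⟶
      (PreGaloisCategory.functorToAction (fibreFunctor p)).obj Z :=
    { hom := FintypeCat.homMk fun c ↦ eZ (μ (eY.symm c))
      comm := fun γ ↦ by
        ext c
        obtain ⟨y, rfl⟩ := eY.surjective c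
        change eZ (μ (eY.symm (γ.hom.app Y (componentOfLift p Y y)))) =
          γ.hom.app Z (componentOfLift p Z (μ (eY.symm (eY y))))
        rw [← componentOfLift_act, ← componentOfLift_act, eY.symm_apply_apply, ← h]
        exact congrArg (fun z ↦ eZ (μ z)) (eY.symm_apply_apply (act γ y)) }
  obtain ⟨g, hg⟩ := (PreGaloisCategory.functorToAction (fibreFunctor p)).map_surjective m
  refine ⟨g.hom, fun y ↦ (bijective_componentOfLift p Z).1 ?_⟩
  refine (componentOfLift_naturality p g y).symm.trans ?_
  refine (ConcreteCategory.congr_hom (congrArg (fun a ↦ a.hom) hg) (eY y)).trans ?_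
  exact congrArg (fun z ↦ eZ (μ z)) (eY.symm_apply_apply y)

variable {F G : LocConstFin f}

/-- On sections the morphism is composition of the classifying morphism with `g`, and only its
additivity needs `m`. Over a finite tame cover additivity is checked on germs at the lifts of `p`;
any two sections are pulled back from such a cover. -/
theorem exists_hom_of_stalk (m : (stalk p.pt).obj F.obj.obj →+ (stalk p.pt).obj G.obj.obj)
    (g : (coverOf F).obj ⟶ (coverOf G).obj)
    (h : ∀ z, m (stalkEquiv F p z) = stalkEquiv G p ((lifts p.pt).map g z)) :
    ∃ φ : F.obj.obj ⟶ G.obj.obj, ((stalk p.pt).map φ).hom = m := by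
  have hF := isUniversal_univSec F
  have hG := isUniversal_univSec G
  let φ (U : X.Etale) (t : F.obj.obj.obj (op U)) : G.obj.obj.obj (op U) :=
    resHom G.obj.obj (hF.classify t ≫ g) (univSec G)
  have hres {U V : X.Etale} (k : V ⟶ U) (t : F.obj.obj.obj (op U)) :
      φ V (resHom F.obj.obj k t) = resHom G.obj.obj k (φ U t) := by
    change resHom _ _ _ = resHom _ _ (resHom _ _ _)
    rw [hF.classify_resHom, Category.assoc, resHom_comp]
  have hgerm {U : X.Etale} (y : (lifts p.pt).obj U) (t : F.obj.obj.obj (op U)) :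
      germHom G.obj.obj y (φ U t) = m (germHom F.obj.obj y t) := by
    rw [germHom_eq_stalkEquiv F, h]
    refine (germHom_map _ _ y _).symm.trans ?_
    rw [Functor.map_comp]
    rfl
  have hadd' {Y : FT f} (s t : F.obj.obj.obj (op Y.obj)) :
      φ _ (s + t) = φ _ s + φ _ t := eq_of_germHom_eq (p := p) fun y ↦ by
    rw [map_add, hgerm, hgerm, hgerm, map_add, map_add]
  have hadd {U : X.Etale} (s t : F.obj.obj.obj (op U)) : φ _ (s + t) = φ _ s + φ _ t := by
    obtain ⟨Y, k, s, t, rfl, rfl⟩ := exists_resHom_eq_FT F s t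
    rw [← map_add, hres, hres, hres, hadd', map_add]
  refine ⟨{ app := fun U ↦ AddCommGrpCat.ofHom (AddMonoidHom.mk' (φ U.unop) hadd)
            naturality := fun U V k ↦ AddCommGrpCat.hom_ext (AddMonoidHom.ext fun t ↦
              hres k.unop t) }, AddMonoidHom.ext fun a ↦ ?_⟩
  obtain ⟨z, rfl⟩ := (stalkEquiv F p).surjective a
  exact (stalk_map_germHom _ _ _).trans (hgerm z (univSec F))

instance : (toModule p : LocConstFin f ⥤ _).Full where
  map_surjective {F G} m := by
    let m' : (stalk p.pt).obj F.obj.obj →+ (stalk p.pt).obj G.obj.obj := m.hom.hom.hom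
    have hm (γ : tamePi1 p) (a : (stalk p.pt).obj F.obj.obj) :
        m' (monodromyFun F γ a) = monodromyFun G γ (m' a) :=
      ConcreteCategory.congr_hom (m.hom.comm γ) a
    obtain ⟨g, hg⟩ := exists_hom_of_equivariant
      (fun z ↦ (stalkEquiv G p).symm (m' (stalkEquiv F p z))) (fun γ z ↦ by
        rw [Equiv.symm_apply_eq, stalkEquiv_apply, ← monodromyFun_germHom, hm]
        rfl)
    obtain ⟨φ, hφ⟩ := exists_hom_of_stalk m' g fun z ↦ by
      rw [hg, Equiv.apply_symm_apply]
    refine ⟨ObjectProperty.homMk (ObjectProperty.homMk φ), ?_⟩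
    exact ObjectProperty.hom_ext _ (Action.hom_ext _ _ (AddCommGrpCat.hom_ext hφ))

end Full

end TameSite

/-! ### Essential surjectivity -/

namespace TameSite

variable {X S : Scheme.{u}} {f : X ⟶ S} [ConnectedSpace X] {p : TamePoint f}

section GroupLaw

/-- A group law on a finite tame cover, compatible with a given injection of the set of lifts of a
tame point into an abelian group. -/
structure GroupLaw {Y : FT f} {A : Type u} [AddCommGroup A]
    (β : (lifts p.pt).obj Y.obj → A) where
  mul : prd Y.obj Y.obj ⟶ Y.obj
  inv : Y.obj ⟶ Y.obj
  one : topEtale X ⟶ Y.obj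
  map_mul (w) : β ((lifts p.pt).map mul w) =
    β ((lifts p.pt).map (prdFst _ _) w) + β ((lifts p.pt).map (prdSnd _ _) w)
  map_inv (w) : β ((lifts p.pt).map inv w) = -β w
  map_one (w) : β ((lifts p.pt).map one w) = 0
  injective : Function.Injective β

namespace GroupLaw

variable {Y : FT f} {A : Type u} [AddCommGroup A] {β : (lifts p.pt).obj Y.obj → A}
  (L : GroupLaw β) {U V : X.Etale}

noncomputable def add (a b : U ⟶ Y.obj) : U ⟶ Y.obj := prdLift a b ≫ L.mul

noncomputable def neg (a : U ⟶ Y.obj) : U ⟶ Y.obj := a ≫ L.inv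

noncomputable def zero (U : X.Etale) : U ⟶ Y.obj := toTop U ≫ L.one

theorem comp_add (k : V ⟶ U) (a b : U ⟶ Y.obj) : k ≫ L.add a b = L.add (k ≫ a) (k ≫ b) := by
  rw [add, ← Category.assoc]
  refine congrArg (· ≫ L.mul) (prd_hom_ext ?_ ?_)
  · rw [Category.assoc, prdLift_fst, prdLift_fst]
  · rw [Category.assoc, prdLift_snd, prdLift_snd]

theorem comp_neg (k : V ⟶ U) (a : U ⟶ Y.obj) : k ≫ L.neg a = L.neg (k ≫ a) :=
  (Category.assoc _ _ _).symm

theorem comp_zero (k : V ⟶ U) : k ≫ L.zero U = L.zero V := by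
  rw [zero, zero, ← Category.assoc, toTop_unique (k ≫ toTop U) (toTop V)]

theorem map_map {U V W : X.Etale} (a : U ⟶ V) (b : V ⟶ W) (w : (lifts p.pt).obj U) :
    (lifts p.pt).map (a ≫ b) w = (lifts p.pt).map b ((lifts p.pt).map a w) :=
  ConcreteCategory.congr_hom ((lifts p.pt).map_comp a b) w

theorem map_add (a b : U ⟶ Y.obj) (w : (lifts p.pt).obj U) :
    β ((lifts p.pt).map (L.add a b) w) =
      β ((lifts p.pt).map a w) + β ((lifts p.pt).map b w) := by
  rw [add, map_map, L.map_mul, ← map_map, ← map_map, prdLift_fst, prdLift_snd]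

theorem map_neg (a : U ⟶ Y.obj) (w : (lifts p.pt).obj U) :
    β ((lifts p.pt).map (L.neg a) w) = -β ((lifts p.pt).map a w) := by
  rw [neg, map_map, L.map_inv]

theorem map_zero (w : (lifts p.pt).obj U) : β ((lifts p.pt).map (L.zero U) w) = 0 := by
  rw [zero, map_map, L.map_one]

theorem hom_ext (L : GroupLaw β) {W : FT f} {a b : W.obj ⟶ Y.obj}
    (h : ∀ w, β ((lifts p.pt).map a w) = β ((lifts p.pt).map b w)) : a = b :=
  W.hom_ext_of_lifts p fun w ↦ L.injective (h w)

theorem add_assoc_cover {W : FT f} (x y z : W.obj ⟶ Y.obj) :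
    L.add (L.add x y) z = L.add x (L.add y z) :=
  L.hom_ext fun w ↦ by rw [L.map_add, L.map_add, L.map_add, L.map_add, add_assoc]

protected theorem add_comm (a b : U ⟶ Y.obj) : L.add a b = L.add b a := by
  let k := prdLift a b
  have h : L.add (prdFst Y.obj Y.obj) (prdSnd Y.obj Y.obj) =
      L.add (prdSnd Y.obj Y.obj) (prdFst Y.obj Y.obj) :=
    L.hom_ext (W := Y.prd Y) fun w ↦ (L.map_add _ _ w).trans
      ((add_comm _ _).trans (L.map_add _ _ w).symm)
  have e := congrArg (k ≫ ·) h
  simp only [L.comp_add] at e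
  have ha : k ≫ prdFst Y.obj Y.obj = a := prdLift_fst _ _
  have hb : k ≫ prdSnd Y.obj Y.obj = b := prdLift_snd _ _
  rwa [ha, hb] at e

/-- Three morphisms from an arbitrary `U` are pulled back from the projections of a triple product.
That product is a finite tame cover, where `β` and the lifts of `p` decide equality. -/
protected theorem add_assoc (a b c : U ⟶ Y.obj) : L.add (L.add a b) c = L.add a (L.add b c) := by
  let P := Y.prd Y
  let k : U ⟶ prd P.obj Y.obj := prdLift (U := P.obj) (prdLift a b) c
  let x : prd P.obj Y.obj ⟶ Y.obj := prdFst P.obj Y.obj ≫ prdFst Y.obj Y.obj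
  let y : prd P.obj Y.obj ⟶ Y.obj := prdFst P.obj Y.obj ≫ prdSnd Y.obj Y.obj
  let z : prd P.obj Y.obj ⟶ Y.obj := prdSnd P.obj Y.obj
  have hx : k ≫ x = a := (Category.assoc _ _ _).symm.trans
    ((congrArg (· ≫ _) (prdLift_fst _ _)).trans (prdLift_fst _ _))
  have hy : k ≫ y = b := (Category.assoc _ _ _).symm.trans
    ((congrArg (· ≫ _) (prdLift_fst _ _)).trans (prdLift_snd _ _))
  have hz : k ≫ z = c := prdLift_snd _ _
  have h : L.add (L.add x y) z = L.add x (L.add y z) := L.add_assoc_cover (W := P.prd Y) x y z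
  have e := congrArg (k ≫ ·) h
  simp only [L.comp_add] at e
  rwa [hx, hy, hz] at e

protected theorem zero_add (a : U ⟶ Y.obj) : L.add (L.zero U) a = a := by
  have h : L.add (L.zero Y.obj) (𝟙 Y.obj) = 𝟙 Y.obj := L.hom_ext fun w ↦ by
    rw [L.map_add, L.map_zero, zero_add]
  have e := congrArg (a ≫ ·) h
  simpa only [L.comp_add, L.comp_zero, Category.comp_id] using e

protected theorem neg_add_cancel (a : U ⟶ Y.obj) : L.add (L.neg a) a = L.zero U := by
  have h : L.add (L.neg (𝟙 Y.obj)) (𝟙 Y.obj) = L.zero Y.obj := L.hom_ext fun w ↦ by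
    rw [L.map_add, L.map_neg, L.map_zero, neg_add_cancel]
  have e := congrArg (a ≫ ·) h
  simpa only [L.comp_add, L.comp_neg, L.comp_zero, Category.comp_id] using e

/-- The morphisms to `Y`. -/
def Sec (_ : GroupLaw β) (U : X.Etale) : Type u := U ⟶ Y.obj

/-- The group structure on the morphisms to `Y`. -/
noncomputable instance addCommGroup (U : X.Etale) : AddCommGroup (L.Sec U) :=
  letI : Add (L.Sec U) := ⟨L.add⟩
  letI : Neg (L.Sec U) := ⟨L.neg⟩
  letI : Zero (L.Sec U) := ⟨L.zero U⟩
  { AddGroup.ofLeftAxioms (G := L.Sec U) L.add_assoc L.zero_add L.neg_add_cancel with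
    add_comm := L.add_comm }

/-- Composition with a morphism. -/
noncomputable def comap (k : V ⟶ U) : L.Sec U →+ L.Sec V where
  toFun a := CategoryStruct.comp (X := V) (Y := U) (Z := Y.obj) k a
  map_zero' := L.comp_zero k
  map_add' a b := L.comp_add k a b

/-- The presheaf of abelian groups represented by `Y`. -/
noncomputable def presheaf : X.Etaleᵒᵖ ⥤ Ab.{u} where
  obj U := AddCommGrpCat.of (L.Sec U.unop)
  map k := AddCommGrpCat.ofHom (L.comap k.unop)
  map_id U := AddCommGrpCat.hom_ext (AddMonoidHom.ext fun a ↦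
    Category.id_comp (X := U.unop) (Y := Y.obj) a)
  map_comp k l := AddCommGrpCat.hom_ext (AddMonoidHom.ext fun a ↦
    Category.assoc (Z := Y.obj) l.unop k.unop a)

/-- The identity as a section of the presheaf represented by `Y`. -/
noncomputable def univ : L.presheaf.obj (op Y.obj) := 𝟙 Y.obj

theorem isUniversal : IsUniversal L.presheaf L.univ := fun U ↦ by
  have e : (fun g : U ⟶ Y.obj ↦ resHom L.presheaf g L.univ) = id :=
    funext fun g ↦ Category.comp_id g
  rw [e]
  exact Function.bijective_id

/-- The sheaf represented by `Y`. -/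
noncomputable def sheaf : LocConstFin f := L.isUniversal.toLocConstFin

/-- The elements of the stalk are the lifts of the tame point. -/
noncomputable def liftsEquiv : (lifts p.pt).obj Y.obj ≃ (stalk p.pt).obj L.presheaf :=
  Equiv.ofBijective _ L.isUniversal.bijective_germHom

theorem liftsEquiv_symm_germHom (w : (lifts p.pt).obj U) (s : U ⟶ Y.obj) :
    L.liftsEquiv.symm (germHom L.presheaf w s) = (lifts p.pt).map s w := by
  rw [Equiv.symm_apply_eq]
  have e : resHom L.presheaf s L.univ = s :=
    Category.comp_id (Y := Y.obj) s
  exact (congrArg (germHom L.presheaf w) e).symm.trans (germHom_map _ _ w _).symm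

/-- The map from the stalk to the given abelian group. -/
noncomputable def stalkHom : (stalk p.pt).obj L.presheaf →+ A :=
  AddMonoidHom.mk' (fun a ↦ β (L.liftsEquiv.symm a)) fun a b ↦ by
    obtain ⟨W, w, s, t, rfl, rfl⟩ := exists_germHom_eq_FT L.sheaf a b
    have e := (germHom L.presheaf w).map_add s t
    refine (congrArg (fun c ↦ β (L.liftsEquiv.symm c)) e).symm.trans ?_
    refine (congrArg β (L.liftsEquiv_symm_germHom w (s + t))).trans ?_
    refine (L.map_add s t w).trans (congrArg₂ (fun c d ↦ β c + β d)
      (L.liftsEquiv_symm_germHom w s).symm (L.liftsEquiv_symm_germHom w t).symm)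

theorem bijective_stalkHom (h : Function.Surjective β) : Function.Bijective L.stalkHom :=
  Function.Bijective.comp (g := β) ⟨L.injective, h⟩ L.liftsEquiv.symm.bijective

theorem stalkHom_monodromy (γ : tamePi1 p) (z : (lifts p.pt).obj Y.obj) :
    L.stalkHom (((monodromy L.sheaf p).ρ γ).hom (L.liftsEquiv z)) = β (act γ z) := by
  refine (congrArg L.stalkHom (monodromy_germHom L.sheaf γ z L.univ)).trans ?_
  exact congrArg β (L.liftsEquiv.symm_apply_apply (act γ z))

theorem stalkHom_liftsEquiv (z : (lifts p.pt).obj Y.obj) : L.stalkHom (L.liftsEquiv z) = β z :=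
  congrArg β (L.liftsEquiv.symm_apply_apply z)

end GroupLaw

end GroupLaw

section EssSurj

open scoped FintypeCatDiscrete

/-- For a discrete set continuity means that each set of elements carrying `m` to `m'` is open;
around any of its points it contains a translate of the stabilizer of `m`. -/
theorem isContinuous_of_isOpen_stabilizer {G : Type*} [Group G] [TopologicalSpace G]
    [IsTopologicalGroup G] (A : Action FintypeCat.{u} G)
    (h : ∀ m : A.V, IsOpen {γ : G | ConcreteCategory.hom (X := A.V) (Y := A.V) (A.ρ γ) m = m}) :
    A.IsContinuous := by
  have hd : DiscreteTopology ((forget₂ (Action FintypeCat.{u} G) TopCat).obj A) := ⟨rfl⟩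
  have hd' : DiscreteTopology ((forget₂ FintypeCat.{u} TopCat).obj A.V) := hd
  refine (Action.isContinuous_def A).2 (continuous_prod_of_discrete_right.2 fun m ↦
    continuous_discrete_rng.2 fun m' ↦ isOpen_iff_mem_nhds.2 fun γ₀ h₀ ↦ ?_)
  have hc : Continuous fun γ : G ↦ γ₀⁻¹ * γ := continuous_const.mul continuous_id
  refine Filter.mem_of_superset (((h m).preimage hc).mem_nhds ?_) fun γ hγ ↦ ?_
  · rw [Set.mem_preimage, inv_mul_cancel, Set.mem_ofPred_eq, map_one]
    rfl
  · have e : A.ρ γ = A.ρ γ₀ * A.ρ (γ₀⁻¹ * γ) := by rw [← map_mul, mul_inv_cancel_left]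
    exact (ConcreteCategory.congr_hom (X := A.V) (Y := A.V) e m).trans
      ((congrArg (ConcreteCategory.hom (X := A.V) (Y := A.V) (A.ρ γ₀)) hγ).trans h₀)

/-- The equivalence of a Galois category with finite sets carrying a continuous action is applied to
the underlying set of the module. -/
theorem exists_equivariant_bijection (M : FinDiscMod.{u} (tamePi1 p)) :
    ∃ (Y : FT f) (β : (lifts p.pt).obj Y.obj → M.obj.V), Function.Bijective β ∧
      ∀ γ y, β (act γ y) = (M.obj.ρ γ).hom (β y) := by
  have := M.property.1
  let A : Action FintypeCat.{u} (tamePi1 p) :=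
    { V := FintypeCat.of M.obj.V
      ρ :=
        { toFun := fun γ ↦ FintypeCat.homMk (M.obj.ρ γ).hom
          map_one' := by
            rw [map_one]
            rfl
          map_mul' := fun γ γ' ↦ by
            rw [map_mul]
            rfl } }
  have hA : A.IsContinuous := isContinuous_of_isOpen_stabilizer A M.property.2
  let i := (PreGaloisCategory.functorToContAction (fibreFunctor p)).objObjPreimageIso ⟨A, hA⟩
  let Y := (PreGaloisCategory.functorToContAction (fibreFunctor p)).objPreimage ⟨A, hA⟩
  let k : (fibreFunctor p).obj Y ≅ A.V := (Action.forget _ _).mapIso ((ObjectProperty.ι _).mapIso i)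
  refine ⟨Y, fun y ↦ k.hom (componentOfLift p Y y), ?_, fun γ y ↦ ?_⟩
  · exact (ConcreteCategory.bijective_of_isIso k.hom).comp (bijective_componentOfLift p Y)
  · refine (congrArg k.hom (componentOfLift_act γ y)).trans ?_
    exact ConcreteCategory.congr_hom (i.hom.hom.comm γ) (componentOfLift p Y y)

/-- Addition, negation and zero of `M` are equivariant because the group acts by additive maps, so
they come from morphisms of covers. -/
theorem nonempty_groupLaw {Y : FT f} {M : FinDiscMod.{u} (tamePi1 p)}
    {β : (lifts p.pt).obj Y.obj → M.obj.V} (hβ : Function.Bijective β)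
    (h : ∀ γ y, β (act γ y) = (M.obj.ρ γ).hom (β y)) : Nonempty (GroupLaw β) := by
  let e := Equiv.ofBijective β hβ
  have he (m : M.obj.V) : β (e.symm m) = m := e.apply_symm_apply m
  obtain ⟨μ, hμ⟩ := exists_hom_of_equivariant (p := p) (Y := Y.prd Y) (Z := Y)
    (fun w ↦ e.symm (β ((lifts p.pt).map (prdFst Y.obj Y.obj) w) +
      β ((lifts p.pt).map (prdSnd Y.obj Y.obj) w))) (fun γ w ↦ hβ.1 (by
        have h₁ := map_act (Y := Y.prd Y) γ (prdFst Y.obj Y.obj) w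
        have h₂ := map_act (Y := Y.prd Y) γ (prdSnd Y.obj Y.obj) w
        rw [h, he, he, map_add, ← h, ← h]
        exact congrArg₂ (fun a b ↦ β a + β b) h₁ h₂))
  obtain ⟨ν, hν⟩ := exists_hom_of_equivariant (p := p) (Y := Y) (Z := Y)
    (fun w ↦ e.symm (-β w)) (fun γ w ↦ hβ.1 (by rw [he, h, h, he, map_neg]))
  obtain ⟨ζ, hζ⟩ := exists_hom_of_equivariant (p := p) (Y := ⟨_, isFiniteTameCover_topEtale⟩)
    (Z := Y) (fun _ ↦ e.symm 0) (fun γ w ↦ hβ.1 (by rw [h, he, map_zero]))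
  exact ⟨⟨μ, ν, ζ, fun w ↦ (congrArg β (hμ w)).trans (he _),
    fun w ↦ (congrArg β (hν w)).trans (he _), fun w ↦ (congrArg β (hζ w)).trans (he _), hβ.1⟩⟩

instance : (toModule p : LocConstFin f ⥤ _).EssSurj where
  mem_essImage M := by
    obtain ⟨Y, β, hβ, h⟩ := exists_equivariant_bijection M
    obtain ⟨L⟩ := nonempty_groupLaw hβ h
    let i : (monodromy L.sheaf p).V ≅ M.obj.V :=
      (AddEquiv.ofBijective L.stalkHom (L.bijective_stalkHom hβ.2)).toAddCommGrpIso
    refine ⟨L.sheaf, ⟨ObjectProperty.isoMk _ (Action.mkIso i fun γ ↦ ?_)⟩⟩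
    refine AddCommGrpCat.hom_ext (AddMonoidHom.ext fun a ↦ ?_)
    obtain ⟨z, rfl⟩ := L.liftsEquiv.surjective a
    refine (L.stalkHom_monodromy γ z).trans ((h γ z).trans ?_)
    exact congrArg (M.obj.ρ γ).hom (L.stalkHom_liftsEquiv z).symm

end EssSurj

end TameSite

theorem mainTheorem8 {X S : Scheme.{u}} (f : X ⟶ S) [ConnectedSpace X] (p : TamePoint f) :
    ∃ (E : LocConstFin f ≌ FinDiscMod.{u} (tamePi1 p))
      (θ : LocConstFin.stalk p.pt ≅ E.functor ⋙ FinDiscMod.toAb (tamePi1 p)),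
      ∀ (F : LocConstFin f) (Y : FT f) (s : F.obj.obj.obj (op Y.obj))
        (y y' : (lifts p.pt).obj Y.obj) (γ : tamePi1 p),
        γ.hom.app Y (componentOfLift p Y y) = componentOfLift p Y y' →
          ((E.functor.obj F).obj.ρ γ).hom (θ.hom.app F (germ p.pt F.obj.obj Y.obj y s)) =
            θ.hom.app F (germ p.pt F.obj.obj Y.obj y' s) := by
  have : (toModule p).IsEquivalence := {}
  -- The comparison of underlying groups is the identity, since the module attached to a sheaf is
  -- its stalk by construction.
  refine ⟨(toModule p).asEquivalence, NatIso.ofComponents (fun F ↦ Iso.refl _)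
    (fun φ ↦ (Category.comp_id _).trans (Category.id_comp _).symm), fun F Y s y y' γ h ↦ ?_⟩
  refine (monodromy_germHom F γ y s).trans ?_
  rw [(act_eq_iff γ y y').2 h]
  rfl
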